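/- **Setting.** Let $d\in\{2,3\}$, $k\ge 1$, and let $\Omega\subset\mathbb R^d$ be a bounded polytopal domain (a connected open set that is the interior of a finite union of convex polytopes). Let $\mathcal T_h$ be a finite partition of $\overline\Omega$ into convex polygons ($d=2$) or polyhedra ($d=3$) with pairwise disjoint interiors such that each edge/face $e$ of an element either lies on $\partial\Omega$ or is an edge/face of exactly one other element. Write $h_T=\operatorname{diam}T$, $h_e=\operatorname{diam}e$, $h=\max_T h_T$. The mesh is shape regular with constants $\rho,\kappa,\alpha>0$: for every element $T$ and every edge/face $e$ of $T$, $$|T|\ge\rho h_T^d,\qquad |e|\ge\rho h_e^{d-1},\qquad h_e\ge\kappa h_T,$$ and the outward normals of any two different edges/faces of $T$ form an angle of at least $\alpha$. For each $T$ let $n=n_T\le N$ be the number of edges/faces of $T$ (or any upper bound for it that is at most $N$, for example the maximum over all elements), and put $j=n+k-1$. Let $P_m(T)$ be the polynomials of degree at most $m$ on $T$. The space $V_h$ and the average $\{v\}$ of $v\in V_h+H_0^1(\Omega)$ are given by one of the following. * **Case 1 (boundary condition enforced strongly).** $V_h=\{v\in L^2(\Omega): v|_T\in P_k(T)\ \forall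 T\in\mathcal T_h,\ v|_{\partial\Omega}=0\}$, and $\{v\}=v$ on edges/faces $e\subset\partial\Omega$. In this case it is assumed that every element has at most $d$ edges/faces on $\partial\Omega$. * **Case 2 (boundary condition enforced weakly).** $V_h=\{v\in L^2(\Omega): v|_T\in P_k(T)\ \forall T\in\mathcal T_h\}$, and $\{v\}=0$ on edges/faces $e\subset\partial\Omega$. In both cases $\{v\}=\frac12(v|_{T_1}+v|_{T_2})$ on an edge/face shared by two elements $T_1,T_2$. The weak gradient $\nabla_w v$ of $v\in V_h+H_0^1(\Omega)$ is defined on each $T$ as the element of $[P_j(T)]^d$ with $$(\nabla_w v,\mathbf q)_T=-(v,\nabla\cdot\mathbf q)_T+\langle\{v\},\mathbf q\cdot\mathbf n\rangle_{\partial T}\qquad\forall\,\mathbf q\in[P_j(T)]^d,$$ where $\mathbf n$ is the outward unit normal, and $|||v|||^2=\sum_{T\in\mathcal T_h}(\nabla_w v,\nabla_w v)_T$. Let $|u|_{k+1}$ be the $L^2(\Omega)$ norm of the tensor of all weak derivatives of $u$ of order $k+1$. **Theorem.** There is a constant $C>0$, depending only on $d,k,N,\rho,\kappa,\alpha$, such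 that for every such $\Omega$ and $\mathcal T_h$ and in both cases the following holds. Let $f\in L^2(\Omega)$, and let $u\in H_0^1(\Omega)$ be the weak solution of $-\Delta u=f$ in $\Omega$, $u=0$ on $\partial\Omega$, that is, $(\nabla u,\nabla v)=(f,v)$ for all $v\in H_0^1(\Omega)$. Assume $u\in H^{k+1}(\Omega)$. If $u_h\in V_h$ satisfies $$\sum_{T\in\mathcal T_h}(\nabla_w u_h,\nabla_w v)_T=(f,v)\qquad\forall v\in V_h,$$ then $$|||u-u_h|||\le C\,h^{k}\,|u|_{k+1}.$$ -/

import Mathlib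

open MeasureTheory Filter Topology
open scoped ContDiff

namespace ConformingDG

noncomputable section

/-- The Euclidean space `ℝᵈ`. -/
abbrev E (d : ℕ) : Type := EuclideanSpace ℝ (Fin d)

/-- Convergence of a sequence of functions in `L²(μ)`. -/
def TendstoL2 {d : ℕ} (μ : Measure (E d)) (φ : ℕ → E d → ℝ) (g : E d → ℝ) : Prop :=
  Tendsto (fun r => eLpNorm (fun x => φ r x - g x) 2 μ) atTop (𝓝 0)

/-! ### Sobolev spaces through weak derivatives -/

/-- The classical partial derivative `∂_{s 0} ⋯ ∂_{s (m-1)} φ` of order `m`. -/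
def partialD {d m : ℕ} (s : Fin m → Fin d) (φ : E d → ℝ) (x : E d) : ℝ :=
  iteratedFDeriv ℝ m φ x (fun r => EuclideanSpace.single (s r) (1 : ℝ))

/-- `φ ∈ C_c^∞(Ω)`, extended by zero to `ℝᵈ`. -/
def IsTestFunction {d : ℕ} (Ω : Set (E d)) (φ : E d → ℝ) : Prop :=
  ContDiff ℝ ∞ φ ∧ HasCompactSupport φ ∧ tsupport φ ⊆ Ω

/-- `g ∈ L²(Ω)` is the weak derivative `∂_{s 0} ⋯ ∂_{s (m-1)} u` in `Ω`. -/
def HasWeakDeriv {d m : ℕ} (Ω : Set (E d)) (s : Fin m → Fin d) (u g : E d → ℝ) : Prop :=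
  MemLp g 2 (volume.restrict Ω) ∧
    ∀ φ : E d → ℝ, IsTestFunction Ω φ →
      ∫ x in Ω, u x * partialD s φ x = (-1 : ℝ) ^ m * ∫ x in Ω, g x * φ x

open Classical in
/-- The weak derivative `∂_{s 0} ⋯ ∂_{s (m-1)} u` in `L²(Ω)` (unique almost everywhere in `Ω`);
zero if there is none. -/
def weakDeriv {d m : ℕ} (Ω : Set (E d)) (s : Fin m → Fin d) (u : E d → ℝ) : E d → ℝ :=
  if h : ∃ g, HasWeakDeriv Ω s u g then h.choose else 0

/-- The weak partial derivative `∂ᵢ u`. -/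
def weakPartial {d : ℕ} (Ω : Set (E d)) (i : Fin d) (u : E d → ℝ) : E d → ℝ :=
  weakDeriv Ω (fun _ : Fin 1 => i) u

/-- `u ∈ H^m(Ω)`. -/
def MemSobolev {d : ℕ} (Ω : Set (E d)) (m : ℕ) (u : E d → ℝ) : Prop :=
  MemLp u 2 (volume.restrict Ω) ∧
    ∀ r ≤ m, ∀ s : Fin r → Fin d, ∃ g, HasWeakDeriv Ω s u g

/-- The semi-norm `|u|_{m,Ω}`: the `L²(Ω)` norm of the tensor `Dᵐu` of all weak derivatives of
order `m`. -/
def sobolevSeminorm {d : ℕ} (Ω : Set (E d)) (m : ℕ) (u : E d → ℝ) : ℝ :=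
  Real.sqrt (∑ s : Fin m → Fin d, ∫ x in Ω, (weakDeriv Ω s u x) ^ 2)

/-- `u ∈ H_0^1(Ω)`: `u` is a limit of test functions in `H^1(Ω)`. -/
def MemH10 {d : ℕ} (Ω : Set (E d)) (u : E d → ℝ) : Prop :=
  MemLp u 2 (volume.restrict Ω) ∧
    ∃ φ : ℕ → E d → ℝ, (∀ r, IsTestFunction Ω (φ r)) ∧
      TendstoL2 (volume.restrict Ω) φ u ∧
      ∀ i : Fin d, ∃ g : E d → ℝ, MemLp g 2 (volume.restrict Ω) ∧
        TendstoL2 (volume.restrict Ω) (fun r => partialD (fun _ : Fin 1 => i) (φ r)) g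

/-- `u` is the weak solution of `-Δu = f` in `Ω`, `u = 0` on `∂Ω`. -/
def IsWeakSolution {d : ℕ} (Ω : Set (E d)) (f u : E d → ℝ) : Prop :=
  MemH10 Ω u ∧
    ∀ v : E d → ℝ, MemH10 Ω v →
      ∫ x in Ω, ∑ i : Fin d, weakPartial Ω i u x * weakPartial Ω i v x = ∫ x in Ω, f x * v x

/-! ### Polytopes -/

/-- The intersection of the half-spaces `⟪ν a, x⟫ ≤ c a`. -/
def halfspaces {d m : ℕ} (ν : Fin m → E d) (c : Fin m → ℝ) : Set (E d) :=
  {x | ∀ a, inner ℝ (ν a) x ≤ c a}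

/-- The part of that intersection on which the `a`-th inequality is an equality. -/
def halfspacesFacet {d m : ℕ} (ν : Fin m → E d) (c : Fin m → ℝ) (a : Fin m) : Set (E d) :=
  halfspaces ν c ∩ {x | inner ℝ (ν a) x = c a}

/-- A convex polytope (polygon if `d = 2`, polyhedron if `d = 3`) with nonempty interior, given by
its irredundant system of inequalities, one for each of its edges/faces. -/
structure ConvexPolytope (d : ℕ) where
  /-- number of edges/faces -/
  numFacets : ℕ
  /-- the outward unit vector orthogonal to each edge/face -/
  outward : Fin numFacets → E d
  /-- position of each edge/face -/
  offset : Fin numFacets → ℝ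
  unit_outward : ∀ a, ‖outward a‖ = 1
  outward_injective : Function.Injective outward
  isBounded : Bornology.IsBounded (halfspaces outward offset)
  interior_nonempty : (interior (halfspaces outward offset)).Nonempty
  facet_pos : ∀ a, 0 < Measure.euclideanHausdorffMeasure (d - 1) (halfspacesFacet outward offset a)

namespace ConvexPolytope

variable {d : ℕ}

/-- The (closed) polytope as a set. -/
def carrier (T : ConvexPolytope d) : Set (E d) := halfspaces T.outward T.offset

/-- The `a`-th edge/face. -/
def facet (T : ConvexPolytope d) (a : Fin T.numFacets) : Set (E d) :=
  halfspacesFacet T.outward T.offset a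

/-- Surface measure on the `a`-th edge/face. -/
def surface (T : ConvexPolytope d) (a : Fin T.numFacets) : Measure (E d) :=
  (Measure.euclideanHausdorffMeasure (d - 1)).restrict (T.facet a)

/-- `g ∈ L²(e)` is the trace on the edge/face `e` of `v|_T ∈ H¹(T)`: smooth functions converge to
`v` in `H¹(T)` and their restrictions to `e` converge to `g` in `L²(e)`. -/
def HasTrace (T : ConvexPolytope d) (a : Fin T.numFacets) (v g : E d → ℝ) : Prop :=
  MemLp g 2 (T.surface a) ∧
    ∃ φ : ℕ → E d → ℝ, (∀ r, ContDiff ℝ ∞ (φ r)) ∧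
      TendstoL2 (volume.restrict T.carrier) φ v ∧
      (∀ i : Fin d, ∃ w : E d → ℝ, MemLp w 2 (volume.restrict T.carrier) ∧
        TendstoL2 (volume.restrict T.carrier) (fun r => partialD (fun _ : Fin 1 => i) (φ r)) w) ∧
      TendstoL2 (T.surface a) φ g

open Classical in
/-- The trace on an edge/face of `v|_T` (unique almost everywhere on it); zero if there is none. -/
def trace (T : ConvexPolytope d) (a : Fin T.numFacets) (v : E d → ℝ) : E d → ℝ :=
  if h : ∃ g, T.HasTrace a v g then h.choose else 0

end ConvexPolytope

/-- `Ω` is a bounded polytopal domain: an open connected set that is the interior of a union of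
finitely many convex polytopes. -/
def IsPolytopalDomain {d : ℕ} (Ω : Set (E d)) : Prop :=
  IsOpen Ω ∧ IsConnected Ω ∧ interior (closure Ω) = Ω ∧
    ∃ (m : ℕ) (P : Fin m → ConvexPolytope d), closure Ω = ⋃ i, (P i).carrier

/-! ### Polytopal meshes -/

/-- A partition of `Ω` into convex polytopes: each edge/face of an element lies on `∂Ω` or is an
edge/face of another element. -/
structure PolytopalMesh {d : ℕ} (Ω : Set (E d)) where
  numCells : ℕ
  cell : Fin numCells → ConvexPolytope d
  cover : ⋃ i, (cell i).carrier = closure Ω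
  interior_disjoint : ∀ i j, i ≠ j →
    Disjoint (interior (cell i).carrier) (interior (cell j).carrier)
  conforming : ∀ i a, (cell i).facet a ⊆ frontier Ω ∨
    ∃ j, j ≠ i ∧ ∃ b, (cell j).facet b = (cell i).facet a

/-- The homogeneous boundary condition is enforced strongly (built into `V_h`) or weakly. -/
inductive BoundaryCase where
  | strong
  | weak

/-- Value of a polynomial at a point. -/
def pval {d : ℕ} (p : MvPolynomial (Fin d) ℝ) (x : E d) : ℝ :=
  MvPolynomial.eval (fun i => x i) p

/-- Divergence of a polynomial vector field. -/
def pdiv {d : ℕ} (q : Fin d → MvPolynomial (Fin d) ℝ) : MvPolynomial (Fin d) ℝ :=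
  ∑ l, MvPolynomial.pderiv l (q l)

/-- `q ∈ [P_j]^d`. -/
def DegLE {d : ℕ} (j : ℕ) (q : Fin d → MvPolynomial (Fin d) ℝ) : Prop :=
  ∀ l, (q l).totalDegree ≤ j

namespace PolytopalMesh

variable {d : ℕ} {Ω : Set (E d)}

/-- The mesh size `h = max_T h_T`, where `h_T` is the diameter of `T`. -/
def meshSize (M : PolytopalMesh Ω) : ℝ := ⨆ i, Metric.diam (M.cell i).carrier

/-- Shape regularity: `|T| ≥ ρ h_T^d`, `|e| ≥ ρ h_e^{d-1}`, `h_e ≥ κ h_T`, and the outward normals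
of any two different edges/faces of `T` form an angle of at least `α`. -/
def ShapeRegular (M : PolytopalMesh Ω) (ρ κ α : ℝ) : Prop :=
  ∀ i,
    ρ * Metric.diam (M.cell i).carrier ^ d ≤ volume.real (M.cell i).carrier ∧
    (∀ a, ρ * Metric.diam ((M.cell i).facet a) ^ (d - 1) ≤
        (Measure.euclideanHausdorffMeasure (d - 1)).real ((M.cell i).facet a) ∧
      κ * Metric.diam (M.cell i).carrier ≤ Metric.diam ((M.cell i).facet a)) ∧
    ∀ a b, a ≠ b →
      α ≤ InnerProductGeometry.angle ((M.cell i).outward a) ((M.cell i).outward b)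

/-- Every element has at most `m` edges/faces on `∂Ω`. -/
def AtMostBoundaryFacets (M : PolytopalMesh Ω) (m : ℕ) : Prop :=
  ∀ i, {a | (M.cell i).facet a ⊆ frontier Ω}.ncard ≤ m

open Classical in
/-- The average `{v}` on the `a`-th edge/face of the `i`-th element. On `∂Ω` it is `v` if the
boundary condition is enforced strongly and `0` if weakly; on an interior edge/face it is the mean
of the two traces. -/
def average (M : PolytopalMesh Ω) (c : BoundaryCase) (v : E d → ℝ) (i : Fin M.numCells)
    (a : Fin (M.cell i).numFacets) : E d → ℝ :=
  if (M.cell i).facet a ⊆ frontier Ω then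
    match c with
    | .strong => (M.cell i).trace a v
    | .weak => 0
  else fun x =>
    (1 / 2 : ℝ) * ∑ j, ∑ b,
      if (M.cell j).facet b = (M.cell i).facet a then (M.cell j).trace b v x else 0

/-- `G ∈ [P_j(T)]^d` satisfies
`(G, q)_T = -(v, ∇·q)_T + ⟨{v}, q·n⟩_{∂T}` for all `q ∈ [P_j(T)]^d`. -/
def IsWeakGradient (M : PolytopalMesh Ω) (c : BoundaryCase) (v : E d → ℝ) (i : Fin M.numCells)
    (j : ℕ) (G : Fin d → MvPolynomial (Fin d) ℝ) : Prop :=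
  DegLE j G ∧ ∀ q : Fin d → MvPolynomial (Fin d) ℝ, DegLE j q →
    ∫ x in (M.cell i).carrier, ∑ l, pval (G l) x * pval (q l) x =
      -(∫ x in (M.cell i).carrier, v x * pval (pdiv q) x) +
        ∑ a, ∫ x, M.average c v i a x * (∑ l, pval (q l) x * (M.cell i).outward a l)
          ∂((M.cell i).surface a)

open Classical in
/-- The weak gradient `∇_w v` on the `i`-th element, with polynomial degree `j`. -/
def weakGradient (M : PolytopalMesh Ω) (c : BoundaryCase) (v : E d → ℝ) (i : Fin M.numCells)
    (j : ℕ) : Fin d → MvPolynomial (Fin d) ℝ :=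
  if h : ∃ G, M.IsWeakGradient c v i j G then h.choose else 0

/-- `(∇_w v, ∇_w w)_{𝒯_h}`, with polynomial degree `j i` on the `i`-th element. -/
def weakForm (M : PolytopalMesh Ω) (c : BoundaryCase) (j : Fin M.numCells → ℕ)
    (v w : E d → ℝ) : ℝ :=
  ∑ i, ∫ x in (M.cell i).carrier,
    ∑ l, pval (M.weakGradient c v i (j i) l) x * pval (M.weakGradient c w i (j i) l) x

/-- The semi-norm `|||v||| = (∇_w v, ∇_w v)_{𝒯_h}^{1/2}`. -/
def energyNorm (M : PolytopalMesh Ω) (c : BoundaryCase) (j : Fin M.numCells → ℕ)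
    (v : E d → ℝ) : ℝ :=
  Real.sqrt (M.weakForm c j v v)

/-- `v ∈ V_h`: on each element `v` is a polynomial of degree at most `k`, and under strong enforcement
of the boundary condition it vanishes on `∂Ω`. -/
def MemVh (M : PolytopalMesh Ω) (c : BoundaryCase) (k : ℕ) (v : E d → ℝ) : Prop :=
  ∀ i, ∃ p : MvPolynomial (Fin d) ℝ, p.totalDegree ≤ k ∧
    v =ᵐ[volume.restrict (M.cell i).carrier] pval p ∧
    (c = BoundaryCase.strong →
      ∀ a, (M.cell i).facet a ⊆ frontier Ω → ∀ x ∈ (M.cell i).facet a, pval p x = 0)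

/-- `u_h ∈ V_h` and `(∇_w u_h, ∇_w v)_{𝒯_h} = (f, v)` for all `v ∈ V_h`. -/
def IsDGSolution (M : PolytopalMesh Ω) (c : BoundaryCase) (k : ℕ) (j : Fin M.numCells → ℕ)
    (f uh : E d → ℝ) : Prop :=
  M.MemVh c k uh ∧
    ∀ v : E d → ℝ, M.MemVh c k v → M.weakForm c j uh v = ∫ x in Ω, f x * v x

end PolytopalMesh

end

end ConformingDG

namespace ConformingDG
noncomputable section

/-! ### Hyperplane measures -/

/-! The argument is of Strang type. For an interpolant `v` in the discrete space, the error splits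
into `u - v` and `w = v - u_h`, and testing the scheme with `w` bounds `|||w|||` by `|||u - v|||`
plus the consistency functional `(∇_w u, ∇_w w) - (f, w)` divided by `|||w|||`
(`energyNorm_sub_sq_le`). Both quantities have to be of order `h^k |u|_{k+1}`.

Consistency. Since `k ≥ 1`, the solution is in `H²` and `-Δu = f` almost everywhere. The traces of
`u` agree across interior facets and vanish on `∂Ω`, so they equal the averages and `∇_w u` tests
against polynomial fields exactly like `∇u`. Green's formula on every element turns `(f, w)` into
element integrals and fluxes of `∇u`. The fluxes paired with `{w}` cancel (`sum_flux_eq_zero`): the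
trace of `∇u` is the same from both sides, the normals are opposite, and `{w}` is single valued and
zero on `∂Ω`. What remains on an element (`Fat.consistency_identity`) is `∇u - Γ` against `∇_w w -
∇w` in the interior and against `w - {w}` on the boundary, for any polynomial field `Γ` that is
admissible as a test field; `Γ` is taken to be a degree `k - 1` approximation of `∇u`.

The scheme has no stabilizer, so `∇w` and the jumps `w - {w}` must be controlled by `∇_w w` on the
same element. This is `weak_gradient_bound`, and it is the reason for the degree `j = n + k - 1`.
Let `W` be the product of the `n` normalized distances to the facet hyperplanes. The field `W ∇w`
has degree at most `n + (k - 1)` and vanishes on the whole boundary, so testing with it bounds `∇w`.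
Omitting the factor of one facet and multiplying by its normal and by the jump, extended constantly
along the normal, gives a field of degree at most `(n - 1) + k` that sees only that facet, so
testing with it bounds the jump.

Uniformity of constants. There is no reference element. Shape regularity enters through
`exists_fat`: every element contains a point at distance at least `γ h` from all facet hyperplanes,
and every facet a point at distance at least `γ h` from all the others. Otherwise boundedly many
thin slabs would cover the element or the facet, contradicting its size. Polynomial norms on the
element are then compared with norms on balls around these points, where finite dimensionality and
scaling give everything (`exists_poly_bound`, `fat_poly_l2`, `fat_poly_facet`).

Interpolation. Taylor polynomials at a well chosen base point give approximation in `L²` on convex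
sets (`exists_taylorPoly_le`). A weighted integration by parts upgrades `L²` approximation of the
function and of its partial derivatives to approximation of the gradient of one single polynomial
(`gradient_approx`). Where `u` has zero trace, the polynomial is corrected to vanish there by
dividing off the gap of one facet at a time (`exists_vanishing_correction`). Stability of `∇_w` in
the broken `H¹` norm (`exists_sum_wgrad_sq_le`) transfers the bounds to the energy norm.

Analytic basis. The divergence theorem on a polytope comes from smooth cut-offs whose derivative
concentrates on the facets. Applied to `φ² (x - x₀)` it yields the multiplicative trace inequality,
which makes traces of limits of smooth functions well defined and extends Green's formula to them.
-/

/-- Surface measure on the hyperplane `⟪ν, x⟫ = c`. -/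
def hyper {d : ℕ} (ν : E d) (c : ℝ) : Measure (E d) :=
  (Measure.euclideanHausdorffMeasure (d - 1)).restrict {x | inner ℝ ν x = c}

lemma finrank_orthogonal_span {d : ℕ} {ν : E d} (hν : ‖ν‖ = 1) :
    Module.finrank ℝ (Submodule.span ℝ {ν})ᗮ = d - 1 := by
  have h := (Submodule.span ℝ {ν}).finrank_add_finrank_orthogonal
  rw [finrank_span_singleton (by intro h; simp [h] at hν), finrank_euclideanSpace_fin] at h
  omega

/-- The orthogonal complement of `ν` is carried isometrically onto the hyperplane. Isometries
preserve Hausdorff measure, and on an inner product space of dimension `d - 1` it is Lebesgue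
measure. -/
lemma hyper_eq_map {d : ℕ} {ν : E d} (hν : ‖ν‖ = 1) (c : ℝ) :
    hyper ν c = Measure.map (fun z : (Submodule.span ℝ {ν})ᗮ => (z : E d) + c • ν) volume := by
  have hi : Isometry (fun z : (Submodule.span ℝ {ν})ᗮ => (z : E d) + c • ν) :=
    (IsometryEquiv.addRight (c • ν)).isometry.comp (isometry_subtype_coe)
  have hr : Set.range (fun z : (Submodule.span ℝ {ν})ᗮ => (z : E d) + c • ν)
      = {x | inner ℝ ν x = c} := by
    ext x
    simp only [Set.mem_range, Subtype.exists, Set.mem_ofPred_eq]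
    constructor
    · rintro ⟨z, hz, rfl⟩
      rw [Submodule.mem_orthogonal_singleton_iff_inner_right] at hz
      simp [inner_add_right, hz, inner_smul_right, hν]
    · intro h
      refine ⟨x - c • ν, ?_, by simp⟩
      rw [Submodule.mem_orthogonal_singleton_iff_inner_right]
      simp [inner_sub_right, inner_smul_right, hν, h]
  rw [hyper, ← hr, ← hi.map_euclideanHausdorffMeasure, ← finrank_orthogonal_span hν,
    InnerProductSpace.euclideanHausdorffMeasure_eq_volume]

lemma measurable_hyper_param {d : ℕ} (ν : E d) (c : ℝ) :
    Measurable (fun z : (Submodule.span ℝ {ν})ᗮ => (z : E d) + c • ν) := by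
  fun_prop

lemma sigmaFinite_hyper {d : ℕ} {ν : E d} (hν : ‖ν‖ = 1) (c : ℝ) :
    SigmaFinite (hyper ν c) := by
  rw [hyper_eq_map hν]
  have : MeasurableEmbedding (fun z : (Submodule.span ℝ {ν})ᗮ => (z : E d) + c • ν) := by
    apply Topology.IsClosedEmbedding.measurableEmbedding
    apply Isometry.isClosedEmbedding
    exact (IsometryEquiv.addRight (c • ν)).isometry.comp (isometry_subtype_coe)
  exact this.sigmaFinite_map

/-- Fubini in the orthogonal splitting: Lebesgue measure is the product of length along `ν` and
surface measure on a hyperplane orthogonal to `ν`. -/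
lemma hyper_coarea {d : ℕ} {ν : E d} (hν : ‖ν‖ = 1) (c : ℝ) :
    MeasurePreserving (fun p : ℝ × E d => p.2 + p.1 • ν)
      ((volume : Measure ℝ).prod (hyper ν c)) volume := by
  have := sigmaFinite_hyper hν c
  set s := Submodule.span ℝ {ν} with hs
  have h1 : MeasurePreserving (fun p : ℝ × sᗮ => (p.2 : E d) + p.1 • ν)
      ((volume : Measure ℝ).prod (volume : Measure sᗮ)) volume := by
    have e1 : MeasurePreserving (LinearIsometryEquiv.toSpanUnitSingleton (𝕜 := ℝ) ν hν) volume
        (volume : Measure s) :=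
      (LinearIsometryEquiv.toSpanUnitSingleton (𝕜 := ℝ) ν hν).measurePreserving
    have e2 := e1.prod (MeasurePreserving.id (volume : Measure sᗮ))
    have e3 := (s.measurePreserving_measurableEquivProd (0 : E d)).symm
    rw [InnerProductSpace.euclideanHausdorffMeasure_eq_volume] at e3
    have e4 := e3.comp e2
    have he : (fun p : ℝ × sᗮ => (p.2 : E d) + p.1 • ν) = ⇑(s.measurableEquivProd (0 : E d)).symm ∘
        Prod.map (⇑(LinearIsometryEquiv.toSpanUnitSingleton (𝕜 := ℝ) ν hν)) id := by
      funext p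
      simp [add_comm]
    rw [he]
    exact e4
  refine ⟨by fun_prop, ?_⟩
  rw [hyper_eq_map hν]
  have h2 : (volume : Measure ℝ).prod (Measure.map (fun z : sᗮ => (z : E d) + c • ν) volume)
      = Measure.map (Prod.map id (fun z : sᗮ => (z : E d) + c • ν))
        ((volume : Measure ℝ).prod volume) := by
    rw [← Measure.map_prod_map _ _ measurable_id (by fun_prop), Measure.map_id]
  rw [h2, Measure.map_map (by fun_prop) (by fun_prop)]
  -- Passing from the hyperplane through the origin to the one at height `c` only translates the
  -- first coordinate.
  have h3 : MeasurePreserving (Prod.map (fun t : ℝ => t + c) (id : sᗮ → sᗮ))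
      ((volume : Measure ℝ).prod volume) ((volume : Measure ℝ).prod volume) :=
    (measurePreserving_add_right volume c).prod (MeasurePreserving.id _)
  have h4 := (h1.comp h3).map_eq
  convert h4 using 2
  ext1 p
  simp [add_smul, add_assoc, add_comm (c • ν)]

/-- Two hyperplanes with normals `ν ≠ μ` which are not the same hyperplane meet in a null set. -/
lemma hyper_inter_null {d : ℕ} {ν μ : E d} (hν : ‖ν‖ = 1) (hμ : ‖μ‖ = 1) (c e : ℝ)
    (hne : ν ≠ μ) (hop : μ = -ν → e ≠ -c) :
    hyper ν c {x | inner ℝ μ x = e} = 0 := by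
  rw [hyper_eq_map hν, Measure.map_apply (by fun_prop)
    (measurableSet_eq_fun (by fun_prop) (by fun_prop))]
  set s := Submodule.span ℝ {ν} with hs
  -- If `μ` annihilates the directions of the first hyperplane, then `μ = ±ν` and the hyperplanes
  -- are parallel and distinct. Otherwise the equation cuts a proper affine subspace, possibly
  -- empty, out of the parameter space.
  by_cases hz : ∀ z ∈ sᗮ, inner ℝ μ z = 0
  · have hm : μ ∈ s := by
      rw [← Submodule.orthogonal_orthogonal s, Submodule.mem_orthogonal]
      intro z hz'
      rw [real_inner_comm]
      exact hz z hz'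
    obtain ⟨a, ha⟩ := Submodule.mem_span_singleton.1 hm
    have ha' : |a| = 1 := by
      rw [← ha, norm_smul, hν] at hμ
      simpa using hμ
    have ha2 : a = -1 := by
      rcases (abs_eq zero_le_one).1 ha' with h | h
      · exact absurd (by rw [← ha, h, one_smul]) hne
      · exact h
    have : (fun z : sᗮ => (z : E d) + c • ν) ⁻¹' {x | inner ℝ μ x = e} = ∅ := by
      ext z
      simp only [Set.mem_preimage, Set.mem_ofPred_eq, Set.mem_empty_iff_false, iff_false]
      rw [inner_add_right, hz z z.2, ← ha, inner_smul_left, inner_smul_right, ha2]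
      simp only [real_inner_self_eq_norm_sq, hν]
      intro h
      refine hop (by rw [← ha, ha2, neg_one_smul]) ?_
      simp at h
      linarith
    rw [this, measure_empty]
  · push Not at hz
    obtain ⟨z0, hz0, hz0'⟩ := hz
    let L : sᗮ →ₗ[ℝ] ℝ := (innerₛₗ ℝ μ).comp sᗮ.subtype
    have hL : ∀ z : sᗮ, L z = inner ℝ μ (z : E d) := fun z => rfl
    by_cases hne' : ∃ z1 : sᗮ, L z1 = e - c * inner ℝ μ ν
    · obtain ⟨z1, hz1⟩ := hne'
      have : (fun z : sᗮ => (z : E d) + c • ν) ⁻¹' {x | inner ℝ μ x = e}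
          = (AffineSubspace.mk' z1 (LinearMap.ker L) : Set sᗮ) := by
        ext z
        simp only [Set.mem_preimage, Set.mem_ofPred_eq, SetLike.mem_coe, AffineSubspace.mem_mk',
          vsub_eq_sub, LinearMap.mem_ker, map_sub, hz1]
        rw [hL, inner_add_right, inner_smul_right]
        constructor <;> intro h <;> linarith
      rw [this]
      apply Measure.addHaar_affineSubspace
      intro htop
      have h1 : (AffineSubspace.mk' z1 (LinearMap.ker L)).direction = ⊤ := by
        rw [htop, AffineSubspace.direction_top]
      rw [AffineSubspace.direction_mk'] at h1
      have : (⟨z0, hz0⟩ : sᗮ) ∈ LinearMap.ker L := by rw [h1]; trivial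
      exact hz0' this
    · push Not at hne'
      have : (fun z : sᗮ => (z : E d) + c • ν) ⁻¹' {x | inner ℝ μ x = e} = ∅ := by
        ext z
        simp only [Set.mem_preimage, Set.mem_ofPred_eq, Set.mem_empty_iff_false, iff_false]
        intro h
        apply hne' z
        rw [hL]
        rw [inner_add_right, inner_smul_right] at h
        linarith
      rw [this, measure_empty]

end
end ConformingDG

namespace ConformingDG
noncomputable section

/-! ### The divergence theorem on a convex polytope -/

lemma deriv_smoothTransition_eq_zero {x : ℝ} (hx : x ∉ Set.Icc (0 : ℝ) 1) :
    deriv Real.smoothTransition x = 0 := by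
  rw [Set.mem_Icc, not_and_or, not_le, not_le] at hx
  rcases hx with hx | hx
  · have : Real.smoothTransition =ᶠ[𝓝 x] fun _ => 0 := by
      filter_upwards [gt_mem_nhds hx] with y hy
      exact Real.smoothTransition.zero_of_nonpos hy.le
    rw [this.deriv_eq, deriv_const]
  · have : Real.smoothTransition =ᶠ[𝓝 x] fun _ => 1 := by
      filter_upwards [lt_mem_nhds hx] with y hy
      exact Real.smoothTransition.one_of_one_le hy.le
    rw [this.deriv_eq, deriv_const]

lemma continuous_deriv_smoothTransition : Continuous (deriv Real.smoothTransition) :=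
  (Real.smoothTransition.contDiff (n := 1)).continuous_deriv le_rfl

/-- The normalization through which the rescaled derivative of a cut-off carries unit mass across a
boundary layer. -/
lemma integral_deriv_smoothTransition : ∫ x, deriv Real.smoothTransition x = 1 := by
  have h0 : Function.support (deriv Real.smoothTransition) ⊆ Set.Icc 0 1 := by
    intro x hx
    by_contra h
    exact hx (deriv_smoothTransition_eq_zero h)
  have hd : ∀ x, HasDerivAt Real.smoothTransition (deriv Real.smoothTransition x) x := fun x =>
    ((Real.smoothTransition.contDiff (n := 1)).differentiable one_ne_zero x).hasDerivAt
  rw [← setIntegral_eq_integral_of_forall_compl_eq_zero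
    (s := Set.Icc (0 : ℝ) 1) (fun x hx => deriv_smoothTransition_eq_zero hx),
    integral_Icc_eq_integral_Ioc, ← intervalIntegral.integral_of_le zero_le_one,
    intervalIntegral.integral_eq_sub_of_hasDerivAt (fun x _ => hd x)
      (continuous_deriv_smoothTransition.intervalIntegrable _ _)]
  simp [Real.smoothTransition.zero, Real.smoothTransition.one]

namespace ConvexPolytope

variable {d : ℕ} (T : ConvexPolytope d)

/-- The distance of `x` to the hyperplane of the `a`-th edge/face, positive inside. -/
def gap (a : Fin T.numFacets) (x : E d) : ℝ := T.offset a - inner ℝ (T.outward a) x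

@[fun_prop]
lemma contDiff_gap {n : WithTop ℕ∞} (a : Fin T.numFacets) : ContDiff ℝ n (T.gap a) :=
  contDiff_const.sub (contDiff_const.inner ℝ contDiff_id)

@[fun_prop]
lemma continuous_gap (a : Fin T.numFacets) : Continuous (T.gap a) := by
  unfold gap; fun_prop

lemma hasFDerivAt_gap (a : Fin T.numFacets) (x : E d) :
    HasFDerivAt (T.gap a) (-(innerSL ℝ (T.outward a))) x := by
  unfold gap
  exact (innerSL ℝ (T.outward a)).hasFDerivAt.const_sub _

lemma gap_add_smul (a b : Fin T.numFacets) (x : E d) (t : ℝ) :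
    T.gap b (x + t • T.outward a) = T.gap b x - t * inner ℝ (T.outward b) (T.outward a) := by
  simp only [gap, inner_add_right, inner_smul_right]; ring

lemma gap_self_add_smul (a : Fin T.numFacets) (x : E d) (t : ℝ) :
    T.gap a (x + t • T.outward a) = T.gap a x - t := by
  simp [gap_add_smul, T.unit_outward]

lemma mem_carrier_iff {x : E d} : x ∈ T.carrier ↔ ∀ a, 0 ≤ T.gap a x := by
  simp [carrier, halfspaces, gap]

lemma mem_facet_iff {a : Fin T.numFacets} {x : E d} :
    x ∈ T.facet a ↔ x ∈ T.carrier ∧ T.gap a x = 0 := by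
  simp only [facet, halfspacesFacet, carrier, gap, Set.mem_inter_iff, Set.mem_ofPred_eq]
  rw [sub_eq_zero, eq_comm (a := T.offset a)]

lemma facet_subset (a : Fin T.numFacets) : T.facet a ⊆ T.carrier := fun _ hx =>
  (T.mem_facet_iff.1 hx).1

lemma isClosed_carrier : IsClosed T.carrier := by
  have : T.carrier = ⋂ a, {x | 0 ≤ T.gap a x} := by
    ext x; simp [mem_carrier_iff]
  rw [this]
  exact isClosed_iInter fun a => isClosed_le continuous_const (T.continuous_gap a)

lemma isCompact_carrier : IsCompact T.carrier :=
  Metric.isCompact_of_isClosed_isBounded T.isClosed_carrier T.isBounded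

lemma isClosed_facet (a : Fin T.numFacets) : IsClosed (T.facet a) := by
  have : T.facet a = T.carrier ∩ {x | T.gap a x = 0} := by
    ext x; simp [mem_facet_iff]
  rw [this]
  exact T.isClosed_carrier.inter (isClosed_eq (T.continuous_gap a) continuous_const)

lemma isCompact_facet (a : Fin T.numFacets) : IsCompact (T.facet a) :=
  T.isCompact_carrier.of_isClosed_subset (T.isClosed_facet a) (T.facet_subset a)

lemma convex_carrier : Convex ℝ T.carrier := by
  have : T.carrier = ⋂ a, {x | (innerSL ℝ (T.outward a)) x ≤ T.offset a} := by
    ext x; simp [carrier, halfspaces]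
  rw [this]
  exact convex_iInter fun a => convex_halfSpace_le (innerSL ℝ (T.outward a)).isLinear _

lemma surface_eq (a : Fin T.numFacets) :
    T.surface a = (hyper (T.outward a) (T.offset a)).restrict T.carrier := by
  rw [surface, hyper, Measure.restrict_restrict T.isClosed_carrier.measurableSet]
  rfl

/-- The centre region: the points with all gaps positive. -/
def inner' : Set (E d) := {x | ∀ a, 0 < T.gap a x}

lemma isOpen_inner' : IsOpen T.inner' := by
  have : T.inner' = ⋂ a, {x | 0 < T.gap a x} := by
    ext x; simp [inner']
  rw [this]
  exact isOpen_iInter_of_finite fun a => isOpen_lt continuous_const (T.continuous_gap a)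

/-- Moving outward from a point of a bounding hyperplane leaves the polytope at once, so an interior
point has positive gaps. -/
lemma interior_carrier : interior T.carrier = T.inner' := by
  apply Set.Subset.antisymm
  · intro x hx a
    have hx' := T.mem_carrier_iff.1 (interior_subset hx) a
    refine lt_of_le_of_ne hx' fun h0 => ?_
    have : Tendsto (fun t : ℝ => x + t • T.outward a) (𝓝[>] 0) (𝓝 x) := by
      have : Tendsto (fun t : ℝ => x + t • T.outward a) (𝓝 0) (𝓝 (x + (0 : ℝ) • T.outward a)) :=
        Continuous.tendsto (by fun_prop) _
      simp only [zero_smul, add_zero] at this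
      exact this.mono_left nhdsWithin_le_nhds
    have h2 := this.eventually (mem_interior_iff_mem_nhds.1 hx)
    obtain ⟨t, ht1, ht2⟩ := (h2.and self_mem_nhdsWithin).exists
    have h3 := T.mem_carrier_iff.1 ht1 a
    rw [gap_self_add_smul, ← h0] at h3
    have ht3 : 0 < t := ht2
    linarith
  · apply interior_maximal _ T.isOpen_inner'
    intro x hx
    exact T.mem_carrier_iff.2 fun a => (hx a).le

lemma inner'_nonempty : T.inner'.Nonempty := by
  rw [← interior_carrier]
  exact T.interior_nonempty

lemma inner'_ae_eq : T.inner' =ᵐ[volume] T.carrier := by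
  rw [← interior_carrier]
  exact interior_ae_eq_of_null_frontier (T.convex_carrier.addHaar_frontier volume)

/-- Opposite edges/faces lie in different hyperplanes. -/
lemma offset_ne_of_outward_eq_neg {a b : Fin T.numFacets} (h : T.outward b = -T.outward a) :
    T.offset b ≠ -T.offset a := by
  intro h2
  obtain ⟨x, hx⟩ := T.inner'_nonempty
  have h1 := hx a
  have h3 := hx b
  simp only [gap, h, h2, inner_neg_left] at h1 h3
  linarith

lemma hyper_gap_null {a b : Fin T.numFacets} (h : b ≠ a) :
    hyper (T.outward a) (T.offset a) {x | T.gap b x = 0} = 0 := by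
  have := hyper_inter_null (T.unit_outward a) (T.unit_outward b) (T.offset a) (T.offset b)
    (fun h' => h (T.outward_injective h').symm) T.offset_ne_of_outward_eq_neg
  convert this using 2
  ext x
  simp only [gap, Set.mem_ofPred_eq]
  constructor <;> intro h <;> linarith

lemma hyper_isCompact_lt_top {ν : E d} (hν : ‖ν‖ = 1) (c : ℝ) {K : Set (E d)} (hK : IsCompact K) :
    hyper ν c K < ⊤ := by
  rw [hyper_eq_map hν, Measure.map_apply (measurable_hyper_param _ _) hK.measurableSet]
  have : Topology.IsClosedEmbedding
      (fun z : (Submodule.span ℝ {ν})ᗮ => (z : E d) + c • ν) := by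
    apply Isometry.isClosedEmbedding
    exact (IsometryEquiv.addRight (c • ν)).isometry.comp (isometry_subtype_coe)
  exact (this.isCompact_preimage hK).measure_lt_top

instance isFiniteMeasure_surface (a : Fin T.numFacets) : IsFiniteMeasure (T.surface a) := by
  rw [surface_eq]
  exact ⟨by
    rw [Measure.restrict_apply_univ]
    exact hyper_isCompact_lt_top (T.unit_outward a) _ T.isCompact_carrier⟩

lemma surface_ae_mem (a : Fin T.numFacets) : ∀ᵐ x ∂(T.surface a), x ∈ T.facet a :=
  ae_restrict_mem (T.isClosed_facet a).measurableSet

/-- Different facets lie in different hyperplanes, and these meet in a set of surface measure zero.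
Hence almost every point of a facet lies on no other facet hyperplane. -/
lemma surface_ae_pos (a : Fin T.numFacets) :
    ∀ᵐ x ∂(T.surface a), ∀ b, b ≠ a → 0 < T.gap b x := by
  have h : ∀ b, b ≠ a → ∀ᵐ x ∂(T.surface a), T.gap b x ≠ 0 := by
    intro b hb
    rw [surface_eq]
    have h0 : ∀ᵐ x ∂(hyper (T.outward a) (T.offset a)), T.gap b x ≠ 0 := by
      rw [ae_iff]
      simpa using T.hyper_gap_null hb
    exact ae_restrict_of_ae h0
  have h' : ∀ b, ∀ᵐ x ∂(T.surface a), b ≠ a → T.gap b x ≠ 0 := fun b => by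
    by_cases hb : b = a
    · simp [hb]
    · filter_upwards [h b hb] with x hx _ using hx
  filter_upwards [ae_all_iff.2 h', T.surface_ae_mem a] with x hx hx2 b hb
  exact lt_of_le_of_ne (T.mem_carrier_iff.1 (T.facet_subset a hx2) b) (hx b hb).symm

/-- The cut-off function of scale `1/n`. -/
def cutoff (n : ℝ) (x : E d) : ℝ := ∏ a, Real.smoothTransition (n * T.gap a x)

lemma cutoff_eq_zero {n : ℝ} (hn : 0 < n) {x : E d} (hx : x ∉ T.carrier) : T.cutoff n x = 0 := by
  rw [mem_carrier_iff] at hx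
  push Not at hx
  obtain ⟨a, ha⟩ := hx
  exact Finset.prod_eq_zero (Finset.mem_univ a)
    (Real.smoothTransition.zero_of_nonpos (mul_nonpos_of_nonneg_of_nonpos hn.le ha.le))

lemma contDiff_cutoff (n : ℝ) : ContDiff ℝ 1 (T.cutoff n) := by
  unfold cutoff
  apply contDiff_prod
  intro a _
  exact Real.smoothTransition.contDiff.comp (contDiff_const.mul (T.contDiff_gap a))

lemma hasCompactSupport_cutoff {n : ℝ} (hn : 0 < n) : HasCompactSupport (T.cutoff n) :=
  HasCompactSupport.intro T.isCompact_carrier fun _ hx => T.cutoff_eq_zero hn hx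

/-- The part of the cut-off function without the `a`-th factor. -/
def cutoffErase (a : Fin T.numFacets) (n : ℝ) (x : E d) : ℝ :=
  ∏ b ∈ Finset.univ.erase a, Real.smoothTransition (n * T.gap b x)

lemma continuous_cutoffErase (a : Fin T.numFacets) (n : ℝ) : Continuous (T.cutoffErase a n) := by
  unfold cutoffErase
  refine continuous_finsetProd _ fun b _ => ?_
  exact Real.smoothTransition.continuous.comp (by fun_prop)

lemma fderiv_cutoff (n : ℝ) (x w : E d) :
    fderiv ℝ (T.cutoff n) x w = -∑ a, inner ℝ (T.outward a) w *
      (n * deriv Real.smoothTransition (n * T.gap a x) * T.cutoffErase a n x) := by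
  have h : ∀ a ∈ Finset.univ, HasFDerivAt (fun x => Real.smoothTransition (n * T.gap a x))
      (deriv Real.smoothTransition (n * T.gap a x) • (n • (-(innerSL ℝ (T.outward a))))) x := by
    intro a _
    have h1 := (((Real.smoothTransition.contDiff (n := 1)).differentiable one_ne_zero)
      (n * T.gap a x)).hasDerivAt
    exact h1.comp_hasFDerivAt x ((T.hasFDerivAt_gap a x).const_mul n)
  have h2 := HasFDerivAt.finsetProd h
  unfold cutoff
  rw [h2.fderiv, sum_apply, ← Finset.sum_neg_distrib]
  refine Finset.sum_congr rfl fun a _ => ?_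
  simp [cutoffErase]
  ring

lemma abs_prod_smoothTransition_le {ι : Type*} (s : Finset ι) (f : ι → ℝ) :
    |∏ i ∈ s, Real.smoothTransition (f i)| ≤ 1 := by
  rw [Finset.abs_prod]
  refine Finset.prod_le_one (fun _ _ => abs_nonneg _) fun i _ => ?_
  rw [abs_of_nonneg (Real.smoothTransition.nonneg _)]
  exact Real.smoothTransition.le_one _

end ConvexPolytope
end
end ConformingDG

namespace ConformingDG
noncomputable section

/-- Layer coordinates: `p.1` is `n` times the depth below the hyperplane and `p.2` the foot point.
The Jacobian produces the factor `n` that appears in the derivative of the cut-off of scale `1/n`.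
-/
lemma map_hyper_scaled {d : ℕ} {ν : E d} (hν : ‖ν‖ = 1) (c : ℝ) {n : ℝ} (hn : 0 < n) :
    Measure.map (fun p : ℝ × E d => p.2 - (p.1 / n) • ν) ((volume : Measure ℝ).prod (hyper ν c))
      = ENNReal.ofReal n • volume := by
  have := sigmaFinite_hyper hν c
  have h1 : (fun p : ℝ × E d => p.2 - (p.1 / n) • ν)
      = (fun p : ℝ × E d => p.2 + p.1 • ν) ∘ (Prod.map (fun s => (-n⁻¹) * s) id) := by
    funext p
    simp [sub_eq_add_neg, div_eq_inv_mul]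
  rw [h1, ← Measure.map_map (by fun_prop) (by fun_prop),
    ← Measure.map_prod_map _ _ (by fun_prop) measurable_id, Measure.map_id,
    Real.map_volume_mul_left (by simp [hn.ne']), Measure.prod_smul_left, Measure.map_smul,
    (hyper_coarea hν c).map_eq]
  simp [abs_of_pos hn]

namespace ConvexPolytope

variable {d : ℕ} (T : ConvexPolytope d)

/-- The cut-off has compact support, so integrating by parts on the whole space leaves no boundary
term. By the product rule its derivative is a sum of layers, one along each facet. -/
lemma integral_cutoff_fderiv {φ : E d → ℝ} (hφ : ContDiff ℝ 1 φ) (w : E d) {n : ℝ} (hn : 0 < n) :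
    ∫ x, T.cutoff n x * fderiv ℝ φ x w = ∑ a, inner ℝ (T.outward a) w *
      ∫ x, n * (deriv Real.smoothTransition (n * T.gap a x) * (T.cutoffErase a n x * φ x)) := by
  have hφ' : Continuous fun x => fderiv ℝ φ x w := (hφ.continuous_fderiv one_ne_zero).clm_apply
    continuous_const
  have hc' : Continuous fun x => fderiv ℝ (T.cutoff n) x w :=
    ((T.contDiff_cutoff n).continuous_fderiv one_ne_zero).clm_apply continuous_const
  have hs := T.hasCompactSupport_cutoff hn
  have hs' : HasCompactSupport fun x => fderiv ℝ (T.cutoff n) x w := hs.fderiv_apply ℝ w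
  have hcc := (T.contDiff_cutoff n).continuous
  rw [integral_mul_fderiv_eq_neg_fderiv_mul_of_integrable
    ((hc'.mul hφ.continuous).integrable_of_hasCompactSupport hs'.mul_right)
    ((hcc.mul hφ').integrable_of_hasCompactSupport hs.mul_right)
    ((hcc.mul hφ.continuous).integrable_of_hasCompactSupport hs.mul_right)
    (fun x _ => (T.contDiff_cutoff n).differentiable one_ne_zero x)
    (fun x _ => hφ.differentiable one_ne_zero x)]
  have hint : ∀ a, Integrable fun x =>
      n * (deriv Real.smoothTransition (n * T.gap a x) * (T.cutoffErase a n x * φ x)) := by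
    intro a
    apply Continuous.integrable_of_hasCompactSupport
    · exact continuous_const.mul ((continuous_deriv_smoothTransition.comp (by fun_prop)).mul
        ((T.continuous_cutoffErase a n).mul hφ.continuous))
    · apply HasCompactSupport.intro T.isCompact_carrier
      intro x hx
      rw [mem_carrier_iff] at hx
      push Not at hx
      obtain ⟨b, hb⟩ := hx
      have hb' : n * T.gap b x < 0 := mul_neg_of_pos_of_neg hn hb
      by_cases hba : b = a
      · subst hba
        rw [deriv_smoothTransition_eq_zero (by simp [hb'])]
        simp
      · have : T.cutoffErase a n x = 0 := by
          apply Finset.prod_eq_zero (Finset.mem_erase.2 ⟨hba, Finset.mem_univ b⟩)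
          exact Real.smoothTransition.zero_of_nonpos hb'.le
        rw [this]; simp
  simp_rw [← integral_const_mul]
  rw [← integral_finsetSum _ fun a _ => (hint a).const_mul _, ← integral_neg]
  refine integral_congr_ae (Eventually.of_forall fun x => ?_)
  simp only [fderiv_cutoff]
  rw [neg_mul, neg_neg, Finset.sum_mul]
  refine Finset.sum_congr rfl fun a _ => ?_
  ring

/-- In layer coordinates the profile across the facet no longer depends on `n`; only the remaining
factors do. -/
lemma integral_layer {φ : E d → ℝ} (hφ : Continuous φ) (a : Fin T.numFacets) {n : ℝ}
    (hn : 0 < n) :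
    ∫ x, n * (deriv Real.smoothTransition (n * T.gap a x) * (T.cutoffErase a n x * φ x)) =
    ∫ p : ℝ × E d, deriv Real.smoothTransition p.1 *
      (T.cutoffErase a n (p.2 - (p.1 / n) • T.outward a) * φ (p.2 - (p.1 / n) • T.outward a))
      ∂((volume : Measure ℝ).prod (hyper (T.outward a) (T.offset a))) := by
  have := sigmaFinite_hyper (T.unit_outward a) (T.offset a)
  have hcont : Continuous fun x =>
      deriv Real.smoothTransition (n * T.gap a x) * (T.cutoffErase a n x * φ x) :=
    (continuous_deriv_smoothTransition.comp (by fun_prop)).mul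
        ((T.continuous_cutoffErase a n).mul hφ)
  have h1 : ∫ x, deriv Real.smoothTransition (n * T.gap a x) * (T.cutoffErase a n x * φ x)
      ∂(ENNReal.ofReal n • (volume : Measure (E d))) =
      n * ∫ x, deriv Real.smoothTransition (n * T.gap a x) * (T.cutoffErase a n x * φ x) := by
    rw [integral_smul_measure, ENNReal.toReal_ofReal hn.le, smul_eq_mul]
  rw [integral_const_mul, ← h1, ← map_hyper_scaled (T.unit_outward a) (T.offset a) hn,
    integral_map (by fun_prop) hcont.aestronglyMeasurable]
  refine integral_congr_ae ?_
  have h2 : ∀ᵐ p : ℝ × E d ∂((volume : Measure ℝ).prod (hyper (T.outward a) (T.offset a))),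
      p.2 ∈ {x | inner ℝ (T.outward a) x = T.offset a} := by
    have : ∀ᵐ x ∂(hyper (T.outward a) (T.offset a)),
        x ∈ {x | inner ℝ (T.outward a) x = T.offset a} :=
      ae_restrict_mem (measurableSet_eq_fun (by fun_prop) (by fun_prop))
    exact Measure.quasiMeasurePreserving_snd.ae this
  filter_upwards [h2] with p hp
  have h3 : n * T.gap a (p.2 - (p.1 / n) • T.outward a) = p.1 := by
    have hp' : inner ℝ (T.outward a) p.2 = T.offset a := hp
    rw [sub_eq_add_neg, ← neg_smul, gap_self_add_smul, gap, hp']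
    field_simp
    ring
  simp only [h3]

lemma exists_abs_le_on_carrier {φ : E d → ℝ} (hφ : Continuous φ) :
    ∃ C, 0 ≤ C ∧ ∀ x ∈ T.carrier, |φ x| ≤ C := by
  obtain ⟨C, hC⟩ := T.isCompact_carrier.exists_bound_of_continuousOn hφ.continuousOn
  exact ⟨max C 0, le_max_right _ _, fun x hx => (hC x hx).trans (le_max_left _ _)⟩

/-- Dominated convergence in layer coordinates. Over a foot point whose other gaps are positive the
remaining cut-off factors become 1, over one with a negative gap they become 0, and zero gaps are
negligible. The profile has integral 1, so the limit is the integral over the facet. -/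
lemma tendsto_layer {φ : E d → ℝ} (hφ : Continuous φ) (a : Fin T.numFacets) :
    Tendsto (fun m : ℕ => ∫ p : ℝ × E d, deriv Real.smoothTransition p.1 *
      (T.cutoffErase a (m + 1) (p.2 - (p.1 / (m + 1)) • T.outward a) *
        φ (p.2 - (p.1 / (m + 1)) • T.outward a))
      ∂((volume : Measure ℝ).prod (hyper (T.outward a) (T.offset a)))) atTop
      (𝓝 (∫ x, φ x ∂(T.surface a))) := by
  have := sigmaFinite_hyper (T.unit_outward a) (T.offset a)
  set σ := hyper (T.outward a) (T.offset a) with hσ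
  set S : Set (E d) := {y | ∀ b, b ≠ a → 0 < T.gap b y} with hS
  have hSm : MeasurableSet S := by
    have : S = ⋂ b, ⋂ (_ : b ≠ a), {y | 0 < T.gap b y} := by ext y; simp [hS]
    rw [this]
    exact MeasurableSet.iInter fun b => MeasurableSet.iInter fun _ =>
      (isOpen_lt continuous_const (T.continuous_gap b)).measurableSet
  have hH : ∀ᵐ x ∂σ, T.gap a x = 0 := by
    have : ∀ᵐ x ∂σ, x ∈ {x | inner ℝ (T.outward a) x = T.offset a} :=
      ae_restrict_mem (measurableSet_eq_fun (by fun_prop) (by fun_prop))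
    filter_upwards [this] with x hx
    have hx' : inner ℝ (T.outward a) x = T.offset a := hx
    rw [gap, hx', sub_self]
  have hne : ∀ᵐ x ∂σ, ∀ b, b ≠ a → T.gap b x ≠ 0 := by
    refine ae_all_iff.2 fun b => ?_
    by_cases hb : b = a
    · simp [hb]
    · have h0 : ∀ᵐ x ∂σ, T.gap b x ≠ 0 := by
        rw [ae_iff]
        simpa using T.hyper_gap_null hb
      filter_upwards [h0] with x hx _ using hx
  have hlim : ∫ x, φ x ∂(T.surface a) = ∫ p : ℝ × E d, deriv Real.smoothTransition p.1 *
      S.indicator φ p.2 ∂((volume : Measure ℝ).prod σ) := by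
    rw [integral_prod_mul (deriv Real.smoothTransition) (S.indicator φ),
      integral_deriv_smoothTransition, one_mul, integral_indicator hSm, surface_eq]
    apply setIntegral_congr_set
    filter_upwards [hH, hne] with x hx1 hx2
    apply propext
    change x ∈ T.carrier ↔ x ∈ S
    rw [mem_carrier_iff]
    constructor
    · intro h b hb
      exact lt_of_le_of_ne (h b) (hx2 b hb).symm
    · intro h b
      by_cases hb : b = a
      · rw [hb, hx1]
      · exact (h b hb).le
  rw [hlim]
  obtain ⟨M1, hM1⟩ := (isCompact_Icc (a := (0 : ℝ)) (b := 1)).exists_bound_of_continuousOn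
    continuous_deriv_smoothTransition.continuousOn
  obtain ⟨M2, hM20, hM2⟩ := T.exists_abs_le_on_carrier hφ
  obtain ⟨R, hR⟩ := T.isBounded.exists_norm_le
  have hM10 : 0 ≤ M1 := (norm_nonneg _).trans (hM1 0 (by simp))
  have hae1 : ∀ᵐ p : ℝ × E d ∂((volume : Measure ℝ).prod σ), T.gap a p.2 = 0 :=
    Measure.quasiMeasurePreserving_snd.ae hH
  have hae2 : ∀ᵐ p : ℝ × E d ∂((volume : Measure ℝ).prod σ), ∀ b, b ≠ a → T.gap b p.2 ≠ 0 :=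
    Measure.quasiMeasurePreserving_snd.ae hne
  -- The integrand vanishes unless the profile variable is in `[0, 1]` and the shifted point lies in
  -- the polytope. The shift has length at most 1, so the foot point is then in the ball of radius
  -- `R + 1`.
  refine tendsto_integral_of_dominated_convergence
    (Set.indicator (Set.Icc (0 : ℝ) 1 ×ˢ Metric.closedBall (0 : E d) (R + 1)) fun _ => M1 * M2)
    ?_ ?_ ?_ ?_
  · intro m
    apply Continuous.aestronglyMeasurable
    have h1 : Continuous fun p : ℝ × E d => p.2 - (p.1 / (m + 1 : ℝ)) • T.outward a := by fun_prop
    exact (continuous_deriv_smoothTransition.comp continuous_fst).mul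
      (((T.continuous_cutoffErase a _).comp h1).mul (hφ.comp h1))
  · rw [integrable_indicator_iff (measurableSet_Icc.prod measurableSet_closedBall)]
    apply integrableOn_const _
    · rw [Measure.prod_prod]
      exact (ENNReal.mul_lt_top (by simp) (hyper_isCompact_lt_top (T.unit_outward a) _
        (isCompact_closedBall _ _))).ne
  · intro m
    filter_upwards [hae1] with p hp
    have hm : (0 : ℝ) < m + 1 := by positivity
    by_cases hs : p.1 ∈ Set.Icc (0 : ℝ) 1
    swap
    · rw [deriv_smoothTransition_eq_zero hs, zero_mul, norm_zero]
      exact Set.indicator_nonneg (fun _ _ => by positivity) _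
    set x := p.2 - (p.1 / (m + 1 : ℝ)) • T.outward a with hx
    have hga : T.gap a x = p.1 / (m + 1) := by
      rw [hx, sub_eq_add_neg, ← neg_smul, gap_self_add_smul, hp]; ring
    by_cases hxT : x ∈ T.carrier
    · have hy : p.2 ∈ Metric.closedBall (0 : E d) (R + 1) := by
        rw [mem_closedBall_zero_iff]
        have : p.2 = x + (p.1 / (m + 1 : ℝ)) • T.outward a := by simp [hx]
        rw [this]
        refine (norm_add_le _ _).trans (add_le_add (hR x hxT) ?_)
        rw [norm_smul, T.unit_outward, mul_one, Real.norm_eq_abs, abs_of_nonneg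
          (div_nonneg hs.1 hm.le), div_le_one hm]
        have : (0 : ℝ) ≤ m := by positivity
        linarith [hs.2]
      rw [Set.indicator_of_mem (Set.mk_mem_prod hs hy), norm_mul, norm_mul]
      have h1 := hM1 p.1 hs
      have h2 : ‖T.cutoffErase a (m + 1) x‖ ≤ 1 := abs_prod_smoothTransition_le _ _
      have h3 := hM2 x hxT
      rw [← Real.norm_eq_abs] at h3
      calc _ ≤ M1 * (1 * M2) := by gcongr
        _ = _ := by ring
    · have : T.cutoffErase a (m + 1) x = 0 := by
        rw [mem_carrier_iff] at hxT
        push Not at hxT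
        obtain ⟨b, hb⟩ := hxT
        have hba : b ≠ a := by
          rintro rfl
          rw [hga] at hb
          exact absurd hb (not_lt.2 (div_nonneg hs.1 hm.le))
        apply Finset.prod_eq_zero (Finset.mem_erase.2 ⟨hba, Finset.mem_univ b⟩)
        exact Real.smoothTransition.zero_of_nonpos (mul_nonpos_of_nonneg_of_nonpos hm.le hb.le)
      rw [this, zero_mul, mul_zero, norm_zero]
      exact Set.indicator_nonneg (fun _ _ => by positivity) _
  · filter_upwards [hae2] with p hp
    apply Tendsto.const_mul
    have hinv : Tendsto (fun m : ℕ => p.1 / ((m : ℝ) + 1)) atTop (𝓝 0) :=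
      tendsto_const_div_atTop_nhds_zero_nat p.1 |>.comp (tendsto_add_atTop_nat 1) |>.congr
        fun m => by simp
    have h1 : Tendsto (fun m : ℕ => φ (p.2 - (p.1 / ((m : ℝ) + 1)) • T.outward a)) atTop
        (𝓝 (φ p.2)) := by
      have : Tendsto (fun m : ℕ => p.2 - (p.1 / ((m : ℝ) + 1)) • T.outward a) atTop (𝓝 p.2) := by
        simpa using (tendsto_const_nhds (x := p.2)).sub (hinv.smul_const (T.outward a))
      exact (hφ.tendsto _).comp this
    have hgap : ∀ (m : ℕ) b, ((m : ℝ) + 1) * T.gap b (p.2 - (p.1 / ((m : ℝ) + 1)) • T.outward a)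
        = ((m : ℝ) + 1) * T.gap b p.2 + p.1 * inner ℝ (T.outward b) (T.outward a) := by
      intro m b
      have hm : (m : ℝ) + 1 ≠ 0 := by positivity
      rw [sub_eq_add_neg, ← neg_smul, gap_add_smul]
      field_simp
      ring
    have hm1 : Tendsto (fun m : ℕ => (m : ℝ) + 1) atTop atTop :=
      tendsto_atTop_add_const_right _ _ tendsto_natCast_atTop_atTop
    by_cases hpS : p.2 ∈ S
    · rw [Set.indicator_of_mem hpS]
      refine h1.congr' ?_
      have : ∀ᶠ m : ℕ in atTop, ∀ b, b ≠ a → 1 ≤ ((m : ℝ) + 1) * T.gap b p.2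
          + p.1 * inner ℝ (T.outward b) (T.outward a) := by
        refine eventually_all.2 fun b => ?_
        by_cases hb : b = a
        · simp [hb]
        · have := tendsto_atTop_add_const_right _ (p.1 * inner ℝ (T.outward b) (T.outward a))
            (hm1.atTop_mul_const (hpS b hb))
          filter_upwards [this.eventually_ge_atTop 1] with m hm _ using hm
      filter_upwards [this] with m hm
      have : T.cutoffErase a (m + 1) (p.2 - (p.1 / ((m : ℝ) + 1)) • T.outward a) = 1 := by
        apply Finset.prod_eq_one
        intro b hb
        rw [hgap]
        exact Real.smoothTransition.one_of_one_le (hm b (Finset.ne_of_mem_erase hb))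
      rw [this, one_mul]
    · rw [Set.indicator_of_notMem hpS]
      have hpS' : ∃ b, b ≠ a ∧ T.gap b p.2 < 0 := by
        simp only [hS, Set.mem_ofPred_eq] at hpS
        push Not at hpS
        obtain ⟨b, hb, hb2⟩ := hpS
        exact ⟨b, hb, lt_of_le_of_ne hb2 (hp b hb)⟩
      obtain ⟨b, hb, hb2⟩ := hpS'
      refine tendsto_const_nhds.congr' ?_
      have := tendsto_atBot_add_const_right _ (p.1 * inner ℝ (T.outward b) (T.outward a))
            (hm1.atTop_mul_const_of_neg hb2)
      filter_upwards [this.eventually_le_atBot 0] with m hm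
      have : T.cutoffErase a (m + 1) (p.2 - (p.1 / ((m : ℝ) + 1)) • T.outward a) = 0 := by
        apply Finset.prod_eq_zero (Finset.mem_erase.2 ⟨hb, Finset.mem_univ b⟩)
        rw [hgap]
        exact Real.smoothTransition.zero_of_nonpos hm
      rw [this, zero_mul]

/-- The divergence theorem, in the direction `w`. -/
theorem integral_fderiv_carrier {φ : E d → ℝ} (hφ : ContDiff ℝ 1 φ) (w : E d) :
    ∫ x in T.carrier, fderiv ℝ φ x w =
      ∑ a, inner ℝ (T.outward a) w * ∫ x, φ x ∂(T.surface a) := by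
  have hφ' : Continuous fun x => fderiv ℝ φ x w := (hφ.continuous_fderiv one_ne_zero).clm_apply
    continuous_const
  -- The same integrals have two limits: the facet integrals, through the layers, and the volume
  -- integral, since the cut-off tends to the indicator of the interior.
  have h1 : Tendsto (fun m : ℕ => ∫ x, T.cutoff (m + 1) x * fderiv ℝ φ x w) atTop
      (𝓝 (∑ a, inner ℝ (T.outward a) w * ∫ x, φ x ∂(T.surface a))) := by
    have : ∀ m : ℕ, (0 : ℝ) < m + 1 := fun m => by positivity
    simp_rw [fun m : ℕ => T.integral_cutoff_fderiv hφ w (this m),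
      fun (m : ℕ) a => T.integral_layer hφ.continuous a (this m)]
    exact tendsto_finsetSum _ fun a _ => (T.tendsto_layer hφ.continuous a).const_mul _
  refine tendsto_nhds_unique ?_ h1
  rw [← setIntegral_congr_set T.inner'_ae_eq, ← integral_indicator T.isOpen_inner'.measurableSet]
  obtain ⟨M, hM0, hM⟩ := T.exists_abs_le_on_carrier hφ'
  refine tendsto_integral_of_dominated_convergence (T.carrier.indicator fun _ => M) ?_ ?_ ?_ ?_
  · intro m
    exact ((T.contDiff_cutoff _).continuous.mul hφ').aestronglyMeasurable
  · rw [integrable_indicator_iff T.isClosed_carrier.measurableSet]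
    exact integrableOn_const T.isCompact_carrier.measure_lt_top.ne (by simp)
  · intro m
    refine Eventually.of_forall fun x => ?_
    by_cases hx : x ∈ T.carrier
    · rw [Set.indicator_of_mem hx, norm_mul]
      have h2 : ‖T.cutoff (m + 1) x‖ ≤ 1 := abs_prod_smoothTransition_le _ _
      have h3 := hM x hx
      rw [← Real.norm_eq_abs] at h3
      calc _ ≤ 1 * M := by gcongr
        _ = _ := one_mul _
    · rw [T.cutoff_eq_zero (by positivity) hx, zero_mul, norm_zero, Set.indicator_of_notMem hx]
  · refine Eventually.of_forall fun x => ?_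
    have hm1 : Tendsto (fun m : ℕ => (m : ℝ) + 1) atTop atTop :=
      tendsto_atTop_add_const_right _ _ tendsto_natCast_atTop_atTop
    by_cases hx : x ∈ T.inner'
    · rw [Set.indicator_of_mem hx]
      refine tendsto_const_nhds.congr' ?_
      have : ∀ᶠ m : ℕ in atTop, ∀ b, 1 ≤ ((m : ℝ) + 1) * T.gap b x :=
        eventually_all.2 fun b => (hm1.atTop_mul_const (hx b)).eventually_ge_atTop 1
      filter_upwards [this] with m hm
      have : T.cutoff (m + 1) x = 1 := Finset.prod_eq_one fun b _ =>
        Real.smoothTransition.one_of_one_le (hm b)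
      rw [this, one_mul]
    · rw [Set.indicator_of_notMem hx]
      refine tendsto_const_nhds.congr fun m => ?_
      have hx' : ∃ b, T.gap b x ≤ 0 := by
        simp only [inner', Set.mem_ofPred_eq] at hx
        push Not at hx
        exact hx
      obtain ⟨b, hb⟩ := hx'
      have : T.cutoff (m + 1) x = 0 := Finset.prod_eq_zero (Finset.mem_univ b)
        (Real.smoothTransition.zero_of_nonpos
          (mul_nonpos_of_nonneg_of_nonpos (by positivity) hb))
      rw [this, zero_mul]

end ConvexPolytope
end
end ConformingDG

namespace ConformingDG
noncomputable section

/-! ### Polynomial functions -/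

/-- The partial derivative `∂ᵢ f`. -/
def pd {d : ℕ} (i : Fin d) (f : E d → ℝ) (x : E d) : ℝ :=
  fderiv ℝ f x (EuclideanSpace.single i (1 : ℝ))

/-- `f` is a polynomial function of degree at most `m`. -/
def IsPoly {d : ℕ} (m : ℕ) (f : E d → ℝ) : Prop :=
  ∃ p : MvPolynomial (Fin d) ℝ, p.totalDegree ≤ m ∧ f = pval p

section pval
variable {d : ℕ}

@[simp] lemma pval_add (p q : MvPolynomial (Fin d) ℝ) (x : E d) :
    pval (p + q) x = pval p x + pval q x := by simp [pval]
@[simp] lemma pval_mul (p q : MvPolynomial (Fin d) ℝ) (x : E d) :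
    pval (p * q) x = pval p x * pval q x := by simp [pval]
@[simp] lemma pval_C (c : ℝ) (x : E d) : pval (MvPolynomial.C c : MvPolynomial (Fin d) ℝ) x = c := by
  simp [pval]
@[simp] lemma pval_X (i : Fin d) (x : E d) : pval (MvPolynomial.X i) x = x i := by simp [pval]
@[simp] lemma pval_zero (x : E d) : pval (0 : MvPolynomial (Fin d) ℝ) x = 0 := by simp [pval]
@[simp] lemma pval_one (x : E d) : pval (1 : MvPolynomial (Fin d) ℝ) x = 1 := by simp [pval]
@[simp] lemma pval_smul (c : ℝ) (p : MvPolynomial (Fin d) ℝ) (x : E d) :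
    pval (c • p) x = c * pval p x := by simp [pval]
lemma pval_sum {ι : Type*} (s : Finset ι) (p : ι → MvPolynomial (Fin d) ℝ) (x : E d) :
    pval (∑ i ∈ s, p i) x = ∑ i ∈ s, pval (p i) x := by simp [pval]

lemma contDiff_pval (p : MvPolynomial (Fin d) ℝ) {n : WithTop ℕ∞} : ContDiff ℝ n (pval p) := by
  induction p using MvPolynomial.induction_on with
  | C a =>
    have : pval (MvPolynomial.C a : MvPolynomial (Fin d) ℝ) = fun _ => a := by ext x; simp
    rw [this]; exact contDiff_const
  | add p q hp hq =>
    have : pval (p + q) = fun x => pval p x + pval q x := by ext x; simp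
    rw [this]; exact hp.add hq
  | mul_X p i hp =>
    have : pval (p * MvPolynomial.X i) = fun x => pval p x * x i := by ext x; simp
    rw [this]
    exact hp.mul (by fun_prop)

lemma continuous_pval (p : MvPolynomial (Fin d) ℝ) : Continuous (pval p) :=
  (contDiff_pval p (n := 0)).continuous

lemma pd_pval (i : Fin d) (p : MvPolynomial (Fin d) ℝ) :
    pd i (pval p) = pval (MvPolynomial.pderiv i p) := by
  funext x
  induction p using MvPolynomial.induction_on with
  | C a =>
    have : pval (MvPolynomial.C a : MvPolynomial (Fin d) ℝ) = fun _ => a := by ext x; simp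
    simp [pd, this]
  | add p q hp hq =>
    have : pval (p + q) = fun x => pval p x + pval q x := by ext x; simp
    rw [map_add, pval_add, ← hp, ← hq, pd, this, fderiv_fun_add
      ((contDiff_pval p (n := 1)).differentiable one_ne_zero x)
      ((contDiff_pval q (n := 1)).differentiable one_ne_zero x)]
    rfl
  | mul_X p j hp =>
    have : pval (p * MvPolynomial.X j) = fun x => pval p x * x j := by ext x; simp
    have hj : HasFDerivAt (fun x : E d => x j) (EuclideanSpace.proj j : E d →L[ℝ] ℝ) x :=
      (EuclideanSpace.proj j : E d →L[ℝ] ℝ).hasFDerivAt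
    have h1 : fderiv ℝ (fun x => pval p x * x j) x = _ :=
      (((contDiff_pval p (n := 1)).differentiable one_ne_zero x).hasFDerivAt.mul hj).fderiv
    rw [MvPolynomial.pderiv_mul, pval_add, pval_mul, pval_mul, ← hp, MvPolynomial.pderiv_X, pd, this,
      h1]
    by_cases hij : i = j
    · subst hij
      simp [pd]
      ring
    · simp [pd, Ne.symm hij]
      ring

lemma totalDegree_pderiv_le (i : Fin d) (p : MvPolynomial (Fin d) ℝ) {m : ℕ}
    (hp : p.totalDegree ≤ m) : (MvPolynomial.pderiv i p).totalDegree ≤ m - 1 := by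
  rw [p.as_sum, map_sum]
  apply MvPolynomial.totalDegree_finsetSum_le
  intro s hs
  rw [MvPolynomial.pderiv_monomial]
  by_cases h0 : s i = 0
  · simp [h0]
  refine (MvPolynomial.totalDegree_monomial_le _ _).trans ?_
  have h1 : (s.sum fun _ e => e) ≤ m := (MvPolynomial.le_totalDegree hs).trans hp
  have h2 : s = (s - Finsupp.single i 1) + Finsupp.single i 1 := by
    ext j
    by_cases hij : j = i
    · subst hij; simp; omega
    · simp [Ne.symm hij]
  rw [h2, Finsupp.sum_add_index' (fun _ => rfl) (fun _ _ _ => rfl), Finsupp.sum_single_index rfl] at h1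
  have h3 : (s - Finsupp.single i 1).sum (fun _ e => e) ≤ m - 1 := by omega
  exact h3

/-- A polynomial that vanishes on a nonempty open set is zero. -/
lemma eq_zero_of_pval_eq_zero {p : MvPolynomial (Fin d) ℝ} {U : Set (E d)} (hU : IsOpen U)
    (hne : U.Nonempty) (h : ∀ x ∈ U, pval p x = 0) : p = 0 := by
  obtain ⟨x, hx⟩ := hne
  have hV : IsOpen ((WithLp.toLp 2 : (Fin d → ℝ) → E d) ⁻¹' U) :=
    hU.preimage (PiLp.continuous_toLp 2 _)
  obtain ⟨r, hr, hball⟩ := Metric.isOpen_iff.1 hV (WithLp.ofLp x) (by simpa using hx)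
  apply MvPolynomial.funext_set (fun i => Metric.ball (x i) r)
  · intro i
    exact infinite_of_mem_nhds (x i) (Metric.ball_mem_nhds _ hr)
  · intro y hy
    rw [← ball_pi _ hr] at hy
    have := h _ (hball hy)
    simpa [pval] using this

end pval

namespace IsPoly
variable {d m n : ℕ} {f g : E d → ℝ}

lemma mono (hf : IsPoly m f) (h : m ≤ n) : IsPoly n f := by
  obtain ⟨p, hp, rfl⟩ := hf
  exact ⟨p, hp.trans h, rfl⟩

lemma const (c : ℝ) : IsPoly m (fun _ : E d => c) :=
  ⟨MvPolynomial.C c, by simp, by ext x; simp⟩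

lemma add (hf : IsPoly m f) (hg : IsPoly m g) : IsPoly m (fun x => f x + g x) := by
  obtain ⟨p, hp, rfl⟩ := hf
  obtain ⟨q, hq, rfl⟩ := hg
  exact ⟨p + q, (MvPolynomial.totalDegree_add _ _).trans (max_le hp hq), by ext x; simp⟩

lemma mul (hf : IsPoly m f) (hg : IsPoly n g) : IsPoly (m + n) (fun x => f x * g x) := by
  obtain ⟨p, hp, rfl⟩ := hf
  obtain ⟨q, hq, rfl⟩ := hg
  exact ⟨p * q, (MvPolynomial.totalDegree_mul _ _).trans (add_le_add hp hq), by ext x; simp⟩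

lemma const_mul (hf : IsPoly m f) (c : ℝ) : IsPoly m (fun x => c * f x) := by
  have := (const (d := d) (m := 0) c).mul hf
  rwa [zero_add] at this

lemma sub (hf : IsPoly m f) (hg : IsPoly m g) : IsPoly m (fun x => f x - g x) := by
  have := hf.add (hg.const_mul (-1))
  simpa [sub_eq_add_neg] using this

lemma sum {ι : Type*} (s : Finset ι) {F : ι → E d → ℝ} (h : ∀ i ∈ s, IsPoly m (F i)) :
    IsPoly m (fun x => ∑ i ∈ s, F i x) := by
  classical
  induction s using Finset.induction_on with
  | empty => simpa using const (d := d) (m := m) 0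
  | insert a s ha ih =>
    simp only [Finset.sum_insert ha]
    exact (h a (Finset.mem_insert_self _ _)).add
      (ih fun i hi => h i (Finset.mem_insert_of_mem hi))

lemma prod {ι : Type*} (s : Finset ι) {F : ι → E d → ℝ} {e : ι → ℕ}
    (h : ∀ i ∈ s, IsPoly (e i) (F i)) :
    IsPoly (∑ i ∈ s, e i) (fun x => ∏ i ∈ s, F i x) := by
  classical
  induction s using Finset.induction_on with
  | empty => simpa using const (d := d) (m := 0) 1
  | insert a s ha ih =>
    simp only [Finset.prod_insert ha, Finset.sum_insert ha]
    exact (h a (Finset.mem_insert_self _ _)).mul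
      (ih fun i hi => h i (Finset.mem_insert_of_mem hi))

lemma pow (hf : IsPoly m f) (e : ℕ) : IsPoly (e * m) (fun x => f x ^ e) := by
  have := prod (Finset.range e) (F := fun _ => f) (e := fun _ => m) (fun _ _ => hf)
  simpa using this

lemma coord (i : Fin d) : IsPoly 1 (fun x : E d => x i) :=
  ⟨MvPolynomial.X i, by simp, by ext x; simp⟩

lemma inner_left (v : E d) : IsPoly 1 (fun x : E d => inner ℝ v x) := by
  have : (fun x : E d => inner ℝ v x) = fun x => ∑ i, v i * x i := by
    ext x; simp [PiLp.inner_apply, mul_comm]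
  rw [this]
  exact sum _ fun i _ => (coord i).const_mul _

/-- Composition with an affine map. -/
lemma comp_affine (hf : IsPoly m f) {A : E d → E d} (hA : ∀ i, IsPoly 1 (fun x => A x i)) :
    IsPoly m (fun x => f (A x)) := by
  obtain ⟨p, hp, rfl⟩ := hf
  have h1 : (fun x => pval p (A x))
      = fun x => ∑ s ∈ p.support, p.coeff s * ∏ i ∈ s.support, (A x i) ^ (s i) := by
    ext x
    rw [pval, MvPolynomial.eval_eq]
  rw [h1]
  refine sum _ fun s hs => const_mul ?_ _
  have h2 := prod s.support (F := fun i x => A x i ^ (s i)) (e := fun i => s i * 1)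
    (fun i _ => (hA i).pow (s i))
  refine h2.mono ?_
  simp only [mul_one]
  exact (MvPolynomial.le_totalDegree hs).trans hp

lemma contDiff (hf : IsPoly m f) {k : WithTop ℕ∞} : ContDiff ℝ k f := by
  obtain ⟨p, hp, rfl⟩ := hf
  exact contDiff_pval p

lemma continuous (hf : IsPoly m f) : Continuous f := (hf.contDiff (k := 0)).continuous

lemma differentiable (hf : IsPoly m f) : Differentiable ℝ f :=
  (hf.contDiff (k := 1)).differentiable one_ne_zero

lemma pd (hf : IsPoly m f) (i : Fin d) : IsPoly (m - 1) (ConformingDG.pd i f) := by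
  obtain ⟨p, hp, rfl⟩ := hf
  exact ⟨_, totalDegree_pderiv_le i p hp, pd_pval i p⟩

lemma comp_add_smul (hf : IsPoly m f) (y : E d) (r : ℝ) : IsPoly m (fun x => f (y + r • x)) :=
  hf.comp_affine fun i => by
    simpa using (const (d := d) (m := 1) (y i)).add ((coord i).const_mul r)

end IsPoly

/-! ### Finite-dimensional tools -/

/-- Riesz representation for a positive definite form on a finite-dimensional space. -/
lemma exists_riesz {V : Type*} [AddCommGroup V] [Module ℝ V] [FiniteDimensional ℝ V]
    (B : V →ₗ[ℝ] V →ₗ[ℝ] ℝ) (hB : ∀ v, v ≠ 0 → 0 < B v v) (ℓ : V →ₗ[ℝ] ℝ) :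
    ∃ g, ∀ v, B g v = ℓ v := by
  have hinj : Function.Injective B := by
    rw [← LinearMap.ker_eq_bot, LinearMap.ker_eq_bot']
    intro v hv
    by_contra h
    have := hB v h
    rw [hv] at this
    simp at this
  have hsurj : Function.Surjective B :=
    (LinearMap.injective_iff_surjective_of_finrank_eq_finrank
      (Subspace.dual_finrank_eq (K := ℝ) (V := V)).symm).1 hinj
  obtain ⟨g, hg⟩ := hsurj ℓ
  exact ⟨g, fun v => by rw [hg]⟩

/-- A linear functional is bounded by a positive definite form. -/
lemma exists_sq_le_form {V : Type*} [AddCommGroup V] [Module ℝ V] [FiniteDimensional ℝ V]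
    (B : V →ₗ[ℝ] V →ₗ[ℝ] ℝ) (hB : ∀ v, v ≠ 0 → 0 < B v v) (hs : ∀ v w, B v w = B w v)
    (ℓ : V →ₗ[ℝ] ℝ) : ∃ C, 0 ≤ C ∧ ∀ v, ℓ v ^ 2 ≤ C * B v v := by
  obtain ⟨g, hg⟩ := exists_riesz B hB ℓ
  have hB0 : ∀ v, 0 ≤ B v v := fun v => by
    by_cases h : v = 0
    · simp [h]
    · exact (hB v h).le
  refine ⟨B g g, hB0 g, fun v => ?_⟩
  rw [← hg]
  have := LinearMap.BilinForm.apply_mul_apply_le_of_forall_zero_le B hB0 g v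
  rw [hs v g] at this
  rw [sq]
  exact this

/-- The `L²(S)` inner product on polynomials of degree at most `m`. -/
def polyForm {d : ℕ} (m : ℕ) {S : Set (E d)} (hS : Bornology.IsBounded S) :
    MvPolynomial.restrictTotalDegree (Fin d) ℝ m →ₗ[ℝ]
      MvPolynomial.restrictTotalDegree (Fin d) ℝ m →ₗ[ℝ] ℝ :=
  have hi : ∀ p q : MvPolynomial (Fin d) ℝ, IntegrableOn (fun x => pval p x * pval q x) S :=
    fun p q => (((continuous_pval p).mul (continuous_pval q)).continuousOn.integrableOn_compact
      (hS.isCompact_closure)).mono_set subset_closure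
  LinearMap.mk₂ ℝ (fun p q => ∫ x in S, pval p.1 x * pval q.1 x)
    (fun p p' q => by
      simp only [Submodule.coe_add, pval_add, add_mul]
      exact integral_add (hi _ _) (hi _ _))
    (fun c p q => by
      simp only [Submodule.coe_smul, pval_smul, mul_assoc, integral_const_mul, smul_eq_mul])
    (fun p q q' => by
      simp only [Submodule.coe_add, pval_add, mul_add]
      exact integral_add (hi _ _) (hi _ _))
    (fun c p q => by
      simp only [Submodule.coe_smul, pval_smul, mul_left_comm, integral_const_mul, smul_eq_mul])

lemma polyForm_apply {d : ℕ} (m : ℕ) {S : Set (E d)} (hS : Bornology.IsBounded S)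
    (p q : MvPolynomial.restrictTotalDegree (Fin d) ℝ m) :
    polyForm m hS p q = ∫ x in S, pval p.1 x * pval q.1 x := rfl

lemma integral_sq_pos {d : ℕ} {S : Set (E d)} (hS : Bornology.IsBounded S)
    (hi : (interior S).Nonempty) {p : MvPolynomial (Fin d) ℝ} (hp : p ≠ 0) :
    0 < ∫ x in S, pval p x * pval p x := by
  have hint : IntegrableOn (fun x => pval p x * pval p x) S :=
    (((continuous_pval p).mul (continuous_pval p)).continuousOn.integrableOn_compact
      (hS.isCompact_closure)).mono_set subset_closure
  have h0 : ∀ x, 0 ≤ pval p x * pval p x := fun x => mul_self_nonneg _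
  have hx : ∃ x ∈ interior S, pval p x ≠ 0 := by
    by_contra hcon
    push Not at hcon
    exact hp (eq_zero_of_pval_eq_zero isOpen_interior hi hcon)
  refine lt_of_lt_of_le ?_ (setIntegral_mono_set hint (Eventually.of_forall h0)
    (LE.le.eventuallyLE (interior_subset (s := S))))
  rw [setIntegral_pos_iff_support_of_nonneg_ae (Eventually.of_forall h0)
    (hint.mono_set interior_subset)]
  obtain ⟨x, hx1, hx2⟩ := hx
  apply IsOpen.measure_pos
  · apply IsOpen.inter _ isOpen_interior
    have : Function.support (fun x => pval p x * pval p x) = {x | pval p x ≠ 0} := by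
      ext x; simp
    rw [this]
    exact isOpen_ne_fun (continuous_pval p) continuous_const
  · exact ⟨x, by simpa using hx2, hx1⟩

lemma polyForm_pos {d : ℕ} (m : ℕ) {S : Set (E d)} (hS : Bornology.IsBounded S)
    (hi : (interior S).Nonempty) (p : MvPolynomial.restrictTotalDegree (Fin d) ℝ m) (hp : p ≠ 0) :
    0 < polyForm m hS p p :=
  integral_sq_pos hS hi (by simpa using hp)

lemma polyForm_symm {d : ℕ} (m : ℕ) {S : Set (E d)} (hS : Bornology.IsBounded S)
    (p q : MvPolynomial.restrictTotalDegree (Fin d) ℝ m) :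
    polyForm m hS p q = polyForm m hS q p := by
  simp only [polyForm_apply, mul_comm]

/-- Finite dimensionality: each coordinate in a basis is bounded by the `L²` norm on the unit ball,
and basis polynomials and their derivatives are bounded on the ball of radius `K`. Balls are the
only reference domains needed later. -/
lemma exists_poly_bound_unit (d m : ℕ) (K : ℝ) :
    ∃ C, 0 < C ∧ ∀ f : E d → ℝ, IsPoly m f → ∀ x ∈ Metric.closedBall (0 : E d) K,
      (f x ^ 2 ≤ C * ∫ z in Metric.ball (0 : E d) 1, f z ^ 2) ∧
      ∀ i, pd i f x ^ 2 ≤ C * ∫ z in Metric.ball (0 : E d) 1, f z ^ 2 := by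
  let V := MvPolynomial.restrictTotalDegree (Fin d) ℝ m
  have hS : Bornology.IsBounded (Metric.ball (0 : E d) 1) := Metric.isBounded_ball
  have hi : (interior (Metric.ball (0 : E d) 1)).Nonempty := by
    rw [Metric.isOpen_ball.interior_eq]; exact Metric.nonempty_ball.2 one_pos
  let B := polyForm (d := d) m hS
  let b := Module.finBasis ℝ V
  have hc : ∀ j, ∃ C, 0 ≤ C ∧ ∀ v, (b.coord j v) ^ 2 ≤ C * B v v := fun j =>
    exists_sq_le_form B (polyForm_pos m hS hi) (polyForm_symm m hS) (b.coord j)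
  choose C hC0 hC using hc
  have hM : ∀ (q : MvPolynomial (Fin d) ℝ), ∃ M, ∀ x ∈ Metric.closedBall (0 : E d) K,
      |pval q x| ≤ M := fun q =>
    (isCompact_closedBall (0 : E d) K).exists_bound_of_continuousOn (continuous_pval q).continuousOn
  choose M hM using hM
  -- a bound for any linear operator with values in polynomials
  have key : ∀ D : MvPolynomial (Fin d) ℝ →ₗ[ℝ] MvPolynomial (Fin d) ℝ, ∃ C', 0 ≤ C' ∧
      ∀ v : V, ∀ x ∈ Metric.closedBall (0 : E d) K, pval (D v.1) x ^ 2 ≤ C' * B v v := by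
    intro D
    refine ⟨(∑ j, Real.sqrt (C j) * |M (D (b j).1)|) ^ 2, by positivity, fun v x hx => ?_⟩
    have h1 : pval (D v.1) x = ∑ j, b.coord j v * pval (D (b j).1) x := by
      conv_lhs => rw [← b.sum_repr v]
      rw [Submodule.coe_sum, map_sum, pval_sum]
      simp
    have hB0 : 0 ≤ B v v := by
      by_cases h : v = 0
      · simp [h]
      · exact (polyForm_pos m hS hi v h).le
    have h2 : |pval (D v.1) x| ≤ (∑ j, Real.sqrt (C j) * |M (D (b j).1)|) * Real.sqrt (B v v) := by
      rw [h1, Finset.sum_mul]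
      refine (Finset.abs_sum_le_sum_abs _ _).trans (Finset.sum_le_sum fun j _ => ?_)
      rw [abs_mul]
      have h3 : |b.coord j v| ≤ Real.sqrt (C j) * Real.sqrt (B v v) := by
        rw [← Real.sqrt_mul (hC0 j)]
        exact Real.abs_le_sqrt (hC j v)
      have h4 : |pval (D (b j).1) x| ≤ |M (D (b j).1)| := (hM _ x hx).trans (le_abs_self _)
      calc _ ≤ (Real.sqrt (C j) * Real.sqrt (B v v)) * |M (D (b j).1)| := by gcongr
        _ = _ := by ring
    calc pval (D v.1) x ^ 2 = |pval (D v.1) x| ^ 2 := (sq_abs _).symm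
      _ ≤ ((∑ j, Real.sqrt (C j) * |M (D (b j).1)|) * Real.sqrt (B v v)) ^ 2 := by gcongr
      _ = _ := by rw [mul_pow, Real.sq_sqrt hB0]
  obtain ⟨C0, hC00, hC0'⟩ := key LinearMap.id
  have key2 := fun i : Fin d => key (MvPolynomial.pderiv i).toLinearMap
  choose C1 hC10 hC1 using key2
  have hsum : 0 ≤ ∑ i, C1 i := Finset.sum_nonneg fun i _ => hC10 i
  refine ⟨C0 + ∑ i, C1 i + 1, by positivity, ?_⟩
  rintro f ⟨p, hp, rfl⟩ x hx
  have hB : ∫ z in Metric.ball (0 : E d) 1, pval p z ^ 2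
      = B ⟨p, (MvPolynomial.mem_restrictTotalDegree _ _ _).2 hp⟩
        ⟨p, (MvPolynomial.mem_restrictTotalDegree _ _ _).2 hp⟩ := by
    simp only [B, polyForm_apply, sq]
  have hpos : 0 ≤ ∫ z in Metric.ball (0 : E d) 1, pval p z ^ 2 :=
    integral_nonneg fun z => sq_nonneg _
  constructor
  · refine (hC0' ⟨p, (MvPolynomial.mem_restrictTotalDegree _ _ _).2 hp⟩ x hx).trans ?_
    rw [← hB]
    apply mul_le_mul_of_nonneg_right _ hpos
    linarith
  · intro i
    rw [pd_pval]
    refine (hC1 i ⟨p, (MvPolynomial.mem_restrictTotalDegree _ _ _).2 hp⟩ x hx).trans ?_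
    rw [← hB]
    apply mul_le_mul_of_nonneg_right _ hpos
    have := Finset.single_le_sum (f := C1) (fun i _ => hC10 i) (Finset.mem_univ i)
    linarith

lemma pd_comp_add_smul {d : ℕ} {f : E d → ℝ} (hf : Differentiable ℝ f) (y : E d) (r : ℝ)
    (i : Fin d) (x : E d) : pd i (fun x => f (y + r • x)) x = r * pd i f (y + r • x) := by
  have h1 : HasFDerivAt (fun x : E d => y + r • x) (r • ContinuousLinearMap.id ℝ (E d)) x :=
    ((hasFDerivAt_id x).const_smul r).const_add y
  have h2 := ((hf (y + r • x)).hasFDerivAt.comp x h1).fderiv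
  simp only [pd]
  have h3 : (fun x => f (y + r • x)) = f ∘ (fun x => y + r • x) := rfl
  rw [h3, h2]
  simp

lemma setIntegral_ball_comp {d : ℕ} (f : E d → ℝ) (y : E d) {r : ℝ} (hr : 0 < r) :
    ∫ z in Metric.ball y r, f z = r ^ d * ∫ z in Metric.ball (0 : E d) 1, f (y + r • z) := by
  have h1 := Measure.setIntegral_comp_smul_of_pos (volume : Measure (E d))
    (fun z => f (y + z)) (Metric.ball (0 : E d) 1) hr
  rw [finrank_euclideanSpace_fin, smul_unitBall_of_pos hr] at h1
  rw [h1, smul_eq_mul, ← mul_assoc, mul_inv_cancel₀ (by positivity), one_mul]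
  rw [← integral_indicator measurableSet_ball, ← integral_indicator measurableSet_ball,
    ← integral_add_left_eq_self _ y]
  refine integral_congr_ae (Eventually.of_forall fun z => ?_)
  by_cases hz : z ∈ Metric.ball (0 : E d) r
  · have hz' : y + z ∈ Metric.ball y r := by
      rw [mem_ball_zero_iff] at hz; rwa [mem_ball_iff_norm, add_sub_cancel_left]
    simp only [Set.indicator_of_mem hz, Set.indicator_of_mem hz']
  · have hz' : y + z ∉ Metric.ball y r := by
      rw [mem_ball_zero_iff] at hz; rwa [mem_ball_iff_norm, add_sub_cancel_left]
    simp only [Set.indicator_of_notMem hz, Set.indicator_of_notMem hz']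

/-- Norm equivalence and inverse inequality on balls, scaled. -/
lemma exists_poly_bound (d m : ℕ) (K : ℝ) :
    ∃ C, 0 < C ∧ ∀ f : E d → ℝ, IsPoly m f → ∀ (y : E d) (r : ℝ), 0 < r →
      ∀ x ∈ Metric.closedBall y (K * r),
      (r ^ d * f x ^ 2 ≤ C * ∫ z in Metric.ball y r, f z ^ 2) ∧
      ∀ i, r ^ d * (r * pd i f x) ^ 2 ≤ C * ∫ z in Metric.ball y r, f z ^ 2 := by
  obtain ⟨C, hC, h⟩ := exists_poly_bound_unit d m K
  refine ⟨C, hC, fun f hf y r hr x hx => ?_⟩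
  have hx' : r⁻¹ • (x - y) ∈ Metric.closedBall (0 : E d) K := by
    rw [mem_closedBall_zero_iff, norm_smul, norm_inv, Real.norm_of_nonneg hr.le,
      inv_mul_le_iff₀ hr, ← dist_eq_norm, mul_comm]
    exact hx
  have hxx : y + r • (r⁻¹ • (x - y)) = x := by
    rw [smul_inv_smul₀ hr.ne']; abel
  obtain ⟨h1, h2⟩ := h _ (hf.comp_add_smul y r) _ hx'
  simp only [hxx, pd_comp_add_smul hf.differentiable] at h1 h2
  rw [setIntegral_ball_comp _ y hr]
  constructor
  · calc _ ≤ r ^ d * (C * _) := mul_le_mul_of_nonneg_left h1 (by positivity)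
      _ = _ := by ring
  · intro i
    calc _ ≤ r ^ d * (C * _) := mul_le_mul_of_nonneg_left (h2 i) (by positivity)
      _ = _ := by ring

end
end ConformingDG

namespace ConformingDG
noncomputable section

/-! ### The `L²` norm -/

/-- The norm of `L²(μ)`. -/
def l2 {d : ℕ} (μ : Measure (E d)) (f : E d → ℝ) : ℝ := Real.sqrt (∫ x, f x ^ 2 ∂μ)

section l2
variable {d : ℕ} {μ : Measure (E d)} {f g : E d → ℝ}

lemma memLp_add (hf : MemLp f 2 μ) (hg : MemLp g 2 μ) : MemLp (fun x => f x + g x) 2 μ := hf.add hg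

lemma memLp_sub (hf : MemLp f 2 μ) (hg : MemLp g 2 μ) : MemLp (fun x => f x - g x) 2 μ := hf.sub hg

lemma memLp_neg (hf : MemLp f 2 μ) : MemLp (fun x => -f x) 2 μ := hf.neg

lemma l2_nonneg : 0 ≤ l2 μ f := Real.sqrt_nonneg _

lemma l2_sq : l2 μ f ^ 2 = ∫ x, f x ^ 2 ∂μ :=
  Real.sq_sqrt (integral_nonneg fun _ => sq_nonneg _)

lemma l2_congr (h : f =ᵐ[μ] g) : l2 μ f = l2 μ g := by
  unfold l2
  congr 1
  apply integral_congr_ae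
  filter_upwards [h] with x hx
  rw [hx]

lemma eLpNorm_eq_l2 (hf : MemLp f 2 μ) : eLpNorm f 2 μ = ENNReal.ofReal (l2 μ f) := by
  rw [hf.eLpNorm_eq_integral_rpow_norm (by simp) (by simp), l2, Real.sqrt_eq_rpow]
  simp

lemma l2_eq_toReal (hf : MemLp f 2 μ) : l2 μ f = (eLpNorm f 2 μ).toReal := by
  rw [eLpNorm_eq_l2 hf, ENNReal.toReal_ofReal l2_nonneg]

lemma l2_add_le (hf : MemLp f 2 μ) (hg : MemLp g 2 μ) :
    l2 μ (fun x => f x + g x) ≤ l2 μ f + l2 μ g := by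
  rw [l2_eq_toReal hf, l2_eq_toReal hg, l2_eq_toReal (memLp_add hf hg),
    ← ENNReal.toReal_add hf.2.ne hg.2.ne]
  exact ENNReal.toReal_mono (ENNReal.add_ne_top.2 ⟨hf.2.ne, hg.2.ne⟩)
    (eLpNorm_add_le hf.1 hg.1 (by norm_num))

lemma l2_const_mul (c : ℝ) : l2 μ (fun x => c * f x) = |c| * l2 μ f := by
  simp only [l2, mul_pow, integral_const_mul]
  rw [Real.sqrt_mul (sq_nonneg c), Real.sqrt_sq_eq_abs]

lemma l2_neg : l2 μ (fun x => -f x) = l2 μ f := by simp [l2]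

lemma l2_sub_comm : l2 μ (fun x => f x - g x) = l2 μ (fun x => g x - f x) := by
  simp only [l2]
  congr 2
  ext x
  ring

lemma l2_sub_le (hf : MemLp f 2 μ) (hg : MemLp g 2 μ) :
    l2 μ (fun x => f x - g x) ≤ l2 μ f + l2 μ g := by
  have := l2_add_le hf (memLp_neg hg)
  rw [l2_neg] at this
  simpa [sub_eq_add_neg] using this

lemma l2_le_add_sub (hf : MemLp f 2 μ) (hg : MemLp g 2 μ) :
    l2 μ f ≤ l2 μ g + l2 μ (fun x => f x - g x) := by
  have := l2_add_le hg (memLp_sub hf hg)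
  simpa using this

lemma abs_integral_mul_le (hf : MemLp f 2 μ) (hg : MemLp g 2 μ) :
    |∫ x, f x * g x ∂μ| ≤ l2 μ f * l2 μ g := by
  have h := integral_mul_norm_le_Lp_mul_Lq (μ := μ) (f := f) (g := g) Real.HolderConjugate.two_two
    (by simpa using hf) (by simpa using hg)
  have h1 : |∫ x, f x * g x ∂μ| ≤ ∫ x, ‖f x‖ * ‖g x‖ ∂μ := by
    rw [← Real.norm_eq_abs]
    refine (norm_integral_le_integral_norm _).trans (le_of_eq ?_)
    simp
  refine h1.trans (h.trans (le_of_eq ?_))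
  simp [l2, Real.sqrt_eq_rpow]

lemma integrable_mul_of_memLp (hf : MemLp f 2 μ) (hg : MemLp g 2 μ) :
    Integrable (fun x => f x * g x) μ := hf.integrable_mul hg

lemma l2_mono_set {s t : Set (E d)} (hst : s ⊆ t) (hf : MemLp f 2 (μ.restrict t)) :
    l2 (μ.restrict s) f ≤ l2 (μ.restrict t) f :=
  Real.sqrt_le_sqrt (setIntegral_mono_set hf.integrable_sq
    (Eventually.of_forall fun _ => sq_nonneg _) (LE.le.eventuallyLE hst))

lemma l2_le_of_abs_le (hf : AEStronglyMeasurable f μ) (hg : MemLp g 2 μ)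
    (h : ∀ᵐ x ∂μ, |f x| ≤ |g x|) : l2 μ f ≤ l2 μ g := by
  apply Real.sqrt_le_sqrt
  have hf' : MemLp f 2 μ := hg.mono hf (by simpa using h)
  apply integral_mono_ae hf'.integrable_sq hg.integrable_sq
  filter_upwards [h] with x hx
  exact sq_le_sq.2 hx

lemma TendstoL2.tendsto_l2 {φ : ℕ → E d → ℝ} (h : TendstoL2 μ φ g) (hφ : ∀ r, MemLp (φ r) 2 μ)
    (hg : MemLp g 2 μ) : Tendsto (fun r => l2 μ (fun x => φ r x - g x)) atTop (𝓝 0) := by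
  have h1 : ∀ r, l2 μ (fun x => φ r x - g x) = (eLpNorm (fun x => φ r x - g x) 2 μ).toReal :=
    fun r => l2_eq_toReal (memLp_sub (hφ r) hg)
  simp_rw [h1]
  exact (ENNReal.tendsto_toReal ENNReal.zero_ne_top).comp h

lemma tendstoL2_of_l2 {φ : ℕ → E d → ℝ} (hφ : ∀ r, MemLp (φ r) 2 μ) (hg : MemLp g 2 μ)
    (h : Tendsto (fun r => l2 μ (fun x => φ r x - g x)) atTop (𝓝 0)) : TendstoL2 μ φ g := by
  have h1 : ∀ r, eLpNorm (fun x => φ r x - g x) 2 μ =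
      ENNReal.ofReal (l2 μ (fun x => φ r x - g x)) := fun r => eLpNorm_eq_l2 (memLp_sub (hφ r) hg)
  unfold TendstoL2
  simp_rw [h1]
  simpa using ENNReal.tendsto_ofReal h

lemma tendsto_l2_norm {φ : ℕ → E d → ℝ} (hφ : ∀ r, MemLp (φ r) 2 μ) (hg : MemLp g 2 μ)
    (h : Tendsto (fun r => l2 μ (fun x => φ r x - g x)) atTop (𝓝 0)) :
    Tendsto (fun r => l2 μ (φ r)) atTop (𝓝 (l2 μ g)) := by
  rw [tendsto_iff_dist_tendsto_zero]
  refine squeeze_zero (fun _ => dist_nonneg) (fun r => ?_) h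
  rw [Real.dist_eq, abs_sub_le_iff]
  constructor
  · linarith [l2_le_add_sub (hφ r) hg]
  · have := l2_le_add_sub hg (hφ r)
    rw [l2_sub_comm] at this
    linarith

lemma tendsto_integral_mul {φ : ℕ → E d → ℝ} {ψ : E d → ℝ} (hφ : ∀ r, MemLp (φ r) 2 μ)
    (hg : MemLp g 2 μ) (hψ : MemLp ψ 2 μ)
    (h : Tendsto (fun r => l2 μ (fun x => φ r x - g x)) atTop (𝓝 0)) :
    Tendsto (fun r => ∫ x, φ r x * ψ x ∂μ) atTop (𝓝 (∫ x, g x * ψ x ∂μ)) := by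
  rw [tendsto_iff_dist_tendsto_zero]
  refine squeeze_zero (fun _ => dist_nonneg) (fun r => ?_) (by simpa using h.mul_const (l2 μ ψ))
  rw [Real.dist_eq, ← integral_sub (integrable_mul_of_memLp (hφ r) hψ)
    (integrable_mul_of_memLp hg hψ)]
  have := abs_integral_mul_le (memLp_sub (hφ r) hg) hψ
  simpa [sub_mul] using this

lemma l2_eq_zero_iff (hf : MemLp f 2 μ) : l2 μ f = 0 ↔ f =ᵐ[μ] 0 := by
  rw [l2, Real.sqrt_eq_zero (integral_nonneg fun _ => sq_nonneg _),
    integral_eq_zero_iff_of_nonneg (fun _ => sq_nonneg _) hf.integrable_sq]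
  constructor <;> intro h <;> filter_upwards [h] with x hx
  · simpa using hx
  · simp [hx]

lemma ae_eq_of_tendsto_l2 {φ : ℕ → E d → ℝ} (hφ : ∀ r, MemLp (φ r) 2 μ)
    (hf : MemLp f 2 μ) (hg : MemLp g 2 μ)
    (h1 : Tendsto (fun r => l2 μ (fun x => φ r x - f x)) atTop (𝓝 0))
    (h2 : Tendsto (fun r => l2 μ (fun x => φ r x - g x)) atTop (𝓝 0)) : f =ᵐ[μ] g := by
  have h3 : l2 μ (fun x => f x - g x) = 0 := by
    apply le_antisymm _ l2_nonneg
    have h4 : Tendsto (fun r => l2 μ (fun x => φ r x - f x) + l2 μ (fun x => φ r x - g x)) atTop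
        (𝓝 0) := by simpa using h1.add h2
    refine ge_of_tendsto h4 (Eventually.of_forall fun r => ?_)
    have := l2_add_le (memLp_sub hf (hφ r)) (memLp_sub (hφ r) hg)
    simp only [sub_add_sub_cancel] at this
    rw [l2_sub_comm (f := φ r) (g := f)]
    exact this
  have := (l2_eq_zero_iff (memLp_sub hf hg)).1 h3
  filter_upwards [this] with x hx
  simpa [sub_eq_zero] using hx

/-- Completeness of `L²(μ)`. -/
lemma exists_l2_limit {φ : ℕ → E d → ℝ} (hφ : ∀ r, MemLp (φ r) 2 μ)
    (h : ∀ ε > 0, ∃ N, ∀ m ≥ N, ∀ n ≥ N, l2 μ (fun x => φ m x - φ n x) < ε) :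
    ∃ g, MemLp g 2 μ ∧ Tendsto (fun r => l2 μ (fun x => φ r x - g x)) atTop (𝓝 0) := by
  let u : ℕ → Lp ℝ 2 μ := fun r => (hφ r).toLp
  have hdist : ∀ m n, dist (u m) (u n) = l2 μ (fun x => φ m x - φ n x) := by
    intro m n
    rw [Lp.dist_def, l2_eq_toReal (memLp_sub (hφ m) (hφ n))]
    congr 1
    apply eLpNorm_congr_ae
    filter_upwards [(hφ m).coeFn_toLp, (hφ n).coeFn_toLp] with x h1 h2
    simp [u, h1, h2]
  have hu : CauchySeq u := Metric.cauchySeq_iff.2 fun ε hε => by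
    simpa [hdist] using h ε hε
  obtain ⟨G, hG⟩ := cauchySeq_tendsto_of_complete hu
  refine ⟨G, Lp.memLp G, ?_⟩
  rw [tendsto_iff_dist_tendsto_zero] at hG
  refine hG.congr fun r => ?_
  rw [Lp.dist_def, l2_eq_toReal (memLp_sub (hφ r) (Lp.memLp G))]
  congr 1
  apply eLpNorm_congr_ae
  filter_upwards [(hφ r).coeFn_toLp] with x h1
  simp [u, h1]

lemma memLp_of_continuous_of_isCompact {f : E d → ℝ} (hf : Continuous f) {K : Set (E d)}
    (hK : IsCompact K) [IsFiniteMeasure (μ.restrict K)] : MemLp f 2 (μ.restrict K) := by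
  obtain ⟨C, hC⟩ := hK.exists_bound_of_continuousOn hf.continuousOn
  exact MemLp.of_bound hf.aestronglyMeasurable C
    ((ae_restrict_iff' hK.measurableSet).2 (Eventually.of_forall hC))

end l2

namespace ConvexPolytope
variable {d : ℕ} (T : ConvexPolytope d)

/-- Lebesgue measure on the polytope. -/
abbrev vol : Measure (E d) := volume.restrict T.carrier

instance isFiniteMeasure_vol : IsFiniteMeasure T.vol :=
  ⟨by rw [Measure.restrict_apply_univ]; exact T.isCompact_carrier.measure_lt_top⟩

lemma memLp_vol {f : E d → ℝ} (hf : Continuous f) : MemLp f 2 T.vol :=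
  haveI : IsFiniteMeasure (volume.restrict T.carrier) := T.isFiniteMeasure_vol
  memLp_of_continuous_of_isCompact hf T.isCompact_carrier

lemma memLp_surface {f : E d → ℝ} (hf : Continuous f) (a : Fin T.numFacets) :
    MemLp f 2 (T.surface a) :=
  haveI : IsFiniteMeasure
    ((Measure.euclideanHausdorffMeasure (d - 1)).restrict (T.facet a)) :=
    T.isFiniteMeasure_surface a
  memLp_of_continuous_of_isCompact hf (T.isCompact_facet a)

end ConvexPolytope
end
end ConformingDG

namespace ConformingDG
noncomputable section

/-! ### Slabs -/

/-- The volume of the unit ball. -/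
def ballVol (d : ℕ) : ℝ := volume.real (Metric.closedBall (0 : E d) 1)

lemma ballVol_nonneg (d : ℕ) : 0 ≤ ballVol d := measureReal_nonneg

lemma volume_real_closedBall {d : ℕ} (x : E d) {r : ℝ} (hr : 0 ≤ r) :
    volume.real (Metric.closedBall x r) = r ^ d * ballVol d := by
  have h := Measure.addHaar_closedBall' (volume : Measure (E d)) x hr
  rw [finrank_euclideanSpace_fin] at h
  rw [measureReal_def, h, ENNReal.toReal_mul, ENNReal.toReal_ofReal (by positivity)]
  rfl

/-- Sections of sets: `δ · σ(A)` is at most the volume of a set containing the points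
`y + t ν` with `y ∈ A` and `0 ≤ t ≤ δ`. -/
lemma mul_hyper_le {d : ℕ} {ν : E d} (hν : ‖ν‖ = 1) (c : ℝ) {δ : ℝ} (hδ : 0 ≤ δ)
    {A S : Set (E d)} (hS : MeasurableSet S) (hSb : Bornology.IsBounded S)
    (h : ∀ y ∈ A, inner ℝ ν y = c → ∀ t ∈ Set.Icc 0 δ, y + t • ν ∈ S) :
    δ * (hyper ν c).real A ≤ volume.real S := by
  have := sigmaFinite_hyper hν c
  have h1 : ENNReal.ofReal δ * hyper ν c A ≤ volume S := by
    have h2 : ((volume : Measure ℝ).prod (hyper ν c)) (Set.Icc 0 δ ×ˢ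
        (A ∩ {x | inner ℝ ν x = c})) ≤ volume S := by
      rw [← (hyper_coarea hν c).measure_preimage hS.nullMeasurableSet]
      apply measure_mono
      rintro ⟨t, y⟩ ⟨ht, hy1, hy2⟩
      exact h y hy1 hy2 t ht
    rw [Measure.prod_prod, Real.volume_Icc, sub_zero] at h2
    convert h2 using 2
    rw [hyper, Measure.restrict_apply' (measurableSet_eq_fun (by fun_prop) (by fun_prop)),
      Measure.restrict_apply' (measurableSet_eq_fun (by fun_prop) (by fun_prop)),
      Set.inter_assoc, Set.inter_self]
  have h3 := ENNReal.toReal_mono hSb.measure_lt_top.ne h1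
  rwa [ENNReal.toReal_mul, ENNReal.toReal_ofReal hδ] at h3

/-- The cylinder of height `R` over the disc lies in the ball of radius `2R`. -/
lemma hyper_closedBall_le {d : ℕ} {ν : E d} (hν : ‖ν‖ = 1) (c : ℝ) (z : E d) {R : ℝ}
    (hR : 0 < R) : R * (hyper ν c).real (Metric.closedBall z R) ≤ (2 * R) ^ d * ballVol d := by
  rw [← volume_real_closedBall z (by positivity)]
  refine mul_hyper_le hν c hR.le measurableSet_closedBall Metric.isBounded_closedBall ?_
  intro y hy _ t ht
  rw [mem_closedBall_iff_norm] at hy ⊢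
  have : y + t • ν - z = (y - z) + t • ν := by abel
  rw [this]
  refine (norm_add_le _ _).trans ?_
  rw [norm_smul, hν, mul_one, Real.norm_of_nonneg ht.1]
  linarith [ht.2]

/-- Fubini along `τ`. All slices of the slab project into one disc of radius `2R`, because the slab
is thinner than `R`; the area of that disc is bounded through a ball of radius `4R`. -/
lemma slab_le {d : ℕ} {τ : E d} (hτ : ‖τ‖ = 1) (c : ℝ) {ε R : ℝ} (hε : 0 ≤ ε) (hR : 0 < R)
    (hεR : ε ≤ R) (z : E d) :
    R * volume.real {x | x ∈ Metric.closedBall z R ∧ inner ℝ τ x ∈ Set.Icc c (c + ε)}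
      ≤ ε * ((4 * R) ^ d * ballVol d) := by
  have := sigmaFinite_hyper hτ 0
  set S := {x | x ∈ Metric.closedBall z R ∧ inner ℝ τ x ∈ Set.Icc c (c + ε)} with hS
  have hSm : MeasurableSet S := by
    apply measurableSet_closedBall.inter
    exact measurableSet_Icc.preimage (f := fun x : E d => inner ℝ τ x) (by fun_prop)
  have h1 : volume S ≤ ENNReal.ofReal ε * hyper τ 0 (Metric.closedBall (z - c • τ) (2 * R)) := by
    rw [← (hyper_coarea hτ 0).measure_preimage hSm.nullMeasurableSet]
    have h2 : ((volume : Measure ℝ).prod (hyper τ 0)) (Set.Icc c (c + ε) ×ˢ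
        (Metric.closedBall (z - c • τ) (2 * R))) =
        ENNReal.ofReal ε * hyper τ 0 (Metric.closedBall (z - c • τ) (2 * R)) := by
      rw [Measure.prod_prod, Real.volume_Icc, add_sub_cancel_left]
    rw [← h2]
    apply measure_mono_ae
    have hH : ∀ᵐ p : ℝ × E d ∂((volume : Measure ℝ).prod (hyper τ 0)), inner ℝ τ p.2 = 0 := by
      have : ∀ᵐ x ∂(hyper τ 0), x ∈ {x | inner ℝ τ x = 0} :=
        ae_restrict_mem (measurableSet_eq_fun (by fun_prop) (by fun_prop))
      exact Measure.quasiMeasurePreserving_snd.ae this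
    filter_upwards [hH] with p hp hpS
    obtain ⟨hp1, hp2⟩ := hpS
    have hp3 : inner ℝ τ (p.2 + p.1 • τ) = p.1 := by
      simp [inner_add_right, inner_smul_right, hp, hτ]
    rw [hp3] at hp2
    refine ⟨hp2, ?_⟩
    rw [mem_closedBall_iff_norm] at hp1 ⊢
    have : p.2 - (z - c • τ) = (p.2 + p.1 • τ - z) + (c - p.1) • τ := by
      rw [sub_smul]; abel
    rw [this]
    refine (norm_add_le _ _).trans ?_
    rw [norm_smul, hτ, mul_one, Real.norm_eq_abs, abs_of_nonpos (by linarith [hp2.1])]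
    linarith [hp2.2]
  have hfin : hyper τ 0 (Metric.closedBall (z - c • τ) (2 * R)) < ⊤ :=
    ConvexPolytope.hyper_isCompact_lt_top hτ 0 (isCompact_closedBall _ _)
  have h3 := ENNReal.toReal_mono (ENNReal.mul_ne_top (by simp) hfin.ne) h1
  rw [ENNReal.toReal_mul, ENNReal.toReal_ofReal hε] at h3
  have h4 := hyper_closedBall_le hτ 0 (z - c • τ) (R := 2 * R) (by positivity)
  have h5 : 0 ≤ (hyper τ 0).real (Metric.closedBall (z - c • τ) (2 * R)) := measureReal_nonneg
  change volume.real S ≤ ε * (hyper τ 0).real _ at h3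
  have h6 : (2 * (2 * R)) = 4 * R := by ring
  rw [h6] at h4
  calc R * volume.real S ≤ R * (ε * (hyper τ 0).real (Metric.closedBall (z - c • τ) (2 * R))) := by
        gcongr
    _ = ε * (R * (hyper τ 0).real (Metric.closedBall (z - c • τ) (2 * R))) := by ring
    _ ≤ ε * ((2 * R) * (hyper τ 0).real (Metric.closedBall (z - c • τ) (2 * R))) := by
        gcongr; linarith
    _ ≤ _ := by gcongr

/-! ### Interior points of shape regular elements and of their facets -/

/-- A polytope of size `h`, with an interior point whose distance to all hyperplanes is at least
`γ h` and a point of each edge/face with the same property for the other hyperplanes. -/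
structure Fat {d : ℕ} (T : ConvexPolytope d) (h γ : ℝ) : Prop where
  pos : 0 < h
  diam_le : ∀ x ∈ T.carrier, ∀ y ∈ T.carrier, dist x y ≤ h
  center : ∃ x, ∀ a, γ * h ≤ T.gap a x
  facet_center : ∀ a, ∃ y ∈ T.facet a, ∀ b, b ≠ a → γ * h ≤ T.gap b y

namespace ConvexPolytope
variable {d : ℕ} (T : ConvexPolytope d)

/-- If every point were closer than `γ h` to some facet hyperplane, at most `N` slabs of thickness
`γ h` would cover the element, and their total volume is less than `ρ h^d`. -/
lemma exists_center {N : ℕ} (hN : T.numFacets ≤ N) {h ρ γ : ℝ} (hh : 0 < h)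
    (hdiam : ∀ x ∈ T.carrier, ∀ y ∈ T.carrier, dist x y ≤ h) (hγ0 : 0 ≤ γ) (hγ1 : γ ≤ 1)
    (hγ : N * (γ * (4 ^ d * ballVol d)) < ρ)
    (hvol : ρ * h ^ d ≤ volume.real T.carrier) : ∃ x, ∀ a, γ * h ≤ T.gap a x := by
  by_contra hcon
  push Not at hcon
  obtain ⟨z, hz⟩ := T.inner'_nonempty
  have hzT : z ∈ T.carrier := T.mem_carrier_iff.2 fun a => (hz a).le
  have h1 : T.carrier ⊆ ⋃ a, {x | x ∈ Metric.closedBall z h ∧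
      inner ℝ (T.outward a) x ∈ Set.Icc (T.offset a - γ * h) (T.offset a - γ * h + γ * h)} := by
    intro x hx
    obtain ⟨a, ha⟩ := hcon x
    refine Set.mem_iUnion.2 ⟨a, hdiam x hx z hzT, ?_, ?_⟩
    · simp only [gap] at ha; linarith
    · have := T.mem_carrier_iff.1 hx a
      simp only [gap] at this; linarith
  have hfin : ∀ a, volume {x | x ∈ Metric.closedBall z h ∧
      inner ℝ (T.outward a) x ∈ Set.Icc (T.offset a - γ * h) (T.offset a - γ * h + γ * h)} ≠ ⊤ :=
    fun a => ((Metric.isBounded_closedBall (x := z) (r := h)).subset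
      (fun x hx => hx.1)).measure_lt_top.ne
  have h2 := (measureReal_mono h1 (by
    refine (lt_of_le_of_lt (measure_iUnion_le _) ?_).ne
    rw [tsum_fintype]
    exact ENNReal.sum_lt_top.2 fun a _ => (hfin a).lt_top)).trans
    (measureReal_iUnion_fintype_le (μ := volume) _)
  have h3 : h * volume.real T.carrier ≤ ∑ a : Fin T.numFacets, (γ * h) * ((4 * h) ^ d * ballVol d) := by
    calc _ ≤ h * ∑ a, volume.real {x | x ∈ Metric.closedBall z h ∧
      inner ℝ (T.outward a) x ∈ Set.Icc (T.offset a - γ * h) (T.offset a - γ * h + γ * h)} := by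
          gcongr
      _ ≤ _ := by
          rw [Finset.mul_sum]
          refine Finset.sum_le_sum fun a _ => ?_
          exact slab_le (T.unit_outward a) _ (by positivity) hh (by nlinarith) z
  rw [Finset.sum_const, Finset.card_univ, Fintype.card_fin, nsmul_eq_mul] at h3
  have h4 : h * (ρ * h ^ d) ≤ h * h ^ d * (N * (γ * (4 ^ d * ballVol d))) := by
    calc h * (ρ * h ^ d) ≤ h * volume.real T.carrier := by gcongr
      _ ≤ T.numFacets * ((γ * h) * ((4 * h) ^ d * ballVol d)) := h3
      _ ≤ N * ((γ * h) * ((4 * h) ^ d * ballVol d)) := by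
          have := ballVol_nonneg d
          gcongr
      _ = _ := by rw [mul_pow]; ring
  have h5 : h * h ^ d * (N * (γ * (4 ^ d * ballVol d))) < h * h ^ d * ρ := by
    gcongr
  linarith

/-- The part of the normal `ν_b` orthogonal to `ν_a`. -/
def tang (a b : Fin T.numFacets) : E d :=
  T.outward b - (inner ℝ (T.outward a) (T.outward b)) • T.outward a

lemma norm_tang_sq (a b : Fin T.numFacets) :
    ‖T.tang a b‖ ^ 2 = 1 - (inner ℝ (T.outward a) (T.outward b)) ^ 2 := by
  rw [tang, ← real_inner_self_eq_norm_sq]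
  simp only [inner_sub_left, inner_sub_right, inner_smul_left, inner_smul_right,
    real_inner_self_eq_norm_sq, T.unit_outward, real_inner_comm (T.outward a) (T.outward b)]
  simp
  ring

lemma inner_outward_eq (a b : Fin T.numFacets) (x : E d) :
    inner ℝ (T.outward b) x = inner ℝ (T.outward a) (T.outward b) * inner ℝ (T.outward a) x
      + inner ℝ (T.tang a b) x := by
  simp [tang, inner_sub_left, inner_smul_left]

/-- Nearly parallel normals cannot be nearly equal, by the angle condition, so they are nearly
opposite and `c ≤ 0`. Going from the centre to a point of facet `a` then cannot decrease the gap of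
`b` through the normal displacement, and the tangential displacement costs at most `‖tang‖ h ≤ γ h /
2`. -/
lemma gap_ge_of_tang_small {h γ : ℝ} (hh : 0 < h)
    (hdiam : ∀ x ∈ T.carrier, ∀ y ∈ T.carrier, dist x y ≤ h) (hγ : 0 < γ)
    {x0 : E d} (hx0 : ∀ a, γ * h ≤ T.gap a x0) {α : ℝ} (hα : 0 < α) {a b : Fin T.numFacets}
    (hang : α ≤ InnerProductGeometry.angle (T.outward a) (T.outward b))
    (hs1 : ‖T.tang a b‖ ≤ γ / 2) (hs2 : ‖T.tang a b‖ < Real.sin (min α (Real.pi / 2)))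
    {y : E d} (hy : y ∈ T.facet a) : γ / 2 * h ≤ T.gap b y := by
  have hx0T : x0 ∈ T.carrier := T.mem_carrier_iff.2 fun a =>
    le_trans (by positivity) (hx0 a)
  set c := inner ℝ (T.outward a) (T.outward b) with hc
  have hc0 : c ≤ 0 := by
    -- With `c > 0` the bound `c ≤ cos β` forces `‖tang‖ ≥ sin β`; the truncation of `α` at `π/2`
    -- keeps `β` where the sine is positive.
    by_contra hcp
    push Not at hcp
    have hcos : Real.cos (InnerProductGeometry.angle (T.outward a) (T.outward b)) = c := by
      rw [InnerProductGeometry.cos_angle, T.unit_outward, T.unit_outward]; simp [hc]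
    set β := min α (Real.pi / 2) with hβ
    have hβ0 : 0 < β := lt_min hα (by positivity)
    have h1 : c ≤ Real.cos β := by
      rw [← hcos]
      exact Real.cos_le_cos_of_nonneg_of_le_pi hβ0.le (InnerProductGeometry.angle_le_pi _ _)
        ((min_le_left _ _).trans hang)
    have hsin : 0 < Real.sin β := Real.sin_pos_of_pos_of_lt_pi hβ0
      ((min_le_right _ _).trans_lt (by linarith [Real.pi_pos]))
    have h2 : Real.sin β ^ 2 ≤ ‖T.tang a b‖ ^ 2 := by
      rw [norm_tang_sq, Real.sin_sq]
      have : c ^ 2 ≤ Real.cos β ^ 2 := by gcongr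
      linarith
    have := (sq_le_sq₀ hsin.le (norm_nonneg _)).1 h2
    linarith
  have hya := T.mem_facet_iff.1 hy
  have h1 : T.gap b y = T.gap b x0 + c * (T.gap a y - T.gap a x0) + inner ℝ (T.tang a b) (x0 - y) := by
    have e1 := T.inner_outward_eq a b (x0 - y)
    simp only [gap]
    simp only [inner_sub_right] at e1 ⊢
    linarith
  have h2 : -(‖T.tang a b‖ * h) ≤ inner ℝ (T.tang a b) (x0 - y) := by
    have h3 := abs_real_inner_le_norm (T.tang a b) (x0 - y)
    have h4 : ‖x0 - y‖ ≤ h := by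
      rw [← dist_eq_norm]; exact hdiam x0 hx0T y hya.1
    have h5 : ‖T.tang a b‖ * ‖x0 - y‖ ≤ ‖T.tang a b‖ * h := by gcongr
    linarith [neg_abs_le (inner ℝ (T.tang a b) (x0 - y))]
  have h3 : 0 ≤ c * (T.gap a y - T.gap a x0) := by
    rw [hya.2, zero_sub]
    have := hx0 a
    have : 0 ≤ T.gap a x0 := le_trans (by positivity) this
    nlinarith
  have h4 : ‖T.tang a b‖ * h ≤ γ / 2 * h := by gcongr
  have h5 := hx0 b
  linarith

/-- The covering argument on a facet. Hyperplanes almost parallel to it are harmless by `hsmall`.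
Each of the others leaves a strip of width at most `γ h / s` in the facet, and `N` such strips are
too small to cover it. The strips are measured in a ball of radius `2h`, which is where `8^d` and
the factor 2 of `2ρ` come from. -/
lemma exists_facet_center {N : ℕ} (hN : T.numFacets ≤ N) {h ρ γ γ₁ s : ℝ} (hd : 1 ≤ d)
    (hh : 0 < h)
    (hdiam : ∀ x ∈ T.carrier, ∀ y ∈ T.carrier, dist x y ≤ h) (hγ0 : 0 ≤ γ) (hs : 0 < s)
    (hγ1 : γ ≤ s) (hγγ : γ ≤ γ₁) (a : Fin T.numFacets)
    (hsmall : ∀ b, b ≠ a → ‖T.tang a b‖ < s → ∀ y ∈ T.facet a, γ₁ * h ≤ T.gap b y)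
    (hγ : N * (γ / s * (8 ^ d * ballVol d)) < 2 * ρ)
    (hvol : ρ * h ^ (d - 1) ≤ (Measure.euclideanHausdorffMeasure (d - 1)).real (T.facet a)) :
    ∃ y ∈ T.facet a, ∀ b, b ≠ a → γ * h ≤ T.gap b y := by
  by_contra hcon
  push Not at hcon
  obtain ⟨z, hz⟩ := T.inner'_nonempty
  have hzT : z ∈ T.carrier := T.mem_carrier_iff.2 fun a => (hz a).le
  -- the part of the facet close to the hyperplane `b`
  let A : Fin T.numFacets → Set (E d) := fun b =>
    {y | y ∈ T.facet a ∧ b ≠ a ∧ s ≤ ‖T.tang a b‖ ∧ T.gap b y < γ * h}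
  have hσ : T.facet a ⊆ {x | inner ℝ (T.outward a) x = T.offset a} := fun x hx => hx.2
  have hreal : (Measure.euclideanHausdorffMeasure (d - 1)).real (T.facet a) =
      (hyper (T.outward a) (T.offset a)).real (T.facet a) := by
    rw [measureReal_def, measureReal_def, hyper,
      Measure.restrict_apply (T.isClosed_facet a).measurableSet, Set.inter_eq_left.2 hσ]
  have hfinite : hyper (T.outward a) (T.offset a) (T.facet a) ≠ ⊤ :=
    (hyper_isCompact_lt_top (T.unit_outward a) _ (T.isCompact_facet a)).ne
  have h1 : T.facet a ⊆ ⋃ b, A b := by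
    intro y hy
    obtain ⟨b, hb, hb2⟩ := hcon y hy
    refine Set.mem_iUnion.2 ⟨b, hy, hb, ?_, hb2⟩
    by_contra hlt
    push Not at hlt
    have h3 := hsmall b hb hlt y hy
    have : γ * h ≤ γ₁ * h := by gcongr
    linarith
  have hfinA : ∀ b, hyper (T.outward a) (T.offset a) (A b) ≠ ⊤ := fun b =>
    ((measure_mono (fun y hy => hy.1)).trans_lt hfinite.lt_top).ne
  have h2 := (measureReal_mono h1 (by
    refine (lt_of_le_of_lt (measure_iUnion_le _) ?_).ne
    rw [tsum_fintype]
    exact ENNReal.sum_lt_top.2 fun a _ => (hfinA a).lt_top)).trans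
    (measureReal_iUnion_fintype_le (μ := hyper (T.outward a) (T.offset a)) _)
  have h3 : ∀ b, (2 * h) * (h * (hyper (T.outward a) (T.offset a)).real (A b)) ≤
      γ / s * h * ((8 * h) ^ d * ballVol d) := by
    intro b
    by_cases hb : b ≠ a ∧ s ≤ ‖T.tang a b‖
    swap
    · have : A b = ∅ := by
        ext y
        simp only [A, Set.mem_ofPred_eq, Set.mem_empty_iff_false, iff_false]
        tauto
      rw [this, measureReal_empty]
      have := ballVol_nonneg d
      simp only [mul_zero]
      positivity
    obtain ⟨hb1, hb2⟩ := hb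
    set s' := ‖T.tang a b‖ with hs'
    have hs'0 : 0 < s' := hs.trans_le hb2
    set τ := s'⁻¹ • T.tang a b with hτ
    have hτ1 : ‖τ‖ = 1 := by
      rw [hτ, norm_smul, norm_inv, Real.norm_of_nonneg hs'0.le, inv_mul_cancel₀ hs'0.ne']
    -- Along the unit tangent `τ` the gap of `b` has slope `s'`, so gaps between 0 and `γ h` fill an
    -- interval of length `γ h / s'`.
    set c0 := s'⁻¹ * (T.offset b - inner ℝ (T.outward a) (T.outward b) * T.offset a - γ * h) with hc0
    have h4 := slab_le hτ1 c0 (ε := γ / s * h) (R := 2 * h) (by positivity) (by positivity)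
      (by
        have : γ / s ≤ 1 := (div_le_one hs).2 hγ1
        nlinarith) z
    -- Thickening the strip by `h` along the facet normal leaves `τ` unchanged, since the two are
    -- orthogonal, and turns its area into the volume of part of a slab.
    have h5 : h * (hyper (T.outward a) (T.offset a)).real (A b) ≤
        volume.real {x | x ∈ Metric.closedBall z (2 * h) ∧
          inner ℝ τ x ∈ Set.Icc c0 (c0 + γ / s * h)} := by
      apply mul_hyper_le (T.unit_outward a) _ hh.le
      · apply measurableSet_closedBall.inter
        exact measurableSet_Icc.preimage (f := fun x : E d => inner ℝ τ x) (by fun_prop)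
      · exact (Metric.isBounded_closedBall (x := z) (r := 2 * h)).subset (fun x hx => hx.1)
      · intro y hy hya t ht
        have hyT := T.facet_subset a hy.1
        constructor
        · rw [mem_closedBall_iff_norm]
          have e1 : y + t • T.outward a - z = (y - z) + t • T.outward a := by abel
          rw [e1]
          refine (norm_add_le _ _).trans ?_
          rw [norm_smul, T.unit_outward, mul_one, Real.norm_of_nonneg ht.1, ← dist_eq_norm]
          linarith [ht.2, hdiam y hyT z hzT]
        · have e2 : inner ℝ (T.tang a b) (T.outward a) = 0 := by
            simp [tang, inner_sub_left, inner_smul_left, T.unit_outward,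
              real_inner_comm (T.outward a) (T.outward b)]
          have e3 : inner ℝ τ (y + t • T.outward a) =
              s'⁻¹ * (T.offset b - inner ℝ (T.outward a) (T.outward b) * T.offset a - T.gap b y) := by
            rw [hτ, inner_smul_left, inner_add_right, inner_smul_right, e2, mul_zero, add_zero]
            have := T.inner_outward_eq a b y
            rw [hya] at this
            simp only [gap]
            rw [this]
            simp
          rw [e3, hc0]
          have hg0 := T.mem_carrier_iff.1 hyT b
          have hg1 := hy.2.2.2
          constructor
          · exact mul_le_mul_of_nonneg_left (by linarith) (by positivity)
          · have : γ / s' * h ≤ γ / s * h := by gcongr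
            have e4 : s'⁻¹ * (T.offset b - inner ℝ (T.outward a) (T.outward b) * T.offset a - γ * h)
              + γ / s' * h = s'⁻¹ * (T.offset b -
                inner ℝ (T.outward a) (T.outward b) * T.offset a) := by
              field_simp; ring
            have e5 : s'⁻¹ * (T.offset b - inner ℝ (T.outward a) (T.outward b) * T.offset a
                - T.gap b y) ≤ s'⁻¹ * (T.offset b -
                inner ℝ (T.outward a) (T.outward b) * T.offset a) := by
              exact mul_le_mul_of_nonneg_left (by linarith) (by positivity)
            linarith
    have e6 : (4 * (2 * h)) = 8 * h := by ring
    rw [e6] at h4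
    calc _ ≤ (2 * h) * volume.real {x | x ∈ Metric.closedBall z (2 * h) ∧
          inner ℝ τ x ∈ Set.Icc c0 (c0 + γ / s * h)} := by gcongr
      _ ≤ _ := h4
  have h4 : (2 * h) * (h * (hyper (T.outward a) (T.offset a)).real (T.facet a)) ≤
      ∑ b : Fin T.numFacets, γ / s * h * ((8 * h) ^ d * ballVol d) := by
    calc _ ≤ (2 * h) * (h * ∑ b, (hyper (T.outward a) (T.offset a)).real (A b)) := by gcongr
      _ ≤ _ := by
          rw [Finset.mul_sum, Finset.mul_sum]
          exact Finset.sum_le_sum fun b _ => h3 b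
  rw [Finset.sum_const, Finset.card_univ, Fintype.card_fin, nsmul_eq_mul, ← hreal] at h4
  obtain ⟨e, rfl⟩ : ∃ e, d = e + 1 := ⟨d - 1, by omega⟩
  rw [Nat.add_sub_cancel] at hvol h4
  have h5 : (2 * h) * (h * (ρ * h ^ e)) ≤ h * h ^ (e + 1) *
      (N * (γ / s * (8 ^ (e + 1) * ballVol (e + 1)))) := by
    calc _ ≤ _ := mul_le_mul_of_nonneg_left (mul_le_mul_of_nonneg_left hvol hh.le) (by positivity)
      _ ≤ _ := h4
      _ ≤ N * (γ / s * h * ((8 * h) ^ (e + 1) * ballVol (e + 1))) := by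
          have := ballVol_nonneg (e + 1)
          gcongr
      _ = _ := by rw [mul_pow]; ring
  have h6 : h * h ^ (e + 1) * (N * (γ / s * (8 ^ (e + 1) * ballVol (e + 1))))
      < h * h ^ (e + 1) * (2 * ρ) := by gcongr
  have h7 : (2 * h) * (h * (ρ * h ^ e)) = h * h ^ (e + 1) * (2 * ρ) := by ring
  linarith

lemma diam_pos (hd : 1 ≤ d) : 0 < Metric.diam T.carrier := by
  obtain ⟨x, hx⟩ := T.interior_nonempty
  change x ∈ interior T.carrier at hx
  obtain ⟨r, hr, hball⟩ := Metric.isOpen_iff.1 isOpen_interior x hx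
  have h1 : x + EuclideanSpace.single (⟨0, hd⟩ : Fin d) (r / 2) ∈ T.carrier := by
    apply interior_subset (hball _)
    simp [abs_of_pos hr, hr]
  have h2 := Metric.dist_le_diam_of_mem T.isBounded h1 (interior_subset hx)
  have h3 : dist (x + EuclideanSpace.single (⟨0, hd⟩ : Fin d) (r / 2)) x = r / 2 := by
    simp [abs_of_pos hr]
  exact lt_of_lt_of_le (by rw [h3]; positivity) h2

end ConvexPolytope

/-- The volume condition gives the centre of the element. The angle condition disposes of the almost
parallel hyperplanes, and the facet conditions, combined to `|e| ≥ ρ κ^(d-1) h^(d-1)`, give the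
centres of the facets. -/
lemma exists_fat (d N : ℕ) (hd : 1 ≤ d) {ρ κ α : ℝ} (hρ : 0 < ρ) (hκ : 0 < κ) (hα : 0 < α) :
    ∃ γ, 0 < γ ∧ γ ≤ 1 ∧ ∀ (Ω : Set (E d)) (M : PolytopalMesh Ω), M.ShapeRegular ρ κ α →
      ∀ i, (M.cell i).numFacets ≤ N →
        Fat (M.cell i) (Metric.diam (M.cell i).carrier) γ := by
  have hK := ballVol_nonneg d
  -- choose the constants
  have hsmall : ∀ K : ℝ, 0 ≤ K → ∀ δ > 0, ∃ γ, 0 < γ ∧ γ ≤ 1 ∧ γ * K < δ := by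
    intro K hK δ hδ
    refine ⟨min 1 (δ / (2 * (K + 1))), by positivity, min_le_left _ _, ?_⟩
    calc _ ≤ δ / (2 * (K + 1)) * K := by gcongr; exact min_le_right _ _
      _ < δ := by
        rw [div_mul_eq_mul_div, div_lt_iff₀ (by positivity)]
        nlinarith
  obtain ⟨γ₁, hγ₁, hγ₁1, hγ₁2⟩ := hsmall (N * (4 ^ d * ballVol d)) (by positivity) ρ hρ
  -- The threshold below which two hyperplanes count as almost parallel: both smallness conditions
  -- of `gap_ge_of_tang_small` hold for tangential parts shorter than `s`.
  set s := min (γ₁ / 2) (Real.sin (min α (Real.pi / 2))) with hs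
  have hsin : 0 < Real.sin (min α (Real.pi / 2)) :=
    Real.sin_pos_of_pos_of_lt_pi (lt_min hα (by positivity))
      ((min_le_right _ _).trans_lt (by linarith [Real.pi_pos]))
  have hs0 : 0 < s := lt_min (by positivity) hsin
  obtain ⟨γ₂, hγ₂, hγ₂1, hγ₂2⟩ := hsmall (N * (s⁻¹ * (8 ^ d * ballVol d))) (by positivity)
    (2 * (ρ * κ ^ (d - 1))) (by positivity)
  set γ := min γ₁ (min γ₂ s) with hγ
  have hγ0 : 0 < γ := lt_min hγ₁ (lt_min hγ₂ hs0)
  have hγs : γ ≤ s := (min_le_right _ _).trans (min_le_right _ _)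
  have hγγ₂ : γ ≤ γ₂ := (min_le_right _ _).trans (min_le_left _ _)
  refine ⟨γ, hγ0, (min_le_left _ _).trans hγ₁1, fun Ω M hM i hi => ?_⟩
  obtain ⟨h1, h2, h3⟩ := hM i
  set T := M.cell i
  have hh : 0 < Metric.diam T.carrier := T.diam_pos hd
  have hdiam : ∀ x ∈ T.carrier, ∀ y ∈ T.carrier, dist x y ≤ Metric.diam T.carrier :=
    fun x hx y hy => Metric.dist_le_diam_of_mem T.isBounded hx hy
  obtain ⟨x0, hx0⟩ := T.exists_center hi hh hdiam hγ₁.le hγ₁1 (by linarith) h1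
  refine ⟨hh, hdiam, ⟨x0, fun a => le_trans ?_ (hx0 a)⟩, fun a => ?_⟩
  · gcongr
    exact min_le_left _ _
  · refine T.exists_facet_center hi (ρ := ρ * κ ^ (d - 1)) (γ₁ := γ₁ / 2) hd hh hdiam hγ0.le hs0 hγs
      (hγs.trans (min_le_left _ _)) a ?_ ?_ ?_
    · intro b hb hlt y hy
      exact T.gap_ge_of_tang_small hh hdiam hγ₁ hx0 hα (h3 a b hb.symm)
        (hlt.le.trans (min_le_left _ _)) (hlt.trans_le (min_le_right _ _)) hy
    · calc N * (γ / s * (8 ^ d * ballVol d)) ≤ N * (γ₂ / s * (8 ^ d * ballVol d)) := by gcongr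
        _ = γ₂ * (N * (s⁻¹ * (8 ^ d * ballVol d))) := by rw [div_eq_mul_inv]; ring
        _ < _ := hγ₂2
    · obtain ⟨h4, h5⟩ := h2 a
      refine le_trans ?_ h4
      rw [mul_assoc, ← mul_pow]
      gcongr

end
end ConformingDG

/-! ### Projection onto a facet and weights vanishing on facets -/

namespace ConformingDG
noncomputable section

namespace ConvexPolytope
variable {d : ℕ} (T : ConvexPolytope d)

/-- Orthogonal projection onto the hyperplane of the `a`-th edge/face. -/
def proj (a : Fin T.numFacets) (x : E d) : E d := x + T.gap a x • T.outward a

lemma isPoly_gap (a : Fin T.numFacets) : IsPoly 1 (T.gap a) := by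
  unfold gap
  exact (IsPoly.const _).sub (IsPoly.inner_left _)

lemma isPoly_proj (a : Fin T.numFacets) (i : Fin d) : IsPoly 1 (fun x => T.proj a x i) := by
  have := (IsPoly.coord i).add ((T.isPoly_gap a).const_mul (T.outward a i))
  simpa [proj, mul_comm] using this

lemma proj_of_mem_facet {a : Fin T.numFacets} {x : E d} (hx : x ∈ T.facet a) :
    T.proj a x = x := by
  simp [proj, (T.mem_facet_iff.1 hx).2]

/-- The normalized product of the gaps of some edges/faces. -/
def wt (h : ℝ) (s : Finset (Fin T.numFacets)) (x : E d) : ℝ := ∏ b ∈ s, T.gap b x / h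

lemma isPoly_wt (h : ℝ) (s : Finset (Fin T.numFacets)) : IsPoly s.card (T.wt h s) := by
  have := IsPoly.prod s (F := fun b x => h⁻¹ * T.gap b x) (e := fun _ => 1)
    (fun b _ => (T.isPoly_gap b).const_mul _)
  simp only [Finset.sum_const, smul_eq_mul, mul_one] at this
  have h2 : T.wt h s = fun x => ∏ b ∈ s, h⁻¹ * T.gap b x := by
    ext x
    simp only [wt, div_eq_inv_mul]
  rw [h2]
  exact this

lemma wt_eq_zero {h : ℝ} {s : Finset (Fin T.numFacets)} {b : Fin T.numFacets} (hb : b ∈ s)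
    {x : E d} (hx : x ∈ T.facet b) : T.wt h s x = 0 :=
  Finset.prod_eq_zero hb (by rw [(T.mem_facet_iff.1 hx).2, zero_div])

/-- The quotient `(f - f ∘ proj) / gap` of polynomials. -/
lemma exists_quotient (a : Fin T.numFacets) {m : ℕ} {f : E d → ℝ} (hf : IsPoly m f) :
    ∃ q, IsPoly (m - 1) q ∧ (m = 0 → q = 0) ∧ ∀ x, f x - f (T.proj a x) = T.gap a x * q x := by
  -- Divisibility by the gap is stable under products, by `fg - f'g' = f (g - g') + g' (f - f')`,
  -- and under sums, so it suffices to check coordinates. The clause for `m = 0` repairs the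
  -- truncated `m - 1`: the quotient of a constant is zero.
  let D : ℕ → (E d → ℝ) → Prop := fun m f => IsPoly m f ∧ ∃ q, IsPoly (m - 1) q ∧
    (m = 0 → q = 0) ∧ ∀ x, f x - f (T.proj a x) = T.gap a x * q x
  have hmul : ∀ m n f g, D m f → D n g → D (m + n) (fun x => f x * g x) := by
    rintro m n f g ⟨hf, qf, hqf, hqf0, hqf1⟩ ⟨hg, qg, hqg, hqg0, hqg1⟩
    refine ⟨hf.mul hg, fun x => f x * qg x + g (T.proj a x) * qf x, ?_, ?_, ?_⟩
    · apply IsPoly.add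
      · rcases Nat.eq_zero_or_pos n with h | h
        · rw [hqg0 h]
          simpa using IsPoly.const (d := d) (m := m + n - 1) 0
        · exact (hf.mul hqg).mono (by omega)
      · rcases Nat.eq_zero_or_pos m with h | h
        · rw [hqf0 h]
          simpa using IsPoly.const (d := d) (m := m + n - 1) 0
        · exact ((hg.comp_affine (T.isPoly_proj a)).mul hqf).mono (by omega)
    · intro h
      ext x
      simp [hqf0 (by omega), hqg0 (by omega)]
    · intro x
      have h1 := hqf1 x
      have h2 := hqg1 x
      linear_combination f x * h2 + g (T.proj a x) * h1
  have hconst : ∀ c : ℝ, D 0 (fun _ => c) := fun c =>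
    ⟨IsPoly.const c, 0, IsPoly.const (d := d) (m := 0) 0, fun _ => rfl,
      fun x => by simp⟩
  have hmono : ∀ m n f, m ≤ n → D m f → D n f := by
    rintro m n f hmn ⟨hf, q, hq, hq0, hq1⟩
    exact ⟨hf.mono hmn, q, hq.mono (by omega), fun h => hq0 (by omega), hq1⟩
  have hadd : ∀ m f g, D m f → D m g → D m (fun x => f x + g x) := by
    rintro m f g ⟨hf, qf, hqf, hqf0, hqf1⟩ ⟨hg, qg, hqg, hqg0, hqg1⟩
    refine ⟨hf.add hg, fun x => qf x + qg x, hqf.add hqg, ?_, ?_⟩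
    · intro h
      ext x
      simp [hqf0 h, hqg0 h]
    · intro x
      linear_combination hqf1 x + hqg1 x
  have hcoord : ∀ i, D 1 (fun x => x i) := fun i =>
    ⟨IsPoly.coord i, fun _ => -T.outward a i, IsPoly.const _, by simp, fun x => by
      simp [proj]⟩
  have hpow : ∀ i e, D e (fun x => x i ^ e) := by
    intro i e
    induction e with
    | zero => simpa using hconst 1
    | succ e ih => simpa [pow_succ] using hmul _ _ _ _ ih (hcoord i)
  have hprod : ∀ (s : Fin d →₀ ℕ) (t : Finset (Fin d)),
      D (∑ i ∈ t, s i) (fun x => ∏ i ∈ t, x i ^ s i) := by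
    intro s t
    induction t using Finset.induction_on with
    | empty => simpa using hconst 1
    | insert i t hi ih =>
      simp only [Finset.prod_insert hi, Finset.sum_insert hi]
      exact hmul _ _ _ _ (hpow i (s i)) ih
  obtain ⟨p, hp, rfl⟩ := hf
  have hsum : ∀ t ⊆ p.support, D m (fun x => ∑ s ∈ t, p.coeff s * ∏ i ∈ s.support, x i ^ s i) := by
    intro t ht
    induction t using Finset.induction_on with
    | empty => simpa using hmono 0 m _ (Nat.zero_le _) (hconst 0)
    | insert s t hs ih =>
      simp only [Finset.sum_insert hs]
      apply hadd _ _ _ _ (ih ((Finset.subset_insert _ _).trans ht))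
      have h1 := hmul _ _ _ _ (hconst (p.coeff s)) (hprod s s.support)
      refine hmono _ _ _ ?_ h1
      rw [zero_add]
      exact (MvPolynomial.le_totalDegree (ht (Finset.mem_insert_self _ _))).trans hp
  have h1 : (fun x => ∑ s ∈ p.support, p.coeff s * ∏ i ∈ s.support, x i ^ s i) = pval p := by
    ext x
    rw [pval, MvPolynomial.eval_eq]
  have := hsum p.support subset_rfl
  rw [h1] at this
  exact this.2

end ConvexPolytope

namespace Fat
variable {d : ℕ} {T : ConvexPolytope d} {h γ : ℝ}

lemma gap_le (hT : Fat T h γ) (a : Fin T.numFacets) {x : E d} (hx : x ∈ T.carrier) :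
    T.gap a x ≤ h := by
  obtain ⟨y, hy, -⟩ := hT.facet_center a
  have h1 := (T.mem_facet_iff.1 hy).2
  have h2 : T.gap a x = inner ℝ (T.outward a) (y - x) := by
    simp only [ConvexPolytope.gap, inner_sub_right] at h1 ⊢
    linarith
  rw [h2]
  refine (real_inner_le_norm _ _).trans ?_
  rw [T.unit_outward, one_mul, ← dist_eq_norm]
  exact hT.diam_le y (T.facet_subset a hy) x hx

lemma wt_nonneg (hT : Fat T h γ) (s : Finset (Fin T.numFacets)) {x : E d} (hx : x ∈ T.carrier) :
    0 ≤ T.wt h s x :=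
  Finset.prod_nonneg fun b _ => div_nonneg (T.mem_carrier_iff.1 hx b) hT.pos.le

lemma wt_le_one (hT : Fat T h γ) (s : Finset (Fin T.numFacets)) {x : E d} (hx : x ∈ T.carrier) :
    T.wt h s x ≤ 1 :=
  Finset.prod_le_one (fun b _ => div_nonneg (T.mem_carrier_iff.1 hx b) hT.pos.le)
    fun b _ => (div_le_one hT.pos).2 (hT.gap_le b hx)

lemma gap_ge_sub {T : ConvexPolytope d} (a : Fin T.numFacets) (x y : E d) :
    T.gap a y - dist x y ≤ T.gap a x := by
  have h1 : T.gap a y - T.gap a x = inner ℝ (T.outward a) (x - y) := by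
    simp only [ConvexPolytope.gap, inner_sub_right]; ring
  have h2 := real_inner_le_norm (T.outward a) (x - y)
  rw [T.unit_outward, one_mul, ← dist_eq_norm] at h2
  linarith

/-- A gap changes by at most the distance moved, so within `γ h / 2` of the given point every factor
is at least `γ / 2`. Since `γ / 2 < 1`, the exponent may be raised to `N`. -/
lemma wt_ge (hT : Fat T h γ) (hγ : 0 < γ) (hγ1 : γ ≤ 1) {N : ℕ} (hN : T.numFacets ≤ N)
    (s : Finset (Fin T.numFacets)) {x y : E d} (hy : ∀ b ∈ s, γ * h ≤ T.gap b y)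
    (hx : x ∈ Metric.closedBall y (γ / 2 * h)) : (γ / 2) ^ N ≤ T.wt h s x := by
  have hh := hT.pos
  have hcard : s.card ≤ N := (Finset.card_le_univ s).trans (by simpa using hN)
  calc (γ / 2) ^ N ≤ (γ / 2) ^ s.card := pow_le_pow_of_le_one (by positivity) (by linarith) hcard
    _ = ∏ b ∈ s, (γ / 2) := by rw [Finset.prod_const]
    _ ≤ T.wt h s x := by
      refine Finset.prod_le_prod (fun _ _ => by positivity) fun b hb => ?_
      rw [le_div_iff₀ hh]
      have h1 := gap_ge_sub b x y
      have h2 : dist x y ≤ γ / 2 * h := hx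
      have h3 := hy b hb
      nlinarith

end Fat


end
end ConformingDG

/-! ### Inverse and trace inequalities for polynomials on fat polytopes -/

namespace ConformingDG
noncomputable section

namespace Fat
variable {d : ℕ} {T : ConvexPolytope d} {h γ : ℝ}

lemma ball_subset {x0 : E d} (hx0 : ∀ a, γ * h ≤ T.gap a x0) :
    Metric.closedBall x0 (γ * h) ⊆ T.carrier := by
  intro x hx
  refine T.mem_carrier_iff.2 fun a => ?_
  have h1 := gap_ge_sub a x x0
  have h2 : dist x x0 ≤ γ * h := hx
  linarith [hx0 a]

lemma mem_of_gap (hT : Fat T h γ) (hγ : 0 < γ) {x0 : E d} (hx0 : ∀ a, γ * h ≤ T.gap a x0) :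
    x0 ∈ T.carrier :=
  ball_subset hx0 (Metric.mem_closedBall_self (mul_nonneg hγ.le hT.pos.le))

lemma l2_vol_sq_le (hT : Fat T h γ) {g : E d → ℝ} {B : ℝ} (hB : 0 ≤ B)
    (hg : ∀ x ∈ T.carrier, h ^ d * g x ^ 2 ≤ B) : l2 T.vol g ^ 2 ≤ ballVol d * B := by
  have hh := hT.pos
  obtain ⟨z, hz⟩ := T.inner'_nonempty
  have hzT : z ∈ T.carrier := T.mem_carrier_iff.2 fun a => (hz a).le
  have h1 : volume.real T.carrier ≤ h ^ d * ballVol d := by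
    rw [← volume_real_closedBall z hh.le]
    exact measureReal_mono (fun x hx => hT.diam_le x hx z hzT)
      (isCompact_closedBall z h).measure_lt_top.ne
  rw [l2_sq]
  have h2 : ‖∫ x, g x ^ 2 ∂T.vol‖ ≤ (B / h ^ d) * volume.real T.carrier := by
    apply norm_setIntegral_le_of_norm_le_const T.isCompact_carrier.measure_lt_top
    intro x hx
    rw [Real.norm_of_nonneg (sq_nonneg _), le_div_iff₀ (by positivity), mul_comm]
    exact hg x hx
  calc _ ≤ _ := Real.le_norm_self _
    _ ≤ _ := h2
    _ ≤ (B / h ^ d) * (h ^ d * ballVol d) := by gcongr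
    _ = _ := by field_simp

/-- A facet of an element of diameter `h` has area of order at most `h^(d-1)`, so a pointwise bound
costs one factor `h` less than in the volume. -/
lemma l2_surface_sq_le (hT : Fat T h γ) (a : Fin T.numFacets) {g : E d → ℝ} {B : ℝ} (hB : 0 ≤ B)
    (hg : ∀ x ∈ T.facet a, h ^ d * g x ^ 2 ≤ B) :
    h * l2 (T.surface a) g ^ 2 ≤ 2 ^ d * ballVol d * B := by
  have hh := hT.pos
  obtain ⟨z, hz⟩ := T.inner'_nonempty
  have hzT : z ∈ T.carrier := T.mem_carrier_iff.2 fun a => (hz a).le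
  have h1 : h * (T.surface a).real Set.univ ≤ (2 * h) ^ d * ballVol d := by
    refine le_trans ?_ (hyper_closedBall_le (T.unit_outward a) (T.offset a) z hh)
    gcongr
    rw [T.surface_eq, measureReal_def, measureReal_def, Measure.restrict_apply_univ]
    refine ENNReal.toReal_mono (ConvexPolytope.hyper_isCompact_lt_top (T.unit_outward a) _
      (isCompact_closedBall _ _)).ne (measure_mono ?_)
    exact fun x hx => hT.diam_le x hx z hzT
  rw [l2_sq]
  have h2 : ‖∫ x, g x ^ 2 ∂(T.surface a)‖ ≤ (B / h ^ d) * (T.surface a).real Set.univ := by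
    apply norm_integral_le_of_norm_le_const
    filter_upwards [T.surface_ae_mem a] with x hx
    rw [Real.norm_of_nonneg (sq_nonneg _), le_div_iff₀ (by positivity), mul_comm]
    exact hg x hx
  calc _ ≤ h * ((B / h ^ d) * (T.surface a).real Set.univ) :=
        mul_le_mul_of_nonneg_left ((Real.le_norm_self _).trans h2) hh.le
    _ = (B / h ^ d) * (h * (T.surface a).real Set.univ) := by ring
    _ ≤ (B / h ^ d) * ((2 * h) ^ d * ballVol d) := by gcongr
    _ = _ := by rw [mul_pow]; field_simp

/-- Keeping a single factor of the weight; this makes `(gap / h)²` an admissible facet weight when a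
polynomial has been divided by that gap. -/
lemma wt_erase_le (hT : Fat T h γ) {a b : Fin T.numFacets} (hb : b ≠ a) {x : E d}
    (hx : x ∈ T.carrier) : T.wt h (Finset.univ.erase a) x ≤ T.gap b x / h := by
  have h1 : b ∈ Finset.univ.erase a := Finset.mem_erase.2 ⟨hb, Finset.mem_univ b⟩
  have h2 : T.wt h (Finset.univ.erase a) x =
      T.gap b x / h * T.wt h ((Finset.univ.erase a).erase b) x := by
    rw [ConvexPolytope.wt, ConvexPolytope.wt, Finset.mul_prod_erase _ (fun b => T.gap b x / h) h1]
  rw [h2]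
  exact mul_le_of_le_one_right (div_nonneg (T.mem_carrier_iff.1 hx b) hT.pos.le)
    (hT.wt_le_one _ hx)

lemma l2_wt_mul_le (hT : Fat T h γ) (s : Finset (Fin T.numFacets)) {f : E d → ℝ}
    (hf : Continuous f) : l2 T.vol (fun x => T.wt h s x * f x) ≤ l2 T.vol f := by
  apply l2_le_of_abs_le ((T.isPoly_wt h s).continuous.mul hf).aestronglyMeasurable (T.memLp_vol hf)
  refine (ae_restrict_iff' T.isClosed_carrier.measurableSet).2 (Eventually.of_forall fun x hx => ?_)
  change |T.wt h s x * f x| ≤ |f x|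
  rw [abs_mul, abs_of_nonneg (hT.wt_nonneg s hx)]
  exact mul_le_of_le_one_left (abs_nonneg _) (hT.wt_le_one s hx)

end Fat

/-- On the ball of radius `γ h / 2` about the centre the weight is bounded below. The whole element
lies in the concentric ball that is `2 / γ` times larger, so norm equivalence on balls carries the
bound to every point of the element. -/
lemma fat_poly_bound (d m N : ℕ) {γ : ℝ} (hγ : 0 < γ) (hγ1 : γ ≤ 1) :
    ∃ C, 0 < C ∧ ∀ (T : ConvexPolytope d) (h : ℝ), Fat T h γ → T.numFacets ≤ N →
      ∀ f, IsPoly m f → ∀ x ∈ T.carrier,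
        h ^ d * f x ^ 2 ≤ C * ∫ z, T.wt h Finset.univ z * f z ^ 2 ∂T.vol ∧
        ∀ i, h ^ d * (h * pd i f x) ^ 2 ≤ C * ∫ z, T.wt h Finset.univ z * f z ^ 2 ∂T.vol := by
  obtain ⟨C, hC, hp⟩ := exists_poly_bound d m (2 / γ)
  refine ⟨(2 / γ) ^ (d + 2) * (C * (2 / γ) ^ N), by positivity, fun T h hT hN f hf x hx => ?_⟩
  have hh := hT.pos
  obtain ⟨x0, hx0⟩ := hT.center
  have hx0T := hT.mem_of_gap hγ hx0
  have hr : 0 < γ / 2 * h := by positivity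
  have hx' : x ∈ Metric.closedBall x0 (2 / γ * (γ / 2 * h)) := by
    have : 2 / γ * (γ / 2 * h) = h := by field_simp
    rw [this]
    exact hT.diam_le x hx x0 hx0T
  have hsub : Metric.ball x0 (γ / 2 * h) ⊆ T.carrier :=
    (Metric.ball_subset_closedBall.trans (Metric.closedBall_subset_closedBall
      (by nlinarith))).trans (Fat.ball_subset hx0)
  have hcW := (T.isPoly_wt h Finset.univ).continuous
  have hint : IntegrableOn (fun z => T.wt h Finset.univ z * f z ^ 2) T.carrier :=
    (hcW.mul (hf.continuous.pow 2)).continuousOn.integrableOn_compact T.isCompact_carrier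
  have hint2 : IntegrableOn (fun z => f z ^ 2) T.carrier :=
    (hf.continuous.pow 2).continuousOn.integrableOn_compact T.isCompact_carrier
  have h1 : ∫ z in Metric.ball x0 (γ / 2 * h), f z ^ 2 ≤
      (2 / γ) ^ N * ∫ z, T.wt h Finset.univ z * f z ^ 2 ∂T.vol := by
    have h2 : ∫ z in Metric.ball x0 (γ / 2 * h), T.wt h Finset.univ z * f z ^ 2 ≤
        ∫ z, T.wt h Finset.univ z * f z ^ 2 ∂T.vol := by
      apply setIntegral_mono_set hint _ (LE.le.eventuallyLE hsub)
      refine (ae_restrict_iff' T.isClosed_carrier.measurableSet).2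
        (Eventually.of_forall fun z hz => ?_)
      exact mul_nonneg (hT.wt_nonneg _ hz) (sq_nonneg _)
    refine le_trans ?_ (mul_le_mul_of_nonneg_left h2 (by positivity))
    rw [← integral_const_mul]
    apply setIntegral_mono_on (hint2.mono_set hsub) ((hint.mono_set hsub).const_mul _)
      measurableSet_ball
    intro z hz
    have h3 := hT.wt_ge hγ hγ1 hN Finset.univ (fun b _ => hx0 b) (Metric.ball_subset_closedBall hz)
    have h4 : 1 ≤ (2 / γ) ^ N * T.wt h Finset.univ z := by
      calc (1 : ℝ) = (2 / γ) ^ N * (γ / 2) ^ N := by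
            rw [← mul_pow]; field_simp; simp
        _ ≤ _ := by gcongr
    nlinarith [sq_nonneg (f z)]
  obtain ⟨h5, h6⟩ := hp f hf x0 _ hr x hx'
  have hI0 : 0 ≤ ∫ z in Metric.ball x0 (γ / 2 * h), f z ^ 2 := integral_nonneg fun _ => sq_nonneg _
  have h21 : (1 : ℝ) ≤ 2 / γ := by rw [le_div_iff₀ hγ]; linarith
  have hr1 : (2 / γ) ^ d * (γ / 2 * h) ^ d = h ^ d := by
    rw [← mul_pow]; congr 1; field_simp
  have hr2 : 2 / γ * (γ / 2 * h) = h := by field_simp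
  constructor
  · calc h ^ d * f x ^ 2 = (2 / γ) ^ d * ((γ / 2 * h) ^ d * f x ^ 2) := by rw [← hr1]; ring
      _ ≤ (2 / γ) ^ d * (C * ∫ z in Metric.ball x0 (γ / 2 * h), f z ^ 2) := by gcongr
      _ ≤ (2 / γ) ^ (d + 2) * (C * ∫ z in Metric.ball x0 (γ / 2 * h), f z ^ 2) := by
          exact mul_le_mul_of_nonneg_right (pow_le_pow_right₀ h21 (by omega)) (by positivity)
      _ ≤ (2 / γ) ^ (d + 2) *
          (C * ((2 / γ) ^ N * ∫ z, T.wt h Finset.univ z * f z ^ 2 ∂T.vol)) := by gcongr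
      _ = _ := by ring
  · intro i
    calc h ^ d * (h * pd i f x) ^ 2 =
          (2 / γ) ^ (d + 2) * ((γ / 2 * h) ^ d * ((γ / 2 * h) * pd i f x) ^ 2) := by
          have e : (2 / γ) ^ 2 * ((γ / 2 * h) * pd i f x) ^ 2 = (h * pd i f x) ^ 2 := by
            rw [← mul_pow]; congr 1; field_simp
          rw [pow_add, ← hr1, ← e]; ring
      _ ≤ (2 / γ) ^ (d + 2) * (C * ∫ z in Metric.ball x0 (γ / 2 * h), f z ^ 2) := by
          exact mul_le_mul_of_nonneg_left (h6 i) (by positivity)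
      _ ≤ (2 / γ) ^ (d + 2) *
          (C * ((2 / γ) ^ N * ∫ z, T.wt h Finset.univ z * f z ^ 2 ∂T.vol)) := by gcongr
      _ = _ := by ring

lemma integral_wt_le {d : ℕ} {T : ConvexPolytope d} {h γ : ℝ} (hT : Fat T h γ) {f : E d → ℝ}
    (hf : Continuous f) : ∫ z, T.wt h Finset.univ z * f z ^ 2 ∂T.vol ≤ l2 T.vol f ^ 2 := by
  rw [l2_sq]
  apply setIntegral_mono_on _ _ T.isClosed_carrier.measurableSet
  · intro x hx
    exact mul_le_of_le_one_left (sq_nonneg _) (hT.wt_le_one _ hx)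
  · exact ((T.isPoly_wt h _).continuous.mul (hf.pow 2)).continuousOn.integrableOn_compact
      T.isCompact_carrier
  · exact (hf.pow 2).continuousOn.integrableOn_compact T.isCompact_carrier

/-- Inverse, weighted and trace inequalities for polynomials on a fat polytope. -/
lemma fat_poly_l2 (d m N : ℕ) {γ : ℝ} (hγ : 0 < γ) (hγ1 : γ ≤ 1) :
    ∃ C, 0 < C ∧ ∀ (T : ConvexPolytope d) (h : ℝ), Fat T h γ → T.numFacets ≤ N →
      ∀ f, IsPoly m f →
        l2 T.vol f ^ 2 ≤ C * ∫ z, T.wt h Finset.univ z * f z ^ 2 ∂T.vol ∧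
        (∀ i, h ^ 2 * l2 T.vol (pd i f) ^ 2 ≤ C * l2 T.vol f ^ 2) ∧
        ∀ a, h * l2 (T.surface a) f ^ 2 ≤ C * l2 T.vol f ^ 2 := by
  obtain ⟨C, hC, hp⟩ := fat_poly_bound d m N hγ hγ1
  have hv := ballVol_nonneg d
  refine ⟨2 ^ d * ballVol d * C + C, by positivity, fun T h hT hN f hf => ?_⟩
  have hh := hT.pos
  have hW := integral_wt_le hT hf.continuous
  have hI0 : 0 ≤ ∫ z, T.wt h Finset.univ z * f z ^ 2 ∂T.vol := by
    apply setIntegral_nonneg T.isClosed_carrier.measurableSet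
    intro z hz
    exact mul_nonneg (hT.wt_nonneg _ hz) (sq_nonneg _)
  set I := ∫ z, T.wt h Finset.univ z * f z ^ 2 ∂T.vol
  have h2d : (1 : ℝ) ≤ 2 ^ d := one_le_pow₀ one_le_two
  have hcc : ballVol d * C ≤ 2 ^ d * ballVol d * C + C := by
    have : ballVol d * C ≤ 2 ^ d * (ballVol d * C) := le_mul_of_one_le_left (by positivity) h2d
    linarith
  refine ⟨?_, fun i => ?_, fun a => ?_⟩
  · have h1 := hT.l2_vol_sq_le (g := f) (B := C * I) (by positivity)
      (fun x hx => (hp T h hT hN f hf x hx).1)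
    calc _ ≤ _ := h1
      _ = (ballVol d * C) * I := by ring
      _ ≤ _ := by gcongr
  · have h1 := hT.l2_vol_sq_le (g := fun x => h * pd i f x) (B := C * I) (by positivity)
      (fun x hx => (hp T h hT hN f hf x hx).2 i)
    rw [l2_const_mul, mul_pow, sq_abs] at h1
    calc _ ≤ _ := h1
      _ = (ballVol d * C) * I := by ring
      _ ≤ _ := by gcongr
  · have h1 := hT.l2_surface_sq_le a (g := f) (B := C * I) (by positivity)
      (fun x hx => (hp T h hT hN f hf x (T.facet_subset a hx)).1)
    calc _ ≤ _ := h1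
      _ = (2 ^ d * ballVol d * C) * I := by ring
      _ ≤ (2 ^ d * ballVol d * C + C) * I := by gcongr; linarith
      _ ≤ _ := by gcongr

/-- Polynomials on an edge/face, extended constantly in the normal direction. -/
lemma fat_poly_facet (d m N : ℕ) {γ : ℝ} (hγ : 0 < γ) (hγ1 : γ ≤ 1) :
    ∃ C, 0 < C ∧ ∀ (T : ConvexPolytope d) (h : ℝ), Fat T h γ → T.numFacets ≤ N →
      ∀ f, IsPoly m f → ∀ (a : Fin T.numFacets) (θ : E d → ℝ), Continuous θ →
        (∀ y ∈ T.facet a, T.wt h (Finset.univ.erase a) y ^ 2 ≤ θ y) → ∀ x ∈ T.carrier,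
        h ^ d * f (T.proj a x) ^ 2 ≤ C * (h * ∫ y, θ y * f y ^ 2 ∂(T.surface a)) := by
  obtain ⟨C, hC, hp⟩ := exists_poly_bound d m (2 / γ)
  refine ⟨(2 / γ) ^ d * (C * (γ * (2 / γ) ^ (N * 2))), by positivity,
    fun T h hT hN f hf a θ hθ hθW x hx => ?_⟩
  have hh := hT.pos
  obtain ⟨y0, hy0, hy0g⟩ := hT.facet_center a
  have hy0T := T.facet_subset a hy0
  have hr : 0 < γ / 2 * h := by positivity
  set r := γ / 2 * h with hrdef
  have hx' : x ∈ Metric.closedBall y0 (2 / γ * r) := by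
    have : 2 / γ * (γ / 2 * h) = h := by field_simp
    rw [hrdef, this]
    exact hT.diam_le x hx y0 hy0T
  have hg : IsPoly m (fun x => f (T.proj a x)) := hf.comp_affine (T.isPoly_proj a)
  set σ := hyper (T.outward a) (T.offset a) with hσ
  have hsf : SigmaFinite σ := sigmaFinite_hyper (T.unit_outward a) _
  have hfc : IsFiniteMeasureOnCompacts σ :=
    ⟨fun _ hK => ConvexPolytope.hyper_isCompact_lt_top (T.unit_outward a) _ hK⟩
  have hH : ∀ᵐ y ∂σ, T.gap a y = 0 := by
    have : ∀ᵐ x ∂σ, x ∈ {x | inner ℝ (T.outward a) x = T.offset a} :=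
      ae_restrict_mem (measurableSet_eq_fun (by fun_prop) (by fun_prop))
    filter_upwards [this] with x hx
    have hx' : inner ℝ (T.outward a) x = T.offset a := hx
    rw [ConvexPolytope.gap, hx', sub_self]
  have hH0 : inner ℝ (T.outward a) y0 = T.offset a := hy0.2
  -- the disc lies in the facet
  have hdisc : ∀ y ∈ Metric.closedBall y0 r, T.gap a y = 0 → y ∈ T.facet a := by
    intro y hy hya
    refine T.mem_facet_iff.2 ⟨T.mem_carrier_iff.2 fun b => ?_, hya⟩
    by_cases hb : b = a
    · rw [hb, hya]
    · have h1 := Fat.gap_ge_sub b y y0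
      have h2 : dist y y0 ≤ γ / 2 * h := hy
      have h3 := hy0g b hb
      nlinarith
  -- comparison of the ball with the disc
  have h1 : ∫ z in Metric.ball y0 r, f (T.proj a z) ^ 2 ≤
      2 * r * ∫ y in Metric.closedBall y0 r, f y ^ 2 ∂σ := by
    have e1 : ∫ z in Metric.ball y0 r, f (T.proj a z) ^ 2 =
        ∫ p : ℝ × E d, (Metric.ball y0 r).indicator (fun z => f (T.proj a z) ^ 2)
          (p.2 + p.1 • T.outward a) ∂((volume : Measure ℝ).prod σ) := by
      rw [← integral_indicator measurableSet_ball,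
        ← (hyper_coarea (T.unit_outward a) (T.offset a)).map_eq]
      exact integral_map (by fun_prop)
        (((hg.continuous.pow 2).measurable.indicator measurableSet_ball).aestronglyMeasurable)
    have e2 : 2 * r * ∫ y in Metric.closedBall y0 r, f y ^ 2 ∂σ =
        ∫ p : ℝ × E d, (Set.Icc (-r) r).indicator (fun _ => (1 : ℝ)) p.1 *
          (Metric.closedBall y0 r).indicator (fun y => f y ^ 2) p.2
          ∂((volume : Measure ℝ).prod σ) := by
      rw [integral_prod_mul (μ := (volume : Measure ℝ)) (ν := σ)
        ((Set.Icc (-r) r).indicator (fun _ => (1 : ℝ)))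
        ((Metric.closedBall y0 r).indicator (fun y => f y ^ 2)),
        integral_indicator measurableSet_Icc, integral_indicator measurableSet_closedBall]
      simp only [integral_const, measureReal_restrict_apply_univ, smul_eq_mul, mul_one,
        Real.volume_real_Icc]
      rw [max_eq_left (by linarith)]
      ring
    rw [e1, e2]
    have hae1 : ∀ᵐ p : ℝ × E d ∂((volume : Measure ℝ).prod σ), T.gap a p.2 = 0 :=
      Measure.quasiMeasurePreserving_snd.ae hH
    apply integral_mono_of_nonneg
    · exact Eventually.of_forall fun p => Set.indicator_nonneg (fun _ _ => sq_nonneg _) _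
    · apply Integrable.mul_prod (f := (Set.Icc (-r) r).indicator (fun _ => (1 : ℝ)))
        (g := (Metric.closedBall y0 r).indicator (fun y => f y ^ 2))
      · rw [integrable_indicator_iff measurableSet_Icc]
        exact integrableOn_const (by simp)
      · rw [integrable_indicator_iff measurableSet_closedBall]
        exact (hf.continuous.pow 2).continuousOn.integrableOn_compact (isCompact_closedBall _ _)
    · filter_upwards [hae1] with p hpa
      by_cases hpb : p.2 + p.1 • T.outward a ∈ Metric.ball y0 r
      swap
      · rw [Set.indicator_of_notMem hpb]
        exact mul_nonneg (Set.indicator_nonneg (fun _ _ => zero_le_one) _)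
          (Set.indicator_nonneg (fun _ _ => sq_nonneg _) _)
      have hproj : T.proj a (p.2 + p.1 • T.outward a) = p.2 := by
        rw [ConvexPolytope.proj, T.gap_self_add_smul, hpa]; simp
      -- By Pythagoras, a point of the ball has normal coordinate in `[-r, r]` and its foot in the
      -- disc of radius `r`. As `f ∘ proj` is constant along normals, the ball integral is at most
      -- `2r` times the disc integral.
      have horth : inner ℝ (p.2 - y0) (p.1 • T.outward a) = 0 := by
        rw [inner_smul_right, real_inner_comm, inner_sub_right, hH0]
        have : inner ℝ (T.outward a) p.2 = T.offset a := by
          simp only [ConvexPolytope.gap] at hpa; linarith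
        rw [this]; simp
      have hpyth := norm_add_sq_real (p.2 - y0) (p.1 • T.outward a)
      rw [horth] at hpyth
      have hn : ‖p.2 - y0 + p.1 • T.outward a‖ < r := by
        rw [mem_ball_iff_norm] at hpb
        have : p.2 - y0 + p.1 • T.outward a = p.2 + p.1 • T.outward a - y0 := by abel
        rwa [this]
      rw [norm_smul, T.unit_outward, mul_one, Real.norm_eq_abs, sq_abs] at hpyth
      have hsq : ‖p.2 - y0 + p.1 • T.outward a‖ ^ 2 ≤ r ^ 2 := by gcongr
      have hp1 : p.1 ∈ Set.Icc (-r) r := by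
        rw [Set.mem_Icc, ← abs_le]
        apply abs_le_of_sq_le_sq _ hr.le
        nlinarith [sq_nonneg ‖p.2 - y0‖]
      have hp2 : p.2 ∈ Metric.closedBall y0 r := by
        rw [mem_closedBall_iff_norm]
        apply (sq_le_sq₀ (norm_nonneg _) hr.le).1
        nlinarith [sq_nonneg p.1]
      rw [Set.indicator_of_mem hpb, Set.indicator_of_mem hp1, Set.indicator_of_mem hp2, hproj,
        one_mul]
  have hintθ : Integrable (fun y => θ y * f y ^ 2) (T.surface a) :=
    ((T.memLp_surface hθ a).integrable_mul (T.memLp_surface (hf.continuous.pow 2) a))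
  have hintf : Integrable (fun y => f y ^ 2) (T.surface a) :=
    (T.memLp_surface hf.continuous a).integrable_sq
  have hθ0 : ∀ y ∈ T.facet a, 0 ≤ θ y := fun y hy => (sq_nonneg _).trans (hθW y hy)
  have h2 : ∫ y in Metric.closedBall y0 r, f y ^ 2 ∂σ ≤
      (2 / γ) ^ (N * 2) * ∫ y, θ y * f y ^ 2 ∂(T.surface a) := by
    have e1 : ∫ y in Metric.closedBall y0 r, f y ^ 2 ∂σ =
        ∫ y in Metric.closedBall y0 r, f y ^ 2 ∂(T.surface a) := by
      rw [T.surface_eq, Measure.restrict_restrict measurableSet_closedBall]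
      apply setIntegral_congr_set
      filter_upwards [hH] with y hy
      apply propext
      change y ∈ Metric.closedBall y0 r ↔ y ∈ Metric.closedBall y0 r ∩ T.carrier
      constructor
      · intro hyb
        exact ⟨hyb, T.facet_subset a (hdisc y hyb hy)⟩
      · exact fun hyb => hyb.1
    rw [e1]
    have e2 : ∫ y in Metric.closedBall y0 r, θ y * f y ^ 2 ∂(T.surface a) ≤
        ∫ y, θ y * f y ^ 2 ∂(T.surface a) := by
      apply setIntegral_le_integral hintθ
      filter_upwards [T.surface_ae_mem a] with y hy
      exact mul_nonneg (hθ0 y hy) (sq_nonneg _)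
    refine le_trans ?_ (mul_le_mul_of_nonneg_left e2 (by positivity))
    rw [← integral_const_mul]
    apply integral_mono_ae hintf.integrableOn (hintθ.integrableOn.const_mul _)
    have hae : ∀ᵐ y ∂((T.surface a).restrict (Metric.closedBall y0 r)), y ∈ T.facet a :=
      ae_restrict_of_ae (T.surface_ae_mem a)
    filter_upwards [hae, ae_restrict_mem measurableSet_closedBall] with y hy1 hy2
    have e3 := hT.wt_ge hγ hγ1 hN (Finset.univ.erase a)
      (fun b hb => hy0g b (Finset.ne_of_mem_erase hb)) hy2
    -- The exponent is doubled because `θ` dominates only the square of the facet weight.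
    have e4 : 1 ≤ (2 / γ) ^ (N * 2) * θ y := by
      calc (1 : ℝ) = (2 / γ) ^ (N * 2) * ((γ / 2) ^ N) ^ 2 := by
            rw [← pow_mul, ← mul_pow]; field_simp; simp
        _ ≤ (2 / γ) ^ (N * 2) * (T.wt h (Finset.univ.erase a) y) ^ 2 := by gcongr
        _ ≤ _ := by gcongr; exact hθW y hy1
    nlinarith [sq_nonneg (f y)]
  have h3 := (hp _ hg y0 r hr x hx').1
  have hr1 : (2 / γ) ^ d * r ^ d = h ^ d := by
    rw [← mul_pow, hrdef]; congr 1; field_simp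
  have hr2 : 2 * r = γ * h := by rw [hrdef]; ring
  calc h ^ d * f (T.proj a x) ^ 2 = (2 / γ) ^ d * (r ^ d * f (T.proj a x) ^ 2) := by
        rw [← hr1]; ring
    _ ≤ (2 / γ) ^ d * (C * (2 * r * ((2 / γ) ^ (N * 2) * ∫ y, θ y * f y ^ 2 ∂(T.surface a)))) := by
        refine mul_le_mul_of_nonneg_left ?_ (by positivity)
        refine h3.trans (mul_le_mul_of_nonneg_left ?_ hC.le)
        exact h1.trans (mul_le_mul_of_nonneg_left h2 (by positivity))
    _ = _ := by rw [hr2]; ring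

end
end ConformingDG

/-! ### Control of gradients and jumps by the weak gradient, and vanishing corrections -/

namespace ConformingDG
noncomputable section

lemma sum_outward_sq {d : ℕ} (T : ConvexPolytope d) (a : Fin T.numFacets) :
    ∑ l, T.outward a l * T.outward a l = 1 := by
  have h := EuclideanSpace.real_norm_sq_eq (T.outward a)
  rw [T.unit_outward] at h
  simp only [← pow_two]
  linarith

lemma abs_outward_le_one {d : ℕ} (T : ConvexPolytope d) (a : Fin T.numFacets) (l : Fin d) :
    |T.outward a l| ≤ 1 := by
  have h := sum_outward_sq T a
  have h1 : T.outward a l * T.outward a l ≤ ∑ l, T.outward a l * T.outward a l :=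
    Finset.single_le_sum (f := fun l => T.outward a l * T.outward a l)
      (fun i _ => mul_self_nonneg _) (Finset.mem_univ l)
  rw [abs_le_one_iff_mul_self_le_one]
  linarith

/-- The facet part: bounds of a facet polynomial by its weighted norm. -/
lemma fat_facet_l2 (d m N : ℕ) {γ : ℝ} (hγ : 0 < γ) (hγ1 : γ ≤ 1) :
    ∃ C, 0 < C ∧ ∀ (T : ConvexPolytope d) (h : ℝ), Fat T h γ → T.numFacets ≤ N →
      ∀ f, IsPoly m f → ∀ (a : Fin T.numFacets) (θ : E d → ℝ), Continuous θ →
        (∀ y ∈ T.facet a, T.wt h (Finset.univ.erase a) y ^ 2 ≤ θ y) →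
        l2 T.vol (fun x => f (T.proj a x)) ^ 2 ≤ C * h * ∫ y, θ y * f y ^ 2 ∂(T.surface a) ∧
        l2 (T.surface a) f ^ 2 ≤ C * ∫ y, θ y * f y ^ 2 ∂(T.surface a) := by
  obtain ⟨C, hC, hp⟩ := fat_poly_facet d m N hγ hγ1
  have hv := ballVol_nonneg d
  refine ⟨2 ^ d * ballVol d * C + C, by positivity, fun T h hT hN f hf a θ hθ hθW => ?_⟩
  have hh := hT.pos
  have key := hp T h hT hN f hf a θ hθ hθW
  have hI0 : 0 ≤ ∫ y, θ y * f y ^ 2 ∂(T.surface a) := by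
    apply integral_nonneg_of_ae
    filter_upwards [T.surface_ae_mem a] with y hy
    exact mul_nonneg ((sq_nonneg _).trans (hθW y hy)) (sq_nonneg _)
  set I := ∫ y, θ y * f y ^ 2 ∂(T.surface a)
  have h2d : (1 : ℝ) ≤ 2 ^ d := one_le_pow₀ one_le_two
  have hcc : ballVol d * C ≤ 2 ^ d * ballVol d * C + C := by
    have : ballVol d * C ≤ 2 ^ d * (ballVol d * C) := le_mul_of_one_le_left (by positivity) h2d
    linarith
  constructor
  · calc _ ≤ ballVol d * (C * (h * I)) := hT.l2_vol_sq_le (by positivity) key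
      _ = (ballVol d * C) * (h * I) := by ring
      _ ≤ (2 ^ d * ballVol d * C + C) * (h * I) := by gcongr
      _ = _ := by ring
  · have h1 := hT.l2_surface_sq_le a (g := f) (B := C * (h * I)) (by positivity) (fun x hx => by
      have := key x (T.facet_subset a hx)
      rwa [T.proj_of_mem_facet hx] at this)
    have h2 : h * l2 (T.surface a) f ^ 2 ≤ h * (2 ^ d * ballVol d * C * I) := by
      calc _ ≤ _ := h1
        _ = _ := by ring
    calc _ ≤ 2 ^ d * ballVol d * C * I := le_of_mul_le_mul_left h2 hh
      _ ≤ _ := by gcongr; linarith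

lemma sum_add_sq_le {d : ℕ} (x y : Fin d → ℝ) :
    (∑ l, (x l + y l)) ^ 2 ≤ 2 * d * (∑ l, x l ^ 2 + ∑ l, y l ^ 2) := by
  have h := sq_sum_le_card_mul_sum_sq (s := (Finset.univ : Finset (Fin d)))
    (f := fun l => x l + y l)
  rw [Finset.card_univ, Fintype.card_fin] at h
  refine h.trans ?_
  rw [← Finset.sum_add_distrib, mul_comm (2 : ℝ), mul_assoc, Finset.mul_sum 
    (a := (2 : ℝ))]
  gcongr with l
  nlinarith [sq_nonneg (x l - y l)]

/-- A polynomial `p` and its jumps are controlled by the weak gradient `G`. -/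
lemma weak_gradient_bound (d k N : ℕ) (hk : 1 ≤ k) {γ : ℝ} (hγ : 0 < γ) (hγ1 : γ ≤ 1) :
    ∃ C, 0 < C ∧ ∀ (T : ConvexPolytope d) (h : ℝ), Fat T h γ → T.numFacets ≤ N →
      ∀ j, T.numFacets + k - 1 ≤ j → ∀ (p : E d → ℝ) (G : Fin d → E d → ℝ)
      (μ : Fin T.numFacets → E d → ℝ), IsPoly k p → (∀ l, Continuous (G l)) →
      (∀ a, IsPoly k (μ a)) →
      (∀ q : Fin d → E d → ℝ, (∀ l, IsPoly j (q l)) →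
        ∫ x, ∑ l, G l x * q l x ∂T.vol = ∫ x, ∑ l, pd l p x * q l x ∂T.vol -
          ∑ a, ∫ x, μ a x * ∑ l, q l x * T.outward a l ∂(T.surface a)) →
      ∑ l, l2 T.vol (pd l p) ^ 2 ≤ C * ∑ l, l2 T.vol (G l) ^ 2 ∧
      ∀ a, l2 (T.surface a) (μ a) ^ 2 ≤ C * h * ∑ l, l2 T.vol (G l) ^ 2 := by
  obtain ⟨C1, hC1, hp1⟩ := fat_poly_l2 d (k - 1) N hγ hγ1
  obtain ⟨C2, hC2, hp2⟩ := fat_facet_l2 d k N hγ hγ1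
  refine ⟨C1 ^ 2 + C2 * (2 * d * (C1 ^ 2 + 1) * C2), by positivity,
    fun T h hT hN j hj p G μ hp hG hμ hyp => ?_⟩
  have hh := hT.pos
  set A := ∑ l, l2 T.vol (pd l p) ^ 2
  set B := ∑ l, l2 T.vol (G l) ^ 2
  have hB0 : 0 ≤ B := Finset.sum_nonneg fun _ _ => sq_nonneg _
  have hpd : ∀ l, IsPoly (k - 1) (pd l p) := fun l => hp.pd l
  have hA : A ≤ C1 ^ 2 * B := by
    set W := T.wt h Finset.univ
    have hW := T.isPoly_wt h Finset.univ
    -- The test field `W ∇p` has degree at most `n + (k - 1)`, which is just admissible. It vanishes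
    -- on every facet, so no jump term survives.
    have e1 := hyp (fun l x => W x * pd l p x) (fun l => (hW.mul (hpd l)).mono (by
      rw [Finset.card_univ, Fintype.card_fin]; omega))
    have e2 : ∑ a, ∫ x, μ a x * ∑ l, W x * pd l p x * T.outward a l ∂(T.surface a) = 0 := by
      apply Finset.sum_eq_zero
      intro a _
      apply integral_eq_zero_of_ae
      filter_upwards [T.surface_ae_mem a] with x hx
      have : W x = 0 := T.wt_eq_zero (Finset.mem_univ a) hx
      simp [this]
    rw [e2, sub_zero, integral_finsetSum, integral_finsetSum] at e1
    rotate_left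
    · exact fun l _ => integrable_mul_of_memLp (T.memLp_vol (hpd l).continuous)
        (T.memLp_vol (hW.continuous.mul (hpd l).continuous))
    · exact fun l _ => integrable_mul_of_memLp (T.memLp_vol (hG l))
        (T.memLp_vol (hW.continuous.mul (hpd l).continuous))
    have e3 : A ≤ C1 * ∑ l, ∫ x, pd l p x * (W x * pd l p x) ∂T.vol := by
      rw [Finset.mul_sum]
      refine Finset.sum_le_sum fun l _ => ?_
      refine (hp1 T h hT hN _ (hpd l)).1.trans (le_of_eq ?_)
      congr 2 with x
      ring
    -- Young's inequality; half of the gradient norm is absorbed on the left.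
    have e4 : ∀ l, C1 * ∫ x, G l x * (W x * pd l p x) ∂T.vol ≤
        C1 ^ 2 * l2 T.vol (G l) ^ 2 / 2 + l2 T.vol (pd l p) ^ 2 / 2 := by
      intro l
      have e5 : ∫ x, G l x * (W x * pd l p x) ∂T.vol ≤ l2 T.vol (G l) * l2 T.vol (pd l p) :=
        (le_abs_self _).trans ((abs_integral_mul_le (T.memLp_vol (hG l))
          (T.memLp_vol (hW.continuous.mul (hpd l).continuous))).trans
          (mul_le_mul_of_nonneg_left (hT.l2_wt_mul_le _ (hpd l).continuous) l2_nonneg))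
      have := mul_le_mul_of_nonneg_left e5 hC1.le
      nlinarith [sq_nonneg (C1 * l2 T.vol (G l) - l2 T.vol (pd l p))]
    rw [← e1, Finset.mul_sum] at e3
    have e6 := e3.trans (Finset.sum_le_sum fun l _ => e4 l)
    rw [Finset.sum_add_distrib, ← Finset.sum_div, ← Finset.sum_div, ← Finset.mul_sum] at e6
    change A ≤ C1 ^ 2 * B / 2 + A / 2 at e6
    linarith
  refine ⟨hA.trans (mul_le_mul_of_nonneg_right (le_add_of_nonneg_right (by positivity)) hB0),
    fun a => ?_⟩
  set w := T.wt h (Finset.univ.erase a)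
  have hw := T.isPoly_wt h (Finset.univ.erase a)
  set f := fun x => μ a (T.proj a x)
  have hf : IsPoly k f := (hμ a).comp_affine (T.isPoly_proj a)
  have hν := abs_outward_le_one T a
  -- Since `0 ≤ w ≤ 1` on the element, `w² ≤ w` and `w` itself can serve as the facet weight.
  obtain ⟨f1, f2⟩ := hp2 T h hT hN _ (hμ a) a w hw.continuous (fun y hy => by
    have h1 := hT.wt_nonneg (Finset.univ.erase a) (T.facet_subset a hy)
    have h2 := hT.wt_le_one (Finset.univ.erase a) (T.facet_subset a hy)
    exact pow_le_of_le_one h1 h2 two_ne_zero)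
  set Y := ∫ y, w y * μ a y ^ 2 ∂(T.surface a)
  have hwf : Continuous fun x => w x * f x := hw.continuous.mul hf.continuous
  -- The test field is the normal of `a` times `w` times the jump extended constantly along that
  -- normal, of degree at most `(n - 1) + k`. It vanishes on all facets but `a`, where its normal
  -- component is `w μ a`.
  have e1 := hyp (fun l x => T.outward a l * (w x * f x)) (fun l =>
    ((hw.mul hf).const_mul _).mono (by
      rw [Finset.card_erase_of_mem (Finset.mem_univ a), Finset.card_univ, Fintype.card_fin]
      have := a.pos
      omega))
  have e2 : ∑ b, ∫ x, μ b x * ∑ l, T.outward a l * (w x * f x) * T.outward b l ∂(T.surface b)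
      = Y := by
    rw [Finset.sum_eq_single a]
    · apply integral_congr_ae
      filter_upwards [T.surface_ae_mem a] with x hx
      have h1 : f x = μ a x := by simp only [f]; rw [T.proj_of_mem_facet hx]
      have h2 : ∑ l, T.outward a l * (w x * f x) * T.outward a l = w x * f x := by
        conv_rhs => rw [← mul_one (w x * f x), ← sum_outward_sq T a, Finset.mul_sum]
        exact Finset.sum_congr rfl fun l _ => by ring
      rw [h2, h1]; ring
    · intro b _ hb
      apply integral_eq_zero_of_ae
      filter_upwards [T.surface_ae_mem b] with x hx
      have : w x = 0 :=
        T.wt_eq_zero (Finset.mem_erase.2 ⟨hb, Finset.mem_univ b⟩) hx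
      simp [this]
    · simp
  rw [e2, integral_finsetSum, integral_finsetSum] at e1
  rotate_left
  · exact fun l _ => integrable_mul_of_memLp (T.memLp_vol (hpd l).continuous)
      (T.memLp_vol (continuous_const.mul hwf))
  · exact fun l _ => integrable_mul_of_memLp (T.memLp_vol (hG l))
      (T.memLp_vol (continuous_const.mul hwf))
  set Z := l2 T.vol f
  have e3 : l2 T.vol (fun x => w x * f x) ≤ Z := hT.l2_wt_mul_le _ hf.continuous
  have e3' : ∀ l, l2 T.vol (fun x => T.outward a l * (w x * f x)) ≤ Z := fun l => by
    rw [l2_const_mul]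
    exact (mul_le_of_le_one_left l2_nonneg (hν l)).trans e3
  have e4 : ∀ g : E d → ℝ, Continuous g → ∀ l,
      |∫ x, g x * (T.outward a l * (w x * f x)) ∂T.vol| ≤ l2 T.vol g * Z := fun g hg l =>
    (abs_integral_mul_le (T.memLp_vol hg) (T.memLp_vol (continuous_const.mul hwf))).trans
      (mul_le_mul_of_nonneg_left (e3' l) l2_nonneg)
  set S := ∑ l, (l2 T.vol (pd l p) + l2 T.vol (G l))
  have e5 : Y ≤ S * Z := by
    have : Y = ∑ l, (∫ x, pd l p x * (T.outward a l * (w x * f x)) ∂T.vol -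
        ∫ x, G l x * (T.outward a l * (w x * f x)) ∂T.vol) := by
      rw [Finset.sum_sub_distrib]; linarith
    rw [this, Finset.sum_mul]
    refine Finset.sum_le_sum fun l _ => ?_
    have h1 := abs_le.1 (e4 _ (hpd l).continuous l)
    have h2 := abs_le.1 (e4 _ (hG l) l)
    rw [add_mul]
    linarith
  have hY0 : 0 ≤ Y := by
    have := (sq_nonneg (l2 (T.surface a) (μ a))).trans f2
    exact nonneg_of_mul_nonneg_right this hC2
  have hS : S ^ 2 ≤ 2 * d * (A + B) := sum_add_sq_le _ _
  -- The extension satisfies `Z² ≤ C2 h Y`, so squaring `Y ≤ S Z` and cancelling one factor `Y`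
  -- gains the power of `h`.
  have e6 : Y ≤ S ^ 2 * (C2 * h) := by
    rcases hY0.eq_or_lt with h0 | h0
    · rw [← h0]; positivity
    · have : Y * Y ≤ S ^ 2 * (C2 * h) * Y := by
        calc Y * Y ≤ (S * Z) * (S * Z) := mul_self_le_mul_self hY0 e5
          _ = S ^ 2 * Z ^ 2 := by ring
          _ ≤ S ^ 2 * (C2 * h * Y) := by gcongr
          _ = _ := by ring
      exact le_of_mul_le_mul_right this h0
  calc l2 (T.surface a) (μ a) ^ 2 ≤ C2 * Y := f2
    _ ≤ C2 * ((2 * d * (A + B)) * (C2 * h)) :=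
        mul_le_mul_of_nonneg_left (e6.trans (mul_le_mul_of_nonneg_right hS (by positivity))) hC2.le
    _ ≤ C2 * ((2 * d * (C1 ^ 2 * B + B)) * (C2 * h)) := by gcongr
    _ = (C2 * (2 * d * (C1 ^ 2 + 1) * C2)) * (h * B) := by ring
    _ ≤ (C1 ^ 2 + C2 * (2 * d * (C1 ^ 2 + 1) * C2)) * (h * B) :=
        mul_le_mul_of_nonneg_right (le_add_of_nonneg_left (by positivity)) (by positivity)
    _ = _ := by ring

lemma l2_add_sq_le {d : ℕ} {μ : Measure (E d)} {f g : E d → ℝ} (hf : MemLp f 2 μ)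
    (hg : MemLp g 2 μ) : l2 μ (fun x => f x + g x) ^ 2 ≤ 2 * l2 μ f ^ 2 + 2 * l2 μ g ^ 2 := by
  have h1 := l2_add_le hf hg
  have h2 : 0 ≤ l2 μ (fun x => f x + g x) := l2_nonneg
  nlinarith [sq_nonneg (l2 μ f - l2 μ g)]

lemma l2_sub_sq_le {d : ℕ} {μ : Measure (E d)} {f g : E d → ℝ} (hf : MemLp f 2 μ)
    (hg : MemLp g 2 μ) : l2 μ (fun x => f x - g x) ^ 2 ≤ 2 * l2 μ f ^ 2 + 2 * l2 μ g ^ 2 := by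
  have h1 := l2_sub_le hf hg
  have h2 : 0 ≤ l2 μ (fun x => f x - g x) := l2_nonneg
  nlinarith [sq_nonneg (l2 μ f - l2 μ g)]

/-- A polynomial can be corrected to vanish on a set of edges/faces, at a cost measured by its
norms there. -/
lemma exists_vanishing_correction (d m N : ℕ) {γ : ℝ} (hγ : 0 < γ) (hγ1 : γ ≤ 1) :
    ∃ C, 0 < C ∧ ∀ (T : ConvexPolytope d) (h : ℝ), Fat T h γ → T.numFacets ≤ N →
      ∀ f, IsPoly m f → ∀ F : Finset (Fin T.numFacets), ∃ f', IsPoly m f' ∧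
        (∀ a ∈ F, ∀ x ∈ T.facet a, f' x = 0) ∧
        l2 T.vol (fun x => f x - f' x) ^ 2 ≤ C * h * ∑ a ∈ F, l2 (T.surface a) f ^ 2 := by
  -- Induction on the degree. Subtracting from `f` its normal extension off one facet `a` leaves
  -- `gap a` times a polynomial `q` of lower degree. Correcting `q` on the remaining facets and
  -- multiplying by `gap a` again yields a polynomial that vanishes on all of them.
  induction m with
  | zero =>
    obtain ⟨C, hC, hp⟩ := fat_facet_l2 d 0 N hγ hγ1
    refine ⟨C, hC, fun T h hT hN f hf F => ?_⟩
    have hh := hT.pos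
    rcases F.eq_empty_or_nonempty with rfl | ⟨a, ha⟩
    · exact ⟨f, hf, by simp, by simp [l2]⟩
    -- A constant is its own normal extension, so a single facet controls it and it may be replaced
    -- by zero.
    refine ⟨fun _ => 0, IsPoly.const 0, fun _ _ _ _ => rfl, ?_⟩
    obtain ⟨q, -, hq0, hq⟩ := T.exists_quotient a hf
    have hfp : (fun x => f x - 0) = fun x => f (T.proj a x) := by
      ext x
      have := hq x
      rw [hq0 rfl] at this
      simpa [sub_eq_zero] using this
    rw [hfp]
    have h1 := (hp T h hT hN f hf a (fun _ => 1) continuous_const (fun y hy => by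
      have h1 := hT.wt_nonneg (Finset.univ.erase a) (T.facet_subset a hy)
      have h2 := hT.wt_le_one (Finset.univ.erase a) (T.facet_subset a hy)
      exact pow_le_one₀ h1 h2)).1
    simp only [one_mul] at h1
    rw [← l2_sq] at h1
    refine h1.trans (mul_le_mul_of_nonneg_left ?_ (by positivity))
    exact Finset.single_le_sum (f := fun a => l2 (T.surface a) f ^ 2) (fun _ _ => sq_nonneg _) ha
  | succ m ih =>
    obtain ⟨C0, hC0, ih⟩ := ih
    obtain ⟨K1, hK1, hp1⟩ := fat_facet_l2 d (m + 1) N hγ hγ1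
    obtain ⟨K2, hK2, hp2⟩ := fat_poly_l2 d (m + 1) N hγ hγ1
    refine ⟨2 * K1 + 4 * C0 * K1 + 4 * C0 * K1 * (N * (K2 * K1)), by positivity,
      fun T h hT hN f hf F => ?_⟩
    have hh := hT.pos
    rcases F.eq_empty_or_nonempty with rfl | ⟨a, ha⟩
    · exact ⟨f, hf, by simp, by simp [l2]⟩
    obtain ⟨q, hq, -, hfq⟩ := T.exists_quotient a hf
    obtain ⟨q', hq', hq'0, hqq⟩ := ih T h hT hN q hq (F.erase a)
    have hg := T.isPoly_gap a
    have hfp : IsPoly (m + 1) fun x => f (T.proj a x) := hf.comp_affine (T.isPoly_proj a)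
    set L := fun b => l2 (T.surface b) f ^ 2
    have hL0 : ∀ b, 0 ≤ L b := fun b => sq_nonneg _
    refine ⟨fun x => T.gap a x * q' x, (hg.mul hq').mono (by omega), ?_, ?_⟩
    · intro b hb x hx
      by_cases hba : b = a
      · subst hba
        simp only [(T.mem_facet_iff.1 hx).2, zero_mul]
      · simp only [hq'0 b (Finset.mem_erase.2 ⟨hba, hb⟩) x hx, mul_zero]
    have e0 : l2 T.vol (fun x => f (T.proj a x)) ^ 2 ≤ K1 * h * L a := by
      have h1 := (hp1 T h hT hN f hf a (fun _ => 1) continuous_const (fun y hy => by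
        have h1 := hT.wt_nonneg (Finset.univ.erase a) (T.facet_subset a hy)
        have h2 := hT.wt_le_one (Finset.univ.erase a) (T.facet_subset a hy)
        exact pow_le_one₀ h1 h2)).1
      simp only [one_mul] at h1
      rwa [← l2_sq] at h1
    have e1 : ∀ b, l2 (T.surface b) (fun x => f (T.proj a x)) ^ 2 ≤ K2 * K1 * L a := by
      intro b
      have h1 := (hp2 T h hT hN _ hfp).2.2 b
      have h2 : h * l2 (T.surface b) (fun x => f (T.proj a x)) ^ 2 ≤ h * (K2 * K1 * L a) := by
        calc _ ≤ _ := h1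
          _ ≤ K2 * (K1 * h * L a) := by gcongr
          _ = _ := by ring
      exact le_of_mul_le_mul_left h2 hh
    -- Dividing by `gap a` is unstable near facet `a`. The weight `(gap a / h)²` undoes the division
    -- and still dominates the square of the weight of facet `b`, so no bound is lost.
    have e2 : ∀ b ∈ F.erase a, h ^ 2 * l2 (T.surface b) q ^ 2 ≤
        2 * K1 * (L b + K2 * K1 * L a) := by
      intro b hb
      have hba := Finset.ne_of_mem_erase hb
      have h1 := (hp1 T h hT hN q (hq.mono (by omega)) b (fun x => (T.gap a x / h) ^ 2)
        ((hg.continuous.div_const h).pow 2) (fun y hy => by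
          have h1 := hT.wt_nonneg (Finset.univ.erase b) (T.facet_subset b hy)
          exact pow_le_pow_left₀ h1 (hT.wt_erase_le (Ne.symm hba) (T.facet_subset b hy)) 2)).2
      have h2 : ∫ y, (T.gap a y / h) ^ 2 * q y ^ 2 ∂(T.surface b) =
          (h ^ 2)⁻¹ * l2 (T.surface b) (fun x => f x - f (T.proj a x)) ^ 2 := by
        rw [l2_sq, ← integral_const_mul]
        congr 1
        ext y
        rw [hfq]
        field_simp
      rw [h2] at h1
      have h3 := l2_sub_sq_le (T.memLp_surface hf.continuous b) (T.memLp_surface hfp.continuous b)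
      calc h ^ 2 * l2 (T.surface b) q ^ 2 ≤ h ^ 2 * (K1 * ((h ^ 2)⁻¹ *
            l2 (T.surface b) (fun x => f x - f (T.proj a x)) ^ 2)) := by gcongr
        _ = K1 * l2 (T.surface b) (fun x => f x - f (T.proj a x)) ^ 2 := by field_simp
        _ ≤ K1 * (2 * L b + 2 * (K2 * K1 * L a)) := by
            refine mul_le_mul_of_nonneg_left (h3.trans ?_) hK1.le
            exact add_le_add le_rfl (mul_le_mul_of_nonneg_left (e1 b) zero_le_two)
        _ = _ := by ring
    have e3 : l2 T.vol (fun x => T.gap a x * (q x - q' x)) ≤ h * l2 T.vol (fun x => q x - q' x) := by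
      have hc := hq.continuous.sub hq'.continuous
      have hcm : h * l2 T.vol (fun x => q x - q' x) = l2 T.vol (fun x => h * (q x - q' x)) := by
        rw [l2_const_mul, abs_of_pos hh]
      rw [hcm]
      apply l2_le_of_abs_le (hg.continuous.mul hc).aestronglyMeasurable
        (T.memLp_vol (continuous_const.mul hc))
      refine (ae_restrict_iff' T.isClosed_carrier.measurableSet).2
        (Eventually.of_forall fun x hx => ?_)
      change |T.gap a x * (q x - q' x)| ≤ |h * (q x - q' x)|
      rw [abs_mul, abs_mul, abs_of_nonneg (T.mem_carrier_iff.1 hx a), abs_of_pos hh]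
      exact mul_le_mul_of_nonneg_right (hT.gap_le a hx) (abs_nonneg _)
    have e4 : (fun x => f x - T.gap a x * q' x) =
        fun x => f (T.proj a x) + T.gap a x * (q x - q' x) := by
      ext x
      have := hfq x
      linear_combination this
    have hLa : L a ≤ ∑ b ∈ F, L b := Finset.single_le_sum (fun b _ => hL0 b) ha
    have hLe : ∑ b ∈ F.erase a, L b ≤ ∑ b ∈ F, L b :=
      Finset.sum_le_sum_of_subset_of_nonneg (Finset.erase_subset _ _) (fun b _ _ => hL0 b)
    have hcard : ((F.erase a).card : ℝ) ≤ N := by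
      have : (F.erase a).card ≤ T.numFacets := by
        simpa using Finset.card_le_univ (F.erase a)
      exact_mod_cast this.trans hN
    have e5 : h ^ 2 * ∑ b ∈ F.erase a, l2 (T.surface b) q ^ 2 ≤
        2 * K1 * (1 + N * (K2 * K1)) * ∑ b ∈ F, L b := by
      rw [Finset.mul_sum]
      refine (Finset.sum_le_sum e2).trans ?_
      rw [← Finset.mul_sum, Finset.sum_add_distrib, Finset.sum_const, nsmul_eq_mul, mul_assoc (2 * K1)]
      refine mul_le_mul_of_nonneg_left ?_ (by positivity)
      rw [add_mul, one_mul]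
      refine add_le_add hLe ?_
      rw [mul_assoc (N : ℝ)]
      refine mul_le_mul hcard ?_ ?_ (by positivity)
      · exact mul_le_mul_of_nonneg_left hLa (by positivity)
      · have := hL0 a
        positivity
    have e6 : l2 T.vol (fun x => T.gap a x * (q x - q' x)) ^ 2 ≤
        C0 * h * (2 * K1 * (1 + N * (K2 * K1)) * ∑ b ∈ F, L b) := by
      calc _ ≤ (h * l2 T.vol (fun x => q x - q' x)) ^ 2 := by
            exact pow_le_pow_left₀ l2_nonneg e3 2
        _ = h ^ 2 * l2 T.vol (fun x => q x - q' x) ^ 2 := by ring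
        _ ≤ h ^ 2 * (C0 * h * ∑ b ∈ F.erase a, l2 (T.surface b) q ^ 2) := by gcongr
        _ = C0 * h * (h ^ 2 * ∑ b ∈ F.erase a, l2 (T.surface b) q ^ 2) := by ring
        _ ≤ _ := mul_le_mul_of_nonneg_left e5 (by positivity)
    rw [e4]
    calc _ ≤ _ := l2_add_sq_le (T.memLp_vol hfp.continuous)
          (T.memLp_vol (hg.continuous.mul (hq.continuous.sub hq'.continuous)))
      _ ≤ 2 * (K1 * h * ∑ b ∈ F, L b) +
          2 * (C0 * h * (2 * K1 * (1 + N * (K2 * K1)) * ∑ b ∈ F, L b)) := by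
          refine add_le_add ?_ (mul_le_mul_of_nonneg_left e6 zero_le_two)
          refine mul_le_mul_of_nonneg_left (e0.trans ?_) zero_le_two
          exact mul_le_mul_of_nonneg_left hLa (by positivity)
      _ = _ := by ring

end
end ConformingDG

/-! ### Traces of H¹ functions and Green's formula on an element -/

namespace ConformingDG
noncomputable section

variable {d : ℕ}

lemma partialD_one (i : Fin d) (φ : E d → ℝ) : partialD (fun _ : Fin 1 => i) φ = pd i φ := by
  ext x
  simp [partialD, pd]

lemma pd_mul {f g : E d → ℝ} (hf : Differentiable ℝ f) (hg : Differentiable ℝ g) (i : Fin d)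
    (x : E d) : pd i (fun x => f x * g x) x = f x * pd i g x + g x * pd i f x := by
  have := ((hf x).hasFDerivAt.mul (hg x).hasFDerivAt).fderiv
  simp only [pd]
  rw [show (fun x => f x * g x) = f * g from rfl, this]
  simp

lemma pd_sub {f g : E d → ℝ} (hf : Differentiable ℝ f) (hg : Differentiable ℝ g) (i : Fin d)
    (x : E d) : pd i (fun x => f x - g x) x = pd i f x - pd i g x := by
  have := ((hf x).hasFDerivAt.sub (hg x).hasFDerivAt).fderiv
  simp only [pd]
  rw [show (fun x => f x - g x) = f - g from rfl, this]
  simp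

lemma pd_const_mul {f : E d → ℝ} (hf : Differentiable ℝ f) (c : ℝ) (i : Fin d)
    (x : E d) : pd i (fun x => c * f x) x = c * pd i f x := by
  have := ((hf x).hasFDerivAt.const_mul c).fderiv
  simp only [pd]
  rw [this]
  simp

lemma continuous_pd {f : E d → ℝ} (hf : ContDiff ℝ 1 f) (i : Fin d) : Continuous (pd i f) :=
  (hf.continuous_fderiv one_ne_zero).clm_apply continuous_const

lemma contDiff_pd {f : E d → ℝ} (hf : ContDiff ℝ ∞ f) (i : Fin d) : ContDiff ℝ ∞ (pd i f) :=
  (hf.fderiv_right (m := ∞) le_rfl).clm_apply contDiff_const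

namespace ConvexPolytope
variable (T : ConvexPolytope d)

lemma integral_pd {φ : E d → ℝ} (hφ : ContDiff ℝ 1 φ) (i : Fin d) :
    ∫ x, pd i φ x ∂T.vol = ∑ a, T.outward a i * ∫ x, φ x ∂(T.surface a) := by
  have := T.integral_fderiv_carrier hφ (EuclideanSpace.single i 1)
  simpa [pd, EuclideanSpace.inner_single_right] using this

lemma integral_mul_pd {φ q : E d → ℝ} (hφ : ContDiff ℝ 1 φ) (hq : ContDiff ℝ 1 q) (i : Fin d) :
    ∫ x, φ x * pd i q x ∂T.vol + ∫ x, pd i φ x * q x ∂T.vol =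
      ∑ a, T.outward a i * ∫ x, φ x * q x ∂(T.surface a) := by
  rw [← T.integral_pd (hφ.mul hq) i, ← integral_add
    (integrable_mul_of_memLp (T.memLp_vol hφ.continuous) (T.memLp_vol (continuous_pd hq i)))
    (integrable_mul_of_memLp (T.memLp_vol (continuous_pd hφ i)) (T.memLp_vol hq.continuous))]
  congr 1
  ext x
  rw [pd_mul (hφ.differentiable one_ne_zero) (hq.differentiable one_ne_zero)]
  ring

end ConvexPolytope

/-- The multiplicative trace inequality. -/
lemma Fat.trace_le {T : ConvexPolytope d} {h γ : ℝ} (hT : Fat T h γ) (hγ : 0 < γ) {φ : E d → ℝ}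
    (hφ : ContDiff ℝ 1 φ) :
    γ * h * ∑ a, l2 (T.surface a) φ ^ 2 ≤
      d * l2 T.vol φ ^ 2 + 2 * h * l2 T.vol φ * ∑ i, l2 T.vol (pd i φ) := by
  obtain ⟨x0, hx0⟩ := hT.center
  have hx0T := hT.mem_of_gap hγ hx0
  have hsq : ContDiff ℝ 1 fun x => φ x * φ x := hφ.mul hφ
  have hco : ∀ i : Fin d, ContDiff ℝ 1 fun x : E d => x i - x0 i := fun i =>
    ((IsPoly.coord i).sub (IsPoly.const (m := 1) (x0 i))).contDiff
  -- The divergence theorem for `φ² (x - x₀)`. On facet `a` the normal component of `x - x₀` is the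
  -- constant `gap a x₀ ≥ γ h`, and in the element `|x - x₀| ≤ h`.
  have e1 : ∀ i, ∫ x, φ x * φ x ∂T.vol + ∫ x, 2 * φ x * pd i φ x * (x i - x0 i) ∂T.vol =
      ∑ a, T.outward a i * ∫ x, φ x * φ x * (x i - x0 i) ∂(T.surface a) := by
    intro i
    rw [← T.integral_mul_pd hsq (hco i) i]
    congr 2
    · ext x
      have : pd i (fun x : E d => x i - x0 i) x = 1 := by
        have h1 := pd_sub (IsPoly.coord i).differentiable
          (IsPoly.const (m := 1) (x0 i)).differentiable i x
        rw [h1]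
        have h2 : pd i (fun x : E d => x i) x = 1 := by
          have := pd_pval i (MvPolynomial.X i : MvPolynomial (Fin d) ℝ)
          have h3 : (pval (MvPolynomial.X i : MvPolynomial (Fin d) ℝ)) = fun x : E d => x i := by
            ext x; simp
          rw [h3] at this
          rw [this]
          simp
        rw [h2]
        simp [pd]
      rw [this, mul_one]
    · ext x
      rw [pd_mul (hφ.differentiable one_ne_zero) (hφ.differentiable one_ne_zero)]
      ring
  have e2 : ∑ i, ∑ a, T.outward a i * ∫ x, φ x * φ x * (x i - x0 i) ∂(T.surface a) =
      ∑ a, T.gap a x0 * l2 (T.surface a) φ ^ 2 := by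
    rw [Finset.sum_comm]
    refine Finset.sum_congr rfl fun a _ => ?_
    simp_rw [← integral_const_mul]
    rw [← integral_finsetSum, l2_sq, ← integral_const_mul]
    · apply integral_congr_ae
      filter_upwards [T.surface_ae_mem a] with x hx
      have h1 := (T.mem_facet_iff.1 hx).2
      have h2 : T.gap a x0 = ∑ i, T.outward a i * (x i - x0 i) := by
        have h3 : T.gap a x0 = inner ℝ (T.outward a) (x - x0) := by
          simp only [ConvexPolytope.gap, inner_sub_right] at h1 ⊢
          linarith
        rw [h3, PiLp.inner_apply]
        simp [mul_comm]
      rw [h2, Finset.sum_mul]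
      exact Finset.sum_congr rfl fun i _ => by ring
    · exact fun i _ => (integrable_mul_of_memLp (T.memLp_surface hsq.continuous a)
        (T.memLp_surface (hco i).continuous a)).const_mul _
  have e3 : ∑ i : Fin d, (∫ x, φ x * φ x ∂T.vol + ∫ x, 2 * φ x * pd i φ x * (x i - x0 i) ∂T.vol) =
      ∑ a, T.gap a x0 * l2 (T.surface a) φ ^ 2 := by
    rw [← e2]
    exact Finset.sum_congr rfl fun i _ => e1 i
  have e4 : γ * h * ∑ a, l2 (T.surface a) φ ^ 2 ≤ ∑ a, T.gap a x0 * l2 (T.surface a) φ ^ 2 := by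
    rw [Finset.mul_sum]
    exact Finset.sum_le_sum fun a _ => mul_le_mul_of_nonneg_right (hx0 a) (sq_nonneg _)
  have e5 : ∫ x, φ x * φ x ∂T.vol = l2 T.vol φ ^ 2 := by
    rw [l2_sq]; congr 1; ext x; ring
  have e6 : ∀ i, ∫ x, 2 * φ x * pd i φ x * (x i - x0 i) ∂T.vol ≤
      2 * h * l2 T.vol φ * l2 T.vol (pd i φ) := by
    intro i
    have hc := continuous_pd hφ i
    have h1 : ∫ x, 2 * φ x * pd i φ x * (x i - x0 i) ∂T.vol =
        2 * ∫ x, φ x * (pd i φ x * (x i - x0 i)) ∂T.vol := by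
      rw [← integral_const_mul]; congr 1; ext x; ring
    have h2 : l2 T.vol (fun x => pd i φ x * (x i - x0 i)) ≤ h * l2 T.vol (pd i φ) := by
      have h3 : h * l2 T.vol (pd i φ) = l2 T.vol (fun x => h * pd i φ x) := by
        rw [l2_const_mul, abs_of_pos hT.pos]
      rw [h3]
      apply l2_le_of_abs_le (hc.mul (hco i).continuous).aestronglyMeasurable
        (T.memLp_vol (continuous_const.mul hc))
      refine (ae_restrict_iff' T.isClosed_carrier.measurableSet).2
        (Eventually.of_forall fun x hx => ?_)
      change |pd i φ x * (x i - x0 i)| ≤ |h * pd i φ x|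
      rw [abs_mul, abs_mul, mul_comm, abs_of_pos hT.pos]
      refine mul_le_mul_of_nonneg_right ?_ (abs_nonneg _)
      have h4 : ‖(x - x0) i‖ ≤ ‖x - x0‖ := PiLp.norm_apply_le (x - x0) i
      rw [← dist_eq_norm] at h4
      exact h4.trans (hT.diam_le x hx x0 hx0T)
    have h5 : ∫ x, φ x * (pd i φ x * (x i - x0 i)) ∂T.vol ≤
        l2 T.vol φ * l2 T.vol (fun x => pd i φ x * (x i - x0 i)) :=
      (le_abs_self _).trans (abs_integral_mul_le (T.memLp_vol hφ.continuous)
        (T.memLp_vol (hc.mul (hco i).continuous)))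
    have h6 := mul_le_mul_of_nonneg_left h2 (l2_nonneg (μ := T.vol) (f := φ))
    rw [h1]
    have h7 := h5.trans h6
    linarith
  refine e4.trans ?_
  rw [← e3, Finset.sum_add_distrib, e5, Finset.sum_const, Finset.card_univ, Fintype.card_fin,
    nsmul_eq_mul, Finset.mul_sum]
  gcongr with i
  exact e6 i

/-- `φ r` are smooth and converge to `v` in `H¹(T)`, the limit of the gradients being `g`. -/
structure H1Approx (T : ConvexPolytope d) (v : E d → ℝ) (g : Fin d → E d → ℝ)
    (φ : ℕ → E d → ℝ) : Prop where
  smooth : ∀ r, ContDiff ℝ ∞ (φ r)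
  memv : MemLp v 2 T.vol
  memg : ∀ i, MemLp (g i) 2 T.vol
  tendv : Tendsto (fun r => l2 T.vol (fun x => φ r x - v x)) atTop (𝓝 0)
  tendg : ∀ i, Tendsto (fun r => l2 T.vol (fun x => pd i (φ r) x - g i x)) atTop (𝓝 0)

namespace H1Approx
variable {T : ConvexPolytope d} {v v' : E d → ℝ} {g g' : Fin d → E d → ℝ} {φ φ' : ℕ → E d → ℝ}

lemma smooth_one (H : H1Approx T v g φ) (r : ℕ) : ContDiff ℝ 1 (φ r) :=
  (H.smooth r).of_le (by exact_mod_cast le_top)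

lemma diff (H : H1Approx T v g φ) (r : ℕ) : Differentiable ℝ (φ r) :=
  (H.smooth_one r).differentiable one_ne_zero

lemma mem (H : H1Approx T v g φ) (r : ℕ) : MemLp (φ r) 2 T.vol :=
  T.memLp_vol (H.smooth r).continuous

lemma mem_pd (H : H1Approx T v g φ) (r : ℕ) (i : Fin d) : MemLp (pd i (φ r)) 2 T.vol :=
  T.memLp_vol (continuous_pd (H.smooth_one r) i)

lemma sub (H : H1Approx T v g φ) (H' : H1Approx T v' g' φ') :
    H1Approx T (fun x => v x - v' x) (fun i x => g i x - g' i x) (fun r x => φ r x - φ' r x) where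
  smooth r := (H.smooth r).sub (H'.smooth r)
  memv := memLp_sub H.memv H'.memv
  memg i := memLp_sub (H.memg i) (H'.memg i)
  tendv := by
    have h0 := H.tendv.add H'.tendv
    rw [add_zero] at h0
    refine squeeze_zero (fun _ => l2_nonneg) (fun r => ?_) h0
    have := l2_sub_le (memLp_sub (H.mem r) H.memv) (memLp_sub (H'.mem r) H'.memv)
    refine le_trans (le_of_eq ?_) this
    congr 1; ext x; ring
  tendg i := by
    have h0 := (H.tendg i).add (H'.tendg i)
    rw [add_zero] at h0
    refine squeeze_zero (fun _ => l2_nonneg) (fun r => ?_) h0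
    have := l2_sub_le (memLp_sub (H.mem_pd r i) (H.memg i))
      (memLp_sub (H'.mem_pd r i) (H'.memg i))
    refine le_trans (le_of_eq ?_) this
    congr 1; ext x
    rw [pd_sub (H.diff r) (H'.diff r)]
    ring

lemma congr (H : H1Approx T v g φ) (hv : v =ᵐ[T.vol] v') (hg : ∀ i, g i =ᵐ[T.vol] g' i) :
    H1Approx T v' g' φ where
  smooth := H.smooth
  memv := (memLp_congr_ae hv).1 H.memv
  memg i := (memLp_congr_ae (hg i)).1 (H.memg i)
  tendv := H.tendv.congr fun r => l2_congr (by filter_upwards [hv] with x hx; rw [hx])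
  tendg i := (H.tendg i).congr fun r => l2_congr (by filter_upwards [hg i] with x hx; rw [hx])

lemma of_contDiff (T : ConvexPolytope d) {f : E d → ℝ} (hf : ContDiff ℝ ∞ f) :
    H1Approx T f (fun i => pd i f) (fun _ => f) where
  smooth _ := hf
  memv := T.memLp_vol hf.continuous
  memg i := T.memLp_vol (contDiff_pd hf i).continuous
  tendv := by simp [l2]
  tendg i := by simp [l2]

lemma hasTrace (H : H1Approx T v g φ) {a : Fin T.numFacets} {t : E d → ℝ}
    (ht : MemLp t 2 (T.surface a))
    (h : Tendsto (fun r => l2 (T.surface a) (fun x => φ r x - t x)) atTop (𝓝 0)) :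
    T.HasTrace a v t := by
  refine ⟨ht, φ, H.smooth, tendstoL2_of_l2 H.mem H.memv H.tendv, fun i => ⟨g i, H.memg i, ?_⟩,
    tendstoL2_of_l2 (fun r => T.memLp_surface (H.smooth r).continuous a) ht h⟩
  simp_rw [partialD_one]
  exact tendstoL2_of_l2 (fun r => H.mem_pd r i) (H.memg i) (H.tendg i)

end H1Approx

namespace ConvexPolytope
variable {T : ConvexPolytope d} {v v' : E d → ℝ}

lemma HasTrace.exists_approx {a : Fin T.numFacets} {t : E d → ℝ} (h : T.HasTrace a v t)
    (hv : MemLp v 2 T.vol) : ∃ g φ, H1Approx T v g φ ∧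
      Tendsto (fun r => l2 (T.surface a) (fun x => φ r x - t x)) atTop (𝓝 0) := by
  obtain ⟨ht, φ, hs, h1, h2, h3⟩ := h
  choose g hg hg2 using h2
  have hs1 : ∀ r, ContDiff ℝ 1 (φ r) := fun r => (hs r).of_le (by exact_mod_cast le_top)
  refine ⟨g, φ, ⟨hs, hv, hg, h1.tendsto_l2 (fun r => T.memLp_vol (hs r).continuous) hv,
    fun i => ?_⟩, h3.tendsto_l2 (fun r => T.memLp_surface (hs r).continuous a) ht⟩
  have := hg2 i
  simp_rw [partialD_one] at this
  exact this.tendsto_l2 (fun r => T.memLp_vol (continuous_pd (hs1 r) i)) (hg i)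

open Classical in
lemma trace_congr (h : v =ᵐ[T.vol] v') (a : Fin T.numFacets) : T.trace a v = T.trace a v' := by
  have : ∀ v v' : E d → ℝ, v =ᵐ[T.vol] v' → ∀ t, T.HasTrace a v t → T.HasTrace a v' t := by
    rintro v v' h t ⟨ht, φ, hs, h1, h2⟩
    refine ⟨ht, φ, hs, ?_, h2⟩
    refine Tendsto.congr (fun r => ?_) h1
    apply eLpNorm_congr_ae
    filter_upwards [h] with x hx
    rw [hx]
  have h2 : T.HasTrace a v = T.HasTrace a v' := by
    ext t
    exact ⟨this v v' h t, this v' v h.symm t⟩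
  have h3 : ∀ P Q : (E d → ℝ) → Prop, P = Q →
      (if h : ∃ g, P g then h.choose else 0) = if h : ∃ g, Q g then h.choose else 0 := by
    rintro P _ rfl
    rfl
  exact h3 _ _ h2

end ConvexPolytope

namespace Fat
variable {T : ConvexPolytope d} {h γ : ℝ}

/-- A crude form with a constant depending on the element; it is needed only for the Cauchy property
of traces. -/
lemma trace_le_linear (hT : Fat T h γ) (hγ : 0 < γ) : ∃ K, 0 ≤ K ∧ ∀ φ : E d → ℝ,
    ContDiff ℝ 1 φ → ∀ a, l2 (T.surface a) φ ≤ K * (l2 T.vol φ + ∑ i, l2 T.vol (pd i φ)) := by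
  have hh := hT.pos
  refine ⟨Real.sqrt ((d + h) / (γ * h)), Real.sqrt_nonneg _, fun φ hφ a => ?_⟩
  have h1 := hT.trace_le hγ hφ
  have h2 : l2 (T.surface a) φ ^ 2 ≤ ∑ a, l2 (T.surface a) φ ^ 2 :=
    Finset.single_le_sum (f := fun a => l2 (T.surface a) φ ^ 2) (fun _ _ => sq_nonneg _)
      (Finset.mem_univ a)
  have hx : 0 ≤ l2 T.vol φ := l2_nonneg
  have hy : 0 ≤ ∑ i, l2 T.vol (pd i φ) := Finset.sum_nonneg fun _ _ => l2_nonneg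
  set x := l2 T.vol φ
  set y := ∑ i, l2 T.vol (pd i φ)
  apply le_of_sq_le_sq _ (by positivity)
  rw [mul_pow, Real.sq_sqrt (by positivity), div_mul_eq_mul_div, le_div_iff₀ (by positivity)]
  have hd : (0 : ℝ) ≤ d := Nat.cast_nonneg d
  have hxy : 0 ≤ x * y := mul_nonneg hx hy
  calc l2 (T.surface a) φ ^ 2 * (γ * h) ≤ γ * h * ∑ a, l2 (T.surface a) φ ^ 2 := by
        rw [mul_comm]; gcongr
    _ ≤ _ := h1
    _ ≤ (d + h) * (x + y) ^ 2 := by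
        nlinarith [mul_nonneg hd hxy, mul_nonneg hd (sq_nonneg y), mul_nonneg hh.le (sq_nonneg x),
          mul_nonneg hh.le (sq_nonneg y)]

/-- In the multiplicative trace inequality the gradient only has to stay bounded when the `L²` norms
tend to zero. This makes traces independent of the approximating sequence without knowing that the
limit gradients agree. -/
lemma tendsto_surface_zero (hT : Fat T h γ) (hγ : 0 < γ) {φ : ℕ → E d → ℝ}
    (hφ : ∀ r, ContDiff ℝ 1 (φ r)) (h0 : Tendsto (fun r => l2 T.vol (φ r)) atTop (𝓝 0))
    {c : ℝ} (hb : Tendsto (fun r => ∑ i, l2 T.vol (pd i (φ r))) atTop (𝓝 c))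
    (a : Fin T.numFacets) : Tendsto (fun r => l2 (T.surface a) (φ r)) atTop (𝓝 0) := by
  have hh := hT.pos
  have h1 : Tendsto (fun r => (γ * h)⁻¹ * (d * l2 T.vol (φ r) ^ 2 +
      2 * h * l2 T.vol (φ r) * ∑ i, l2 T.vol (pd i (φ r)))) atTop (𝓝 0) := by
    have := (((h0.pow 2).const_mul (d : ℝ)).add ((h0.const_mul (2 * h)).mul hb)).const_mul
      ((γ * h)⁻¹)
    simpa using this
  have h2 : Tendsto (fun r => l2 (T.surface a) (φ r) ^ 2) atTop (𝓝 0) := by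
    refine squeeze_zero (fun _ => sq_nonneg _) (fun r => ?_) h1
    have h3 : l2 (T.surface a) (φ r) ^ 2 ≤ ∑ a, l2 (T.surface a) (φ r) ^ 2 :=
      Finset.single_le_sum (f := fun a => l2 (T.surface a) (φ r) ^ 2) (fun _ _ => sq_nonneg _)
        (Finset.mem_univ a)
    rw [← div_eq_inv_mul, le_div_iff₀ (by positivity), mul_comm]
    exact (mul_le_mul_of_nonneg_left h3 (by positivity)).trans (hT.trace_le hγ (hφ r))
  have h3 := h2.sqrt
  simpa [Real.sqrt_sq l2_nonneg] using h3

end Fat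

namespace H1Approx
variable {T : ConvexPolytope d} {v v' : E d → ℝ} {g g' : Fin d → E d → ℝ} {φ φ' : ℕ → E d → ℝ}
  {h γ : ℝ}

/-- The traces of the approximations are Cauchy, so some trace exists. The trace that was chosen
comes with its own approximating sequence, and the difference of the two sequences has vanishing
traces. -/
lemma memLp_trace_and_tendsto (H : H1Approx T v g φ) (hT : Fat T h γ) (hγ : 0 < γ)
    (a : Fin T.numFacets) : MemLp (T.trace a v) 2 (T.surface a) ∧
      Tendsto (fun r => l2 (T.surface a) (fun x => φ r x - T.trace a v x)) atTop (𝓝 0) := by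
  obtain ⟨K, hK, hK2⟩ := hT.trace_le_linear hγ
  have hms : ∀ r, MemLp (φ r) 2 (T.surface a) := fun r => T.memLp_surface (H.smooth r).continuous a
  let s := fun r => l2 T.vol (fun x => φ r x - v x) + ∑ i, l2 T.vol (fun x => pd i (φ r) x - g i x)
  have hs : Tendsto s atTop (𝓝 0) := by
    have := H.tendv.add (tendsto_finsetSum Finset.univ fun i _ => H.tendg i)
    simpa using this
  have hsub : ∀ m n, l2 (T.surface a) (fun x => φ m x - φ n x) ≤ K * (s m + s n) := by
    intro m n
    refine (hK2 _ ((H.smooth_one m).sub (H.smooth_one n)) a).trans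
      (mul_le_mul_of_nonneg_left ?_ hK)
    have h1 : l2 T.vol (fun x => φ m x - φ n x) ≤
        l2 T.vol (fun x => φ m x - v x) + l2 T.vol (fun x => φ n x - v x) := by
      have := l2_sub_le (memLp_sub (H.mem m) H.memv) (memLp_sub (H.mem n) H.memv)
      simpa using this
    have h2 : ∀ i, l2 T.vol (pd i (fun x => φ m x - φ n x)) ≤
        l2 T.vol (fun x => pd i (φ m) x - g i x) + l2 T.vol (fun x => pd i (φ n) x - g i x) := by
      intro i
      have := l2_sub_le (memLp_sub (H.mem_pd m i) (H.memg i)) (memLp_sub (H.mem_pd n i) (H.memg i))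
      refine le_trans (le_of_eq ?_) this
      congr 1; ext x
      rw [pd_sub (H.diff m) (H.diff n)]
      ring
    have h3 := Finset.sum_le_sum fun i (_ : i ∈ Finset.univ) => h2 i
    rw [Finset.sum_add_distrib] at h3
    simp only [s]
    linarith
  obtain ⟨t, ht, htt⟩ := exists_l2_limit hms (fun ε hε => by
    have h1 : Tendsto (fun r => K * s r) atTop (𝓝 0) := by simpa using hs.const_mul K
    obtain ⟨N, hN⟩ := eventually_atTop.1 (h1.eventually (gt_mem_nhds (half_pos hε)))
    refine ⟨N, fun m hm n hn => (hsub m n).trans_lt ?_⟩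
    have := hN m hm
    have := hN n hn
    rw [mul_add]
    linarith)
  have hex : ∃ t, T.HasTrace a v t := ⟨t, H.hasTrace ht htt⟩
  have htr : T.HasTrace a v (T.trace a v) := by
    rw [ConvexPolytope.trace, dif_pos hex]
    exact hex.choose_spec
  refine ⟨htr.1, ?_⟩
  obtain ⟨g', ψ, H', hψ⟩ := htr.exists_approx H.memv
  have Hd := H.sub H'
  have h1 : Tendsto (fun r => l2 T.vol (fun x => φ r x - ψ r x)) atTop (𝓝 0) := by
    have := Hd.tendv
    simpa using this
  have h2 := tendsto_finsetSum (Finset.univ : Finset (Fin d)) fun i _ =>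
    tendsto_l2_norm (fun r => Hd.mem_pd r i) (Hd.memg i) (Hd.tendg i)
  have h3 := hT.tendsto_surface_zero hγ Hd.smooth_one h1 h2 a
  have h4 := h3.add hψ
  rw [add_zero] at h4
  refine squeeze_zero (fun _ => l2_nonneg) (fun r => ?_) h4
  have hψs := T.memLp_surface (H'.smooth r).continuous a
  have := l2_add_le (memLp_sub (hms r) hψs) (memLp_sub hψs htr.1)
  simpa using this

lemma memLp_trace (H : H1Approx T v g φ) (hT : Fat T h γ) (hγ : 0 < γ)
    (a : Fin T.numFacets) : MemLp (T.trace a v) 2 (T.surface a) :=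
  (H.memLp_trace_and_tendsto hT hγ a).1

lemma tendsto_trace (H : H1Approx T v g φ) (hT : Fat T h γ) (hγ : 0 < γ)
    (a : Fin T.numFacets) :
    Tendsto (fun r => l2 (T.surface a) (fun x => φ r x - T.trace a v x)) atTop (𝓝 0) :=
  (H.memLp_trace_and_tendsto hT hγ a).2

lemma trace_eq (H : H1Approx T v g φ) (hT : Fat T h γ) (hγ : 0 < γ) (a : Fin T.numFacets)
    {t : E d → ℝ} (ht : MemLp t 2 (T.surface a))
    (h : Tendsto (fun r => l2 (T.surface a) (fun x => φ r x - t x)) atTop (𝓝 0)) :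
    T.trace a v =ᵐ[T.surface a] t :=
  ae_eq_of_tendsto_l2 (fun r => T.memLp_surface (H.smooth r).continuous a)
    (H.memLp_trace hT hγ a) ht (H.tendsto_trace hT hγ a) h

lemma trace_sub (H : H1Approx T v g φ) (H' : H1Approx T v' g' φ') (hT : Fat T h γ) (hγ : 0 < γ)
    (a : Fin T.numFacets) : T.trace a (fun x => v x - v' x) =ᵐ[T.surface a]
      fun x => T.trace a v x - T.trace a v' x := by
  have m1 := H.memLp_trace hT hγ a
  have m2 := H'.memLp_trace hT hγ a
  refine (H.sub H').trace_eq hT hγ a (memLp_sub m1 m2) ?_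
  have h0 := (H.tendsto_trace hT hγ a).add (H'.tendsto_trace hT hγ a)
  rw [add_zero] at h0
  refine squeeze_zero (fun _ => l2_nonneg) (fun r => ?_) h0
  have := l2_sub_le (memLp_sub (T.memLp_surface (H.smooth r).continuous a) m1)
    (memLp_sub (T.memLp_surface (H'.smooth r).continuous a) m2)
  refine le_trans (le_of_eq ?_) this
  congr 1; ext x; ring

/-- Green's formula. -/
lemma green (H : H1Approx T v g φ) (hT : Fat T h γ) (hγ : 0 < γ) {q : E d → ℝ}
    (hq : ContDiff ℝ 1 q) (i : Fin d) :
    ∫ x, v x * pd i q x ∂T.vol + ∫ x, g i x * q x ∂T.vol =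
      ∑ a, T.outward a i * ∫ x, T.trace a v x * q x ∂(T.surface a) := by
  have h1 := (tendsto_integral_mul H.mem H.memv (T.memLp_vol (continuous_pd hq i)) H.tendv).add
    (tendsto_integral_mul (fun r => H.mem_pd r i) (H.memg i) (T.memLp_vol hq.continuous)
      (H.tendg i))
  have h2 := tendsto_finsetSum Finset.univ fun a (_ : a ∈ Finset.univ) =>
    (tendsto_integral_mul (fun r => T.memLp_surface (H.smooth r).continuous a)
      (H.memLp_trace hT hγ a) (T.memLp_surface hq.continuous a)
      (H.tendsto_trace hT hγ a)).const_mul (T.outward a i)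
  refine tendsto_nhds_unique h1 (h2.congr fun r => ?_)
  rw [T.integral_mul_pd (H.smooth_one r) hq i]

/-- The scaled trace inequality. -/
lemma trace_le (H : H1Approx T v g φ) (hT : Fat T h γ) (hγ : 0 < γ) :
    γ * h * ∑ a, l2 (T.surface a) (T.trace a v) ^ 2 ≤
      2 * d * l2 T.vol v ^ 2 + h ^ 2 * ∑ i, l2 T.vol (g i) ^ 2 := by
  have h1 := (tendsto_finsetSum Finset.univ fun a (_ : a ∈ Finset.univ) =>
    (tendsto_l2_norm (fun r => T.memLp_surface (H.smooth r).continuous a)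
      (H.memLp_trace hT hγ a) (H.tendsto_trace hT hγ a)).pow 2).const_mul (γ * h)
  have h2 := (((tendsto_l2_norm H.mem H.memv H.tendv).pow 2).const_mul (2 * d : ℝ)).add
    ((tendsto_finsetSum Finset.univ fun i (_ : i ∈ Finset.univ) =>
      (tendsto_l2_norm (fun r => H.mem_pd r i) (H.memg i) (H.tendg i)).pow 2).const_mul (h ^ 2))
  refine le_of_tendsto_of_tendsto' h1 h2 fun r => ?_
  refine (hT.trace_le hγ (H.smooth_one r)).trans ?_
  have h3 : ∀ i, 2 * h * l2 T.vol (φ r) * l2 T.vol (pd i (φ r)) ≤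
      l2 T.vol (φ r) ^ 2 + h ^ 2 * l2 T.vol (pd i (φ r)) ^ 2 := fun i => by
    nlinarith [sq_nonneg (l2 T.vol (φ r) - h * l2 T.vol (pd i (φ r)))]
  have h4 := Finset.sum_le_sum fun i (_ : i ∈ Finset.univ) => h3 i
  rw [Finset.sum_add_distrib, Finset.sum_const, Finset.card_univ, Fintype.card_fin,
    nsmul_eq_mul, ← Finset.mul_sum, ← Finset.mul_sum] at h4
  linarith

end H1Approx

lemma trace_of_contDiff {T : ConvexPolytope d} {h γ : ℝ} (hT : Fat T h γ) (hγ : 0 < γ)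
    {f : E d → ℝ} (hf : ContDiff ℝ ∞ f) (a : Fin T.numFacets) :
    T.trace a f =ᵐ[T.surface a] f :=
  (H1Approx.of_contDiff T hf).trace_eq hT hγ a (T.memLp_surface hf.continuous a) (by simp [l2])

end
end ConformingDG

/-! ### Taylor polynomials and the Bramble–Hilbert estimate -/

namespace ConformingDG
noncomputable section

variable {d : ℕ}

lemma iteratedFDeriv_diag (k : ℕ) (φ : E d → ℝ) (z v : E d) :
    iteratedFDeriv ℝ k φ z (fun _ => v) =
      ∑ s : Fin k → Fin d, (∏ r, v (s r)) * partialD s φ z := by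
  have hv : v = ∑ i, v i • EuclideanSpace.single i (1 : ℝ) := by
    have := (EuclideanSpace.basisFun (Fin d) ℝ).sum_repr v
    simpa using this.symm
  have h1 : iteratedFDeriv ℝ k φ z (fun _ => v) =
      iteratedFDeriv ℝ k φ z (fun _ => ∑ i, v i • EuclideanSpace.single i (1 : ℝ)) := by
    rw [← hv]
  rw [h1, ContinuousMultilinearMap.map_sum]
  refine Finset.sum_congr rfl fun s _ => ?_
  rw [ContinuousMultilinearMap.map_smul_univ (iteratedFDeriv ℝ k φ z) (fun r => v (s r))
    (fun r => EuclideanSpace.single (s r) (1 : ℝ)), smul_eq_mul, partialD]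

lemma contDiff_partialD {φ : E d → ℝ} (hφ : ContDiff ℝ ∞ φ) {m : ℕ} (s : Fin m → Fin d) :
    ContDiff ℝ ∞ (partialD s φ) := by
  have h1 : ContDiff ℝ ∞ (iteratedFDeriv ℝ m φ) := by
    apply hφ.iteratedFDeriv_right (m := ∞)
    exact le_of_eq rfl
  exact (ContinuousMultilinearMap.apply ℝ (fun _ : Fin m => E d) ℝ
    (fun r => EuclideanSpace.single (s r) (1 : ℝ))).contDiff.comp h1

/-- The sum of the squares of all derivatives of order `m`. -/
def derivSq (m : ℕ) (φ : E d → ℝ) (z : E d) : ℝ := ∑ s : Fin m → Fin d, partialD s φ z ^ 2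

lemma continuous_derivSq {φ : E d → ℝ} (hφ : ContDiff ℝ ∞ φ) (m : ℕ) :
    Continuous (derivSq m φ) :=
  continuous_finsetSum _ fun s _ => (contDiff_partialD hφ s).continuous.pow 2

lemma derivSq_nonneg (m : ℕ) (φ : E d → ℝ) (z : E d) : 0 ≤ derivSq m φ z :=
  Finset.sum_nonneg fun _ _ => sq_nonneg _

lemma sq_iteratedFDeriv_diag_le (k : ℕ) (φ : E d → ℝ) (z v : E d) :
    iteratedFDeriv ℝ k φ z (fun _ => v) ^ 2 ≤ d ^ k * ‖v‖ ^ (2 * k) * derivSq k φ z := by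
  rw [iteratedFDeriv_diag]
  have h := sq_sum_le_card_mul_sum_sq (s := (Finset.univ : Finset (Fin k → Fin d)))
    (f := fun s => (∏ r, v (s r)) * partialD s φ z)
  refine h.trans ?_
  rw [Finset.card_univ, Fintype.card_fun, Fintype.card_fin, Fintype.card_fin, derivSq, mul_assoc,
    Finset.mul_sum (a := ‖v‖ ^ (2 * k))]
  push_cast
  gcongr with s
  rw [mul_pow]
  gcongr
  rw [mul_comm 2 k, pow_mul, ← sq_abs, Finset.abs_prod]
  gcongr
  calc ∏ r, |v (s r)| ≤ ∏ _r : Fin k, ‖v‖ :=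
        Finset.prod_le_prod (fun _ _ => abs_nonneg _) fun r _ => PiLp.norm_apply_le v (s r)
    _ = ‖v‖ ^ k := by simp

/-- The Taylor polynomial of degree `m` at `y`. -/
def taylorPoly (m : ℕ) (φ : E d → ℝ) (y x : E d) : ℝ :=
  ∑ k ∈ Finset.range (m + 1), (k.factorial : ℝ)⁻¹ * iteratedFDeriv ℝ k φ y (fun _ => x - y)

lemma isPoly_taylorPoly (m : ℕ) (φ : E d → ℝ) (y : E d) : IsPoly m (taylorPoly m φ y) := by
  unfold taylorPoly
  refine IsPoly.sum _ fun k hk => IsPoly.const_mul ?_ _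
  simp_rw [iteratedFDeriv_diag]
  refine IsPoly.sum _ fun s _ => ?_
  have h1 := (IsPoly.prod (Finset.univ : Finset (Fin k)) (F := fun r (x : E d) => x (s r) - y (s r))
    (e := fun _ => 1) (fun r _ => (IsPoly.coord (s r)).sub (IsPoly.const _))).const_mul
    (partialD s φ y)
  have hk' : k ≤ m := by simpa [Nat.lt_succ_iff] using hk
  have h2 := h1.mono (n := m) (by simpa using hk')
  convert h2 using 2 with x
  rw [mul_comm]
  simp

/-- The integral form of the remainder, with the factor `(1 - t)^m / m!` bounded by 1, and Jensen's
inequality on `[0, 1]`. -/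
lemma sq_sub_taylorPoly_le (m : ℕ) {φ : E d → ℝ} (hφ : ContDiff ℝ ∞ φ) (x y : E d) :
    (φ x - taylorPoly m φ y x) ^ 2 ≤ d ^ (m + 1) * ‖x - y‖ ^ (2 * (m + 1)) *
      ∫ t in (0 : ℝ)..1, derivSq (m + 1) φ (y + t • (x - y)) := by
  have ht := map_add_eq_sum_add_integral_iteratedFDeriv (f := φ) (x := y) (y := x - y) (n := m)
    (fun t _ => (hφ.of_le (by exact_mod_cast le_top)).contDiffAt)
  simp only [add_sub_cancel, smul_eq_mul] at ht
  have hc : Continuous fun t : ℝ => iteratedFDeriv ℝ (m + 1) φ (y + t • (x - y)) (fun _ => x - y) := by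
    simp_rw [iteratedFDeriv_diag]
    refine continuous_finsetSum _ fun s _ => continuous_const.mul ?_
    exact (contDiff_partialD hφ s).continuous.comp (by fun_prop)
  set e := fun t : ℝ => iteratedFDeriv ℝ (m + 1) φ (y + t • (x - y)) (fun _ => x - y)
  set g := fun t : ℝ => (m.factorial : ℝ)⁻¹ * ((1 - t) ^ m * e t) with hg
  have hgc : Continuous g := by fun_prop
  set J := ∫ t in (0 : ℝ)..1, g t
  have hJ : φ x - taylorPoly m φ y x = J := by
    rw [ht, taylorPoly, add_sub_cancel_left]
    simp only [J, hg, intervalIntegral.integral_const_mul]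
    rfl
  -- The variance of `g` on the unit interval is nonnegative.
  have h1 : J ^ 2 ≤ ∫ t in (0 : ℝ)..1, g t ^ 2 := by
    have h2 : 0 ≤ ∫ t in (0 : ℝ)..1, (g t - J) ^ 2 :=
      intervalIntegral.integral_nonneg zero_le_one fun t _ => sq_nonneg _
    have h3 : ∫ t in (0 : ℝ)..1, (g t - J) ^ 2 =
        (∫ t in (0 : ℝ)..1, g t ^ 2) - 2 * J * J + J ^ 2 := by
      have h4 : ∀ t, (g t - J) ^ 2 = g t ^ 2 - 2 * J * g t + J ^ 2 := fun t => by ring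
      simp_rw [h4]
      rw [intervalIntegral.integral_add, intervalIntegral.integral_sub,
        intervalIntegral.integral_const_mul, intervalIntegral.integral_const]
      · simp [J]
      all_goals exact Continuous.intervalIntegrable (by fun_prop) _ _
    nlinarith
  rw [hJ]
  refine h1.trans ?_
  rw [← intervalIntegral.integral_const_mul]
  apply intervalIntegral.integral_mono_on zero_le_one
    (Continuous.intervalIntegrable (by fun_prop) _ _)
  · apply Continuous.intervalIntegrable
    exact continuous_const.mul ((continuous_derivSq hφ _).comp (by fun_prop))
  intro t ht
  refine le_trans ?_ (sq_iteratedFDeriv_diag_le (m + 1) φ (y + t • (x - y)) (x - y))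
  change g t ^ 2 ≤ e t ^ 2
  have h5 : |(m.factorial : ℝ)⁻¹ * (1 - t) ^ m| ≤ 1 := by
    rw [abs_mul, abs_pow, abs_inv, Nat.abs_cast]
    have h6 : |1 - t| ≤ 1 := abs_le.2 ⟨by linarith [ht.2], by linarith [ht.1]⟩
    have h7 : (m.factorial : ℝ)⁻¹ ≤ 1 :=
      inv_le_one_of_one_le₀ (by exact_mod_cast Nat.one_le_of_lt (Nat.factorial_pos m))
    exact mul_le_one₀ h7 (by positivity) (pow_le_one₀ (abs_nonneg _) h6)
  apply sq_le_sq.2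
  simp only [hg]
  rw [← mul_assoc, abs_mul]
  exact mul_le_of_le_one_left (abs_nonneg _) h5

/-- The Jacobian of the substitution is `r^(-d) ≤ 2^d`. -/
lemma lintegral_add_smul_le {q : E d → ENNReal} (hq : Measurable q) (w : E d) {r : ℝ}
    (hr : 1 / 2 ≤ r) : ∫⁻ y, q (w + r • y) ≤ 2 ^ d * ∫⁻ z, q z := by
  have hr0 : 0 < r := by linarith
  have h1 : ∫⁻ y, q (w + r • y) = ∫⁻ z, q (w + z) ∂(Measure.map (r • ·) (volume : Measure (E d))) :=
    (lintegral_map (hq.comp (measurable_const_add w)) (measurable_const_smul r)).symm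
  rw [h1, Measure.map_addHaar_smul _ hr0.ne', lintegral_smul_measure,
    lintegral_add_left_eq_self (fun z => q z) w, finrank_euclideanSpace_fin, smul_eq_mul]
  gcongr
  rw [abs_of_pos (by positivity), ← inv_pow]
  calc ENNReal.ofReal (r⁻¹ ^ d) ≤ ENNReal.ofReal (2 ^ d) := by
        apply ENNReal.ofReal_le_ofReal
        gcongr
        rw [inv_le_comm₀ hr0 two_pos]
        linarith
    _ = 2 ^ d := by
        rw [ENNReal.ofReal_pow zero_le_two]; simp

/-- Average over the base point `y` instead of fixing it. The point `(1 - t) y + t x` is integrated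
first in `y` when `t ≤ 1/2` and first in `x` when `t ≥ 1/2`, so the scaling factor is never below
`1/2` and no singular kernel appears. Some base point does no worse than the average. -/
lemma exists_segment_lintegral_le {S : Set (E d)} (hS0 : volume S ≠ 0)
    (hS1 : volume S ≠ ⊤) {q : E d → ENNReal} (hq : Measurable q) :
    ∃ y ∈ S, ∫⁻ x in S, ∫⁻ t in Set.Ioc (0 : ℝ) 1, q (y + t • (x - y)) ≤ 2 ^ d * ∫⁻ z, q z := by
  have hm3 : Measurable fun p : (E d × E d) × ℝ => q (p.1.1 + p.2 • (p.1.2 - p.1.1)) :=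
    hq.comp (by fun_prop)
  have hm1 : Measurable fun p : E d × E d => ∫⁻ t in Set.Ioc (0 : ℝ) 1, q (p.1 + t • (p.2 - p.1)) :=
    hm3.lintegral_prod_right'
  have hm0 : Measurable fun y : E d =>
      ∫⁻ x in S, ∫⁻ t in Set.Ioc (0 : ℝ) 1, q (y + t • (x - y)) := hm1.lintegral_prod_right'
  obtain ⟨y, hy, h⟩ := exists_le_setLAverage hS0 hS1 hm0.aemeasurable
  refine ⟨y, hy, h.trans ?_⟩
  rw [setLAverage_eq]
  apply ENNReal.div_le_of_le_mul
  have e1 : ∀ y : E d, ∫⁻ x in S, ∫⁻ t in Set.Ioc (0 : ℝ) 1, q (y + t • (x - y)) =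
      ∫⁻ t in Set.Ioc (0 : ℝ) 1, ∫⁻ x in S, q (y + t • (x - y)) := by
    intro y
    apply lintegral_lintegral_swap
    exact (hq.comp (by fun_prop : Measurable fun p : E d × ℝ => y + p.2 • (p.1 - y))).aemeasurable
  simp_rw [e1]
  rw [lintegral_lintegral_swap]
  swap
  · have : Measurable fun p : (E d × ℝ) × E d => q (p.1.1 + p.1.2 • (p.2 - p.1.1)) :=
      hq.comp (by fun_prop)
    exact (this.lintegral_prod_right').aemeasurable
  have e2 : ∀ t ∈ Set.Ioc (0 : ℝ) 1, ∫⁻ y in S, ∫⁻ x in S, q (y + t • (x - y)) ≤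
      2 ^ d * (∫⁻ z, q z) * volume S := by
    intro t ht
    rcases le_total t (1 / 2) with h2 | h2
    · rw [lintegral_lintegral_swap]
      swap
      · exact (hq.comp (by fun_prop :
          Measurable fun p : E d × E d => p.1 + t • (p.2 - p.1))).aemeasurable
      rw [← setLIntegral_const]
      refine lintegral_mono fun x => ?_
      refine (setLIntegral_le_lintegral _ _).trans ?_
      have e3 : ∀ y : E d, y + t • (x - y) = t • x + (1 - t) • y := fun y => by
        rw [smul_sub, sub_smul, one_smul]; abel
      simp_rw [e3]
      exact lintegral_add_smul_le hq _ (by linarith)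
    · rw [← setLIntegral_const]
      refine lintegral_mono fun y => ?_
      refine (setLIntegral_le_lintegral _ _).trans ?_
      have e3 : ∀ x : E d, y + t • (x - y) = (1 - t) • y + t • x := fun x => by
        rw [smul_sub, sub_smul, one_smul]; abel
      simp_rw [e3]
      exact lintegral_add_smul_le hq _ h2
  refine (setLIntegral_mono measurable_const e2).trans ?_
  simp

namespace ConvexPolytope
variable (T : ConvexPolytope d)

lemma volume_carrier_pos : 0 < volume T.carrier :=
  Measure.measure_pos_of_nonempty_interior _ T.interior_nonempty

/-- The Bramble–Hilbert lemma for smooth functions. -/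
lemma exists_taylorPoly_le (m : ℕ) {h : ℝ} (hT : ∀ x ∈ T.carrier, ∀ y ∈ T.carrier, dist x y ≤ h)
    {φ : E d → ℝ} (hφ : ContDiff ℝ ∞ φ) : ∃ p, IsPoly m p ∧
      l2 T.vol (fun x => φ x - p x) ^ 2 ≤ d ^ (m + 1) * 2 ^ d * h ^ (2 * (m + 1)) *
        ∑ s : Fin (m + 1) → Fin d, l2 T.vol (partialD s φ) ^ 2 := by
  have hmS := T.isClosed_carrier.measurableSet
  have hQ := continuous_derivSq hφ (m + 1)
  set Q := derivSq (m + 1) φ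
  have hQ0 : ∀ z, 0 ≤ Q z := derivSq_nonneg _ _
  obtain ⟨y, hy, hle⟩ := exists_segment_lintegral_le T.volume_carrier_pos.ne'
    T.isCompact_carrier.measure_lt_top.ne
    (q := T.carrier.indicator fun z => ENNReal.ofReal (Q z))
    ((ENNReal.measurable_ofReal.comp hQ.measurable).indicator hmS)
  have hh : 0 ≤ h := dist_nonneg.trans (hT y hy y hy)
  refine ⟨taylorPoly m φ y, isPoly_taylorPoly m φ y, ?_⟩
  have hpc := (isPoly_taylorPoly m φ y).continuous
  set c : ℝ := d ^ (m + 1) * h ^ (2 * (m + 1)) with hc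
  have hc0 : 0 ≤ c := by positivity
  have hQint : Integrable Q T.vol := hQ.continuousOn.integrableOn_compact T.isCompact_carrier
  have e1 : ∀ x ∈ T.carrier, ENNReal.ofReal ((φ x - taylorPoly m φ y x) ^ 2) ≤
      ENNReal.ofReal c * ∫⁻ t in Set.Ioc (0 : ℝ) 1,
        T.carrier.indicator (fun z => ENNReal.ofReal (Q z)) (y + t • (x - y)) := by
    intro x hx
    have h1 := sq_sub_taylorPoly_le m hφ x y
    have hQt : Continuous fun t : ℝ => Q (y + t • (x - y)) := hQ.comp (by fun_prop)
    have h2 : ENNReal.ofReal (∫ t in (0 : ℝ)..1, Q (y + t • (x - y))) = ∫⁻ t in Set.Ioc (0 : ℝ) 1,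
        T.carrier.indicator (fun z => ENNReal.ofReal (Q z)) (y + t • (x - y)) := by
      rw [intervalIntegral.integral_of_le zero_le_one, ofReal_integral_eq_lintegral_ofReal
        ((hQt.integrableOn_Icc (a := 0) (b := 1)).mono_set Set.Ioc_subset_Icc_self)
        (Eventually.of_forall fun t => hQ0 _)]
      apply setLIntegral_congr_fun measurableSet_Ioc
      intro t ht
      -- By convexity the segment stays in the element, so derivatives outside it never enter.
      have : y + t • (x - y) ∈ T.carrier := by
        have := T.convex_carrier.add_smul_sub_mem hy hx ⟨ht.1.le, ht.2⟩
        exact this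
      simp only [Set.indicator_of_mem this]
    rw [← h2, ← ENNReal.ofReal_mul hc0]
    apply ENNReal.ofReal_le_ofReal
    refine h1.trans ?_
    refine mul_le_mul_of_nonneg_right ?_
      (intervalIntegral.integral_nonneg zero_le_one fun t _ => hQ0 _)
    rw [hc]
    gcongr
    rw [← dist_eq_norm]
    exact hT x hx y hy
  have e2 : ENNReal.ofReal (l2 T.vol (fun x => φ x - taylorPoly m φ y x) ^ 2) ≤
      ENNReal.ofReal (c * 2 ^ d * ∫ z, Q z ∂T.vol) := by
    have hI2 : Integrable (fun x => (φ x - taylorPoly m φ y x) ^ 2) T.vol :=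
      (T.memLp_vol (hφ.continuous.sub hpc)).integrable_sq
    rw [l2_sq, ofReal_integral_eq_lintegral_ofReal
      hI2 (Eventually.of_forall fun _ => sq_nonneg _)]
    have h3 : ∫⁻ z, T.carrier.indicator (fun z => ENNReal.ofReal (Q z)) z =
        ENNReal.ofReal (∫ z, Q z ∂T.vol) := by
      rw [lintegral_indicator hmS, ofReal_integral_eq_lintegral_ofReal hQint
        (Eventually.of_forall hQ0)]
    rw [h3] at hle
    rw [mul_assoc, ENNReal.ofReal_mul hc0, ENNReal.ofReal_mul (p := 2 ^ d) (by positivity),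
      ENNReal.ofReal_pow zero_le_two, ENNReal.ofReal_ofNat]
    refine (setLIntegral_mono' hmS e1).trans ?_
    rw [lintegral_const_mul' _ _ ENNReal.ofReal_ne_top]
    gcongr
  have hI0 : 0 ≤ ∫ z, Q z ∂T.vol := integral_nonneg hQ0
  have e3 := (ENNReal.ofReal_le_ofReal_iff (by positivity)).1 e2
  have e4 : ∫ z, Q z ∂T.vol = ∑ s : Fin (m + 1) → Fin d, l2 T.vol (partialD s φ) ^ 2 := by
    simp_rw [l2_sq]
    exact integral_finsetSum _ fun s _ =>
      (T.memLp_vol (contDiff_partialD hφ s).continuous).integrable_sq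
  rw [← e4]
  refine e3.trans (le_of_eq ?_)
  rw [hc]
  ring

end ConvexPolytope

end
end ConformingDG

/-! ### Mollification and density of smooth functions on an element -/

namespace ConformingDG
noncomputable section

variable {d : ℕ}

lemma partialD_succ {m : ℕ} (s : Fin (m + 1) → Fin d) {φ : E d → ℝ} (hφ : ContDiff ℝ ∞ φ) :
    partialD s φ = pd (s 0) (partialD (Fin.tail s) φ) := by
  ext x
  have h : DifferentiableAt ℝ (iteratedFDeriv ℝ m φ) x :=
    hφ.differentiable_iteratedFDeriv (by exact_mod_cast ENat.natCast_lt_top m) x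
  exact h.iteratedFDeriv_succ_apply_left'

lemma partialD_snoc {m : ℕ} (s : Fin m → Fin d) (i : Fin d) (φ : E d → ℝ) :
    partialD (Fin.snoc s i : Fin (m + 1) → Fin d) φ = fun x =>
      iteratedFDeriv ℝ m (fun y => fderiv ℝ φ y) x (fun r => EuclideanSpace.single (s r) (1 : ℝ))
        (EuclideanSpace.single i 1) := by
  ext x
  simp only [partialD]
  rw [iteratedFDeriv_succ_apply_right]
  congr 2
  · ext r
    simp [Fin.init]
  · simp

/-- The innermost derivative occupies the last index, hence `Fin.snoc`, whereas `partialD_succ`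
splits off the outermost one at index 0. -/
lemma partialD_pd {m : ℕ} (s : Fin m → Fin d) (i : Fin d) {φ : E d → ℝ} (hφ : ContDiff ℝ ∞ φ) :
    partialD s (pd i φ) = partialD (Fin.snoc s i : Fin (m + 1) → Fin d) φ := by
  rw [partialD_snoc]
  ext x
  have h1 : ContDiffAt ℝ m (fderiv ℝ φ) x :=
    ((hφ.fderiv_right (m := ∞) le_rfl).of_le (by exact_mod_cast le_top)).contDiffAt
  have h2 := (ContinuousLinearMap.apply ℝ ℝ (EuclideanSpace.single i (1 : ℝ))
    ).iteratedFDeriv_comp_left h1 (i := m) le_rfl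
  have h3 : pd i φ = (ContinuousLinearMap.apply ℝ ℝ (EuclideanSpace.single i (1 : ℝ))) ∘
      fderiv ℝ φ := by
    ext y; simp [pd]
  rw [partialD, h3, h2]
  rfl

lemma partialD_zero (s : Fin 0 → Fin d) (φ : E d → ℝ) : partialD s φ = φ := by
  ext x; simp [partialD]

lemma partialD_comp_add_smul {m : ℕ} (s : Fin m → Fin d) {φ : E d → ℝ} (hφ : ContDiff ℝ ∞ φ)
    (y : E d) (r : ℝ) (x : E d) :
    partialD s (fun x => φ (y + r • x)) x = r ^ m * partialD s φ (y + r • x) := by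
  have hc : ContDiff ℝ ∞ fun x => φ (y + r • x) := hφ.comp (by fun_prop)
  induction m generalizing x with
  | zero => simp [partialD_zero]
  | succ m ih =>
    rw [partialD_succ s hc, partialD_succ s hφ, funext (ih (Fin.tail s))]
    have hD : ContDiff ℝ ∞ (partialD (Fin.tail s) φ) := contDiff_partialD hφ _
    have hd : Differentiable ℝ (partialD (Fin.tail s) φ) := hD.differentiable (by simp)
    have hd2 : Differentiable ℝ fun x => partialD (Fin.tail s) φ (y + r • x) :=
      hd.comp (by fun_prop)
    rw [pd_const_mul hd2, pd_comp_add_smul hd]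
    ring

lemma hasCompactSupport_pd {φ : E d → ℝ} (h : HasCompactSupport φ) (i : Fin d) :
    HasCompactSupport (pd i φ) := h.fderiv_apply ℝ _

lemma hasCompactSupport_partialD {m : ℕ} (s : Fin m → Fin d) {φ : E d → ℝ}
    (hφ : ContDiff ℝ ∞ φ) (h : HasCompactSupport φ) : HasCompactSupport (partialD s φ) := by
  induction m with
  | zero => rwa [partialD_zero]
  | succ m ih =>
    rw [partialD_succ s hφ]
    exact hasCompactSupport_pd (ih _) _

/-- The convolution of `W` with `η`. -/
def mollify (η W : E d → ℝ) (z : E d) : ℝ := ∫ y, W y * η (z - y)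

lemma mollify_eq_convolution (η W : E d → ℝ) :
    mollify η W = MeasureTheory.convolution W η (ContinuousLinearMap.mul ℝ ℝ) volume := rfl

lemma contDiff_mollify {η W : E d → ℝ} (hη : ContDiff ℝ ∞ η) (hη2 : HasCompactSupport η)
    (hW : LocallyIntegrable W) : ContDiff ℝ ∞ (mollify η W) := by
  rw [mollify_eq_convolution]
  exact hη2.contDiff_convolution_right _ hW hη

lemma pd_mollify {η W : E d → ℝ} (hη : ContDiff ℝ ∞ η) (hη2 : HasCompactSupport η)
    (hW : LocallyIntegrable W) (i : Fin d) : pd i (mollify η W) = mollify (pd i η) W := by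
  have hη1 : ContDiff ℝ 1 η := hη.of_le (by exact_mod_cast le_top)
  ext z
  rw [pd, mollify_eq_convolution,
    (hη2.hasFDerivAt_convolution_right (ContinuousLinearMap.mul ℝ ℝ) hW hη1 z).fderiv,
    convolution_precompR_apply _ hW (hη2.fderiv ℝ) (hη1.continuous_fderiv one_ne_zero)]
  rfl

lemma partialD_mollify {m : ℕ} (s : Fin m → Fin d) {η W : E d → ℝ} (hη : ContDiff ℝ ∞ η)
    (hη2 : HasCompactSupport η) (hW : LocallyIntegrable W) :
    partialD s (mollify η W) = mollify (partialD s η) W := by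
  induction m with
  | zero => rw [partialD_zero, partialD_zero]
  | succ m ih =>
    rw [partialD_succ s (contDiff_mollify hη hη2 hW), ih, partialD_succ s hη,
      pd_mollify (contDiff_partialD hη _) (hasCompactSupport_partialD _ hη hη2) hW]

/-- The reflected kernel `y ↦ η (z - y)` is a test function in `Ω`, and the sign its derivatives
pick up from the reflection cancels the sign in the definition of the weak derivative. -/
lemma mollify_weakDeriv {Ω : Set (E d)} (hΩ : MeasurableSet Ω) {m : ℕ} {s : Fin m → Fin d}
    {u g η : E d → ℝ} (h : HasWeakDeriv Ω s u g) (hη : ContDiff ℝ ∞ η) {ε : ℝ}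
    (hηs : Function.support η ⊆ Metric.closedBall 0 ε) {z : E d}
    (hz : Metric.closedBall z ε ⊆ Ω) :
    mollify (partialD s η) (Ω.indicator u) z = mollify η (Ω.indicator g) z := by
  have hψs : tsupport (fun y => η (z + (-1 : ℝ) • y)) ⊆ Metric.closedBall z ε := by
    apply closure_minimal _ Metric.isClosed_closedBall
    intro y hy
    have h1 := hηs (show z + (-1 : ℝ) • y ∈ Function.support η from hy)
    rw [mem_closedBall_zero_iff] at h1
    rw [mem_closedBall_iff_norm, ← norm_neg]
    convert h1 using 2
    simp; abel
  have hψ : IsTestFunction Ω (fun y => η (z + (-1 : ℝ) • y)) :=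
    ⟨hη.comp (by fun_prop), (isCompact_closedBall z ε).of_isClosed_subset (isClosed_tsupport _) hψs,
      hψs.trans hz⟩
  have h1 := h.2 _ hψ
  have hz1 : ∀ y : E d, z + (-1 : ℝ) • y = z - y := fun y => by simp [sub_eq_add_neg]
  have e : ∀ (v θ : E d → ℝ), mollify θ (Ω.indicator v) z = ∫ y in Ω, v y * θ (z - y) := by
    intro v θ
    rw [mollify, ← integral_indicator hΩ]
    congr 1
    ext y
    by_cases hy : y ∈ Ω <;> simp [hy]
  rw [e, e]
  simp_rw [partialD_comp_add_smul s hη, hz1] at h1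
  have h2 : ∀ y, u y * ((-1) ^ m * partialD s η (z - y)) =
      (-1) ^ m * (u y * partialD s η (z - y)) := fun y => by ring
  simp_rw [h2] at h1
  rw [integral_const_mul] at h1
  exact mul_left_cancel₀ (pow_ne_zero _ (by norm_num)) h1

section
variable {η : E d → ℝ}

lemma memLp_bump (hη : Continuous η) (hη2 : HasCompactSupport η) (z : E d) :
    MemLp (fun y => η (z - y)) 2 volume := by
  have h1 : HasCompactSupport fun y => η (z - y) := by
    have := hη2.comp_homeomorph (Homeomorph.subLeft z)
    exact this
  exact (hη.comp (by fun_prop)).memLp_of_hasCompactSupport h1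

lemma integral_bump (hη1 : ∫ x, η x = 1) (z : E d) : ∫ y, η (z - y) = 1 := by
  rw [integral_sub_left_eq_self (fun y => η y) volume z, hη1]

/-- Jensen's inequality for the probability density `η (z - ·)`. -/
lemma mollify_sq_le (hη : Continuous η) (hη2 : HasCompactSupport η) (hη0 : ∀ x, 0 ≤ η x)
    (hη1 : ∫ x, η x = 1) {W : E d → ℝ} (hW : MemLp W 2 volume) (z : E d) :
    ENNReal.ofReal (mollify η W z ^ 2) ≤
      ∫⁻ y, ENNReal.ofReal (W y ^ 2) * ENNReal.ofReal (η (z - y)) := by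
  obtain ⟨K, hK⟩ := hη2.exists_bound_of_continuous hη
  have hm : AEStronglyMeasurable (fun y => η (z - y)) :=
    (hη.comp (by fun_prop : Continuous fun y => z - y)).aestronglyMeasurable
  have hi1 : Integrable fun y => W y ^ 2 * η (z - y) :=
    hW.integrable_sq.mul_bdd (c := K) hm (Eventually.of_forall fun y => hK _)
  have hi2 : Integrable fun y => W y * η (z - y) :=
    integrable_mul_of_memLp hW (memLp_bump hη hη2 z)
  have hi3 : Integrable fun y => η (z - y) := by
    apply Integrable.comp_sub_left
    exact hη.integrable_of_hasCompactSupport hη2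
  set M := mollify η W z with hM
  have h0 : 0 ≤ ∫ y, (W y - M) ^ 2 * η (z - y) :=
    integral_nonneg fun y => mul_nonneg (sq_nonneg _) (hη0 _)
  have h1 : ∫ y, (W y - M) ^ 2 * η (z - y) = (∫ y, W y ^ 2 * η (z - y)) - 2 * M * M + M ^ 2 := by
    have h2 : ∀ y, (W y - M) ^ 2 * η (z - y) =
        W y ^ 2 * η (z - y) - 2 * M * (W y * η (z - y)) + M ^ 2 * η (z - y) := fun y => by ring
    simp_rw [h2]
    have hi4 : Integrable fun y => W y ^ 2 * η (z - y) - 2 * M * (W y * η (z - y)) :=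
      hi1.sub (hi2.const_mul _)
    rw [integral_add hi4 (hi3.const_mul _), integral_sub hi1 (hi2.const_mul _), integral_const_mul, integral_const_mul,
      integral_bump hη1, mul_one]
    rfl
  have h3 : M ^ 2 ≤ ∫ y, W y ^ 2 * η (z - y) := by nlinarith
  refine (ENNReal.ofReal_le_ofReal h3).trans (le_of_eq ?_)
  rw [ofReal_integral_eq_lintegral_ofReal hi1
    (Eventually.of_forall fun y => mul_nonneg (sq_nonneg _) (hη0 _))]
  congr 1
  ext y
  rw [ENNReal.ofReal_mul (sq_nonneg _)]

/-- Jensen, then Tonelli; composing with a dilation of factor at least `1/2` costs at most `2^d`.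
The bound is uniform in the kernel, which reduces convergence to continuous functions. -/
lemma l2_mollify_sq_le (T : ConvexPolytope d) (hη : ContDiff ℝ ∞ η) (hη2 : HasCompactSupport η)
    (hη0 : ∀ x, 0 ≤ η x) (hη1 : ∫ x, η x = 1) {W : E d → ℝ} (hW : MemLp W 2 volume)
    (y0 : E d) {r : ℝ} (hr : 1 / 2 ≤ r) :
    l2 T.vol (fun x => mollify η W (y0 + r • x)) ^ 2 ≤ 2 ^ d * l2 volume W ^ 2 := by
  have hWl : LocallyIntegrable W := hW.locallyIntegrable (by norm_num)
  have hc : Continuous fun x => mollify η W (y0 + r • x) :=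
    (contDiff_mollify hη hη2 hWl).continuous.comp (by fun_prop)
  have hI : Integrable (fun x => mollify η W (y0 + r • x) ^ 2) T.vol := (T.memLp_vol hc).integrable_sq
  rw [← ENNReal.ofReal_le_ofReal_iff (by positivity), l2_sq,
    ofReal_integral_eq_lintegral_ofReal hI (Eventually.of_forall fun _ => sq_nonneg _)]
  have hWm : AEMeasurable (fun y => ENNReal.ofReal (W y ^ 2)) :=
    (hW.aestronglyMeasurable.aemeasurable.pow_const 2).ennreal_ofReal
  calc ∫⁻ x in T.carrier, ENNReal.ofReal (mollify η W (y0 + r • x) ^ 2)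
      ≤ ∫⁻ x, ∫⁻ y, ENNReal.ofReal (W y ^ 2) * ENNReal.ofReal (η (y0 + r • x - y)) :=
        (setLIntegral_le_lintegral _ _).trans
          (lintegral_mono fun x => mollify_sq_le hη.continuous hη2 hη0 hη1 hW _)
    _ = ∫⁻ y, ∫⁻ x, ENNReal.ofReal (W y ^ 2) * ENNReal.ofReal (η (y0 + r • x - y)) := by
        apply lintegral_lintegral_swap
        have h1 : AEMeasurable (fun p : E d × E d => ENNReal.ofReal (W p.2 ^ 2))
          (volume.prod volume) := hWm.comp_snd
        have h2 : Measurable fun p : E d × E d => ENNReal.ofReal (η (y0 + r • p.1 - p.2)) :=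
          (hη.continuous.measurable.comp (by fun_prop)).ennreal_ofReal
        exact h1.mul h2.aemeasurable
    _ ≤ ∫⁻ y, ENNReal.ofReal (W y ^ 2) * 2 ^ d := by
        refine lintegral_mono fun y => ?_
        rw [lintegral_const_mul' _ _ ENNReal.ofReal_ne_top]
        gcongr
        have h1 := lintegral_add_smul_le (q := fun z => ENNReal.ofReal (η z))
          hη.continuous.measurable.ennreal_ofReal (y0 - y) hr
        have h2 : ∫⁻ z, ENNReal.ofReal (η z) = 1 := by
          rw [← ofReal_integral_eq_lintegral_ofReal
            (hη.continuous.integrable_of_hasCompactSupport hη2) (Eventually.of_forall hη0), hη1]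
          simp
        rw [h2, mul_one] at h1
        refine le_trans (le_of_eq ?_) h1
        congr 1
        ext x
        congr 2
        abel
    _ = ENNReal.ofReal (2 ^ d * l2 volume W ^ 2) := by
        rw [lintegral_mul_const'' _ hWm, l2_sq, ENNReal.ofReal_mul (by positivity),
          ENNReal.ofReal_pow zero_le_two, ENNReal.ofReal_ofNat, mul_comm,
          ofReal_integral_eq_lintegral_ofReal hW.integrable_sq
            (Eventually.of_forall fun _ => sq_nonneg _)]

lemma mollify_sub (hη : Continuous η) (hη2 : HasCompactSupport η) {V W : E d → ℝ}
    (hV : MemLp V 2 volume) (hW : MemLp W 2 volume) (z : E d) :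
    mollify η (fun y => V y - W y) z = mollify η V z - mollify η W z := by
  simp only [mollify, sub_mul]
  exact integral_sub (integrable_mul_of_memLp hV (memLp_bump hη hη2 z))
    (integrable_mul_of_memLp hW (memLp_bump hη hη2 z))

lemma abs_mollify_sub_le (hη : Continuous η) (hη2 : HasCompactSupport η) (hη0 : ∀ x, 0 ≤ η x)
    (hη1 : ∫ x, η x = 1) {ε : ℝ} (hηs : Function.support η ⊆ Metric.closedBall 0 ε) {g : E d → ℝ}
    (hg : MemLp g 2 volume) {z : E d} {c τ : ℝ}
    (h : ∀ y ∈ Metric.closedBall z ε, |g y - c| ≤ τ) : |mollify η g z - c| ≤ τ := by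
  have hi3 : Integrable fun y => η (z - y) :=
    (hη.integrable_of_hasCompactSupport hη2).comp_sub_left z
  have hi2 : Integrable fun y => g y * η (z - y) :=
    integrable_mul_of_memLp hg (memLp_bump hη hη2 z)
  have h1 : mollify η g z - c = ∫ y, (g y * η (z - y) - c * η (z - y)) := by
    rw [integral_sub hi2 (hi3.const_mul c), integral_const_mul, integral_bump hη1, mul_one, mollify]
  have h2 : ∫ y, τ * η (z - y) = τ := by
    rw [integral_const_mul, integral_bump hη1, mul_one]
  rw [h1, ← h2, ← Real.norm_eq_abs]
  refine norm_integral_le_of_norm_le (hi3.const_mul τ) (Eventually.of_forall fun y => ?_)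
  rw [← sub_mul, norm_mul, Real.norm_of_nonneg (hη0 _)]
  by_cases hy : η (z - y) = 0
  · rw [hy, mul_zero, mul_zero]
  · refine mul_le_mul_of_nonneg_right (h y ?_) (hη0 _)
    have := hηs hy
    rw [mem_closedBall_zero_iff] at this
    rwa [mem_closedBall_iff_norm, norm_sub_rev]

end

lemma exists_continuous_l2_sub_le {W : E d → ℝ} (hW : MemLp W 2 volume) {ε : ℝ} (hε : 0 < ε) :
    ∃ g : E d → ℝ, Continuous g ∧ HasCompactSupport g ∧ MemLp g 2 volume ∧
      l2 volume (fun x => W x - g x) ≤ ε := by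
  obtain ⟨g, hg1, hg2, hg3, hg4⟩ := hW.exists_hasCompactSupport_eLpNorm_sub_le (by norm_num)
    (ε := ENNReal.ofReal ε) (by simpa using hε)
  refine ⟨g, hg3, hg1, hg4, ?_⟩
  rw [l2_eq_toReal (memLp_sub hW hg4)]
  exact ENNReal.toReal_le_of_le_ofReal hε.le hg2

/-- Mollification composed with slight contractions is an approximate identity in `L²(T)`. -/
lemma tendsto_l2_mollify (T : ConvexPolytope d) {η : ℕ → E d → ℝ} {ε κ r : ℕ → ℝ} {y0 : ℕ → E d}
    (hη : ∀ n, ContDiff ℝ ∞ (η n)) (hη2 : ∀ n, HasCompactSupport (η n)) (hη0 : ∀ n x, 0 ≤ η n x)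
    (hη1 : ∀ n, ∫ x, η n x = 1) (hηs : ∀ n, Function.support (η n) ⊆ Metric.closedBall 0 (ε n))
    (hr : ∀ n, 1 / 2 ≤ r n) (hd : ∀ n, ∀ x ∈ T.carrier, dist (y0 n + r n • x) x ≤ κ n)
    (hε : Tendsto ε atTop (𝓝 0)) (hκ : Tendsto κ atTop (𝓝 0)) {W : E d → ℝ}
    (hW : MemLp W 2 volume) :
    Tendsto (fun n => l2 T.vol (fun x => mollify (η n) W (y0 n + r n • x) - W x)) atTop (𝓝 0) := by
  have hWT : MemLp W 2 T.vol := hW.restrict _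
  have hcont : ∀ {V : E d → ℝ}, MemLp V 2 volume → ∀ n,
      Continuous fun x => mollify (η n) V (y0 n + r n • x) := fun hV n =>
    (contDiff_mollify (hη n) (hη2 n) (hV.locallyIntegrable (by norm_num))).continuous.comp
      (by fun_prop)
  rw [Metric.tendsto_atTop]
  intro e he
  -- A three-term argument with a continuous compactly supported `g` near `W`: `b` bounds the
  -- mollification followed by the dilation as an operator, and `c` is the norm of the constant 1,
  -- which turns uniform closeness into `L²` closeness.
  set c := Real.sqrt (volume.real T.carrier) with hc
  have hc0 : 0 ≤ c := Real.sqrt_nonneg _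
  set b := Real.sqrt (2 ^ d) with hb
  have hb0 : 0 ≤ b := Real.sqrt_nonneg _
  set ε' := e / (4 * (b + 1)) with hε'
  have hε'0 : 0 < ε' := by positivity
  obtain ⟨g, hg1, hg2, hg3, hg4⟩ := exists_continuous_l2_sub_le hW hε'0
  set τ := e / (4 * (c + 1)) with hτ
  have hτ0 : 0 < τ := by positivity
  obtain ⟨ρ, hρ, hρ2⟩ := Metric.uniformContinuous_iff.1
    (hg2.uniformContinuous_of_continuous hg1) τ hτ0
  have hsum : Tendsto (fun n => ε n + κ n) atTop (𝓝 0) := by simpa using hε.add hκ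
  obtain ⟨N, hN⟩ := eventually_atTop.1 (hsum.eventually (gt_mem_nhds hρ))
  refine ⟨N, fun n hn => ?_⟩
  rw [Real.dist_eq, sub_zero, abs_of_nonneg l2_nonneg]
  have hgT : MemLp g 2 T.vol := T.memLp_vol hg1
  have m1 := T.memLp_vol (hcont hW n)
  have m2 := T.memLp_vol (hcont hg3 n)
  have e1 : l2 T.vol (fun x => mollify (η n) W (y0 n + r n • x) - mollify (η n) g (y0 n + r n • x))
      ≤ b * ε' := by
    have h1 := l2_mollify_sq_le T (hη n) (hη2 n) (hη0 n) (hη1 n) (memLp_sub hW hg3) (y0 n) (hr n)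
    simp_rw [mollify_sub (hη n).continuous (hη2 n) hW hg3] at h1
    apply le_of_sq_le_sq _ (by positivity)
    rw [mul_pow, hb, Real.sq_sqrt (by positivity)]
    refine h1.trans ?_
    gcongr
    exact l2_nonneg
  have e2 : l2 T.vol (fun x => mollify (η n) g (y0 n + r n • x) - g x) ≤ τ * c := by
    have h1 : τ * c = l2 T.vol (fun _ => τ) := by
      rw [l2, integral_const, measureReal_restrict_apply_univ, smul_eq_mul, mul_comm,
        Real.sqrt_mul (by positivity), Real.sqrt_sq hτ0.le, hc]
    rw [h1]
    apply l2_le_of_abs_le ((hcont hg3 n).sub hg1).aestronglyMeasurable (T.memLp_vol continuous_const)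
    refine (ae_restrict_iff' T.isClosed_carrier.measurableSet).2
      (Eventually.of_forall fun x hx => ?_)
    rw [abs_of_pos hτ0]
    apply abs_mollify_sub_le (hη n).continuous (hη2 n) (hη0 n) (hη1 n) (hηs n) hg3
    intro y hy
    have h2 : dist y x < ρ := by
      have h3 := hN n hn
      have h4 := hd n x hx
      have h5 : dist y (y0 n + r n • x) ≤ ε n := hy
      have := dist_triangle y (y0 n + r n • x) x
      linarith
    have := hρ2 h2
    rw [Real.dist_eq] at this
    exact this.le
  have e3 : l2 T.vol (fun x => g x - W x) ≤ ε' := by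
    rw [l2_sub_comm]
    refine le_trans ?_ hg4
    have := l2_mono_set (μ := volume) (Set.subset_univ T.carrier) (f := fun x => W x - g x)
      (by rw [Measure.restrict_univ]; exact memLp_sub hW hg3)
    rwa [Measure.restrict_univ] at this
  have e4 := l2_add_le (memLp_sub m1 m2) (memLp_sub m2 hgT)
  simp only [sub_add_sub_cancel] at e4
  have e5 := l2_add_le (memLp_sub m1 hgT) (memLp_sub hgT hWT)
  simp only [sub_add_sub_cancel] at e5
  have e6 : (b + 1) * ε' = e / 4 := by rw [hε']; field_simp
  have e7 : τ * c ≤ e / 4 := by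
    have : τ * (c + 1) = e / 4 := by rw [hτ]; field_simp
    nlinarith
  linarith

/-- A function with weak derivatives in `Ω` is approximated on a cell by smooth functions together
with all its derivatives. -/
lemma exists_smooth_approx {Ω : Set (E d)} (hΩ : MeasurableSet Ω) {T : ConvexPolytope d} {h γ : ℝ}
    (hT : Fat T h γ) (hγ : 0 < γ) (hTΩ : interior T.carrier ⊆ Ω) {M : ℕ} {u : E d → ℝ}
    {g : ∀ m : ℕ, (Fin m → Fin d) → E d → ℝ}
    (hg : ∀ m ≤ M, ∀ s : Fin m → Fin d, HasWeakDeriv Ω s u (g m s)) (hu : MemLp u 2 (volume.restrict Ω)) :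
    ∃ φ : ℕ → E d → ℝ, (∀ n, ContDiff ℝ ∞ (φ n)) ∧
      ∀ m ≤ M, ∀ s : Fin m → Fin d,
        Tendsto (fun n => l2 T.vol (fun x => partialD s (φ n) x - g m s x)) atTop (𝓝 0) := by
  obtain ⟨x0, hx0⟩ := hT.center
  have hx0T := hT.mem_of_gap hγ hx0
  have hh := hT.pos
  -- The summand 2 keeps `δ n ≤ 1/2`, so the dilation factor `1 - δ n` is at least `1/2`.
  let δ : ℕ → ℝ := fun n => 1 / ((n : ℝ) + 2)
  have hδ0 : ∀ n, 0 < δ n := fun n => by positivity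
  have hδ1 : ∀ n, δ n ≤ 1 / 2 := fun n => by
    apply one_div_le_one_div_of_le two_pos
    have : (0 : ℝ) ≤ n := Nat.cast_nonneg n
    linarith
  have hδt : Tendsto δ atTop (𝓝 0) := by
    have := tendsto_one_div_add_atTop_nhds_zero_nat (𝕜 := ℝ)
    have h2 := (tendsto_add_atTop_iff_nat 1).2 this
    refine h2.congr fun n => ?_
    simp only [δ]
    push_cast
    congr 1
    ring
  -- Contracting the element towards `x₀` by the factor `1 - δ n` leaves gaps of at least `δ n γ h`.
  -- Balls of half that radius stay in the interior, so mollification there sees only `Ω`.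
  let ε : ℕ → ℝ := fun n => δ n * (γ * h) / 2
  have hε0 : ∀ n, 0 < ε n := fun n => by have := hδ0 n; positivity
  let bump : ∀ n, ContDiffBump (0 : E d) := fun n =>
    ⟨ε n / 2, ε n, by have := hε0 n; positivity, by have := hε0 n; linarith⟩
  let η : ℕ → E d → ℝ := fun n => (bump n).normed volume
  have hη : ∀ n, ContDiff ℝ ∞ (η n) := fun n => (bump n).contDiff_normed
  have hη2 : ∀ n, HasCompactSupport (η n) := fun n => (bump n).hasCompactSupport_normed
  have hη0 : ∀ n x, 0 ≤ η n x := fun n x => (bump n).nonneg_normed x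
  have hη1 : ∀ n, ∫ x, η n x = 1 := fun n => (bump n).integral_normed
  have hηs : ∀ n, Function.support (η n) ⊆ Metric.closedBall 0 (ε n) := fun n => by
    rw [(bump n).support_normed_eq]
    exact Metric.ball_subset_closedBall
  let r : ℕ → ℝ := fun n => 1 - δ n
  have hr : ∀ n, 1 / 2 ≤ r n := fun n => by have := hδ1 n; simp only [r]; linarith
  let y0 : ℕ → E d := fun n => δ n • x0
  have hA : ∀ n x, y0 n + r n • x - x = δ n • (x0 - x) := fun n x => by
    simp only [y0, r, sub_smul, one_smul, smul_sub]
    abel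
  have hd : ∀ n, ∀ x ∈ T.carrier, dist (y0 n + r n • x) x ≤ δ n * h := fun n x hx => by
    rw [dist_eq_norm, hA, norm_smul, Real.norm_of_nonneg (hδ0 n).le, ← dist_eq_norm]
    exact mul_le_mul_of_nonneg_left (hT.diam_le x0 hx0T x hx) (hδ0 n).le
  have hball : ∀ n, ∀ x ∈ T.carrier, Metric.closedBall (y0 n + r n • x) (ε n) ⊆ Ω := by
    intro n x hx y hy
    apply hTΩ
    rw [T.interior_carrier]
    intro a
    have h1 := Fat.gap_ge_sub a y (y0 n + r n • x)
    have h2 : dist y (y0 n + r n • x) ≤ δ n * (γ * h) / 2 := hy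
    have h3 : T.gap a (y0 n + r n • x) = δ n * T.gap a x0 + r n * T.gap a x := by
      simp only [ConvexPolytope.gap, y0, r, inner_add_right, inner_smul_right]
      ring
    have h4 := mul_le_mul_of_nonneg_left (hx0 a) (hδ0 n).le
    have h5 : 0 ≤ r n * T.gap a x :=
      mul_nonneg (by have := hr n; linarith) (T.mem_carrier_iff.1 hx a)
    have h6 : 0 < δ n * (γ * h) := by have := hδ0 n; positivity
    linarith
  have hεt : Tendsto ε atTop (𝓝 0) := by
    have := (hδt.mul_const (γ * h)).div_const 2
    simpa using this
  have hκt : Tendsto (fun n => δ n * h) atTop (𝓝 0) := by simpa using hδt.mul_const h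
  set W := Ω.indicator u with hWdef
  have hW : MemLp W 2 volume := (memLp_indicator_iff_restrict hΩ).2 hu
  have hWl : LocallyIntegrable W := hW.locallyIntegrable (by norm_num)
  refine ⟨fun n x => mollify (η n) W (y0 n + r n • x), fun n =>
    (contDiff_mollify (hη n) (hη2 n) hWl).comp (by fun_prop), fun m hm s => ?_⟩
  have hgs : MemLp (Ω.indicator (g m s)) 2 volume :=
    (memLp_indicator_iff_restrict hΩ).2 (hg m hm s).1
  have hgsT : MemLp (Ω.indicator (g m s)) 2 T.vol := hgs.restrict _
  have hconv := tendsto_l2_mollify T hη hη2 hη0 hη1 hηs hr hd hεt hκt hgs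
  have hcm : ∀ n, MemLp (fun x => mollify (η n) (Ω.indicator (g m s)) (y0 n + r n • x)) 2 T.vol :=
    fun n => T.memLp_vol ((contDiff_mollify (hη n) (hη2 n)
      (hgs.locallyIntegrable (by norm_num))).continuous.comp (by fun_prop))
  have hae : ∀ᵐ x ∂T.vol, x ∈ T.carrier ∧ Ω.indicator (g m s) x = g m s x := by
    have h1 : ∀ᵐ x ∂T.vol, x ∈ T.carrier :=
      ae_restrict_mem T.isClosed_carrier.measurableSet
    have h2 : ∀ᵐ x ∂T.vol, x ∈ T.inner' := by
      have h3 : T.vol = volume.restrict T.inner' :=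
        Measure.restrict_congr_set T.inner'_ae_eq.symm
      rw [h3]
      exact ae_restrict_mem T.isOpen_inner'.measurableSet
    filter_upwards [h1, h2] with x hx1 hx2
    refine ⟨hx1, Set.indicator_of_mem (hTΩ ?_) _⟩
    rwa [T.interior_carrier]
  -- By the chain rule the contraction multiplies a derivative of order `m` by `r n ^ m`; the defect
  -- `1 - r n ^ m` tends to zero.
  have heq : ∀ n, l2 T.vol (fun x => partialD s (fun x => mollify (η n) W (y0 n + r n • x)) x -
      g m s x) ≤ l2 T.vol (fun x => mollify (η n) (Ω.indicator (g m s)) (y0 n + r n • x) -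
        Ω.indicator (g m s) x) + (1 - r n ^ m) * l2 T.vol
          (fun x => mollify (η n) (Ω.indicator (g m s)) (y0 n + r n • x)) := by
    intro n
    have hrm : 0 ≤ 1 - r n ^ m := by
      have h1 : r n ^ m ≤ 1 := pow_le_one₀ (by have := hr n; linarith)
        (by have := hδ0 n; simp only [r]; linarith)
      linarith
    have h2 := l2_sub_le (memLp_sub (hcm n) hgsT) ((hcm n).const_mul (1 - r n ^ m))
    rw [l2_const_mul, abs_of_nonneg hrm] at h2
    refine le_trans (le_of_eq (l2_congr ?_)) h2
    filter_upwards [hae] with x hx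
    rw [partialD_comp_add_smul s (contDiff_mollify (hη n) (hη2 n) hWl),
      partialD_mollify s (hη n) (hη2 n) hWl,
      mollify_weakDeriv hΩ (hg m hm s) (hη n) (hηs n) (hball n x hx.1), hx.2]
    ring
  have hlim : Tendsto (fun n => l2 T.vol (fun x => mollify (η n) (Ω.indicator (g m s))
      (y0 n + r n • x) - Ω.indicator (g m s) x) + (1 - r n ^ m) * l2 T.vol
          (fun x => mollify (η n) (Ω.indicator (g m s)) (y0 n + r n • x))) atTop (𝓝 0) := by
    have h1 : Tendsto (fun n => 1 - r n ^ m) atTop (𝓝 0) := by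
      have : Tendsto r atTop (𝓝 (1 - 0)) := hδt.const_sub 1
      have := (this.pow m).const_sub 1
      simpa using this
    have h2 := h1.mul (tendsto_l2_norm hcm hgsT hconv)
    have h3 := hconv.add h2
    simpa using h3
  exact squeeze_zero (fun _ => l2_nonneg) heq hlim

end
end ConformingDG

/-! ### Polynomial approximation in H¹ -/

namespace ConformingDG
noncomputable section

variable {d : ℕ}

namespace ConvexPolytope
variable (T : ConvexPolytope d)

/-- Riesz representation in the space of polynomials with the `L²(T)` inner product. -/
lemma exists_poly_riesz (m : ℕ) (ℓ : MvPolynomial (Fin d) ℝ →ₗ[ℝ] ℝ) :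
    ∃ g : MvPolynomial (Fin d) ℝ, g.totalDegree ≤ m ∧
      ∀ q : MvPolynomial (Fin d) ℝ, q.totalDegree ≤ m →
        ∫ x, pval g x * pval q x ∂T.vol = ℓ q := by
  obtain ⟨g, hg⟩ := exists_riesz (polyForm m T.isBounded)
    (polyForm_pos m T.isBounded T.interior_nonempty)
    (ℓ.comp (MvPolynomial.restrictTotalDegree (Fin d) ℝ m).subtype)
  refine ⟨g.1, (MvPolynomial.mem_restrictTotalDegree _ _ _).1 g.2, fun q hq => ?_⟩
  exact hg ⟨q, (MvPolynomial.mem_restrictTotalDegree _ _ _).2 hq⟩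

/-- The `L²(T)` projection onto polynomials. -/
lemma exists_poly_proj (m : ℕ) {v : E d → ℝ} (hv : MemLp v 2 T.vol) :
    ∃ p, IsPoly m p ∧ ∀ q, IsPoly m q →
      ∫ x, p x * q x ∂T.vol = ∫ x, v x * q x ∂T.vol := by
  have hi : ∀ q : MvPolynomial (Fin d) ℝ, Integrable (fun x => v x * pval q x) T.vol := fun q =>
    integrable_mul_of_memLp hv (T.memLp_vol (continuous_pval q))
  obtain ⟨g, hg, hg2⟩ := T.exists_poly_riesz m
    { toFun := fun q => ∫ x, v x * pval q x ∂T.vol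
      map_add' := fun p q => by
        simp only [pval_add, mul_add]
        exact integral_add (hi p) (hi q)
      map_smul' := fun c q => by
        simp only [pval_smul, mul_left_comm, integral_const_mul, RingHom.id_apply, smul_eq_mul] }
  refine ⟨pval g, ⟨g, hg, rfl⟩, ?_⟩
  rintro q ⟨q', hq', rfl⟩
  exact hg2 q' hq'

/-- Orthogonality. The projection is determined by `v` alone, while Taylor polynomials of smooth
approximations change with the approximation; comparing with the projection allows passing to the
limit. -/
lemma l2_sub_proj_le {m : ℕ} {v p : E d → ℝ} (hv : MemLp v 2 T.vol) (hp : IsPoly m p)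
    (h : ∀ q, IsPoly m q → ∫ x, p x * q x ∂T.vol = ∫ x, v x * q x ∂T.vol) {q : E d → ℝ}
    (hq : IsPoly m q) : l2 T.vol (fun x => v x - p x) ≤ l2 T.vol (fun x => v x - q x) := by
  have mp := T.memLp_vol hp.continuous
  have mq := T.memLp_vol hq.continuous
  have m1 := memLp_sub hv mp
  have m2 := memLp_sub hv mq
  have hr : IsPoly m fun x => q x - p x := hq.sub hp
  have mr := T.memLp_vol hr.continuous
  have h1 : l2 T.vol (fun x => v x - p x) ^ 2 = ∫ x, (v x - p x) * (v x - q x) ∂T.vol := by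
    have h2 : ∫ x, (v x - p x) * (q x - p x) ∂T.vol = 0 := by
      simp only [sub_mul _ _ (q _ - p _)]
      rw [integral_sub (integrable_mul_of_memLp hv mr) (integrable_mul_of_memLp mp mr), h _ hr,
        sub_self]
    have h3 : ∀ x, (v x - p x) ^ 2 = (v x - p x) * (v x - q x) + (v x - p x) * (q x - p x) :=
      fun x => by ring
    rw [l2_sq]
    simp_rw [h3]
    rw [integral_add (integrable_mul_of_memLp m1 m2) (integrable_mul_of_memLp m1 mr), h2, add_zero]
  have h4 := (le_abs_self _).trans (abs_integral_mul_le m1 m2)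
  rw [← h1] at h4
  have h5 : 0 ≤ l2 T.vol (fun x => v x - p x) := l2_nonneg
  have h6 : 0 ≤ l2 T.vol (fun x => v x - q x) := l2_nonneg
  nlinarith

/-- The Bramble–Hilbert lemma for limits of smooth functions. -/
lemma l2_sub_proj_le_of_tendsto {m : ℕ} {h : ℝ}
    (hT : ∀ x ∈ T.carrier, ∀ y ∈ T.carrier, dist x y ≤ h) {v p : E d → ℝ} (hv : MemLp v 2 T.vol)
    (hp : IsPoly m p) (hproj : ∀ q, IsPoly m q → ∫ x, p x * q x ∂T.vol = ∫ x, v x * q x ∂T.vol)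
    {ψ : ℕ → E d → ℝ} (hψ : ∀ r, ContDiff ℝ ∞ (ψ r))
    (hψv : Tendsto (fun r => l2 T.vol (fun x => ψ r x - v x)) atTop (𝓝 0))
    {w : (Fin (m + 1) → Fin d) → E d → ℝ} (hw : ∀ s, MemLp (w s) 2 T.vol)
    (hψw : ∀ s, Tendsto (fun r => l2 T.vol (fun x => partialD s (ψ r) x - w s x)) atTop (𝓝 0)) :
    l2 T.vol (fun x => v x - p x) ^ 2 ≤ d ^ (m + 1) * 2 ^ d * h ^ (2 * (m + 1)) *
      ∑ s, l2 T.vol (w s) ^ 2 := by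
  have h1 : Tendsto (fun r => l2 T.vol (fun x => ψ r x - v x) + Real.sqrt (d ^ (m + 1) * 2 ^ d *
      h ^ (2 * (m + 1)) * ∑ s : Fin (m + 1) → Fin d, l2 T.vol (partialD s (ψ r)) ^ 2)) atTop
      (𝓝 (0 + Real.sqrt (d ^ (m + 1) * 2 ^ d * h ^ (2 * (m + 1)) * ∑ s, l2 T.vol (w s) ^ 2))) := by
    refine hψv.add (Tendsto.sqrt (Tendsto.const_mul _ (tendsto_finsetSum _ fun s _ =>
      Tendsto.pow ?_ 2)))
    exact tendsto_l2_norm (fun r => T.memLp_vol (contDiff_partialD (hψ r) s).continuous) (hw s)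
      (hψw s)
  rw [zero_add] at h1
  have h2 : l2 T.vol (fun x => v x - p x) ≤
      Real.sqrt (d ^ (m + 1) * 2 ^ d * h ^ (2 * (m + 1)) * ∑ s, l2 T.vol (w s) ^ 2) := by
    refine ge_of_tendsto' h1 fun r => ?_
    obtain ⟨q, hq, hq2⟩ := T.exists_taylorPoly_le m hT (hψ r)
    have mq := T.memLp_vol hq.continuous
    have mψ := T.memLp_vol (hψ r).continuous
    refine (T.l2_sub_proj_le hv hp hproj hq).trans ?_
    have h3 := l2_add_le (memLp_sub hv mψ) (memLp_sub mψ mq)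
    simp only [sub_add_sub_cancel] at h3
    rw [l2_sub_comm (f := v) (g := ψ r)] at h3
    exact h3.trans (by gcongr; exact Real.le_sqrt_of_sq_le hq2)
  have h0 : 0 ≤ (d : ℝ) ^ (m + 1) * 2 ^ d * h ^ (2 * (m + 1)) * ∑ s, l2 T.vol (w s) ^ 2 := by
    have : 0 ≤ ∑ s, l2 T.vol (w s) ^ 2 := Finset.sum_nonneg fun _ _ => sq_nonneg _
    have h2 : 0 ≤ h ^ (2 * (m + 1)) := (even_two_mul _).pow_nonneg h
    positivity
  rw [← Real.sq_sqrt h0]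
  exact pow_le_pow_left₀ l2_nonneg h2 2

end ConvexPolytope

/-- Approximation of the gradient follows from `L²` approximation of the function and of its
partial derivatives. -/
lemma gradient_approx (d k N : ℕ) {γ : ℝ} (hγ : 0 < γ) (hγ1 : γ ≤ 1) :
    ∃ C, 0 < C ∧ ∀ (T : ConvexPolytope d) (h : ℝ), Fat T h γ → T.numFacets ≤ N →
      ∀ (v : E d → ℝ) (g : Fin d → E d → ℝ) (φ : ℕ → E d → ℝ), H1Approx T v g φ →
      ∀ p, IsPoly k p → ∀ i q, IsPoly k q →
        h * l2 T.vol (fun x => g i x - pd i p x) ≤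
          C * (l2 T.vol (fun x => v x - p x) + h * l2 T.vol (fun x => g i x - q x)) := by
  obtain ⟨C, hC, hpoly⟩ := fat_poly_l2 d (N + k) N hγ hγ1
  refine ⟨(C + 1) ^ 2 + 1, by positivity, fun T h hT hN v g φ H p hp i q hq => ?_⟩
  have hh := hT.pos
  set r := fun x => pd i p x - q x with hr
  have hrp : IsPoly k r := ((hp.pd i).mono (by omega)).sub hq
  set W := T.wt h Finset.univ with hW
  have hWp := T.isPoly_wt h Finset.univ
  -- The weighted difference of `∂ᵢ p` and `q` vanishes on the boundary, so integrating `∂ᵢ (v - p)`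
  -- against it by parts produces no boundary term. The derivative that falls on the polynomial `z`
  -- is paid for by the inverse inequality.
  set z := fun x => W x * r x with hz
  have hzp : IsPoly (N + k) z := (hWp.mul hrp).mono (by
    rw [Finset.card_univ, Fintype.card_fin]; omega)
  have mr := T.memLp_vol hrp.continuous
  have mz := T.memLp_vol hzp.continuous
  have mpd := T.memLp_vol (hp.pd i).continuous
  have mdz := T.memLp_vol (hzp.pd i).continuous
  have mq := T.memLp_vol hq.continuous
  have mvp := memLp_sub H.memv (T.memLp_vol hp.continuous)
  have mgp := memLp_sub (H.memg i) mpd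
  have mgq := memLp_sub (H.memg i) mq
  have e1 : ∫ x, (v x - p x) * pd i z x ∂T.vol + ∫ x, (g i x - pd i p x) * z x ∂T.vol = 0 := by
    have H2 := H.sub (H1Approx.of_contDiff T hp.contDiff)
    rw [H2.green hT hγ hzp.contDiff i]
    apply Finset.sum_eq_zero
    intro a _
    rw [integral_eq_zero_of_ae, mul_zero]
    filter_upwards [T.surface_ae_mem a] with x hx
    have : W x = 0 := T.wt_eq_zero (Finset.mem_univ a) hx
    simp [hz, this]
  have e2 : ∫ x, W x * r x ^ 2 ∂T.vol =
      ∫ x, (v x - p x) * pd i z x ∂T.vol + ∫ x, (g i x - q x) * z x ∂T.vol := by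
    have h1 : ∀ x, W x * r x ^ 2 = (g i x - q x) * z x - (g i x - pd i p x) * z x := fun x => by
      simp only [hz, hr]; ring
    simp_rw [h1]
    rw [integral_sub (integrable_mul_of_memLp mgq mz) (integrable_mul_of_memLp mgp mz)]
    linarith
  have hz1 : l2 T.vol z ≤ l2 T.vol r := hT.l2_wt_mul_le _ hrp.continuous
  have hdz : h * l2 T.vol (pd i z) ≤ (C + 1) * l2 T.vol r := by
    have h1 := (hpoly T h hT hN z hzp).2.1 i
    apply le_of_sq_le_sq _ (mul_nonneg (by positivity) l2_nonneg)
    rw [mul_pow, mul_pow]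
    refine h1.trans ?_
    have h2 : l2 T.vol z ^ 2 ≤ l2 T.vol r ^ 2 := pow_le_pow_left₀ l2_nonneg hz1 2
    have h3 : C ≤ (C + 1) ^ 2 := by nlinarith
    exact mul_le_mul h3 h2 (sq_nonneg _) (by positivity)
  set X := l2 T.vol (fun x => v x - p x)
  set Y := l2 T.vol (fun x => g i x - q x)
  set R := l2 T.vol r
  have hX : 0 ≤ X := l2_nonneg
  have hY : 0 ≤ Y := l2_nonneg
  have hR : 0 ≤ R := l2_nonneg
  -- The weighted norm of `r` controls its full norm, and it has been split into the `L²` error of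
  -- `p` and that of `q`.
  have e3 : h * R ^ 2 ≤ C * ((C + 1) * X + h * Y) * R := by
    have h1 := (hpoly T h hT hN r (hrp.mono (by omega))).1
    have h2 := (le_abs_self _).trans (abs_integral_mul_le mvp mdz)
    have h3 := (le_abs_self _).trans (abs_integral_mul_le mgq mz)
    have h4 : l2 T.vol (fun x => g i x - q x) * l2 T.vol z ≤ Y * R :=
      mul_le_mul_of_nonneg_left hz1 hY
    have h5 : h * (X * l2 T.vol (pd i z)) ≤ (C + 1) * X * R := by
      calc _ = X * (h * l2 T.vol (pd i z)) := by ring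
        _ ≤ X * ((C + 1) * R) := by gcongr
        _ = _ := by ring
    calc h * R ^ 2 ≤ h * (C * ∫ x, W x * r x ^ 2 ∂T.vol) := by gcongr
      _ ≤ h * (C * (X * l2 T.vol (pd i z) + Y * R)) := by
          rw [e2]
          exact mul_le_mul_of_nonneg_left (mul_le_mul_of_nonneg_left
            (add_le_add h2 (h3.trans h4)) hC.le) hh.le
      _ = C * (h * (X * l2 T.vol (pd i z)) + h * Y * R) := by ring
      _ ≤ C * ((C + 1) * X * R + h * Y * R) := by gcongr
      _ = _ := by ring
  have e4 : h * R ≤ C * ((C + 1) * X + h * Y) := by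
    rcases hR.eq_or_lt with h0 | h0
    · rw [← h0, mul_zero]; positivity
    · apply le_of_mul_le_mul_right _ h0
      calc h * R * R = h * R ^ 2 := by ring
        _ ≤ _ := e3
  have e5 : l2 T.vol (fun x => g i x - pd i p x) ≤ Y + R := by
    have h1 := l2_sub_le mgq mr
    refine le_trans (le_of_eq ?_) h1
    congr 1
    ext x
    simp only [hr]; ring
  have hhY : 0 ≤ h * Y := mul_nonneg hh.le hY
  calc h * l2 T.vol (fun x => g i x - pd i p x) ≤ h * (Y + R) := by gcongr
    _ = h * Y + h * R := by ring
    _ ≤ h * Y + C * ((C + 1) * X + h * Y) := by linarith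
    _ ≤ ((C + 1) ^ 2 + 1) * (X + h * Y) := by nlinarith [mul_nonneg hC.le hX, mul_nonneg hC.le hhY]

/-- Smooth functions whose derivatives `∂_s` of order at most `K` converge to `g m s` in
`L²(T)`. -/
structure SobApprox (T : ConvexPolytope d) (K : ℕ) (g : ∀ m : ℕ, (Fin m → Fin d) → E d → ℝ)
    (φ : ℕ → E d → ℝ) : Prop where
  smooth : ∀ r, ContDiff ℝ ∞ (φ r)
  mem : ∀ m ≤ K, ∀ s : Fin m → Fin d, MemLp (g m s) 2 T.vol
  tend : ∀ m ≤ K, ∀ s : Fin m → Fin d,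
    Tendsto (fun r => l2 T.vol (fun x => partialD s (φ r) x - g m s x)) atTop (𝓝 0)

/-- The derivatives of `∂_l v` in terms of those of `v`. -/
def shiftDeriv (g : ∀ m : ℕ, (Fin m → Fin d) → E d → ℝ) (l : Fin d) (m : ℕ) (s : Fin m → Fin d) :
    E d → ℝ := g (m + 1) (Fin.snoc s l)

/-- The square root of the sum of the squares of the norms of the derivatives of order `m`. -/
def sobSq (T : ConvexPolytope d) (g : ∀ m : ℕ, (Fin m → Fin d) → E d → ℝ) (m : ℕ) : ℝ :=
  ∑ s : Fin m → Fin d, l2 T.vol (g m s) ^ 2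

lemma sobSq_nonneg (T : ConvexPolytope d) (g : ∀ m : ℕ, (Fin m → Fin d) → E d → ℝ) (m : ℕ) :
    0 ≤ sobSq T g m := Finset.sum_nonneg fun _ _ => sq_nonneg _

lemma sobSq_shiftDeriv_le (T : ConvexPolytope d) (g : ∀ m : ℕ, (Fin m → Fin d) → E d → ℝ)
    (l : Fin d) (m : ℕ) : sobSq T (shiftDeriv g l) m ≤ sobSq T g (m + 1) := by
  classical
  have hinj : Function.Injective fun s : Fin m → Fin d => (Fin.snoc s l : Fin (m + 1) → Fin d) :=
    fun s t hst => by
      have := congrArg Fin.init hst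
      simpa using this
  unfold sobSq shiftDeriv
  rw [← Finset.sum_image (s := Finset.univ)
    (g := fun s : Fin m → Fin d => (Fin.snoc s l : Fin (m + 1) → Fin d))
    (f := fun t => l2 T.vol (g (m + 1) t) ^ 2) (fun x _ y _ h => hinj h)]
  exact Finset.sum_le_sum_of_subset_of_nonneg (Finset.subset_univ _) fun _ _ _ => sq_nonneg _

namespace SobApprox
variable {T : ConvexPolytope d} {K : ℕ} {g : ∀ m : ℕ, (Fin m → Fin d) → E d → ℝ}
  {φ : ℕ → E d → ℝ}

lemma shift (H : SobApprox T (K + 1) g φ) (l : Fin d) :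
    SobApprox T K (shiftDeriv g l) (fun r => pd l (φ r)) where
  smooth r := contDiff_pd (H.smooth r) l
  mem m hm s := H.mem (m + 1) (by omega) _
  tend m hm s := by
    have := H.tend (m + 1) (by omega) (Fin.snoc s l)
    refine this.congr fun r => ?_
    rw [partialD_pd s l (H.smooth r)]
    rfl

lemma h1Approx (H : SobApprox T K g φ) (hK : 1 ≤ K) :
    H1Approx T (g 0 ![]) (fun i => g 1 (fun _ => i)) φ where
  smooth := H.smooth
  memv := H.mem 0 (by omega) _
  memg i := H.mem 1 hK _
  tendv := by
    have := H.tend 0 (by omega) ![]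
    simpa [partialD_zero] using this
  tendg i := by
    have := H.tend 1 hK (fun _ => i)
    simpa [partialD_one] using this

end SobApprox

/-- Polynomial approximation in `H¹` on a fat polytope. -/
lemma exists_poly_approx (d m N : ℕ) {γ : ℝ} (hγ : 0 < γ) (hγ1 : γ ≤ 1) :
    ∃ C, 0 < C ∧ ∀ (T : ConvexPolytope d) (h : ℝ), Fat T h γ → T.numFacets ≤ N →
      ∀ (g : ∀ m : ℕ, (Fin m → Fin d) → E d → ℝ) (φ : ℕ → E d → ℝ), SobApprox T (m + 1) g φ →
      ∃ p, IsPoly m p ∧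
        l2 T.vol (fun x => g 0 ![] x - p x) ≤ C * h ^ (m + 1) * Real.sqrt (sobSq T g (m + 1)) ∧
        ∀ i, l2 T.vol (fun x => g 1 (fun _ => i) x - pd i p x) ≤
          C * h ^ m * Real.sqrt (sobSq T g (m + 1)) := by
  obtain ⟨C, hC, hgrad⟩ := gradient_approx d m N hγ hγ1
  -- Summing over all degrees up to `m` gives one constant for both uses: degree `m` for the
  -- function and degree `m - 1` for its derivatives.
  set B := ∑ j ∈ Finset.range (m + 1), ((d : ℝ) ^ (j + 1) * 2 ^ d + 1) with hB
  have hB0 : 0 ≤ B := Finset.sum_nonneg fun j _ => by positivity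
  have hBj : ∀ j ≤ m, (d : ℝ) ^ (j + 1) * 2 ^ d ≤ (B + 1) ^ 2 := by
    intro j hj
    have h1 : (d : ℝ) ^ (j + 1) * 2 ^ d + 1 ≤ B :=
      Finset.single_le_sum (f := fun j => (d : ℝ) ^ (j + 1) * 2 ^ d + 1)
        (fun j _ => by positivity) (Finset.mem_range.2 (by omega))
    nlinarith
  have hBH : ∀ (T : ConvexPolytope d) (h : ℝ), Fat T h γ →
      ∀ j ≤ m, ∀ (g : ∀ m : ℕ, (Fin m → Fin d) → E d → ℝ) (φ : ℕ → E d → ℝ),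
      SobApprox T (j + 1) g φ → ∃ p, IsPoly j p ∧
        l2 T.vol (fun x => g 0 ![] x - p x) ≤
          (B + 1) * h ^ (j + 1) * Real.sqrt (sobSq T g (j + 1)) := by
    intro T h hT j hj g φ H
    have hh := hT.pos
    have mv := H.mem 0 (by omega) ![]
    obtain ⟨p, hp, hp2⟩ := T.exists_poly_proj j mv
    refine ⟨p, hp, ?_⟩
    have h1 := T.l2_sub_proj_le_of_tendsto hT.diam_le mv hp hp2 H.smooth
      (by simpa [partialD_zero] using H.tend 0 (by omega) ![]) (H.mem (j + 1) le_rfl)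
      (H.tend (j + 1) le_rfl)
    apply le_of_sq_le_sq _ (by positivity)
    refine h1.trans ?_
    rw [mul_pow, mul_pow, Real.sq_sqrt (sobSq_nonneg _ _ _), ← pow_mul, mul_comm (j + 1) 2]
    have h2 := sobSq_nonneg T g (j + 1)
    change _ * sobSq T g (j + 1) ≤ _
    exact mul_le_mul_of_nonneg_right (mul_le_mul_of_nonneg_right (hBj j hj) (by positivity)) h2
  refine ⟨C * (2 * (B + 1)) + (B + 1), by positivity, fun T h hT hN g φ H => ?_⟩
  have hh := hT.pos
  have hS : 0 ≤ Real.sqrt (sobSq T g (m + 1)) := Real.sqrt_nonneg _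
  set S := Real.sqrt (sobSq T g (m + 1))
  obtain ⟨p, hp, hp2⟩ := hBH T h hT m le_rfl g φ H
  refine ⟨p, hp, hp2.trans ?_, fun i => ?_⟩
  · have : B + 1 ≤ C * (2 * (B + 1)) + (B + 1) := by
      have : 0 ≤ C * (2 * (B + 1)) := by positivity
      linarith
    gcongr
  have hq : ∃ q, IsPoly m q ∧ l2 T.vol (fun x => g 1 (fun _ => i) x - q x) ≤
      (B + 1) * h ^ m * S := by
    cases m with
    | zero =>
      -- For `m = 0` there is no lower degree to use; zero suffices, since the first derivatives are
      -- themselves the terms of the seminorm.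
      refine ⟨fun _ => 0, IsPoly.const 0, ?_⟩
      simp only [sub_zero, pow_zero, mul_one]
      have h1 : l2 T.vol (g 1 fun _ => i) ≤ S := by
        apply Real.le_sqrt_of_sq_le
        exact Finset.single_le_sum (f := fun s : Fin 1 → Fin d => l2 T.vol (g 1 s) ^ 2)
          (fun _ _ => sq_nonneg _) (Finset.mem_univ _)
      nlinarith
    | succ m =>
      obtain ⟨q, hq, hq2⟩ := hBH T h hT m (by omega) (shiftDeriv g i) _ (H.shift i)
      refine ⟨q, hq.mono (by omega), ?_⟩
      have h1 : shiftDeriv g i 0 ![] = g 1 (fun _ => i) := by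
        unfold shiftDeriv
        congr 1
      rw [h1] at hq2
      refine hq2.trans ?_
      gcongr
      exact Real.sqrt_le_sqrt (sobSq_shiftDeriv_le T g i (m + 1))
  obtain ⟨q, hq, hq2⟩ := hq
  have h1 := hgrad T h hT hN _ _ φ (H.h1Approx (by omega)) p hp i q hq
  apply le_of_mul_le_mul_left _ hh
  refine h1.trans ?_
  calc C * (l2 T.vol (fun x => g 0 ![] x - p x) + h * l2 T.vol (fun x => g 1 (fun _ => i) x - q x))
      ≤ C * ((B + 1) * h ^ (m + 1) * S + h * ((B + 1) * h ^ m * S)) := by gcongr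
    _ = C * (2 * (B + 1)) * h ^ (m + 1) * S := by ring
    _ ≤ (C * (2 * (B + 1)) + (B + 1)) * h ^ (m + 1) * S := by gcongr; linarith
    _ = _ := by ring

end
end ConformingDG

/-! ### Facets shared by two elements -/

namespace ConformingDG
noncomputable section

variable {d : ℕ}

namespace ConvexPolytope
variable {T T' : ConvexPolytope d} {a : Fin T.numFacets} {b : Fin T'.numFacets}

lemma surface_eq_of_facet_eq (h : T'.facet b = T.facet a) : T'.surface b = T.surface a := by
  rw [surface, surface, h]

lemma surface_ne_zero (T : ConvexPolytope d) (a : Fin T.numFacets) : T.surface a ≠ 0 := by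
  intro h
  have h1 : T.surface a Set.univ = 0 := by rw [h]; rfl
  rw [surface, Measure.restrict_apply_univ] at h1
  exact (T.facet_pos a).ne' h1

/-- Facets have positive measure, and both genericity conditions hold almost everywhere on the
common facet. -/
lemma exists_common_point (h : T'.facet b = T.facet a) : ∃ x ∈ T.facet a,
    (∀ c, c ≠ a → 0 < T.gap c x) ∧ ∀ c, c ≠ b → 0 < T'.gap c x := by
  have h1 := T'.surface_ae_pos b
  rw [surface_eq_of_facet_eq h] at h1
  have : (ae (T.surface a)).NeBot := ae_neBot.2 (T.surface_ne_zero a)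
  obtain ⟨x, hx1, hx2, hx3⟩ := ((T.surface_ae_mem a).and ((T.surface_ae_pos a).and h1)).exists
  exact ⟨x, hx1, hx2, hx3⟩

lemma eventually_gap_pos (s : Fin T.numFacets → Prop) {x : E d} (hx : ∀ c, s c → 0 < T.gap c x)
    (v : E d) : ∀ᶠ t in 𝓝 (0 : ℝ), ∀ c, s c → 0 < T.gap c (x + t • v) := by
  rw [eventually_all]
  intro c
  by_cases hc : s c
  · have h1 : ContinuousAt (fun t : ℝ => T.gap c (x + t • v)) 0 := by
      have := T.continuous_gap c
      fun_prop
    have h2 : (0 : ℝ) < T.gap c (x + (0 : ℝ) • v) := by simpa using hx c hc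
    filter_upwards [h1.eventually (lt_mem_nhds h2)] with t ht _ using ht
  · exact Eventually.of_forall fun t h => absurd h hc

/-- Let `v` be the part of the second normal orthogonal to the first. From a point off all other
facets of `T`, a short move along `v` stays in the common facet, where the second normal has
constant inner product. Hence the second normal is orthogonal to `v`, so `v = 0`. -/
lemma outward_eq_or_neg (h : T'.facet b = T.facet a) :
    (T'.outward b = T.outward a ∧ T'.offset b = T.offset a) ∨
      (T'.outward b = -T.outward a ∧ T'.offset b = -T.offset a) := by
  obtain ⟨x, hx, hpos, -⟩ := exists_common_point h
  set ν := T.outward a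
  set ν' := T'.outward b
  set t : ℝ := inner ℝ ν ν' with ht
  set v := ν' - t • ν with hv
  have hνν : inner ℝ ν ν = (1 : ℝ) := by rw [real_inner_self_eq_norm_sq, T.unit_outward]; norm_num
  have hνv : inner ℝ ν v = (0 : ℝ) := by
    rw [hv, inner_sub_right, inner_smul_right, hνν, ← ht]; ring
  have h1 := eventually_gap_pos (fun c => c ≠ a) hpos v
  obtain ⟨s, hs, hs0⟩ := ((h1.filter_mono nhdsWithin_le_nhds).and
    (self_mem_nhdsWithin (a := (0 : ℝ)) (s := Set.Ioi 0))).exists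
  have hs0' : (0 : ℝ) < s := hs0
  have hxa := (T.mem_facet_iff.1 hx).2
  have hmem : x + s • v ∈ T.facet a := by
    have h0 : T.gap a (x + s • v) = 0 := by
      simp only [gap, inner_add_right, inner_smul_right] at hxa ⊢
      rw [hνv]; linarith
    refine T.mem_facet_iff.2 ⟨T.mem_carrier_iff.2 fun c => ?_, h0⟩
    by_cases hc : c = a
    · rw [hc, h0]
    · exact (hs c hc).le
  rw [← h] at hmem hx
  have e1 : inner ℝ ν' x = T'.offset b := hx.2
  have e2 : inner ℝ ν' (x + s • v) = T'.offset b := hmem.2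
  rw [inner_add_right, inner_smul_right, e1] at e2
  have e3 : inner ℝ ν' v = (0 : ℝ) := by
    have : s * inner ℝ ν' v = 0 := by linarith
    exact (mul_eq_zero.1 this).resolve_left hs0'.ne'
  have e4 : inner ℝ v v = (0 : ℝ) := by
    conv_lhs => rw [hv]
    rw [inner_sub_left, e3, inner_smul_left, hνv]; simp
  have e5 : ν' = t • ν := by
    have := inner_self_eq_zero.1 e4
    rwa [hv, sub_eq_zero] at this
  have e6 : |t| = 1 := by
    have := T'.unit_outward b
    change ‖ν'‖ = 1 at this
    rw [e5, norm_smul, T.unit_outward, mul_one] at this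
    exact this
  have e7 : T'.offset b = t * T.offset a := by
    rw [← e1, e5, inner_smul_left]
    simp only [gap] at hxa
    have : inner ℝ ν x = T.offset a := by linarith
    rw [this]; simp
  rcases (abs_eq zero_le_one).1 e6 with h1 | h1
  · left; rw [h1] at e5 e7; exact ⟨by simpa using e5, by simpa using e7⟩
  · right; rw [h1] at e5 e7; exact ⟨by simpa using e5, by simpa using e7⟩

/-- With equal normals both polytopes lie on the same side of the common facet, and a point slightly
below it is interior to both. -/
lemma not_disjoint_of_outward_eq (h : T'.facet b = T.facet a) (h1 : T'.outward b = T.outward a)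
    (h2 : T'.offset b = T.offset a) : ¬ Disjoint (interior T.carrier) (interior T'.carrier) := by
  obtain ⟨x, hx, hpos, hpos'⟩ := exists_common_point h
  have e1 := eventually_gap_pos (fun c => c ≠ a) hpos (-T.outward a)
  have e2 := eventually_gap_pos (fun c => c ≠ b) hpos' (-T.outward a)
  obtain ⟨s, ⟨hs, hs'⟩, hs0⟩ := (((e1.and e2).filter_mono nhdsWithin_le_nhds).and
    (self_mem_nhdsWithin (a := (0 : ℝ)) (s := Set.Ioi 0))).exists
  have hs0' : (0 : ℝ) < s := hs0
  have hνν : inner ℝ (T.outward a) (T.outward a) = (1 : ℝ) := by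
    rw [real_inner_self_eq_norm_sq, T.unit_outward]; norm_num
  have hxa := (T.mem_facet_iff.1 hx).2
  have hga : 0 < T.gap a (x + s • -T.outward a) := by
    simp only [gap, inner_add_right, inner_smul_right, inner_neg_right, hνν] at hxa ⊢
    linarith
  have hgb : 0 < T'.gap b (x + s • -T.outward a) := by
    have : T'.gap b (x + s • -T.outward a) = T.gap a (x + s • -T.outward a) := by
      simp only [gap, h1, h2]
    rwa [this]
  rw [Set.not_disjoint_iff]
  refine ⟨x + s • -T.outward a, ?_, ?_⟩
  · rw [T.interior_carrier]
    intro c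
    by_cases hc : c = a
    · rw [hc]; exact hga
    · exact hs c hc
  · rw [T'.interior_carrier]
    intro c
    by_cases hc : c = b
    · rw [hc]; exact hgb
    · exact hs' c hc

lemma ae_mem_inner' (T : ConvexPolytope d) : ∀ᵐ x ∂T.vol, x ∈ T.inner' := by
  have h3 : T.vol = volume.restrict T.inner' := Measure.restrict_congr_set T.inner'_ae_eq.symm
  rw [h3]
  exact ae_restrict_mem T.isOpen_inner'.measurableSet

end ConvexPolytope

namespace PolytopalMesh
variable {Ω : Set (E d)} (M : PolytopalMesh Ω)

lemma carrier_subset (i : Fin M.numCells) : (M.cell i).carrier ⊆ closure Ω := by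
  rw [← M.cover]
  exact Set.subset_iUnion (fun i => (M.cell i).carrier) i

lemma inner'_subset (hΩ : interior (closure Ω) = Ω) (i : Fin M.numCells) :
    (M.cell i).inner' ⊆ Ω := by
  rw [← (M.cell i).interior_carrier]
  conv_rhs => rw [← hΩ]
  exact interior_mono (M.carrier_subset i)

lemma vol_le (hΩ : interior (closure Ω) = Ω) (i : Fin M.numCells) :
    (M.cell i).vol ≤ volume.restrict Ω := by
  rw [ConvexPolytope.vol, ← Measure.restrict_congr_set (M.cell i).inner'_ae_eq]
  exact Measure.restrict_mono (M.inner'_subset hΩ i) le_rfl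

lemma memLp_vol_of_restrict (hΩ : interior (closure Ω) = Ω) {f : E d → ℝ}
    (hf : MemLp f 2 (volume.restrict Ω)) (i : Fin M.numCells) : MemLp f 2 (M.cell i).vol :=
  hf.mono_measure (M.vol_le hΩ i)

lemma disjoint_inner' {i j : Fin M.numCells} (h : i ≠ j) :
    Disjoint (M.cell i).inner' (M.cell j).inner' := by
  rw [← ConvexPolytope.interior_carrier, ← ConvexPolytope.interior_carrier]
  exact M.interior_disjoint i j h

lemma ae_eq_iUnion (hΩ : interior (closure Ω) = Ω) :
    Ω =ᵐ[volume] ⋃ i, (M.cell i).inner' := by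
  have hsub : ⋃ i, (M.cell i).inner' ⊆ Ω := Set.iUnion_subset fun i => M.inner'_subset hΩ i
  have h : ∀ᵐ x, ∀ i, (x ∈ (M.cell i).inner') = (x ∈ (M.cell i).carrier) :=
    ae_all_iff.2 fun i => (M.cell i).inner'_ae_eq
  filter_upwards [h] with x hx
  apply propext
  constructor
  · intro h1
    have h2 : x ∈ ⋃ i, (M.cell i).carrier := by
      rw [M.cover]; exact subset_closure h1
    obtain ⟨i, hi⟩ := Set.mem_iUnion.1 h2
    rw [← hx i] at hi
    exact Set.mem_iUnion.2 ⟨i, hi⟩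
  · exact fun h1 => hsub h1

lemma integral_eq_sum (hΩ : interior (closure Ω) = Ω) {F : E d → ℝ}
    (hF : IntegrableOn F Ω) : ∫ x in Ω, F x = ∑ i, ∫ x, F x ∂(M.cell i).vol := by
  rw [setIntegral_congr_set (M.ae_eq_iUnion hΩ), integral_iUnion_fintype
    (fun i => (M.cell i).isOpen_inner'.measurableSet)
    (fun i j hij => M.disjoint_inner' hij)
    (fun i => hF.mono_set (M.inner'_subset hΩ i))]
  refine Finset.sum_congr rfl fun i _ => ?_
  rw [setIntegral_congr_set (M.cell i).inner'_ae_eq]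

/-- Equal normals contradict the disjointness of interiors, or the injectivity of normals within one
element. Opposite normals on one hyperplane cannot belong to one element, because it would have
empty interior. -/
lemma opposite_of_facet_eq {i j : Fin M.numCells} {a : Fin (M.cell i).numFacets}
    {b : Fin (M.cell j).numFacets} (h : (M.cell j).facet b = (M.cell i).facet a)
    (hne : (⟨j, b⟩ : Σ i, Fin (M.cell i).numFacets) ≠ ⟨i, a⟩) :
    j ≠ i ∧ (M.cell j).outward b = -(M.cell i).outward a ∧
      (M.cell j).offset b = -(M.cell i).offset a := by
  rcases ConvexPolytope.outward_eq_or_neg h with ⟨h1, h2⟩ | ⟨h1, h2⟩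
  · exfalso
    by_cases hij : j = i
    · subst hij
      exact hne (by rw [(M.cell j).outward_injective h1])
    · exact ConvexPolytope.not_disjoint_of_outward_eq h h1 h2
        (M.interior_disjoint i j (Ne.symm hij))
  · refine ⟨fun hij => ?_, h1, h2⟩
    subst hij
    exact (M.cell j).offset_ne_of_outward_eq_neg h1 h2

/-- An edge/face belongs to at most two elements. -/
lemma eq_of_facet_eq {x y z : Σ i, Fin (M.cell i).numFacets}
    (hy : (M.cell y.1).facet y.2 = (M.cell x.1).facet x.2)
    (hz : (M.cell z.1).facet z.2 = (M.cell x.1).facet x.2) (hyx : y ≠ x) (hzx : z ≠ x) :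
    y = z := by
  by_contra hyz
  obtain ⟨i, a⟩ := x
  obtain ⟨j, b⟩ := y
  obtain ⟨l, c⟩ := z
  -- Three normals cannot be pairwise opposite.
  obtain ⟨-, h1, -⟩ := M.opposite_of_facet_eq hy hyx
  obtain ⟨-, h2, -⟩ := M.opposite_of_facet_eq hz hzx
  obtain ⟨-, h3, -⟩ := M.opposite_of_facet_eq (hy.trans hz.symm) hyz
  rw [h1, h2, neg_neg] at h3
  have h4 : (M.cell i).outward a = 0 := by
    have : (2 : ℝ) • (M.cell i).outward a = 0 := by
      rw [two_smul]
      nth_rewrite 1 [← h3]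
      simp
    simpa using this
  have h5 := (M.cell i).unit_outward a
  rw [h4, norm_zero] at h5
  exact zero_ne_one h5

/-- The traces of an `H¹(Ω)` function from both sides of an edge/face agree. -/
lemma trace_eq_across (hΩ : interior (closure Ω) = Ω) {i j : Fin M.numCells}
    {a : Fin (M.cell i).numFacets} {b : Fin (M.cell j).numFacets}
    (hf : (M.cell j).facet b = (M.cell i).facet a) (hij : j ≠ i)
    (hν : (M.cell j).outward b = -(M.cell i).outward a)
    (hc : (M.cell j).offset b = -(M.cell i).offset a)
    {hi hj γ : ℝ} (hTi : Fat (M.cell i) hi γ) (hTj : Fat (M.cell j) hj γ) (hγ : 0 < γ)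
    {v : E d → ℝ} {g : Fin d → E d → ℝ} {φ ψ : ℕ → E d → ℝ}
    (Hi : H1Approx (M.cell i) v g φ) (Hj : H1Approx (M.cell j) v g ψ)
    (hv : MemLp v 2 (volume.restrict Ω)) (hg : ∀ l, MemLp (g l) 2 (volume.restrict Ω))
    (hweak : ∀ l θ, IsTestFunction Ω θ →
      ∫ x in Ω, v x * pd l θ x = -∫ x in Ω, g l x * θ x) :
    (M.cell i).trace a v =ᵐ[(M.cell i).surface a] (M.cell j).trace b v := by
  have hsurf : (M.cell j).surface b = (M.cell i).surface a := ConvexPolytope.surface_eq_of_facet_eq hf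
  have mi := Hi.memLp_trace hTi hγ a
  have mj := Hj.memLp_trace hTj hγ b
  rw [hsurf] at mj
  -- The open set where all gaps other than those of the common facet are positive. It is covered by
  -- the two elements, hence lies in `Ω`, and it contains almost all of the facet.
  set U : Set (E d) := {x | (∀ c, c ≠ a → 0 < (M.cell i).gap c x) ∧ ∀ c, c ≠ b → 0 < (M.cell j).gap c x} with hU
  have hUopen : IsOpen U := by
    have : U = (⋂ c, ⋂ (_ : c ≠ a), {x | 0 < (M.cell i).gap c x}) ∩
        ⋂ c, ⋂ (_ : c ≠ b), {x | 0 < (M.cell j).gap c x} := by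
      ext x; simp [hU]
    rw [this]
    exact (isOpen_iInter_of_finite fun c => isOpen_iInter_of_finite fun _ =>
      isOpen_lt continuous_const ((M.cell i).continuous_gap c)).inter
      (isOpen_iInter_of_finite fun c => isOpen_iInter_of_finite fun _ =>
      isOpen_lt continuous_const ((M.cell j).continuous_gap c))
  have hgap : ∀ x, (M.cell j).gap b x = -(M.cell i).gap a x := fun x => by
    simp only [ConvexPolytope.gap, hν, hc, inner_neg_left]; ring
  have hUT : ∀ x ∈ U, x ∈ (M.cell i).carrier ∨ x ∈ (M.cell j).carrier := by
    intro x hx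
    rcases le_total 0 ((M.cell i).gap a x) with h0 | h0
    · left
      refine (M.cell i).mem_carrier_iff.2 fun c => ?_
      by_cases hca : c = a
      · rw [hca]; exact h0
      · exact (hx.1 c hca).le
    · right
      refine (M.cell j).mem_carrier_iff.2 fun c => ?_
      by_cases hcb : c = b
      · rw [hcb, hgap]; linarith
      · exact (hx.2 c hcb).le
  have hUΩ : U ⊆ Ω := by
    rw [← hΩ]
    refine interior_maximal (fun x hx => ?_) hUopen
    exact (hUT x hx).elim (fun h => M.carrier_subset i h) (fun h => M.carrier_subset j h)
  have hsum : ∀ F : E d → ℝ, IntegrableOn F Ω → (∀ x ∉ U, F x = 0) →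
      ∫ x in Ω, F x = ∫ x, F x ∂(M.cell i).vol + ∫ x, F x ∂(M.cell j).vol := by
    intro F hF h0
    rw [M.integral_eq_sum hΩ hF]
    refine Finset.sum_eq_add i j (Ne.symm hij) (fun l _ hl => ?_) (by simp) (by simp)
    apply integral_eq_zero_of_ae
    have h1 : ∀ᵐ x ∂(M.cell l).vol, ∀ r, (x ∈ (M.cell r).inner') = (x ∈ (M.cell r).carrier) :=
      ae_restrict_of_ae (ae_all_iff.2 fun r => (M.cell r).inner'_ae_eq)
    filter_upwards [h1, (M.cell l).ae_mem_inner'] with x hx1 hx2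
    apply h0
    intro hxU
    rcases hUT x hxU with h | h
    · rw [← hx1 i] at h
      exact Set.disjoint_left.1 (M.disjoint_inner' hl.1) hx2 h
    · rw [← hx1 j] at h
      exact Set.disjoint_left.1 (M.disjoint_inner' hl.2) hx2 h
  -- For a test function supported in `U`, the weak derivative over `Ω` must equal the sum of the
  -- two Green formulas. The difference is the jump of the traces times one component of the normal.
  have key : ∀ θ : E d → ℝ, ContDiff ℝ ∞ θ → HasCompactSupport θ → tsupport θ ⊆ U →
      ∫ x, θ x • ((M.cell i).trace a v x - (M.cell j).trace b v x) ∂((M.cell i).surface a) = 0 := by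
    intro θ hθ hθc hθU
    have hθ1 : ContDiff ℝ 1 θ := hθ.of_le (by exact_mod_cast le_top)
    have htest : IsTestFunction Ω θ := ⟨hθ, hθc, hθU.trans hUΩ⟩
    have hθ0 : ∀ x ∉ U, θ x = 0 := fun x hx => by
      by_contra h
      exact hx (hθU (subset_tsupport _ h))
    have hdθ0 : ∀ l, ∀ x ∉ U, pd l θ x = 0 := fun l x hx => by
      have : x ∉ tsupport (fderiv ℝ θ) := fun h => hx (hθU (tsupport_fderiv_subset ℝ h))
      rw [pd, image_eq_zero_of_notMem_tsupport this]
      rfl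
    have mθ : MemLp θ 2 (volume.restrict Ω) :=
      (hθ.continuous.memLp_of_hasCompactSupport hθc).restrict _
    have mdθ : ∀ l, MemLp (pd l θ) 2 (volume.restrict Ω) := fun l =>
      ((continuous_pd hθ1 l).memLp_of_hasCompactSupport (hasCompactSupport_pd hθc l)).restrict _
    have e1 : ∀ l, (M.cell i).outward a l * ∫ x, θ x • ((M.cell i).trace a v x - (M.cell j).trace b v x) ∂((M.cell i).surface a)
        = 0 := by
      intro l
      have h1 := hweak l θ htest
      rw [hsum _ (integrable_mul_of_memLp hv (mdθ l)) (fun x hx => by rw [hdθ0 l x hx, mul_zero]),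
        hsum _ (integrable_mul_of_memLp (hg l) mθ) (fun x hx => by rw [hθ0 x hx, mul_zero])] at h1
      have g1 := Hi.green hTi hγ hθ1 l
      have g2 := Hj.green hTj hγ hθ1 l
      have s1 : ∑ c, (M.cell i).outward c l * ∫ x, (M.cell i).trace c v x * θ x ∂((M.cell i).surface c) =
          (M.cell i).outward a l * ∫ x, (M.cell i).trace a v x * θ x ∂((M.cell i).surface a) := by
        refine Finset.sum_eq_single a (fun c _ hca => ?_) (by simp)
        rw [integral_eq_zero_of_ae, mul_zero]
        filter_upwards [(M.cell i).surface_ae_mem c] with x hx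
        have : θ x = 0 := hθ0 x fun hxU => by
          have := hxU.1 c hca
          rw [((M.cell i).mem_facet_iff.1 hx).2] at this
          exact lt_irrefl _ this
        simp [this]
      have s2 : ∑ c, (M.cell j).outward c l * ∫ x, (M.cell j).trace c v x * θ x ∂((M.cell j).surface c) =
          (M.cell j).outward b l * ∫ x, (M.cell j).trace b v x * θ x ∂((M.cell j).surface b) := by
        refine Finset.sum_eq_single b (fun c _ hcb => ?_) (by simp)
        rw [integral_eq_zero_of_ae, mul_zero]
        filter_upwards [(M.cell j).surface_ae_mem c] with x hx
        have : θ x = 0 := hθ0 x fun hxU => by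
          have := hxU.2 c hcb
          rw [((M.cell j).mem_facet_iff.1 hx).2] at this
          exact lt_irrefl _ this
        simp [this]
      rw [s1] at g1
      rw [s2, hsurf, hν] at g2
      have mθs := (M.cell i).memLp_surface hθ.continuous a
      have e2 : ∫ x, θ x • ((M.cell i).trace a v x - (M.cell j).trace b v x) ∂((M.cell i).surface a) =
          ∫ x, (M.cell i).trace a v x * θ x ∂((M.cell i).surface a) - ∫ x, (M.cell j).trace b v x * θ x ∂((M.cell i).surface a) := by
        rw [← integral_sub (integrable_mul_of_memLp mi mθs) (integrable_mul_of_memLp mj mθs)]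
        congr 1; ext x; rw [smul_eq_mul]; ring
      rw [e2]
      have h3 : (-(M.cell i).outward a) l = -(M.cell i).outward a l := rfl
      rw [h3] at g2
      linarith
    -- Multiplying the identity of index `l` by the component of index `l` of the unit normal and
    -- summing removes the normal.
    have e3 := Finset.sum_eq_zero fun l (_ : l ∈ Finset.univ) =>
      (congrArg (fun t => (M.cell i).outward a l * t) (e1 l)).trans (mul_zero _)
    simp_rw [← mul_assoc] at e3
    rw [← Finset.sum_mul, sum_outward_sq, one_mul] at e3
    exact e3
  have hloc : LocallyIntegrableOn (fun x => (M.cell i).trace a v x - (M.cell j).trace b v x) U ((M.cell i).surface a) :=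
    ((memLp_sub mi mj).integrable (by norm_num)).locallyIntegrable.locallyIntegrableOn _
  have hae := hUopen.ae_eq_zero_of_integral_contDiff_smul_eq_zero hloc key
  have h1 := (M.cell j).surface_ae_pos b
  rw [hsurf] at h1
  filter_upwards [hae, (M.cell i).surface_ae_pos a, h1] with x hx h2 h3
  have := hx ⟨h2, h3⟩
  linarith

end PolytopalMesh

end
end ConformingDG

/-! ### Weak derivatives, the equation almost everywhere, and zero boundary traces -/

namespace ConformingDG
noncomputable section

variable {d : ℕ} {Ω : Set (E d)} {u : E d → ℝ}

lemma pd_comm {ψ : E d → ℝ} (hψ : ContDiff ℝ ∞ ψ) (i j : Fin d) :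
    pd i (pd j ψ) = pd j (pd i ψ) := by
  have h2 : ∀ x, DifferentiableAt ℝ (fderiv ℝ ψ) x := fun x =>
    ((hψ.fderiv_right (m := ∞) le_rfl).differentiable (by simp)) x
  have h3 : ∀ l m : Fin d, ∀ x, pd l (pd m ψ) x =
      fderiv ℝ (fderiv ℝ ψ) x (EuclideanSpace.single l 1) (EuclideanSpace.single m 1) := by
    intro l m x
    have := ((h2 x).hasFDerivAt.clm_apply (hasFDerivAt_const
      (EuclideanSpace.single m (1 : ℝ)) x)).fderiv
    have h4 : pd m ψ = fun y => fderiv ℝ ψ y (EuclideanSpace.single m (1 : ℝ)) := rfl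
    rw [h4, pd, this]
    simp
  ext x
  rw [h3, h3]
  refine ((contDiff_infty.1 hψ 2).contDiffAt.isSymmSndFDerivAt
    (n := 2) (by simp)).eq _ _

namespace IsTestFunction
variable {φ : E d → ℝ}

lemma pd (h : IsTestFunction Ω φ) (i : Fin d) : IsTestFunction Ω (ConformingDG.pd i φ) := by
  refine ⟨contDiff_pd h.1 i, hasCompactSupport_pd h.2.1 i, ?_⟩
  refine (closure_mono fun x hx => ?_).trans ((tsupport_fderiv_subset (f := φ) ℝ).trans h.2.2)
  intro h0
  exact hx (by rw [ConformingDG.pd, h0]; rfl)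

lemma memLp (h : IsTestFunction Ω φ) : MemLp φ 2 (volume.restrict Ω) :=
  (h.1.continuous.memLp_of_hasCompactSupport h.2.1).restrict _

lemma eq_zero_of_mem_frontier (h : IsTestFunction Ω φ) (hΩ : IsOpen Ω) {x : E d}
    (hx : x ∈ frontier Ω) : φ x = 0 := by
  by_contra h0
  exact (hΩ.frontier_eq ▸ hx).2 (h.2.2 (subset_tsupport _ h0))

lemma memH10 (h : IsTestFunction Ω φ) : MemH10 Ω φ := by
  refine ⟨h.memLp, fun _ => φ, fun _ => h, by simp [TendstoL2], fun i => ?_⟩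
  refine ⟨ConformingDG.pd i φ, (h.pd i).memLp, ?_⟩
  simp_rw [partialD_one]
  simp [TendstoL2]

lemma setIntegral_eq {ψ : E d → ℝ} (h : IsTestFunction Ω φ) :
    ∫ x in Ω, ψ x * φ x = ∫ x, ψ x * φ x := by
  refine setIntegral_eq_integral_of_forall_compl_eq_zero fun x hx => ?_
  have : φ x = 0 := by
    by_contra h0
    exact hx (h.2.2 (subset_tsupport _ h0))
  rw [this, mul_zero]

lemma hasWeakDeriv (h : IsTestFunction Ω φ) (i : Fin d) :
    HasWeakDeriv Ω (fun _ : Fin 1 => i) φ (ConformingDG.pd i φ) := by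
  refine ⟨(h.pd i).memLp, fun ψ hψ => ?_⟩
  rw [partialD_one, (hψ.pd i).setIntegral_eq, hψ.setIntegral_eq]
  have h1 := integral_mul_fderiv_eq_neg_fderiv_mul_of_integrable (𝕜 := ℝ) (μ := (volume : Measure (E d)))
    (f := φ) (g := ψ) (v := EuclideanSpace.single i (1 : ℝ))
    ((continuous_pd (h.1.of_le (by exact_mod_cast le_top)) i).mul hψ.1.continuous
      |>.integrable_of_hasCompactSupport (h.pd i).2.1.mul_right)
    ((h.1.continuous.mul (hψ.pd i).1.continuous).integrable_of_hasCompactSupport h.2.1.mul_right)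
    ((h.1.continuous.mul hψ.1.continuous).integrable_of_hasCompactSupport h.2.1.mul_right)
    (fun x _ => h.1.differentiable (by simp) x) (fun x _ => hψ.1.differentiable (by simp) x)
  simpa [ConformingDG.pd] using h1

end IsTestFunction

lemma ae_eq_of_integral_mul_test (hΩ : IsOpen Ω) {g g' : E d → ℝ}
    (hg : MemLp g 2 (volume.restrict Ω)) (hg' : MemLp g' 2 (volume.restrict Ω))
    (h : ∀ φ, IsTestFunction Ω φ → ∫ x in Ω, g x * φ x = ∫ x in Ω, g' x * φ x) :
    g =ᵐ[volume.restrict Ω] g' := by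
  have h1 := hΩ.ae_eq_zero_of_integral_contDiff_smul_eq_zero
    (((memLp_sub hg hg').locallyIntegrable (by norm_num)).locallyIntegrableOn Ω)
    (fun φ h1 h2 h3 => by
      have ht : IsTestFunction Ω φ := ⟨h1, h2, h3⟩
      have h4 := h φ ht
      have : (fun x => φ x • (g x - g' x)) = fun x => g x * φ x - g' x * φ x := by
        ext x; rw [smul_eq_mul]; ring
      rw [this, integral_sub (integrable_mul_of_memLp hg ht.memLp)
        (integrable_mul_of_memLp hg' ht.memLp), h4, sub_self])
  filter_upwards [h1, ae_restrict_mem hΩ.measurableSet] with x hx hxΩ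
  exact sub_eq_zero.1 (hx hxΩ)

lemma HasWeakDeriv.ae_eq (hΩ : IsOpen Ω) {m : ℕ} {s : Fin m → Fin d} {g g' : E d → ℝ}
    (h : HasWeakDeriv Ω s u g) (h' : HasWeakDeriv Ω s u g') : g =ᵐ[volume.restrict Ω] g' := by
  refine ae_eq_of_integral_mul_test hΩ h.1 h'.1 fun φ hφ => ?_
  have h1 := (h.2 φ hφ).symm.trans (h'.2 φ hφ)
  exact mul_left_cancel₀ (pow_ne_zero m (by norm_num)) h1

lemma hasWeakDeriv_weakDeriv {m : ℕ} {s : Fin m → Fin d} (h : ∃ g, HasWeakDeriv Ω s u g) :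
    HasWeakDeriv Ω s u (weakDeriv Ω s u) := by
  rw [weakDeriv, dif_pos h]
  exact h.choose_spec

/-- The weak derivatives of all orders, starting with the function itself. -/
def derivFamily (Ω : Set (E d)) (u : E d → ℝ) : ∀ m : ℕ, (Fin m → Fin d) → E d → ℝ
  | 0, _ => u
  | _ + 1, s => weakDeriv Ω s u

lemma MemSobolev.hasWeakDeriv {K : ℕ} (hu : MemSobolev Ω K u) {m : ℕ} (hm : m ≤ K)
    (s : Fin m → Fin d) : HasWeakDeriv Ω s u (derivFamily Ω u m s) := by
  cases m with
  | zero =>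
    refine ⟨hu.1, fun φ _ => ?_⟩
    rw [partialD_zero]
    simp [derivFamily]
  | succ m => exact hasWeakDeriv_weakDeriv (hu.2 (m + 1) hm s)

/-- Second weak derivatives are weak derivatives of the first ones: compare the two defining
identities and commute the derivatives on the smooth test function. -/
lemma MemSobolev.integral_grad_mul_pd {K : ℕ} (hu : MemSobolev Ω K u) (hK : 2 ≤ K)
    (l i : Fin d) {θ : E d → ℝ} (hθ : IsTestFunction Ω θ) :
    ∫ x in Ω, derivFamily Ω u 1 (fun _ => l) x * pd i θ x =
      -∫ x in Ω, derivFamily Ω u 2 (Fin.snoc (fun _ : Fin 1 => i) l) x * θ x := by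
  have h1 := (hu.hasWeakDeriv (by omega) (fun _ : Fin 1 => l)).2 _ (hθ.pd i)
  have h2 := (hu.hasWeakDeriv hK (Fin.snoc (fun _ : Fin 1 => i) l)).2 _ hθ
  rw [← partialD_pd (fun _ : Fin 1 => i) l hθ.1, partialD_one, pd_comm hθ.1, ← partialD_one l, h1]
    at h2
  linarith

/-- The equation holds almost everywhere for a solution in `H²`. -/
lemma IsWeakSolution.ae_eq (hΩ : IsOpen Ω) {f : E d → ℝ} (hf : MemLp f 2 (volume.restrict Ω))
    (h : IsWeakSolution Ω f u) {K : ℕ} (hu : MemSobolev Ω K u) (hK : 2 ≤ K) :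
    f =ᵐ[volume.restrict Ω]
      fun x => -∑ l, derivFamily Ω u 2 (Fin.snoc (fun _ : Fin 1 => l) l) x := by
  have h2 : ∀ l, MemLp (derivFamily Ω u 2 (Fin.snoc (fun _ : Fin 1 => l) l)) 2
      (volume.restrict Ω) := fun l => (hu.hasWeakDeriv hK _).1
  refine ae_eq_of_integral_mul_test hΩ hf (memLp_neg (memLp_finsetSum _ fun l _ => h2 l))
    fun φ hφ => ?_
  -- Test functions lie in `H_0^1`, so the weak formulation applies to them; moving the remaining
  -- derivative onto `u` identifies `f` with minus the trace of the weak Hessian.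
  rw [← h.2 φ hφ.memH10]
  have h3 : ∀ l : Fin d, weakPartial Ω l φ =ᵐ[volume.restrict Ω] pd l φ := fun l =>
    (hasWeakDeriv_weakDeriv ⟨_, hφ.hasWeakDeriv l⟩).ae_eq hΩ (hφ.hasWeakDeriv l)
  have h4 : ∫ x in Ω, ∑ l, weakPartial Ω l u x * weakPartial Ω l φ x =
      ∫ x in Ω, ∑ l, derivFamily Ω u 1 (fun _ => l) x * pd l φ x := by
    refine integral_congr_ae ?_
    filter_upwards [ae_all_iff.2 h3] with x hx
    refine Finset.sum_congr rfl fun l _ => ?_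
    rw [hx l]; rfl
  rw [h4, integral_finsetSum _ fun l _ => integrable_mul_of_memLp
    (hu.hasWeakDeriv (by omega) _).1 (hφ.pd l).memLp]
  simp_rw [neg_mul, Finset.sum_mul]
  rw [integral_neg, integral_finsetSum _ fun l _ => integrable_mul_of_memLp (h2 l) hφ.memLp,
    ← Finset.sum_neg_distrib]
  exact Finset.sum_congr rfl fun l _ => hu.integral_grad_mul_pd hK l l hφ

namespace PolytopalMesh
variable (M : PolytopalMesh Ω)

lemma exists_sobApprox (hΩo : IsOpen Ω) (hΩ : interior (closure Ω) = Ω) {K : ℕ}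
    (hu : MemSobolev Ω K u) {i : Fin M.numCells} {h γ : ℝ} (hT : Fat (M.cell i) h γ)
    (hγ : 0 < γ) : ∃ φ, SobApprox (M.cell i) K (derivFamily Ω u) φ := by
  obtain ⟨φ, h1, h2⟩ := exists_smooth_approx (M := K) hΩo.measurableSet hT hγ
    (by rw [ConvexPolytope.interior_carrier]; exact M.inner'_subset hΩ i)
    (fun m hm s => hu.hasWeakDeriv hm s) hu.1
  exact ⟨φ, h1, fun m hm s => M.memLp_vol_of_restrict hΩ (hu.hasWeakDeriv hm s).1 i, h2⟩

/-- The trace of an `H_0^1(Ω)` function on `∂Ω` vanishes. -/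
lemma trace_eq_zero (hΩo : IsOpen Ω) (hΩ : interior (closure Ω) = Ω) (hu : MemH10 Ω u)
    {i : Fin M.numCells} {h γ : ℝ} (hT : Fat (M.cell i) h γ) (hγ : 0 < γ)
    {a : Fin (M.cell i).numFacets} (ha : (M.cell i).facet a ⊆ frontier Ω) :
    (M.cell i).trace a u =ᵐ[(M.cell i).surface a] 0 := by
  obtain ⟨hm, φ, hφ, hφu, hd⟩ := hu
  choose g hg hgt using hd
  have hres : ∀ {ψ : ℕ → E d → ℝ} {w : E d → ℝ}, (∀ r, MemLp (ψ r) 2 (volume.restrict Ω)) →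
      MemLp w 2 (volume.restrict Ω) → TendstoL2 (volume.restrict Ω) ψ w →
      Tendsto (fun r => l2 (M.cell i).vol (fun x => ψ r x - w x)) atTop (𝓝 0) := by
    intro ψ w h1 h2 h3
    refine TendstoL2.tendsto_l2 (φ := ψ) ?_ (fun r => M.memLp_vol_of_restrict hΩ (h1 r) i)
      (M.memLp_vol_of_restrict hΩ h2 i)
    exact tendsto_of_tendsto_of_tendsto_of_le_of_le tendsto_const_nhds h3 (fun _ => zero_le)
      fun r => eLpNorm_mono_measure _ (M.vol_le hΩ i)
  -- The test functions approximating `u` serve as the smooth approximations on the element, and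
  -- they vanish identically on `∂Ω`.
  have H : H1Approx (M.cell i) u g φ :=
    ⟨fun r => (hφ r).1, M.memLp_vol_of_restrict hΩ hm i,
      fun l => M.memLp_vol_of_restrict hΩ (hg l) i, hres (fun r => (hφ r).memLp) hm hφu,
      fun l => hres (fun r => ((hφ r).pd l).memLp) (hg l) (by simpa only [partialD_one] using hgt l)⟩
  refine H.trace_eq hT hγ a (t := 0) MemLp.zero ?_
  have : ∀ r, l2 ((M.cell i).surface a) (fun x => φ r x - (0 : E d → ℝ) x) = 0 := by
    intro r
    rw [l2_congr (g := fun _ => 0)]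
    · simp [l2]
    · filter_upwards [(M.cell i).surface_ae_mem a] with x hx
      rw [(hφ r).eq_zero_of_mem_frontier hΩo (ha hx)]
      simp
  simp_rw [this]
  exact tendsto_const_nhds

end PolytopalMesh

end
end ConformingDG

/-! ### Facets, partners and averages -/

namespace ConformingDG
noncomputable section

variable {d : ℕ} {Ω : Set (E d)}

namespace PolytopalMesh
variable (M : PolytopalMesh Ω)

/-- The edges/faces of all elements; an interior one appears twice. -/
abbrev Face := Σ i, Fin (M.cell i).numFacets

variable {M} in
/-- The edge/face lies on `∂Ω`. -/
def Face.OnBoundary (x : M.Face) : Prop := (M.cell x.1).facet x.2 ⊆ frontier Ω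

/-- Surface measure on an edge/face. -/
abbrev surf (x : M.Face) : Measure (E d) := (M.cell x.1).surface x.2

/-- Trace from the element to which the edge/face belongs. -/
abbrev tr (v : E d → ℝ) (x : M.Face) : E d → ℝ := (M.cell x.1).trace x.2 v

/-- Letting a boundary facet be its own partner gives a map on all facets, which turns out to be an
involution; sums over facets can then be reindexed. -/
lemma exists_partner (x : M.Face) : ∃ y : M.Face,
    (M.cell y.1).facet y.2 = (M.cell x.1).facet x.2 ∧ (x.OnBoundary → y = x) ∧
      (¬ x.OnBoundary → y ≠ x) := by
  by_cases hx : x.OnBoundary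
  · exact ⟨x, rfl, fun _ => rfl, fun h => absurd hx h⟩
  · obtain ⟨j, hj, b, hb⟩ := (M.conforming x.1 x.2).resolve_left hx
    refine ⟨⟨j, b⟩, hb, fun h => absurd h hx, fun _ h => hj ?_⟩
    rw [← h]

/-- The same edge/face seen from the other side; an edge/face on `∂Ω` is its own partner. -/
def partner (x : M.Face) : M.Face := (M.exists_partner x).choose

lemma facet_partner (x : M.Face) :
    (M.cell (M.partner x).1).facet (M.partner x).2 = (M.cell x.1).facet x.2 :=
  (M.exists_partner x).choose_spec.1

lemma partner_of_onBoundary {x : M.Face} (hx : x.OnBoundary) : M.partner x = x :=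
  (M.exists_partner x).choose_spec.2.1 hx

lemma partner_ne {x : M.Face} (hx : ¬ x.OnBoundary) : M.partner x ≠ x :=
  (M.exists_partner x).choose_spec.2.2 hx

lemma onBoundary_partner {x : M.Face} : (M.partner x).OnBoundary ↔ x.OnBoundary := by
  rw [Face.OnBoundary, Face.OnBoundary, M.facet_partner]

lemma partner_partner (x : M.Face) : M.partner (M.partner x) = x := by
  by_cases hx : x.OnBoundary
  · rw [M.partner_of_onBoundary hx, M.partner_of_onBoundary hx]
  · by_contra h
    have h1 : M.partner (M.partner x) ≠ M.partner x :=
      M.partner_ne fun h => hx (M.onBoundary_partner.1 h)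
    exact h (M.eq_of_facet_eq (M.facet_partner _) (M.facet_partner x).symm h1
      (M.partner_ne hx).symm)

lemma sum_partner {β : Type*} [AddCommMonoid β] (F : M.Face → β) :
    ∑ x, F (M.partner x) = ∑ x, F x :=
  Equiv.sum_comp (Function.Involutive.toPerm M.partner M.partner_partner) F

lemma surf_partner (x : M.Face) : M.surf (M.partner x) = M.surf x :=
  ConvexPolytope.surface_eq_of_facet_eq (M.facet_partner x)

/-- The diameter of an element. -/
abbrev cellDiam (i : Fin M.numCells) : ℝ := Metric.diam (M.cell i).carrier

/-- The common facet has diameter at least `κ` times that of one element and is contained in the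
other, so neighbours have comparable size. -/
lemma cellDiam_partner {ρ κ α : ℝ} (hM : M.ShapeRegular ρ κ α) (x : M.Face) :
    κ * M.cellDiam x.1 ≤ M.cellDiam (M.partner x).1 := by
  refine ((hM x.1).2.1 x.2).2.trans ?_
  rw [← M.facet_partner]
  exact Metric.diam_mono (ConvexPolytope.facet_subset _ _)
    (ConvexPolytope.isCompact_carrier _).isBounded

lemma cellDiam_le (i : Fin M.numCells) : M.cellDiam i ≤ M.meshSize :=
  le_ciSup (f := fun i => M.cellDiam i) (Set.finite_range _).bddAbove i

/-- Exactly two facets of the mesh coincide with an interior facet as sets, so the sum in the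
definition has two nonzero conditions. -/
lemma average_of_interior (c : BoundaryCase) (v : E d → ℝ) {x : M.Face} (hx : ¬ x.OnBoundary) :
    M.average c v x.1 x.2 = fun y => (1 / 2 : ℝ) * (M.tr v x y + M.tr v (M.partner x) y) := by
  have hx' : ¬ (M.cell x.1).facet x.2 ⊆ frontier Ω := hx
  unfold average
  rw [if_neg hx']
  ext y
  congr 1
  rw [← Fintype.sum_sigma' (fun j b =>
    if (M.cell j).facet b = (M.cell x.1).facet x.2 then (M.cell j).trace b v y else 0)]
  rw [Finset.sum_eq_add x (M.partner x) (M.partner_ne hx).symm]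
  · rw [if_pos rfl, if_pos (M.facet_partner x)]
  · intro z _ hz
    rw [if_neg]
    intro h
    exact hz.2 (M.eq_of_facet_eq h (M.facet_partner x) hz.1 (M.partner_ne hx))
  · simp
  · simp

lemma average_partner (c : BoundaryCase) (v : E d → ℝ) (x : M.Face) :
    M.average c v (M.partner x).1 (M.partner x).2 = M.average c v x.1 x.2 := by
  by_cases hx : x.OnBoundary
  · rw [M.partner_of_onBoundary hx]
  · rw [M.average_of_interior c v hx,
      M.average_of_interior c v (fun h => hx (M.onBoundary_partner.1 h)), M.partner_partner]
    ext y
    ring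

lemma average_strong_of_onBoundary (v : E d → ℝ) {x : M.Face} (hx : x.OnBoundary) :
    M.average .strong v x.1 x.2 = M.tr v x := by
  have hx' : (M.cell x.1).facet x.2 ⊆ frontier Ω := hx
  rw [average, if_pos hx']

lemma average_weak_of_onBoundary (v : E d → ℝ) {x : M.Face} (hx : x.OnBoundary) :
    M.average .weak v x.1 x.2 = 0 := by
  have hx' : (M.cell x.1).facet x.2 ⊆ frontier Ω := hx
  rw [average, if_pos hx']

/-- `v` belongs to `H¹` of every element. -/
def CellH1 (v : E d → ℝ) : Prop := ∀ i, ∃ g φ, H1Approx (M.cell i) v g φ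

/-- Every element is fat relative to its diameter. -/
def IsFat (γ : ℝ) : Prop := ∀ i, Fat (M.cell i) (M.cellDiam i) γ

variable {M} {γ : ℝ} {v w : E d → ℝ}

lemma CellH1.sub (hv : M.CellH1 v) (hw : M.CellH1 w) : M.CellH1 (fun x => v x - w x) := fun i => by
  obtain ⟨g, φ, H⟩ := hv i
  obtain ⟨g', φ', H'⟩ := hw i
  exact ⟨_, _, H.sub H'⟩

lemma CellH1.memLp (hv : M.CellH1 v) (i : Fin M.numCells) : MemLp v 2 (M.cell i).vol := by
  obtain ⟨g, φ, H⟩ := hv i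
  exact H.memv

lemma CellH1.memLp_tr (hv : M.CellH1 v) (hM : M.IsFat γ) (hγ : 0 < γ) (x : M.Face) :
    MemLp (M.tr v x) 2 (M.surf x) := by
  obtain ⟨g, φ, H⟩ := hv x.1
  exact H.memLp_trace (hM x.1) hγ x.2

lemma CellH1.memLp_tr_partner (hv : M.CellH1 v) (hM : M.IsFat γ) (hγ : 0 < γ) (x : M.Face) :
    MemLp (M.tr v (M.partner x)) 2 (M.surf x) := by
  rw [← M.surf_partner]
  exact hv.memLp_tr hM hγ _

lemma CellH1.tr_sub (hv : M.CellH1 v) (hw : M.CellH1 w) (hM : M.IsFat γ) (hγ : 0 < γ)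
    (x : M.Face) : M.tr (fun x => v x - w x) x =ᵐ[M.surf x] fun y => M.tr v x y - M.tr w x y := by
  obtain ⟨g, φ, H⟩ := hv x.1
  obtain ⟨g', φ', H'⟩ := hw x.1
  exact H.trace_sub H' (hM x.1) hγ x.2

lemma CellH1.memLp_average (hv : M.CellH1 v) (hM : M.IsFat γ) (hγ : 0 < γ) (c : BoundaryCase)
    (x : M.Face) : MemLp (M.average c v x.1 x.2) 2 (M.surf x) := by
  by_cases hx : x.OnBoundary
  · cases c with
    | strong => rw [M.average_strong_of_onBoundary v hx]; exact hv.memLp_tr hM hγ x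
    | weak => rw [M.average_weak_of_onBoundary v hx]; exact MemLp.zero
  · rw [M.average_of_interior c v hx]
    exact (memLp_add (hv.memLp_tr hM hγ x) (hv.memLp_tr_partner hM hγ x)).const_mul _

lemma CellH1.average_sub (hv : M.CellH1 v) (hw : M.CellH1 w) (hM : M.IsFat γ) (hγ : 0 < γ)
    (c : BoundaryCase) (x : M.Face) : M.average c (fun x => v x - w x) x.1 x.2 =ᵐ[M.surf x]
      fun y => M.average c v x.1 x.2 y - M.average c w x.1 x.2 y := by
  by_cases hx : x.OnBoundary
  · cases c with
    | strong => simp only [M.average_strong_of_onBoundary _ hx]; exact hv.tr_sub hw hM hγ x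
    | weak => simp only [M.average_weak_of_onBoundary _ hx, Pi.zero_apply, sub_zero]; rfl
  · simp only [M.average_of_interior c _ hx]
    have h1 := hv.tr_sub hw hM hγ (M.partner x)
    rw [M.surf_partner] at h1
    filter_upwards [hv.tr_sub hw hM hγ x, h1] with y h2 h3
    rw [h2, h3]
    ring

/-- The difference of the trace and the average, in `L²` of the edge/face. -/
lemma CellH1.l2_tr_sub_average_sq_le (hv : M.CellH1 v) (hM : M.IsFat γ) (hγ : 0 < γ)
    (c : BoundaryCase) (x : M.Face) :
    l2 (M.surf x) (fun y => M.tr v x y - M.average c v x.1 x.2 y) ^ 2 ≤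
      l2 (M.surf x) (M.tr v x) ^ 2 + l2 (M.surf (M.partner x)) (M.tr v (M.partner x)) ^ 2 := by
  have h0 : 0 ≤ l2 (M.surf (M.partner x)) (M.tr v (M.partner x)) ^ 2 := sq_nonneg _
  by_cases hx : x.OnBoundary
  · cases c with
    | strong =>
      rw [M.average_strong_of_onBoundary _ hx]
      have : l2 (M.surf x) (fun y => M.tr v x y - M.tr v x y) = 0 := by simp [l2]
      rw [this]
      nlinarith [sq_nonneg (l2 (M.surf x) (M.tr v x))]
    | weak =>
      rw [M.average_weak_of_onBoundary _ hx]
      simp only [Pi.zero_apply, sub_zero]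
      linarith
  · rw [M.average_of_interior c _ hx, M.surf_partner]
    have e : (fun y => M.tr v x y - (1 / 2 : ℝ) * (M.tr v x y + M.tr v (M.partner x) y)) =
        fun y => (1 / 2 : ℝ) * (M.tr v x y - M.tr v (M.partner x) y) := by
      ext y; ring
    rw [e, l2_const_mul, mul_pow]
    have := l2_sub_sq_le (hv.memLp_tr hM hγ x) (hv.memLp_tr_partner hM hγ x)
    norm_num
    nlinarith [sq_nonneg (l2 (M.surf x) (M.tr v x)),
      sq_nonneg (l2 (M.surf x) (M.tr v (M.partner x)))]

end PolytopalMesh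

end
end ConformingDG

/-! ### Existence and linearity of the weak gradient -/

namespace ConformingDG
noncomputable section

variable {d : ℕ} {Ω : Set (E d)}

namespace PolytopalMesh
variable {M : PolytopalMesh Ω} {γ : ℝ} {v w : E d → ℝ}

/-- Riesz representation, one component at a time; elementwise `H¹` regularity makes the functionals
finite and linear. -/
lemma CellH1.exists_isWeakGradient (hv : M.CellH1 v) (hM : M.IsFat γ) (hγ : 0 < γ)
    (c : BoundaryCase) (i : Fin M.numCells) (j : ℕ) : ∃ G, M.IsWeakGradient c v i j G := by
  have mv := hv.memLp i
  have ma : ∀ a, MemLp (M.average c v i a) 2 ((M.cell i).surface a) :=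
    fun a => hv.memLp_average hM hγ c ⟨i, a⟩
  have iv : ∀ q : MvPolynomial (Fin d) ℝ, Integrable (fun x => v x * pval q x) (M.cell i).vol :=
    fun q => integrable_mul_of_memLp mv ((M.cell i).memLp_vol (continuous_pval q))
  have ia : ∀ a (q : MvPolynomial (Fin d) ℝ),
      Integrable (fun x => M.average c v i a x * pval q x) ((M.cell i).surface a) :=
    fun a q => integrable_mul_of_memLp (ma a) ((M.cell i).memLp_surface (continuous_pval q) a)
  let ℓ : Fin d → MvPolynomial (Fin d) ℝ →ₗ[ℝ] ℝ := fun l =>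
    { toFun := fun q => -(∫ x, v x * pval (MvPolynomial.pderiv l q) x ∂(M.cell i).vol) +
        ∑ a, (M.cell i).outward a l *
          ∫ x, M.average c v i a x * pval q x ∂((M.cell i).surface a)
      map_add' := fun p q => by
        simp only [map_add, pval_add, mul_add]
        rw [integral_add (iv _) (iv _)]
        simp_rw [fun a => integral_add (ia a p) (ia a q), mul_add, Finset.sum_add_distrib]
        ring
      map_smul' := fun r q => by
        have h1 : ∀ (p : MvPolynomial (Fin d) ℝ) x, pval (r • p) x = r * pval p x := fun p x => by
          simp [pval, MvPolynomial.smul_eval]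
        simp only [Derivation.map_smul, h1, RingHom.id_apply, smul_eq_mul]
        simp_rw [mul_left_comm _ r, integral_const_mul, mul_left_comm _ r, ← Finset.mul_sum]
        ring }
  choose G hG hG2 using fun l => (M.cell i).exists_poly_riesz j (ℓ l)
  refine ⟨G, hG, fun q hq => ?_⟩
  rw [integral_finsetSum _ fun l _ => integrable_mul_of_memLp
    ((M.cell i).memLp_vol (continuous_pval (G l))) ((M.cell i).memLp_vol (continuous_pval (q l)))]
  rw [Finset.sum_congr rfl fun l _ => hG2 l (q l) (hq l)]
  simp only [ℓ, LinearMap.coe_mk, AddHom.coe_mk, Finset.sum_add_distrib, Finset.sum_neg_distrib]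
  congr 1
  · congr 1
    simp only [pdiv, pval_sum, Finset.mul_sum]
    rw [integral_finsetSum _ fun l _ => iv _]
  · rw [Finset.sum_comm]
    refine Finset.sum_congr rfl fun a _ => ?_
    simp only [Finset.mul_sum, ← mul_assoc]
    rw [integral_finsetSum _ fun l _ => (ia a (q l)).mul_const _]
    refine Finset.sum_congr rfl fun l _ => ?_
    rw [integral_mul_const, mul_comm]

variable (M) in
/-- The components of the weak gradient as functions. -/
def wgrad (c : BoundaryCase) (j : ℕ) (v : E d → ℝ) (i : Fin M.numCells) (l : Fin d) : E d → ℝ :=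
  pval (M.weakGradient c v i j l)

lemma isWeakGradient_weakGradient {c : BoundaryCase} {i : Fin M.numCells} {j : ℕ}
    (h : ∃ G, M.IsWeakGradient c v i j G) :
    M.IsWeakGradient c v i j (M.weakGradient c v i j) := by
  unfold weakGradient
  rw [dif_pos h]
  exact h.choose_spec

lemma CellH1.isPoly_wgrad (hv : M.CellH1 v) (hM : M.IsFat γ) (hγ : 0 < γ)
    (c : BoundaryCase) (j : ℕ) (i : Fin M.numCells) (l : Fin d) :
    IsPoly j (M.wgrad c j v i l) :=
  ⟨_, (isWeakGradient_weakGradient (hv.exists_isWeakGradient hM hγ c i j)).1 l, rfl⟩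

lemma continuous_wgrad (c : BoundaryCase) (j : ℕ) (v : E d → ℝ) (i : Fin M.numCells) (l : Fin d) :
    Continuous (M.wgrad c j v i l) := continuous_pval _

lemma memLp_wgrad (c : BoundaryCase) (j : ℕ) (v : E d → ℝ) (i : Fin M.numCells) (l : Fin d) :
    MemLp (M.wgrad c j v i l) 2 (M.cell i).vol :=
  (M.cell i).memLp_vol (continuous_wgrad c j v i l)

/-- The weak gradient compared with the gradient. -/
lemma CellH1.integral_wgrad (hv : M.CellH1 v) (hM : M.IsFat γ) (hγ : 0 < γ)
    (c : BoundaryCase) (j : ℕ) {i : Fin M.numCells} {g : Fin d → E d → ℝ} {φ : ℕ → E d → ℝ}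
    (H : H1Approx (M.cell i) v g φ) {q : Fin d → E d → ℝ} (hq : ∀ l, IsPoly j (q l)) :
    ∫ x, ∑ l, M.wgrad c j v i l x * q l x ∂(M.cell i).vol =
      ∫ x, ∑ l, g l x * q l x ∂(M.cell i).vol -
        ∑ a, ∫ x, (M.tr v ⟨i, a⟩ x - M.average c v i a x) *
          ∑ l, q l x * (M.cell i).outward a l ∂((M.cell i).surface a) := by
  have hc : ∀ l, Continuous (q l) := fun l => (hq l).continuous
  have h1 : ∀ l, ∫ x, g l x * q l x ∂(M.cell i).vol =
      ∑ a, (M.cell i).outward a l * ∫ x, M.tr v ⟨i, a⟩ x * q l x ∂((M.cell i).surface a) -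
        ∫ x, v x * pd l (q l) x ∂(M.cell i).vol := fun l => by
    have := H.green (hM i) hγ ((hq l).contDiff) l
    linarith
  choose p hp hp2 using hq
  have h2 := (isWeakGradient_weakGradient (hv.exists_isWeakGradient hM hγ c i j)).2 p hp
  have ma : ∀ a, MemLp (M.average c v i a) 2 ((M.cell i).surface a) :=
    fun a => hv.memLp_average hM hγ c ⟨i, a⟩
  have mt : ∀ a, MemLp (M.tr v ⟨i, a⟩) 2 ((M.cell i).surface a) :=
    fun a => hv.memLp_tr hM hγ ⟨i, a⟩
  have mq : ∀ a l, MemLp (q l) 2 ((M.cell i).surface a) :=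
    fun a l => (M.cell i).memLp_surface (hc l) a
  have mqs : ∀ a, MemLp (fun x => ∑ l, q l x * (M.cell i).outward a l) 2
      ((M.cell i).surface a) := fun a =>
    (M.cell i).memLp_surface (continuous_finsetSum _ fun l _ => (hc l).mul continuous_const) a
  simp only [← fun l => congrFun (hp2 l)] at h2
  change ∫ x, ∑ l, M.wgrad c j v i l x * q l x ∂(M.cell i).vol = _ at h2
  rw [h2, integral_finsetSum _ fun l _ => integrable_mul_of_memLp (H.memg l)
    ((M.cell i).memLp_vol (hc l))]
  simp_rw [h1, Finset.sum_sub_distrib, sub_mul]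
  have e1 : ∫ x in (M.cell i).carrier, v x * pval (pdiv p) x =
      ∑ l, ∫ x, v x * pd l (q l) x ∂(M.cell i).vol := by
    rw [← integral_finsetSum _ fun l _ => integrable_mul_of_memLp H.memv
      ((M.cell i).memLp_vol (by rw [hp2 l, pd_pval]; exact continuous_pval _))]
    refine integral_congr_ae (Eventually.of_forall fun x => ?_)
    simp only [pdiv, pval_sum, Finset.mul_sum, hp2, pd_pval]
  have e2 : ∀ a, ∫ x, M.tr v ⟨i, a⟩ x * (∑ l, q l x * (M.cell i).outward a l) -
      M.average c v i a x * (∑ l, q l x * (M.cell i).outward a l) ∂((M.cell i).surface a) =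
      ∑ l, (M.cell i).outward a l * ∫ x, M.tr v ⟨i, a⟩ x * q l x ∂((M.cell i).surface a) -
      ∫ x, M.average c v i a x * (∑ l, q l x * (M.cell i).outward a l)
        ∂((M.cell i).surface a) := fun a => by
    rw [integral_sub (integrable_mul_of_memLp (mt a) (mqs a))
      (integrable_mul_of_memLp (ma a) (mqs a))]
    congr 1
    simp only [Finset.mul_sum, ← mul_assoc]
    rw [integral_finsetSum _ fun l _ => (integrable_mul_of_memLp (mt a) (mq a l)).mul_const _]
    refine Finset.sum_congr rfl fun l _ => ?_
    rw [integral_mul_const, mul_comm]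
  simp_rw [e2, Finset.sum_sub_distrib]
  rw [e1, Finset.sum_comm (s := (Finset.univ : Finset (Fin d)))]
  ring

/-- The weak gradient is obtained by choice, so linearity is a matter of uniqueness. The defect `D`
is a polynomial field orthogonal to all admissible fields, and it is tested against itself. -/
lemma CellH1.wgrad_sub (hv : M.CellH1 v) (hw : M.CellH1 w) (hM : M.IsFat γ) (hγ : 0 < γ)
    (c : BoundaryCase) (j : ℕ) (i : Fin M.numCells) (l : Fin d) :
    M.wgrad c j (fun x => v x - w x) i l =ᵐ[(M.cell i).vol]
      fun x => M.wgrad c j v i l x - M.wgrad c j w i l x := by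
  obtain ⟨g, φ, H⟩ := hv i
  obtain ⟨g', φ', H'⟩ := hw i
  set D : Fin d → E d → ℝ := fun l x =>
    M.wgrad c j (fun x => v x - w x) i l x - (M.wgrad c j v i l x - M.wgrad c j w i l x) with hD
  have pD : ∀ l, IsPoly j (D l) := fun l => ((hv.sub hw).isPoly_wgrad hM hγ c j i l).sub
    ((hv.isPoly_wgrad hM hγ c j i l).sub (hw.isPoly_wgrad hM hγ c j i l))
  have mD : ∀ l, MemLp (D l) 2 (M.cell i).vol := fun l => (M.cell i).memLp_vol (pD l).continuous
  have mDs : ∀ a, MemLp (fun x => ∑ l, D l x * (M.cell i).outward a l) 2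
      ((M.cell i).surface a) := fun a => (M.cell i).memLp_surface
    (continuous_finsetSum _ fun l _ => (pD l).continuous.mul continuous_const) a
  have e1 := (hv.sub hw).integral_wgrad hM hγ c j (H.sub H') pD
  have e2 := hv.integral_wgrad hM hγ c j H pD
  have e3 := hw.integral_wgrad hM hγ c j H' pD
  have is : ∀ {F : Fin d → E d → ℝ}, (∀ l, MemLp (F l) 2 (M.cell i).vol) →
      Integrable (fun x => ∑ l, F l x * D l x) (M.cell i).vol := fun hF =>
    integrable_finsetSum _ fun l _ => integrable_mul_of_memLp (hF l) (mD l)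
  have e4 : ∫ x, ∑ l, (g l x - g' l x) * D l x ∂(M.cell i).vol =
      ∫ x, ∑ l, g l x * D l x ∂(M.cell i).vol - ∫ x, ∑ l, g' l x * D l x ∂(M.cell i).vol := by
    rw [← integral_sub (is H.memg) (is H'.memg)]
    simp only [sub_mul, Finset.sum_sub_distrib]
  have e5 : ∀ a, ∫ x, (M.tr (fun x => v x - w x) ⟨i, a⟩ x - M.average c (fun x => v x - w x) i a x) *
      ∑ l, D l x * (M.cell i).outward a l ∂((M.cell i).surface a) =
      ∫ x, (M.tr v ⟨i, a⟩ x - M.average c v i a x) *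
        ∑ l, D l x * (M.cell i).outward a l ∂((M.cell i).surface a) -
      ∫ x, (M.tr w ⟨i, a⟩ x - M.average c w i a x) *
        ∑ l, D l x * (M.cell i).outward a l ∂((M.cell i).surface a) := fun a => by
    rw [← integral_sub
      (integrable_mul_of_memLp (memLp_sub (hv.memLp_tr hM hγ ⟨i, a⟩)
        (hv.memLp_average hM hγ c ⟨i, a⟩)) (mDs a))
      (integrable_mul_of_memLp (memLp_sub (hw.memLp_tr hM hγ ⟨i, a⟩)
        (hw.memLp_average hM hγ c ⟨i, a⟩)) (mDs a))]
    refine integral_congr_ae ?_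
    filter_upwards [hv.tr_sub hw hM hγ ⟨i, a⟩, hv.average_sub hw hM hγ c ⟨i, a⟩] with x h1 h2
    rw [h1, h2]
    ring
  have e6 : ∫ x, ∑ l, D l x * D l x ∂(M.cell i).vol = 0 := by
    have : ∫ x, ∑ l, D l x * D l x ∂(M.cell i).vol =
        ∫ x, ∑ l, M.wgrad c j (fun x => v x - w x) i l x * D l x ∂(M.cell i).vol -
        (∫ x, ∑ l, M.wgrad c j v i l x * D l x ∂(M.cell i).vol -
          ∫ x, ∑ l, M.wgrad c j w i l x * D l x ∂(M.cell i).vol) := by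
      rw [← integral_sub (is (memLp_wgrad c j v i)) (is (memLp_wgrad c j w i)),
        ← integral_sub (is (memLp_wgrad c j _ i))
          (show Integrable (fun x => ∑ l, M.wgrad c j v i l x * D l x -
            ∑ l, M.wgrad c j w i l x * D l x) (M.cell i).vol from
            (is (memLp_wgrad c j v i)).sub (is (memLp_wgrad c j w i)))]
      refine integral_congr_ae (Eventually.of_forall fun x => ?_)
      simp only [← Finset.sum_sub_distrib]
      refine Finset.sum_congr rfl fun l _ => ?_
      rw [← sub_mul, ← sub_mul]
    rw [this, e1, e2, e3, e4, Finset.sum_congr rfl fun a _ => e5 a, Finset.sum_sub_distrib]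
    ring
  rw [integral_finsetSum _ fun l _ => integrable_mul_of_memLp (mD l) (mD l)] at e6
  have e7 : ∑ l, l2 (M.cell i).vol (D l) ^ 2 = 0 := by
    rw [← e6]
    refine Finset.sum_congr rfl fun l _ => ?_
    rw [l2_sq]
    simp only [sq]
  have e8 := (Finset.sum_eq_zero_iff_of_nonneg fun l _ => sq_nonneg _).1 e7 l (Finset.mem_univ l)
  have e9 := (l2_eq_zero_iff (mD l)).1 (pow_eq_zero_iff two_ne_zero |>.1 e8)
  filter_upwards [e9] with x hx
  exact sub_eq_zero.1 hx

end PolytopalMesh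

end
end ConformingDG

/-! ### Stability of the weak gradient -/

namespace ConformingDG
noncomputable section

variable {d : ℕ}

lemma abs_integral_sum_mul_le {μ : Measure (E d)} {F G : Fin d → E d → ℝ}
    (hF : ∀ l, MemLp (F l) 2 μ) (hG : ∀ l, MemLp (G l) 2 μ) :
    |∫ x, ∑ l, F l x * G l x ∂μ| ≤ ∑ l, l2 μ (F l) * l2 μ (G l) := by
  rw [integral_finsetSum _ fun l _ => integrable_mul_of_memLp (hF l) (hG l)]
  exact (Finset.abs_sum_le_sum_abs _ _).trans
    (Finset.sum_le_sum fun l _ => abs_integral_mul_le (hF l) (hG l))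

lemma ConvexPolytope.abs_integral_flux_le (T : ConvexPolytope d) (a : Fin T.numFacets)
    {m : E d → ℝ} {q : Fin d → E d → ℝ} (hm : MemLp m 2 (T.surface a))
    (hq : ∀ l, MemLp (q l) 2 (T.surface a)) :
    |∫ x, m x * ∑ l, q l x * T.outward a l ∂(T.surface a)| ≤
      l2 (T.surface a) m * ∑ l, l2 (T.surface a) (q l) := by
  have h1 : ∀ l, MemLp (fun x => m x * T.outward a l) 2 (T.surface a) := fun l => hm.mul_const _
  have h2 := abs_integral_sum_mul_le h1 hq
  have h3 : ∀ x, m x * ∑ l, q l x * T.outward a l = ∑ l, m x * T.outward a l * q l x := fun x => by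
    rw [Finset.mul_sum]
    exact Finset.sum_congr rfl fun l _ => by ring
  simp_rw [h3]
  refine h2.trans ?_
  rw [Finset.mul_sum]
  refine Finset.sum_le_sum fun l _ => mul_le_mul_of_nonneg_right ?_ l2_nonneg
  have h4 : (fun x => m x * T.outward a l) = fun x => T.outward a l * m x := by
    ext x; ring
  rw [h4, l2_const_mul]
  exact mul_le_of_le_one_left l2_nonneg (abs_outward_le_one T a l)

lemma mul_le_add_div {x y s : ℝ} (hs : 0 < s) : x * y ≤ s * x ^ 2 + y ^ 2 / (4 * s) := by
  have h1 : s * x ^ 2 + y ^ 2 / (4 * s) - x * y = (2 * s * x - y) ^ 2 / (4 * s) := by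
    field_simp; ring
  have h2 : 0 ≤ (2 * s * x - y) ^ 2 / (4 * s) := by positivity
  linarith

/-- The field is tested with itself. Volume and facet terms each give up a quarter of its norm to
the left side, the facet terms by the discrete trace inequality. -/
lemma weak_gradient_le (d m N : ℕ) {γ : ℝ} (hγ : 0 < γ) (hγ1 : γ ≤ 1) :
    ∃ C, 0 < C ∧ ∀ (T : ConvexPolytope d) (h : ℝ), Fat T h γ → T.numFacets ≤ N →
      ∀ (D g : Fin d → E d → ℝ) (μ : Fin T.numFacets → E d → ℝ), (∀ l, IsPoly m (D l)) →
      (∀ l, MemLp (g l) 2 T.vol) → (∀ a, MemLp (μ a) 2 (T.surface a)) →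
      (∫ x, ∑ l, D l x * D l x ∂T.vol = ∫ x, ∑ l, g l x * D l x ∂T.vol -
        ∑ a, ∫ x, μ a x * ∑ l, D l x * T.outward a l ∂(T.surface a)) →
      ∑ l, l2 T.vol (D l) ^ 2 ≤
        C * (∑ l, l2 T.vol (g l) ^ 2 + h⁻¹ * ∑ a, l2 (T.surface a) (μ a) ^ 2) := by
  obtain ⟨C, hC, hpoly⟩ := fat_poly_l2 d m N hγ hγ1
  -- The Young parameter `L / h` leaves each facet the share `1 / (4 (N + 1))` of the norm; with at
  -- most `N` facets the shares add up to at most a quarter.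
  set L : ℝ := (N + 1) * C with hL
  have hL0 : 0 < L := by positivity
  refine ⟨2 + 2 * L * d, by positivity, fun T h hT hN D g μ hD hg hμ heq => ?_⟩
  have hh := hT.pos
  have mD : ∀ l, MemLp (D l) 2 T.vol := fun l => T.memLp_vol (hD l).continuous
  have mDs : ∀ a l, MemLp (D l) 2 (T.surface a) := fun a l => T.memLp_surface (hD l).continuous a
  set X := ∑ l, l2 T.vol (D l) ^ 2 with hX
  set G := ∑ l, l2 T.vol (g l) ^ 2 with hG
  set B := ∑ a, l2 (T.surface a) (μ a) ^ 2 with hB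
  have hX0 : 0 ≤ X := Finset.sum_nonneg fun _ _ => sq_nonneg _
  have hG0 : 0 ≤ G := Finset.sum_nonneg fun _ _ => sq_nonneg _
  have hB0 : 0 ≤ B := Finset.sum_nonneg fun _ _ => sq_nonneg _
  have e1 : ∫ x, ∑ l, D l x * D l x ∂T.vol = X := by
    rw [integral_finsetSum _ fun l _ => integrable_mul_of_memLp (mD l) (mD l)]
    refine Finset.sum_congr rfl fun l _ => ?_
    rw [l2_sq]
    simp only [sq]
  have e2 : |∫ x, ∑ l, g l x * D l x ∂T.vol| ≤ G + X / 4 := by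
    refine (abs_integral_sum_mul_le hg mD).trans ?_
    rw [hG, hX, Finset.sum_div, ← Finset.sum_add_distrib]
    refine Finset.sum_le_sum fun l _ => ?_
    nlinarith [sq_nonneg (l2 T.vol (g l) - l2 T.vol (D l) / 2)]
  have e3 : ∀ a, |∫ x, μ a x * ∑ l, D l x * T.outward a l ∂(T.surface a)| ≤
      L * d * h⁻¹ * l2 (T.surface a) (μ a) ^ 2 + X / (4 * (N + 1)) := by
    intro a
    refine (T.abs_integral_flux_le a (hμ a) (mDs a)).trans ?_
    have h1 : ∀ l, l2 (T.surface a) (μ a) * l2 (T.surface a) (D l) ≤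
        L * h⁻¹ * l2 (T.surface a) (μ a) ^ 2 + l2 T.vol (D l) ^ 2 / (4 * (N + 1)) := by
      intro l
      refine (mul_le_add_div (s := L * h⁻¹) (by positivity)).trans ?_
      have h2 := (hpoly T h hT hN (D l) (hD l)).2.2 a
      have h3 : l2 (T.surface a) (D l) ^ 2 / (4 * (L * h⁻¹)) =
          h * l2 (T.surface a) (D l) ^ 2 / (4 * L) := by field_simp
      rw [h3]
      have h4 : h * l2 (T.surface a) (D l) ^ 2 / (4 * L) ≤ C * l2 T.vol (D l) ^ 2 / (4 * L) := by
        gcongr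
      have h5 : C * l2 T.vol (D l) ^ 2 / (4 * L) = l2 T.vol (D l) ^ 2 / (4 * (N + 1)) := by
        rw [hL]; field_simp
      linarith
    rw [Finset.mul_sum]
    refine (Finset.sum_le_sum fun l _ => h1 l).trans (le_of_eq ?_)
    rw [Finset.sum_add_distrib, Finset.sum_const, Finset.card_univ, Fintype.card_fin, nsmul_eq_mul,
      hX, Finset.sum_div]
    ring
  have e4 : |∑ a, ∫ x, μ a x * ∑ l, D l x * T.outward a l ∂(T.surface a)| ≤
      L * d * h⁻¹ * B + X / 4 := by
    refine (Finset.abs_sum_le_sum_abs _ _).trans ((Finset.sum_le_sum fun a _ => e3 a).trans ?_)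
    rw [Finset.sum_add_distrib, ← Finset.mul_sum, Finset.sum_const, Finset.card_univ,
      Fintype.card_fin, nsmul_eq_mul]
    have h1 : (T.numFacets : ℝ) ≤ N + 1 := by
      have : (T.numFacets : ℝ) ≤ N := by exact_mod_cast hN
      linarith
    have h2 : (T.numFacets : ℝ) * (X / (4 * (N + 1))) ≤ (N + 1) * (X / (4 * (N + 1))) := by
      gcongr
    have h3 : ((N : ℝ) + 1) * (X / (4 * (N + 1))) = X / 4 := by field_simp
    linarith
  rw [e1] at heq
  have e5 := abs_le.1 e2
  have e6 := abs_le.1 e4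
  have hLB : 0 ≤ L * d * (h⁻¹ * B) := by positivity
  have hGL : 0 ≤ L * d * G := by positivity
  have hhB : 0 ≤ h⁻¹ * B := by positivity
  nlinarith

namespace PolytopalMesh

/-- Stability of the weak gradient in the broken `H¹` norm. -/
lemma exists_sum_wgrad_sq_le (d m N : ℕ) {γ κ : ℝ} (hγ : 0 < γ) (hγ1 : γ ≤ 1) (hκ : 0 < κ) :
    ∃ C, 0 < C ∧ ∀ (Ω : Set (E d)) (M : PolytopalMesh Ω) (ρ α : ℝ), M.ShapeRegular ρ κ α →
      M.IsFat γ → (∀ i, (M.cell i).numFacets ≤ N) →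
      ∀ (c : BoundaryCase) (j : Fin M.numCells → ℕ), (∀ i, j i ≤ m) → ∀ (v : E d → ℝ)
      (g : Fin M.numCells → Fin d → E d → ℝ), (∀ i, ∃ φ, H1Approx (M.cell i) v (g i) φ) →
      ∑ i, ∑ l, l2 (M.cell i).vol (M.wgrad c (j i) v i l) ^ 2 ≤
        C * ∑ i, ((M.cellDiam i)⁻¹ ^ 2 * l2 (M.cell i).vol v ^ 2 +
          ∑ l, l2 (M.cell i).vol (g i l) ^ 2) := by
  obtain ⟨C, hC, hbound⟩ := weak_gradient_le d m N hγ hγ1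
  set K : ℝ := (1 + κ⁻¹) * γ⁻¹ * (2 * d + 1) with hK
  have hK0 : 0 < K := by positivity
  refine ⟨C * (1 + K), by positivity, fun Ω M ρ α hM hF hN c j hj v g hg => ?_⟩
  have hv : M.CellH1 v := fun i => ⟨g i, hg i⟩
  choose φ H using hg
  have hh : ∀ i, 0 < M.cellDiam i := fun i => (hF i).pos
  set e : M.Face → ℝ := fun x => l2 (M.surf x) (M.tr v x) ^ 2 with he
  set δ : M.Face → ℝ := fun x =>
    l2 (M.surf x) (fun y => M.tr v x y - M.average c v x.1 x.2 y) ^ 2 with hδ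
  have he0 : ∀ x, 0 ≤ e x := fun x => sq_nonneg _
  have h1 : ∀ i, ∑ l, l2 (M.cell i).vol (M.wgrad c (j i) v i l) ^ 2 ≤
      C * (∑ l, l2 (M.cell i).vol (g i l) ^ 2 + (M.cellDiam i)⁻¹ * ∑ a, δ ⟨i, a⟩) := by
    intro i
    exact hbound (M.cell i) _ (hF i) (hN i) _ (g i)
      (fun a y => M.tr v ⟨i, a⟩ y - M.average c v i a y)
      (fun l => (hv.isPoly_wgrad hF hγ c (j i) i l).mono (hj i)) (H i).memg
      (fun a => memLp_sub (hv.memLp_tr hF hγ ⟨i, a⟩) (hv.memLp_average hF hγ c ⟨i, a⟩))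
      (hv.integral_wgrad hF hγ c (j i) (H i) fun l => hv.isPoly_wgrad hF hγ c (j i) i l)
  -- A jump also involves the trace from the neighbour. Reindexing by partners moves this
  -- contribution to its own element, and comparing diameters costs `κ⁻¹`.
  have h2 : ∑ i, (M.cellDiam i)⁻¹ * ∑ a, δ ⟨i, a⟩ ≤
      (1 + κ⁻¹) * ∑ i, (M.cellDiam i)⁻¹ * ∑ a, e ⟨i, a⟩ := by
    simp_rw [Finset.mul_sum]
    rw [← Fintype.sum_sigma' (fun i a => (M.cellDiam i)⁻¹ * δ ⟨i, a⟩),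
      ← Fintype.sum_sigma' (fun i a => (1 + κ⁻¹) * ((M.cellDiam i)⁻¹ * e ⟨i, a⟩))]
    have h3 : ∀ x : M.Face, (M.cellDiam x.1)⁻¹ * δ x ≤
        (M.cellDiam x.1)⁻¹ * e x + (M.cellDiam x.1)⁻¹ * e (M.partner x) := fun x => by
      rw [← mul_add]
      exact mul_le_mul_of_nonneg_left (hv.l2_tr_sub_average_sq_le hF hγ c x)
        (inv_nonneg.2 (hh _).le)
    refine (Finset.sum_le_sum fun x _ => h3 x).trans ?_
    rw [Finset.sum_add_distrib]
    have h4 : ∑ x : M.Face, (M.cellDiam x.1)⁻¹ * e (M.partner x) =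
        ∑ x : M.Face, (M.cellDiam (M.partner x).1)⁻¹ * e x := by
      rw [← M.sum_partner]
      simp only [M.partner_partner]
    rw [h4, ← Finset.sum_add_distrib]
    refine Finset.sum_le_sum fun x _ => ?_
    have h5 : (M.cellDiam (M.partner x).1)⁻¹ ≤ κ⁻¹ * (M.cellDiam x.1)⁻¹ := by
      rw [← mul_inv]
      exact inv_anti₀ (mul_pos hκ (hh _)) (M.cellDiam_partner hM x)
    nlinarith [mul_le_mul_of_nonneg_right h5 (he0 x)]
  have h3 : ∀ i, (M.cellDiam i)⁻¹ * ∑ a, e ⟨i, a⟩ ≤ γ⁻¹ * (2 * d + 1) *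
      ((M.cellDiam i)⁻¹ ^ 2 * l2 (M.cell i).vol v ^ 2 +
          ∑ l, l2 (M.cell i).vol (g i l) ^ 2) := by
    intro i
    have h4 := (H i).trace_le (hF i) hγ
    have hi := hh i
    change γ * M.cellDiam i * ∑ a, e ⟨i, a⟩ ≤ _ at h4
    have hG0 : 0 ≤ ∑ l, l2 (M.cell i).vol (g i l) ^ 2 := Finset.sum_nonneg fun _ _ => sq_nonneg _
    have h5 : (M.cellDiam i)⁻¹ * ∑ a, e ⟨i, a⟩ =
        γ⁻¹ * (M.cellDiam i)⁻¹ ^ 2 * (γ * M.cellDiam i * ∑ a, e ⟨i, a⟩) := by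
      field_simp
    rw [h5]
    refine (mul_le_mul_of_nonneg_left h4 (by positivity)).trans ?_
    have h6 : γ⁻¹ * (M.cellDiam i)⁻¹ ^ 2 * (2 * d * l2 (M.cell i).vol v ^ 2 +
        M.cellDiam i ^ 2 * ∑ l, l2 (M.cell i).vol (g i l) ^ 2) =
        γ⁻¹ * (2 * d * ((M.cellDiam i)⁻¹ ^ 2 * l2 (M.cell i).vol v ^ 2) +
          ∑ l, l2 (M.cell i).vol (g i l) ^ 2) := by
      field_simp
    rw [h6, mul_assoc γ⁻¹]
    refine mul_le_mul_of_nonneg_left ?_ (by positivity)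
    have h7 : 0 ≤ (M.cellDiam i)⁻¹ ^ 2 * l2 (M.cell i).vol v ^ 2 := by positivity
    have h8 : (0 : ℝ) ≤ d := by positivity
    nlinarith [mul_nonneg h8 hG0]
  set Q := ∑ i, ((M.cellDiam i)⁻¹ ^ 2 * l2 (M.cell i).vol v ^ 2 +
          ∑ l, l2 (M.cell i).vol (g i l) ^ 2) with hQ
  have h4 : ∑ i, (M.cellDiam i)⁻¹ * ∑ a, e ⟨i, a⟩ ≤ γ⁻¹ * (2 * d + 1) * Q := by
    rw [hQ, Finset.mul_sum]
    exact Finset.sum_le_sum fun i _ => h3 i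
  have h5 : ∑ i, ∑ l, l2 (M.cell i).vol (g i l) ^ 2 ≤ Q :=
    Finset.sum_le_sum fun i _ => le_add_of_nonneg_left (by positivity)
  refine (Finset.sum_le_sum fun i _ => h1 i).trans ?_
  rw [← Finset.mul_sum, Finset.sum_add_distrib, mul_assoc]
  refine mul_le_mul_of_nonneg_left ?_ hC.le
  have h6 : (1 + κ⁻¹) * ∑ i, (M.cellDiam i)⁻¹ * ∑ a, e ⟨i, a⟩ ≤ K * Q := by
    refine (mul_le_mul_of_nonneg_left h4 (by positivity)).trans (le_of_eq ?_)
    rw [hK]; ring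
  linarith

end PolytopalMesh

end
end ConformingDG

/-! ### Consistency error on one element -/

namespace ConformingDG
noncomputable section

variable {d : ℕ}

lemma sub_mul_sub_integral {μ : Measure (E d)} {a b c e : E d → ℝ} (ha : MemLp a 2 μ)
    (hb : MemLp b 2 μ) (hc : MemLp c 2 μ) (he : MemLp e 2 μ) :
    ∫ x, (a x - b x) * (c x - e x) ∂μ =
      ∫ x, a x * c x ∂μ - ∫ x, a x * e x ∂μ - ∫ x, b x * c x ∂μ + ∫ x, b x * e x ∂μ := by
  have h1 : Integrable (fun x => a x * c x - a x * e x) μ :=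
    (integrable_mul_of_memLp ha hc).sub (integrable_mul_of_memLp ha he)
  have h2 : Integrable (fun x => b x * c x - b x * e x) μ :=
    (integrable_mul_of_memLp hb hc).sub (integrable_mul_of_memLp hb he)
  have h3 : ∀ x, (a x - b x) * (c x - e x) =
      (a x * c x - a x * e x) - (b x * c x - b x * e x) := fun x => by ring
  simp_rw [h3]
  rw [integral_sub h1 h2, integral_sub (integrable_mul_of_memLp ha hc)
    (integrable_mul_of_memLp ha he), integral_sub (integrable_mul_of_memLp hb hc)
    (integrable_mul_of_memLp hb he)]
  ring

/-- The consistency error on one element, up to the fluxes that cancel between elements. -/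
lemma Fat.consistency_identity {T : ConvexPolytope d} {h γ : ℝ} (hT : Fat T h γ) (hγ : 0 < γ)
    {g : Fin d → E d → ℝ} {G : Fin d → Fin d → E d → ℝ} {ψ : Fin d → ℕ → E d → ℝ}
    (H : ∀ l, H1Approx T (g l) (G l) (ψ l)) {p : E d → ℝ} (hp : ContDiff ℝ ∞ p)
    {W Γ : Fin d → E d → ℝ} {A : Fin T.numFacets → E d → ℝ} (hW : ∀ l, MemLp (W l) 2 T.vol)
    (hΓ : ∀ l, Continuous (Γ l)) (hA : ∀ a, MemLp (A a) 2 (T.surface a))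
    (hspec : ∫ x, ∑ l, W l x * Γ l x ∂T.vol = ∫ x, ∑ l, pd l p x * Γ l x ∂T.vol -
      ∑ a, ∫ x, (p x - A a x) * ∑ l, Γ l x * T.outward a l ∂(T.surface a)) :
    ∫ x, ∑ l, g l x * W l x ∂T.vol + ∫ x, (∑ l, G l l x) * p x ∂T.vol =
      ∫ x, ∑ l, (g l x - Γ l x) * (W l x - pd l p x) ∂T.vol +
      ∑ a, ∫ x, (p x - A a x) * ∑ l, (T.trace a (g l) x - Γ l x) * T.outward a l ∂(T.surface a) +
      ∑ a, ∑ l, T.outward a l * ∫ x, T.trace a (g l) x * A a x ∂(T.surface a) := by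
  have hp1 : ContDiff ℝ 1 p := hp.of_le (by exact_mod_cast le_top)
  have mp : MemLp p 2 T.vol := T.memLp_vol hp.continuous
  have mdp : ∀ l, MemLp (pd l p) 2 T.vol := fun l => T.memLp_vol (continuous_pd hp1 l)
  have mΓ : ∀ l, MemLp (Γ l) 2 T.vol := fun l => T.memLp_vol (hΓ l)
  have sp : ∀ a, MemLp p 2 (T.surface a) := fun a => T.memLp_surface hp.continuous a
  have sΓ : ∀ a l, MemLp (Γ l) 2 (T.surface a) := fun a l => T.memLp_surface (hΓ l) a
  have st : ∀ a l, MemLp (T.trace a (g l)) 2 (T.surface a) := fun a l =>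
    (H l).memLp_trace hT hγ a
  have flux : ∀ {m : E d → ℝ} {q : Fin d → E d → ℝ} (a : Fin T.numFacets),
      MemLp m 2 (T.surface a) → (∀ l, MemLp (q l) 2 (T.surface a)) →
      ∫ x, m x * ∑ l, q l x * T.outward a l ∂(T.surface a) =
        ∑ l, T.outward a l * ∫ x, q l x * m x ∂(T.surface a) := by
    intro m q a hm hq
    simp only [Finset.mul_sum]
    rw [integral_finsetSum]
    · refine Finset.sum_congr rfl fun l _ => ?_
      rw [← integral_const_mul]
      congr 1; ext x; ring
    · intro l _
      have h1 := (integrable_mul_of_memLp hm (hq l)).mul_const (T.outward a l)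
      have h2 : (fun x => m x * (q l x * T.outward a l)) =
          fun x => m x * q l x * T.outward a l := by ext x; ring
      rw [h2]; exact h1
  have e1 : ∫ x, (∑ l, G l l x) * p x ∂T.vol = ∑ l, ∫ x, G l l x * p x ∂T.vol := by
    simp only [Finset.sum_mul]
    rw [integral_finsetSum _ fun l _ => integrable_mul_of_memLp ((H l).memg l) mp]
  -- Green's formula moves the divergence of `g` onto `p`. Everything else is expansion into
  -- elementary integrals, among which the claimed identity is linear.
  have e2 : ∀ l, ∫ x, G l l x * p x ∂T.vol =
      ∑ a, T.outward a l * ∫ x, T.trace a (g l) x * p x ∂(T.surface a) -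
        ∫ x, g l x * pd l p x ∂T.vol := fun l => by
    have := (H l).green hT hγ hp1 l
    linarith
  have e3 : ∫ x, ∑ l, (g l x - Γ l x) * (W l x - pd l p x) ∂T.vol =
      ∑ l, (∫ x, g l x * W l x ∂T.vol - ∫ x, g l x * pd l p x ∂T.vol -
        ∫ x, Γ l x * W l x ∂T.vol + ∫ x, Γ l x * pd l p x ∂T.vol) := by
    rw [integral_finsetSum _ fun l _ => integrable_mul_of_memLp (memLp_sub (H l).memv (mΓ l))
      (memLp_sub (hW l) (mdp l))]
    exact Finset.sum_congr rfl fun l _ => sub_mul_sub_integral (H l).memv (mΓ l) (hW l) (mdp l)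
  have e4 : ∀ a, ∫ x, (p x - A a x) * ∑ l, (T.trace a (g l) x - Γ l x) * T.outward a l
      ∂(T.surface a) = ∑ l, T.outward a l * (∫ x, T.trace a (g l) x * p x ∂(T.surface a) -
        ∫ x, T.trace a (g l) x * A a x ∂(T.surface a) - ∫ x, Γ l x * p x ∂(T.surface a) +
        ∫ x, Γ l x * A a x ∂(T.surface a)) := fun a => by
    rw [flux a (memLp_sub (sp a) (hA a)) fun l => memLp_sub (st a l) (sΓ a l)]
    refine Finset.sum_congr rfl fun l _ => ?_
    rw [sub_mul_sub_integral (st a l) (sΓ a l) (sp a) (hA a)]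
  have e5 : ∀ a, ∫ x, (p x - A a x) * ∑ l, Γ l x * T.outward a l ∂(T.surface a) =
      ∑ l, T.outward a l * (∫ x, Γ l x * p x ∂(T.surface a) -
        ∫ x, Γ l x * A a x ∂(T.surface a)) := fun a => by
    rw [flux a (memLp_sub (sp a) (hA a)) (sΓ a)]
    refine Finset.sum_congr rfl fun l _ => ?_
    rw [← integral_sub (integrable_mul_of_memLp (sΓ a l) (sp a))
      (integrable_mul_of_memLp (sΓ a l) (hA a))]
    simp only [mul_sub]
  rw [integral_finsetSum _ fun l _ => integrable_mul_of_memLp (hW l) (mΓ l),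
    integral_finsetSum _ fun l _ => integrable_mul_of_memLp (mdp l) (mΓ l),
    Finset.sum_congr rfl fun a _ => e5 a] at hspec
  have c1 : ∀ l, ∫ x, W l x * Γ l x ∂T.vol = ∫ x, Γ l x * W l x ∂T.vol := fun l => by
    simp only [mul_comm]
  have c2 : ∀ l, ∫ x, pd l p x * Γ l x ∂T.vol = ∫ x, Γ l x * pd l p x ∂T.vol := fun l => by
    simp only [mul_comm]
  simp only [c1, c2] at hspec
  rw [e1, e3, Finset.sum_congr rfl fun a _ => e4 a,
    integral_finsetSum _ fun l _ => integrable_mul_of_memLp (H l).memv (hW l),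
    Finset.sum_congr rfl fun l _ => e2 l]
  simp only [mul_add, mul_sub, Finset.sum_add_distrib, Finset.sum_sub_distrib] at hspec ⊢
  rw [Finset.sum_comm (s := (Finset.univ : Finset (Fin d)))]
  linarith

lemma Fat.l2_trace_sub_sq_le {T : ConvexPolytope d} {h γ : ℝ} (hT : Fat T h γ) (hγ : 0 < γ)
    {v : E d → ℝ} {g : Fin d → E d → ℝ} {φ : ℕ → E d → ℝ} (H : H1Approx T v g φ)
    {q : E d → ℝ} (hq : ContDiff ℝ ∞ q) (a : Fin T.numFacets) :
    γ * h * l2 (T.surface a) (fun x => T.trace a v x - q x) ^ 2 ≤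
      2 * d * l2 T.vol (fun x => v x - q x) ^ 2 +
        h ^ 2 * ∑ i, l2 T.vol (fun x => g i x - pd i q x) ^ 2 := by
  have Hq := H1Approx.of_contDiff T hq
  have h1 := (H.sub Hq).trace_le hT hγ
  refine le_trans ?_ h1
  have h2 : l2 (T.surface a) (fun x => T.trace a v x - q x) =
      l2 (T.surface a) (T.trace a fun x => v x - q x) := by
    apply l2_congr
    filter_upwards [H.trace_sub Hq hT hγ a, trace_of_contDiff hT hγ hq a] with x h3 h4
    rw [h3, h4]
  rw [h2]
  have h3 : 0 ≤ γ * h := (mul_pos hγ hT.pos).le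
  exact mul_le_mul_of_nonneg_left (Finset.single_le_sum
    (f := fun a => l2 (T.surface a) (T.trace a fun x => v x - q x) ^ 2)
    (fun _ _ => sq_nonneg _) (Finset.mem_univ a)) h3

/-- Bound of the consistency error on one element. -/
lemma exists_consistency_le (d k N : ℕ) {γ : ℝ} (hγ : 0 < γ) (hγ1 : γ ≤ 1) :
    ∃ C, 0 < C ∧ ∀ (T : ConvexPolytope d) (h : ℝ), Fat T h γ → T.numFacets ≤ N →
      ∀ j, T.numFacets + (k + 1) - 1 ≤ j →
      ∀ (g : Fin d → E d → ℝ) (G : Fin d → Fin d → E d → ℝ) (ψ : Fin d → ℕ → E d → ℝ),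
      (∀ l, H1Approx T (g l) (G l) (ψ l)) →
      ∀ S, 0 ≤ S → (∀ l, ∃ q, IsPoly k q ∧ l2 T.vol (fun x => g l x - q x) ≤ h ^ (k + 1) * S ∧
        ∀ i, l2 T.vol (fun x => G l i x - pd i q x) ≤ h ^ k * S) →
      ∀ (p : E d → ℝ) (W : Fin d → E d → ℝ) (A μ : Fin T.numFacets → E d → ℝ),
      IsPoly (k + 1) p → (∀ l, Continuous (W l)) → (∀ a, MemLp (A a) 2 (T.surface a)) →
      (∀ a, IsPoly (k + 1) (μ a)) → (∀ a, (fun x => p x - A a x) =ᵐ[T.surface a] μ a) →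
      (∀ q : Fin d → E d → ℝ, (∀ l, IsPoly j (q l)) →
        ∫ x, ∑ l, W l x * q l x ∂T.vol = ∫ x, ∑ l, pd l p x * q l x ∂T.vol -
          ∑ a, ∫ x, (p x - A a x) * ∑ l, q l x * T.outward a l ∂(T.surface a)) →
      |∫ x, ∑ l, g l x * W l x ∂T.vol + ∫ x, (∑ l, G l l x) * p x ∂T.vol -
        ∑ a, ∑ l, T.outward a l * ∫ x, T.trace a (g l) x * A a x ∂(T.surface a)| ≤
        C * (h ^ (k + 1) * S) * Real.sqrt (∑ l, l2 T.vol (W l) ^ 2) := by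
  obtain ⟨C, hC, hlne⟩ := weak_gradient_bound d (k + 1) N (by omega) hγ hγ1
  -- The factor `3 d` is `2 d` from the `L²` part and `d` from the `d` partial derivatives in the
  -- scaled trace inequality.
  set B : ℝ := Real.sqrt (C * (γ⁻¹ * (3 * d))) with hB
  refine ⟨d * (1 + Real.sqrt C) + N * (d * B) + 1, by positivity,
    fun T h hT hN j hj g G ψ H S hS hΓ p W A μ hp hW hA hμ hAμ hspec => ?_⟩
  have hh := hT.pos
  choose Γ hΓp hΓ1 hΓ2 using hΓ
  have hspec' : ∀ q : Fin d → E d → ℝ, (∀ l, IsPoly j (q l)) →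
      ∫ x, ∑ l, W l x * q l x ∂T.vol = ∫ x, ∑ l, pd l p x * q l x ∂T.vol -
        ∑ a, ∫ x, μ a x * ∑ l, q l x * T.outward a l ∂(T.surface a) := by
    intro q hq
    rw [hspec q hq]
    congr 1
    refine Finset.sum_congr rfl fun a _ => integral_congr_ae ?_
    filter_upwards [hAμ a] with x hx
    rw [hx]
  obtain ⟨hb1, hb2⟩ := hlne T h hT hN j hj p W μ hp hW hμ hspec'
  have hkj : k ≤ j := by omega
  have mW : ∀ l, MemLp (W l) 2 T.vol := fun l => T.memLp_vol (hW l)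
  have mdp : ∀ l, MemLp (pd l p) 2 T.vol := fun l => T.memLp_vol (hp.pd l).continuous
  have mΓ : ∀ l, MemLp (Γ l) 2 T.vol := fun l => T.memLp_vol (hΓp l).continuous
  rw [hT.consistency_identity hγ H hp.contDiff mW (fun l => (hΓp l).continuous) hA
    (hspec Γ fun l => (hΓp l).mono hkj), add_sub_cancel_right]
  set X := ∑ l, l2 T.vol (W l) ^ 2 with hX
  have hX0 : 0 ≤ X := Finset.sum_nonneg fun _ _ => sq_nonneg _
  set R := h ^ (k + 1) * S with hR
  have hR0 : 0 ≤ R := by positivity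
  -- The gradient of `p` is bounded by the weak gradient `W`, so `W - ∇p` is as well.
  have t1 : |∫ x, ∑ l, (g l x - Γ l x) * (W l x - pd l p x) ∂T.vol| ≤
      d * (1 + Real.sqrt C) * (R * Real.sqrt X) := by
    refine (abs_integral_sum_mul_le (fun l => memLp_sub (H l).memv (mΓ l))
      (fun l => memLp_sub (mW l) (mdp l))).trans ?_
    have h1 : ∀ l, l2 T.vol (fun x => g l x - Γ l x) * l2 T.vol (fun x => W l x - pd l p x) ≤
        R * ((1 + Real.sqrt C) * Real.sqrt X) := by
      intro l
      have h2 : l2 T.vol (W l) ≤ Real.sqrt X := Real.le_sqrt_of_sq_le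
        (Finset.single_le_sum (f := fun l => l2 T.vol (W l) ^ 2) (fun _ _ => sq_nonneg _)
          (Finset.mem_univ l))
      have h3 : l2 T.vol (pd l p) ≤ Real.sqrt C * Real.sqrt X := by
        rw [← Real.sqrt_mul hC.le]
        exact Real.le_sqrt_of_sq_le ((Finset.single_le_sum
          (f := fun l => l2 T.vol (pd l p) ^ 2) (fun _ _ => sq_nonneg _)
          (Finset.mem_univ l)).trans hb1)
      have h4 := l2_sub_le (mW l) (mdp l)
      refine mul_le_mul (hΓ1 l) ?_ l2_nonneg hR0
      linarith
    refine (Finset.sum_le_sum fun l _ => h1 l).trans (le_of_eq ?_)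
    rw [Finset.sum_const, Finset.card_univ, Fintype.card_fin, nsmul_eq_mul]
    ring
  -- The jump is of order `√h` times the norm of `W`, and the trace of `g - Γ` is of order `R / √h`;
  -- the powers of `h` cancel.
  have t2 : ∀ a, |∫ x, (p x - A a x) * ∑ l, (T.trace a (g l) x - Γ l x) * T.outward a l
      ∂(T.surface a)| ≤ d * B * (R * Real.sqrt X) := by
    intro a
    have sΓ : ∀ l, MemLp (Γ l) 2 (T.surface a) := fun l =>
      T.memLp_surface (hΓp l).continuous a
    refine (T.abs_integral_flux_le a (memLp_sub (T.memLp_surface hp.continuous a) (hA a))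
      fun l => memLp_sub ((H l).memLp_trace hT hγ a) (sΓ l)).trans ?_
    rw [l2_congr (hAμ a), Finset.mul_sum]
    have h1 : ∀ l, l2 (T.surface a) (μ a) *
        l2 (T.surface a) (fun x => T.trace a (g l) x - Γ l x) ≤ B * (R * Real.sqrt X) := by
      intro l
      have h2 := hT.l2_trace_sub_sq_le hγ (H l) (hΓp l).contDiff a
      have h3 : l2 T.vol (fun x => g l x - Γ l x) ^ 2 ≤ R ^ 2 :=
        pow_le_pow_left₀ l2_nonneg (hΓ1 l) 2
      have h4 : ∑ i, l2 T.vol (fun x => G l i x - pd i (Γ l) x) ^ 2 ≤ d * (h ^ k * S) ^ 2 := by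
        refine (Finset.sum_le_sum fun i _ => pow_le_pow_left₀ l2_nonneg (hΓ2 l i) 2).trans
          (le_of_eq ?_)
        rw [Finset.sum_const, Finset.card_univ, Fintype.card_fin, nsmul_eq_mul]
      have h5 : γ * h * l2 (T.surface a) (fun x => T.trace a (g l) x - Γ l x) ^ 2 ≤
          3 * d * R ^ 2 := by
        refine h2.trans ?_
        have h6 : h ^ 2 * (d * (h ^ k * S) ^ 2) = d * R ^ 2 := by rw [hR]; ring
        have h7 : (2 * d : ℝ) * l2 T.vol (fun x => g l x - Γ l x) ^ 2 ≤ 2 * d * R ^ 2 := by gcongr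
        have h8 := mul_le_mul_of_nonneg_left h4 (sq_nonneg h)
        linarith
      have h6 : l2 (T.surface a) (fun x => T.trace a (g l) x - Γ l x) ^ 2 ≤
          (γ * h)⁻¹ * (3 * d * R ^ 2) := by
        rw [inv_mul_eq_div, le_div_iff₀' (by positivity)]
        exact h5
      have h7 := hb2 a
      refine (pow_le_pow_iff_left₀ (mul_nonneg l2_nonneg l2_nonneg) (by positivity)
        two_ne_zero).1 ?_
      rw [mul_pow, mul_pow, mul_pow, Real.sq_sqrt hX0, hB, Real.sq_sqrt (by positivity)]
      calc _ ≤ C * h * X * ((γ * h)⁻¹ * (3 * d * R ^ 2)) := by gcongr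
        _ = _ := by field_simp
    refine (Finset.sum_le_sum fun l _ => h1 l).trans (le_of_eq ?_)
    rw [Finset.sum_const, Finset.card_univ, Fintype.card_fin, nsmul_eq_mul]
    ring
  have t3 : |∑ a, ∫ x, (p x - A a x) * ∑ l, (T.trace a (g l) x - Γ l x) * T.outward a l
      ∂(T.surface a)| ≤ N * (d * B) * (R * Real.sqrt X) := by
    refine (Finset.abs_sum_le_sum_abs _ _).trans ((Finset.sum_le_sum fun a _ => t2 a).trans ?_)
    rw [Finset.sum_const, Finset.card_univ, Fintype.card_fin, nsmul_eq_mul]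
    have h1 : (T.numFacets : ℝ) ≤ N := by exact_mod_cast hN
    have h2 : 0 ≤ d * B * (R * Real.sqrt X) := by positivity
    have := mul_le_mul_of_nonneg_right h1 h2
    linarith
  have t4 : 0 ≤ R * Real.sqrt X := by positivity
  refine (abs_add_le _ _).trans ?_
  linarith

end
end ConformingDG

/-! ### Discrete functions, cancellation of fluxes, and the consistency error of the scheme -/

namespace ConformingDG
noncomputable section

variable {d : ℕ} {Ω : Set (E d)}

namespace PolytopalMesh
variable {M : PolytopalMesh Ω}

lemma integrableOn_of_cells (hΩ : interior (closure Ω) = Ω) {F : E d → ℝ}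
    (hF : ∀ i, Integrable F (M.cell i).vol) : IntegrableOn F Ω := by
  have h1 : IntegrableOn F (⋃ i, (M.cell i).inner') :=
    integrableOn_finite_iUnion.2 fun i =>
      (show IntegrableOn F (M.cell i).carrier volume from hF i).congr_set_ae (M.cell i).inner'_ae_eq
  exact h1.congr_set_ae (M.ae_eq_iUnion hΩ)

variable (M) in
/-- The polynomials `p i` represent a function of `V_h`. -/
structure VhData (c : BoundaryCase) (k : ℕ) (w : E d → ℝ) (p : Fin M.numCells → E d → ℝ) :
    Prop where
  poly : ∀ i, IsPoly k (p i)
  ae_eq : ∀ i, w =ᵐ[(M.cell i).vol] p i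
  boundary : c = BoundaryCase.strong → ∀ x : M.Face, x.OnBoundary →
    ∀ y ∈ (M.cell x.1).facet x.2, p x.1 y = 0

lemma MemVh.exists_data {c : BoundaryCase} {k : ℕ} {w : E d → ℝ} (hw : M.MemVh c k w) :
    ∃ p, M.VhData c k w p := by
  choose p h1 h2 h3 using hw
  exact ⟨fun i => pval (p i), fun i => ⟨p i, h1 i, rfl⟩, h2, fun hc x hx => h3 x.1 hc x.2 hx⟩

namespace VhData
variable {c : BoundaryCase} {k : ℕ} {v w : E d → ℝ} {p q : Fin M.numCells → E d → ℝ} {γ : ℝ}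

lemma memVh (h : M.VhData c k w p) : M.MemVh c k w := by
  intro i
  obtain ⟨q, hq, hq2⟩ := h.poly i
  refine ⟨q, hq, hq2 ▸ h.ae_eq i, fun hc a ha x hx => ?_⟩
  rw [← hq2]
  exact h.boundary hc ⟨i, a⟩ ha x hx

lemma sub (h : M.VhData c k v p) (h' : M.VhData c k w q) :
    M.VhData c k (fun x => v x - w x) (fun i x => p i x - q i x) where
  poly i := (h.poly i).sub (h'.poly i)
  ae_eq i := by
    filter_upwards [h.ae_eq i, h'.ae_eq i] with x h1 h2
    rw [h1, h2]
  boundary hc x hx y hy := by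
    rw [h.boundary hc x hx y hy, h'.boundary hc x hx y hy, sub_zero]

lemma h1Approx (h : M.VhData c k w p) (i : Fin M.numCells) :
    H1Approx (M.cell i) w (fun l => pd l (p i)) (fun _ => p i) :=
  (H1Approx.of_contDiff (M.cell i) (h.poly i).contDiff).congr (h.ae_eq i).symm
    fun _ => EventuallyEq.rfl

lemma cellH1 (h : M.VhData c k w p) : M.CellH1 w := fun i => ⟨_, _, h.h1Approx i⟩

lemma tr_ae_eq (h : M.VhData c k w p) (hM : M.IsFat γ) (hγ : 0 < γ) (x : M.Face) :
    M.tr w x =ᵐ[M.surf x] p x.1 := by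
  have h1 := ConvexPolytope.trace_congr (h.ae_eq x.1) x.2
  rw [tr, h1]
  exact trace_of_contDiff (hM x.1) hγ (h.poly x.1).contDiff x.2

lemma tr_partner_ae_eq (h : M.VhData c k w p) (hM : M.IsFat γ) (hγ : 0 < γ) (x : M.Face) :
    M.tr w (M.partner x) =ᵐ[M.surf x] p (M.partner x).1 := by
  rw [← M.surf_partner]
  exact h.tr_ae_eq hM hγ _

lemma average_ae_eq_zero (h : M.VhData c k w p) (hM : M.IsFat γ) (hγ : 0 < γ) {x : M.Face}
    (hx : x.OnBoundary) : M.average c w x.1 x.2 =ᵐ[M.surf x] 0 := by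
  cases c with
  | weak => rw [M.average_weak_of_onBoundary _ hx]
  | strong =>
    rw [M.average_strong_of_onBoundary _ hx]
    filter_upwards [h.tr_ae_eq hM hγ x, (M.cell x.1).surface_ae_mem x.2] with y h1 h2
    rw [h1, h.boundary rfl x hx y h2]
    rfl

/-- The bound of jumps by the weak gradient requires the jump to be a polynomial. It is half the
difference of the two polynomials inside `Ω`; on `∂Ω` it is the polynomial itself under weak
enforcement and zero under strong enforcement. -/
lemma exists_jump (h : M.VhData c k w p) (hM : M.IsFat γ) (hγ : 0 < γ) (x : M.Face) :
    ∃ μ, IsPoly k μ ∧ (fun y => p x.1 y - M.average c w x.1 x.2 y) =ᵐ[M.surf x] μ := by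
  by_cases hx : x.OnBoundary
  · cases c with
    | weak =>
      refine ⟨p x.1, h.poly x.1, ?_⟩
      rw [M.average_weak_of_onBoundary _ hx]
      simp only [Pi.zero_apply, sub_zero]
      rfl
    | strong =>
      refine ⟨fun _ => 0, IsPoly.const 0, ?_⟩
      filter_upwards [h.average_ae_eq_zero hM hγ hx, (M.cell x.1).surface_ae_mem x.2] with y h1 h2
      rw [h1, h.boundary rfl x hx y h2]
      simp
  · refine ⟨fun y => (1 / 2 : ℝ) * (p x.1 y - p (M.partner x).1 y),
      ((h.poly _).sub (h.poly _)).const_mul _, ?_⟩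
    rw [M.average_of_interior c w hx]
    filter_upwards [h.tr_ae_eq hM hγ x, h.tr_partner_ae_eq hM hγ x] with y h1 h2
    rw [h1, h2]
    ring

lemma integral_wgrad (h : M.VhData c k w p) (hM : M.IsFat γ) (hγ : 0 < γ) (j : ℕ)
    (i : Fin M.numCells) {q : Fin d → E d → ℝ} (hq : ∀ l, IsPoly j (q l)) :
    ∫ x, ∑ l, M.wgrad c j w i l x * q l x ∂(M.cell i).vol =
      ∫ x, ∑ l, pd l (p i) x * q l x ∂(M.cell i).vol -
        ∑ a, ∫ x, (p i x - M.average c w i a x) *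
          ∑ l, q l x * (M.cell i).outward a l ∂((M.cell i).surface a) := by
  rw [h.cellH1.integral_wgrad hM hγ c j (h.h1Approx i) hq]
  congr 1
  refine Finset.sum_congr rfl fun a _ => integral_congr_ae ?_
  filter_upwards [h.tr_ae_eq hM hγ ⟨i, a⟩] with x hx
  rw [hx]

end VhData

/-- The fluxes through the two sides of every edge/face cancel. -/
lemma sum_flux_eq_zero {t : Fin d → M.Face → E d → ℝ} {A : M.Face → E d → ℝ}
    (ht : ∀ l x, ¬ x.OnBoundary → t l (M.partner x) =ᵐ[M.surf x] t l x)
    (hA : ∀ x, A (M.partner x) = A x) (hA0 : ∀ x, x.OnBoundary → A x =ᵐ[M.surf x] 0) :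
    ∑ i, ∑ a, ∑ l, (M.cell i).outward a l * ∫ y, t l ⟨i, a⟩ y * A ⟨i, a⟩ y
      ∂((M.cell i).surface a) = 0 := by
  set F : M.Face → ℝ := fun x => ∑ l, (M.cell x.1).outward x.2 l *
    ∫ y, t l x y * A x y ∂(M.surf x) with hF
  rw [← Fintype.sum_sigma' (fun i a => F ⟨i, a⟩)]
  change ∑ x, F x = 0
  -- Only the normal changes sign between the two sides. On `∂Ω` the facet is its own partner, but
  -- there the flux vanishes. The total is therefore equal to its negative.
  have h1 : ∀ x, F (M.partner x) = -F x := by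
    intro x
    by_cases hx : x.OnBoundary
    · have h0 : F x = 0 := by
        refine Finset.sum_eq_zero fun l _ => ?_
        rw [integral_eq_zero_of_ae, mul_zero]
        filter_upwards [hA0 x hx] with y hy
        rw [hy]
        simp
      rw [M.partner_of_onBoundary hx, h0, neg_zero]
    · obtain ⟨-, h2, -⟩ := M.opposite_of_facet_eq (M.facet_partner x) (M.partner_ne hx)
      simp only [hF]
      rw [← Finset.sum_neg_distrib]
      refine Finset.sum_congr rfl fun l _ => ?_
      rw [h2, hA, M.surf_partner, integral_congr_ae (g := fun y => t l x y * A x y)]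
      · simp
      · filter_upwards [ht l x hx] with y hy
        rw [hy]
  have h2 := M.sum_partner F
  simp only [h1, Finset.sum_neg_distrib] at h2
  linarith

end PolytopalMesh

lemma shiftDeriv_zero (g : ∀ m : ℕ, (Fin m → Fin d) → E d → ℝ) (l : Fin d) :
    shiftDeriv g l 0 ![] = g 1 (fun _ => l) := by
  unfold shiftDeriv
  congr 1

namespace PolytopalMesh
variable {M : PolytopalMesh Ω} {γ : ℝ} {u : E d → ℝ} {K : ℕ}

lemma h1Approx_of_memSobolev (hΩo : IsOpen Ω) (hΩ : interior (closure Ω) = Ω)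
    (hu : MemSobolev Ω K u) (hK : 1 ≤ K) (hM : M.IsFat γ) (hγ : 0 < γ) (i : Fin M.numCells) :
    ∃ φ, H1Approx (M.cell i) u (fun l => derivFamily Ω u 1 (fun _ => l)) φ := by
  obtain ⟨φ, H⟩ := M.exists_sobApprox hΩo hΩ hu (hM i) hγ
  exact ⟨φ, H.h1Approx hK⟩

lemma h1Approx_grad_of_memSobolev (hΩo : IsOpen Ω) (hΩ : interior (closure Ω) = Ω)
    (hu : MemSobolev Ω (K + 1) u) (hK : 1 ≤ K) (hM : M.IsFat γ) (hγ : 0 < γ) (l : Fin d)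
    (i : Fin M.numCells) :
    ∃ φ, H1Approx (M.cell i) (derivFamily Ω u 1 (fun _ => l))
      (fun m => derivFamily Ω u 2 (Fin.snoc (fun _ : Fin 1 => m) l)) φ := by
  obtain ⟨φ, H⟩ := M.exists_sobApprox hΩo hΩ hu (hM i) hγ
  have h1 := (H.shift l).h1Approx hK
  rw [shiftDeriv_zero] at h1
  exact ⟨_, h1⟩

lemma tr_partner_ae_eq (hΩ : interior (closure Ω) = Ω) (hM : M.IsFat γ) (hγ : 0 < γ)
    {v : E d → ℝ} {g : Fin d → E d → ℝ} (H : ∀ i, ∃ φ, H1Approx (M.cell i) v g φ)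
    (hv : MemLp v 2 (volume.restrict Ω)) (hg : ∀ l, MemLp (g l) 2 (volume.restrict Ω))
    (hweak : ∀ l θ, IsTestFunction Ω θ → ∫ x in Ω, v x * pd l θ x = -∫ x in Ω, g l x * θ x)
    {x : M.Face} (hx : ¬ x.OnBoundary) : M.tr v (M.partner x) =ᵐ[M.surf x] M.tr v x := by
  obtain ⟨h1, h2, h3⟩ := M.opposite_of_facet_eq (M.facet_partner x) (M.partner_ne hx)
  obtain ⟨φ, Hi⟩ := H x.1
  obtain ⟨ψ, Hj⟩ := H (M.partner x).1
  exact (M.trace_eq_across hΩ (M.facet_partner x) h1 h2 h3 (hM _) (hM _) hγ Hi Hj hv hg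
    hweak).symm

lemma tr_ae_eq_average (hΩo : IsOpen Ω) (hΩ : interior (closure Ω) = Ω)
    (hu : MemSobolev Ω K u) (hK : 1 ≤ K) (hu0 : MemH10 Ω u) (hM : M.IsFat γ) (hγ : 0 < γ)
    (c : BoundaryCase) (x : M.Face) : M.tr u x =ᵐ[M.surf x] M.average c u x.1 x.2 := by
  by_cases hx : x.OnBoundary
  · cases c with
    | strong => rw [M.average_strong_of_onBoundary _ hx]
    | weak =>
      rw [M.average_weak_of_onBoundary _ hx]
      exact M.trace_eq_zero hΩo hΩ hu0 (hM x.1) hγ hx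
  · rw [M.average_of_interior c u hx]
    have h1 : M.tr u (M.partner x) =ᵐ[M.surf x] M.tr u x := by
      refine tr_partner_ae_eq hΩ hM hγ (fun i => h1Approx_of_memSobolev hΩo hΩ hu hK hM hγ i)
        hu.1 (fun l => (hu.hasWeakDeriv hK _).1) (fun l θ hθ => ?_) hx
      have := (hu.hasWeakDeriv hK (fun _ : Fin 1 => l)).2 θ hθ
      rw [partialD_one] at this
      simpa using this
    filter_upwards [h1] with y hy
    rw [hy]
    ring

/-- The consistency error of the scheme. -/
lemma exists_consistency_bound (d k N : ℕ) {γ : ℝ} (hγ : 0 < γ) (hγ1 : γ ≤ 1) :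
    ∃ C, 0 < C ∧ ∀ (Ω : Set (E d)) (M : PolytopalMesh Ω), IsOpen Ω → interior (closure Ω) = Ω →
      M.IsFat γ → (∀ i, (M.cell i).numFacets ≤ N) →
      ∀ (c : BoundaryCase) (j : Fin M.numCells → ℕ),
      (∀ i, (M.cell i).numFacets + (k + 1) - 1 ≤ j i) → ∀ f u : E d → ℝ,
      MemLp f 2 (volume.restrict Ω) → IsWeakSolution Ω f u → MemSobolev Ω (k + 2) u →
      ∀ w, M.MemVh c (k + 1) w →
      |∑ i, ∫ x, ∑ l, M.wgrad c (j i) u i l x * M.wgrad c (j i) w i l x ∂(M.cell i).vol -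
          ∫ x in Ω, f x * w x| ≤
        C * ∑ i, M.cellDiam i ^ (k + 1) *
          Real.sqrt (sobSq (M.cell i) (derivFamily Ω u) (k + 2)) *
          Real.sqrt (∑ l, l2 (M.cell i).vol (M.wgrad c (j i) w i l) ^ 2) := by
  obtain ⟨C1, hC1, happ⟩ := exists_poly_approx d k N hγ hγ1
  obtain ⟨C2, hC2, hloc⟩ := exists_consistency_le d k N hγ hγ1
  refine ⟨C2 * C1, by positivity, fun Ω M hΩo hΩ hF hN c j hj f u hf hsol hu w hw => ?_⟩
  obtain ⟨p, hp⟩ := hw.exists_data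
  set g : Fin d → E d → ℝ := fun l => derivFamily Ω u 1 (fun _ => l) with hg
  set G : Fin d → Fin d → E d → ℝ :=
    fun l m => derivFamily Ω u 2 (Fin.snoc (fun _ : Fin 1 => m) l) with hG
  have Hu := fun i => h1Approx_of_memSobolev (M := M) hΩo hΩ hu (by omega) hF hγ i
  have Hg := fun l i => h1Approx_grad_of_memSobolev (M := M) hΩo hΩ hu (by omega) hF hγ l i
  have hcu : M.CellH1 u := fun i => ⟨_, Hu i⟩
  have hgt : ∀ l x, ¬ x.OnBoundary → M.tr (g l) (M.partner x) =ᵐ[M.surf x] M.tr (g l) x :=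
    fun l x hx => tr_partner_ae_eq hΩ hF hγ (Hg l) (hu.hasWeakDeriv (by omega) _).1
      (fun m => (hu.hasWeakDeriv (by omega) _).1)
      (fun m θ hθ => hu.integral_grad_mul_pd (by omega) l m hθ) hx
  -- The traces of `u` equal its averages, so the jump terms vanish and the weak gradient of `u`
  -- acts on polynomial fields as `∇u`.
  have e1 : ∀ i, ∫ x, ∑ l, M.wgrad c (j i) u i l x * M.wgrad c (j i) w i l x ∂(M.cell i).vol =
      ∫ x, ∑ l, g l x * M.wgrad c (j i) w i l x ∂(M.cell i).vol := by
    intro i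
    obtain ⟨φ, H⟩ := Hu i
    rw [hcu.integral_wgrad hF hγ c (j i) H fun l => hp.cellH1.isPoly_wgrad hF hγ c (j i) i l,
      Finset.sum_eq_zero, sub_zero]
    intro a _
    apply integral_eq_zero_of_ae
    filter_upwards [tr_ae_eq_average hΩo hΩ hu (by omega) hsol.1 hF hγ c ⟨i, a⟩] with x hx
    rw [hx]
    simp
  have hfi := hsol.ae_eq hΩo hf hu (by omega)
  have e2 : ∫ x in Ω, f x * w x = -∑ i, ∫ x, (∑ l, G l l x) * p i x ∂(M.cell i).vol := by
    rw [M.integral_eq_sum hΩ (M.integrableOn_of_cells hΩ fun i =>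
      integrable_mul_of_memLp (M.memLp_vol_of_restrict hΩ hf i) (hp.h1Approx i).memv),
      ← Finset.sum_neg_distrib]
    refine Finset.sum_congr rfl fun i _ => ?_
    rw [← integral_neg]
    refine integral_congr_ae ?_
    filter_upwards [hp.ae_eq i, ae_mono (M.vol_le hΩ i) hfi] with x h1 h2
    rw [h1, h2, neg_mul]
  have e3 := sum_flux_eq_zero (t := fun l => M.tr (g l)) (A := fun x => M.average c w x.1 x.2)
    hgt (fun x => M.average_partner c w x) (fun x hx => hp.average_ae_eq_zero hF hγ hx)
  have e4 : ∑ i, ∫ x, ∑ l, M.wgrad c (j i) u i l x * M.wgrad c (j i) w i l x ∂(M.cell i).vol -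
      ∫ x in Ω, f x * w x =
      ∑ i, (∫ x, ∑ l, g l x * M.wgrad c (j i) w i l x ∂(M.cell i).vol +
        ∫ x, (∑ l, G l l x) * p i x ∂(M.cell i).vol -
        ∑ a, ∑ l, (M.cell i).outward a l * ∫ x, (M.cell i).trace a (g l) x * M.average c w i a x
          ∂((M.cell i).surface a)) := by
    rw [Finset.sum_sub_distrib, Finset.sum_add_distrib, e2, Finset.sum_congr rfl fun i _ => e1 i]
    rw [show ∑ i, ∑ a, ∑ l, (M.cell i).outward a l * ∫ x, (M.cell i).trace a (g l) x *
      M.average c w i a x ∂((M.cell i).surface a) = 0 from e3]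
    ring
  rw [e4]
  refine (Finset.abs_sum_le_sum_abs _ _).trans ?_
  rw [Finset.mul_sum]
  refine Finset.sum_le_sum fun i _ => ?_
  choose ψ Hψ using fun l => Hg l i
  choose μ hμ hμ2 using fun a => hp.exists_jump hF hγ ⟨i, a⟩
  obtain ⟨φ, HS⟩ := M.exists_sobApprox hΩo hΩ hu (hF i) hγ
  set S := Real.sqrt (sobSq (M.cell i) (derivFamily Ω u) (k + 2)) with hS
  have hS0 : 0 ≤ S := Real.sqrt_nonneg _
  have hh := (hF i).pos
  -- The discrete degree is `k + 1` here, so `∇u` has weak derivatives of order `k + 1` and is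
  -- approximated by polynomials of degree `k`; these are derivatives of `u` of order `k + 2`.
  have happ' : ∀ l, ∃ q, IsPoly k q ∧
      l2 (M.cell i).vol (fun x => g l x - q x) ≤ M.cellDiam i ^ (k + 1) * (C1 * S) ∧
      ∀ m, l2 (M.cell i).vol (fun x => G l m x - pd m q x) ≤ M.cellDiam i ^ k * (C1 * S) := by
    intro l
    obtain ⟨q, h1, h2, h3⟩ := happ (M.cell i) _ (hF i) (hN i) _ _ (HS.shift l)
    rw [shiftDeriv_zero] at h2
    have h4 : Real.sqrt (sobSq (M.cell i) (shiftDeriv (derivFamily Ω u) l) (k + 1)) ≤ S :=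
      Real.sqrt_le_sqrt (sobSq_shiftDeriv_le _ _ l (k + 1))
    refine ⟨q, h1, h2.trans ?_, fun m => (h3 m).trans ?_⟩
    · rw [show M.cellDiam i ^ (k + 1) * (C1 * S) = C1 * M.cellDiam i ^ (k + 1) * S by ring]
      exact mul_le_mul_of_nonneg_left h4 (by positivity)
    · rw [show M.cellDiam i ^ k * (C1 * S) = C1 * M.cellDiam i ^ k * S by ring]
      exact mul_le_mul_of_nonneg_left h4 (by positivity)
  have h5 := hloc (M.cell i) _ (hF i) (hN i) (j i) (hj i) g G ψ Hψ (C1 * S) (by positivity) happ'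
    (p i) (M.wgrad c (j i) w i) (M.average c w i) μ (hp.poly i)
    (fun l => continuous_wgrad c (j i) w i l)
    (fun a => hp.cellH1.memLp_average hF hγ c ⟨i, a⟩) hμ hμ2
    (fun q hq => hp.integral_wgrad hF hγ (j i) i hq)
  refine h5.trans (le_of_eq ?_)
  ring

end PolytopalMesh

end
end ConformingDG

/-! ### Interpolation error -/

namespace ConformingDG
noncomputable section

variable {d : ℕ}

/-- Polynomial approximation that preserves a zero trace on given edges/faces. -/
lemma exists_poly_approx_vanishing (d m N : ℕ) {γ : ℝ} (hγ : 0 < γ) (hγ1 : γ ≤ 1) :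
    ∃ C, 0 < C ∧ ∀ (T : ConvexPolytope d) (h : ℝ), Fat T h γ → T.numFacets ≤ N →
      ∀ (g : ∀ m : ℕ, (Fin m → Fin d) → E d → ℝ) (φ : ℕ → E d → ℝ), SobApprox T (m + 1) g φ →
      ∀ F : Finset (Fin T.numFacets), (∀ a ∈ F, T.trace a (g 0 ![]) =ᵐ[T.surface a] 0) →
      ∃ p, IsPoly m p ∧ (∀ a ∈ F, ∀ x ∈ T.facet a, p x = 0) ∧
        l2 T.vol (fun x => g 0 ![] x - p x) ≤ C * h ^ (m + 1) * Real.sqrt (sobSq T g (m + 1)) ∧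
        ∀ i, l2 T.vol (fun x => g 1 (fun _ => i) x - pd i p x) ≤
          C * h ^ m * Real.sqrt (sobSq T g (m + 1)) := by
  obtain ⟨C1, hC1, happ⟩ := exists_poly_approx d m N hγ hγ1
  obtain ⟨C2, hC2, hcor⟩ := exists_vanishing_correction d m N hγ hγ1
  obtain ⟨C3, hC3, hpoly⟩ := fat_poly_l2 d m N hγ hγ1
  set B : ℝ := Real.sqrt (C2 * (N * (γ⁻¹ * (3 * d * C1 ^ 2)))) with hB
  set B' : ℝ := Real.sqrt C3 * B with hB'
  have hB0 : 0 ≤ B := Real.sqrt_nonneg _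
  have hB'0 : 0 ≤ B' := mul_nonneg (Real.sqrt_nonneg _) hB0
  refine ⟨C1 + B + B', by positivity, fun T h hT hN g φ H F hF => ?_⟩
  have hh := hT.pos
  obtain ⟨p, hp, hp1, hp2⟩ := happ T h hT hN g φ H
  obtain ⟨p', hp', hv, hc⟩ := hcor T h hT hN p hp F
  have H1 := H.h1Approx (by omega)
  set S := Real.sqrt (sobSq T g (m + 1)) with hS
  have hS0 : 0 ≤ S := Real.sqrt_nonneg _
  -- Where the function has zero trace, the trace of the approximating polynomial is itself an
  -- approximation error and hence small.
  have hface : ∀ a ∈ F, l2 (T.surface a) p ^ 2 ≤ (γ * h)⁻¹ * (3 * d * (C1 * h ^ (m + 1) * S) ^ 2) := by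
    intro a ha
    have e1 := hT.l2_trace_sub_sq_le hγ H1 hp.contDiff a
    have e2 : l2 (T.surface a) (fun x => T.trace a (g 0 ![]) x - p x) = l2 (T.surface a) p := by
      rw [l2_sub_comm]
      apply l2_congr
      filter_upwards [hF a ha] with x hx
      rw [hx]
      simp
    rw [e2] at e1
    have e3 : l2 T.vol (fun x => g 0 ![] x - p x) ^ 2 ≤ (C1 * h ^ (m + 1) * S) ^ 2 :=
      pow_le_pow_left₀ l2_nonneg hp1 2
    have e4 : ∑ i, l2 T.vol (fun x => g 1 (fun _ => i) x - pd i p x) ^ 2 ≤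
        d * (C1 * h ^ m * S) ^ 2 := by
      refine (Finset.sum_le_sum fun i _ => pow_le_pow_left₀ l2_nonneg (hp2 i) 2).trans
        (le_of_eq ?_)
      rw [Finset.sum_const, Finset.card_univ, Fintype.card_fin, nsmul_eq_mul]
    rw [inv_mul_eq_div, le_div_iff₀' (by positivity)]
    refine e1.trans ?_
    have e5 : (2 * d : ℝ) * l2 T.vol (fun x => g 0 ![] x - p x) ^ 2 ≤
        2 * d * (C1 * h ^ (m + 1) * S) ^ 2 := by gcongr
    have e6 := mul_le_mul_of_nonneg_left e4 (sq_nonneg h)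
    have e7 : h ^ 2 * (d * (C1 * h ^ m * S) ^ 2) = d * (C1 * h ^ (m + 1) * S) ^ 2 := by ring
    linarith
  have hsum : ∑ a ∈ F, l2 (T.surface a) p ^ 2 ≤
      N * ((γ * h)⁻¹ * (3 * d * (C1 * h ^ (m + 1) * S) ^ 2)) := by
    refine (Finset.sum_le_sum hface).trans ?_
    rw [Finset.sum_const, nsmul_eq_mul]
    have : (F.card : ℝ) ≤ N := by
      have h1 : F.card ≤ T.numFacets := by simpa using Finset.card_le_univ F
      exact_mod_cast h1.trans hN
    gcongr
  have hdiff : l2 T.vol (fun x => p x - p' x) ≤ B * h ^ (m + 1) * S := by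
    refine (pow_le_pow_iff_left₀ l2_nonneg (by positivity) two_ne_zero).1 ?_
    rw [mul_pow, mul_pow, hB, Real.sq_sqrt (by positivity)]
    refine hc.trans ?_
    calc _ ≤ C2 * h * (N * ((γ * h)⁻¹ * (3 * d * (C1 * h ^ (m + 1) * S) ^ 2))) := by gcongr
      _ = _ := by field_simp
  -- The correction is a polynomial, so the inverse inequality bounds its gradient at the cost of
  -- one power of `h`.
  have hgrad : ∀ i, l2 T.vol (pd i (fun x => p x - p' x)) ≤ B' * h ^ m * S := by
    intro i
    have e1 := (hpoly T h hT hN _ (hp.sub hp')).2.1 i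
    have e2 : (h * l2 T.vol (pd i (fun x => p x - p' x))) ^ 2 ≤
        (Real.sqrt C3 * l2 T.vol (fun x => p x - p' x)) ^ 2 := by
      rw [mul_pow, mul_pow, Real.sq_sqrt hC3.le]
      exact e1
    have e3 := (pow_le_pow_iff_left₀ (mul_nonneg hh.le l2_nonneg)
      (mul_nonneg (Real.sqrt_nonneg _) l2_nonneg) two_ne_zero).1 e2
    have e4 : Real.sqrt C3 * l2 T.vol (fun x => p x - p' x) ≤
        Real.sqrt C3 * (B * h ^ (m + 1) * S) := by gcongr
    refine le_of_mul_le_mul_left ((e3.trans e4).trans (le_of_eq ?_)) hh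
    rw [hB']; ring
  have mp := T.memLp_vol hp.continuous
  have mp' := T.memLp_vol hp'.continuous
  have q1 : 0 ≤ h ^ (m + 1) * S := by positivity
  have q2 : 0 ≤ h ^ m * S := by positivity
  refine ⟨p', hp', hv, ?_, fun i => ?_⟩
  · have e1 := l2_add_le (memLp_sub H1.memv mp) (memLp_sub mp mp')
    have e2 : (fun x => g 0 ![] x - p x + (p x - p' x)) = fun x => g 0 ![] x - p' x := by
      ext x; ring
    rw [e2] at e1
    have := mul_nonneg hB'0 q1
    nlinarith
  · have e1 := l2_add_le (memLp_sub (H1.memg i) (T.memLp_vol (hp.pd i).continuous))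
      (T.memLp_vol ((hp.sub hp').pd i).continuous)
    have e2 : (fun x => g 1 (fun _ => i) x - pd i p x + pd i (fun x => p x - p' x) x) =
        fun x => g 1 (fun _ => i) x - pd i p' x := by
      ext x
      rw [pd_sub hp.differentiable hp'.differentiable]
      ring
    rw [e2] at e1
    have e3 := hgrad i
    have e4 := hp2 i
    have := mul_nonneg hB0 q2
    nlinarith

namespace PolytopalMesh
variable {Ω : Set (E d)} {M : PolytopalMesh Ω} {γ : ℝ}

variable (M) in
/-- The function that equals `p i` inside the `i`-th element. -/
def piecewise (p : Fin M.numCells → E d → ℝ) (x : E d) : ℝ :=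
  ∑ i, (M.cell i).inner'.indicator (p i) x

lemma piecewise_ae_eq (p : Fin M.numCells → E d → ℝ) (i : Fin M.numCells) :
    M.piecewise p =ᵐ[(M.cell i).vol] p i := by
  filter_upwards [(M.cell i).ae_mem_inner'] with x hx
  rw [piecewise, Finset.sum_eq_single i]
  · exact Set.indicator_of_mem hx _
  · intro j _ hj
    exact Set.indicator_of_notMem (Set.disjoint_left.1 (M.disjoint_inner' hj.symm) hx) _
  · simp

lemma sum_sobSq (hΩ : interior (closure Ω) = Ω) {u : E d → ℝ} {K : ℕ}
    (hu : MemSobolev Ω (K + 1) u) :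
    ∑ i, sobSq (M.cell i) (derivFamily Ω u) (K + 1) = sobolevSeminorm Ω (K + 1) u ^ 2 := by
  rw [sobolevSeminorm, Real.sq_sqrt (Finset.sum_nonneg fun s _ =>
    integral_nonneg fun x => sq_nonneg _)]
  simp only [sobSq]
  rw [Finset.sum_comm]
  refine Finset.sum_congr rfl fun s _ => ?_
  have h1 : MemLp (weakDeriv Ω s u) 2 (volume.restrict Ω) := (hu.hasWeakDeriv le_rfl s).1
  rw [M.integral_eq_sum hΩ h1.integrable_sq]
  exact Finset.sum_congr rfl fun i _ => l2_sq

/-- The interpolation error in the energy norm. -/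
lemma exists_interpolation_bound (d k N : ℕ) {γ κ : ℝ} (hγ : 0 < γ) (hγ1 : γ ≤ 1) (hκ : 0 < κ) :
    ∃ C, 0 < C ∧ ∀ (Ω : Set (E d)) (M : PolytopalMesh Ω) (ρ α : ℝ), M.ShapeRegular ρ κ α →
      IsOpen Ω → interior (closure Ω) = Ω → M.IsFat γ → (∀ i, (M.cell i).numFacets ≤ N) →
      ∀ (c : BoundaryCase) (j : Fin M.numCells → ℕ), (∀ i, j i ≤ N + k) → ∀ u : E d → ℝ,
      MemH10 Ω u → MemSobolev Ω (k + 1) u → ∃ v p, M.VhData c k v p ∧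
      ∑ i, ∑ l, l2 (M.cell i).vol (M.wgrad c (j i) (fun x => u x - v x) i l) ^ 2 ≤
        C * ∑ i, (M.cellDiam i ^ k *
          Real.sqrt (sobSq (M.cell i) (derivFamily Ω u) (k + 1))) ^ 2 := by
  classical
  obtain ⟨C1, hC1, happ⟩ := exists_poly_approx_vanishing d k N hγ hγ1
  obtain ⟨C2, hC2, hst⟩ := exists_sum_wgrad_sq_le d (N + k) N hγ hγ1 hκ
  refine ⟨C2 * ((d + 1) * C1 ^ 2), by positivity,
    fun Ω M ρ α hM hΩo hΩ hF hN c j hj u hu0 hu => ?_⟩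
  have hp : ∀ i, ∃ p, IsPoly k p ∧
      (∀ a, (M.cell i).facet a ⊆ frontier Ω → ∀ x ∈ (M.cell i).facet a, p x = 0) ∧
      l2 (M.cell i).vol (fun x => u x - p x) ≤ C1 * M.cellDiam i ^ (k + 1) *
        Real.sqrt (sobSq (M.cell i) (derivFamily Ω u) (k + 1)) ∧
      ∀ l, l2 (M.cell i).vol (fun x => derivFamily Ω u 1 (fun _ => l) x - pd l p x) ≤
        C1 * M.cellDiam i ^ k * Real.sqrt (sobSq (M.cell i) (derivFamily Ω u) (k + 1)) := by
    intro i
    obtain ⟨φ, H⟩ := M.exists_sobApprox hΩo hΩ hu (hF i) hγ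
    -- The interpolant is made to vanish on all boundary facets of the element, whichever way the
    -- boundary condition is enforced, so one construction serves both cases.
    obtain ⟨p, h1, h2, h3, h4⟩ := happ (M.cell i) _ (hF i) (hN i) _ φ H
      (Finset.univ.filter fun a => (M.cell i).facet a ⊆ frontier Ω)
      (fun a ha => M.trace_eq_zero hΩo hΩ hu0 (hF i) hγ (Finset.mem_filter.1 ha).2)
    exact ⟨p, h1, fun a ha => h2 a (by simpa using ha), h3, h4⟩
  choose p h1 h2 h3 h4 using hp
  have hv : M.VhData c k (M.piecewise p) p := ⟨h1, M.piecewise_ae_eq p, fun _ x hx => h2 x.1 x.2 hx⟩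
  refine ⟨M.piecewise p, p, hv, ?_⟩
  have h5 := hst Ω M ρ α hM hF hN c j hj (fun x => u x - M.piecewise p x)
    (fun i l x => derivFamily Ω u 1 (fun _ => l) x - pd l (p i) x) (fun i => by
      obtain ⟨φ, H⟩ := h1Approx_of_memSobolev hΩo hΩ hu (by omega) hF hγ i
      exact ⟨_, H.sub (hv.h1Approx i)⟩)
  refine h5.trans ?_
  rw [mul_assoc C2]
  refine mul_le_mul_of_nonneg_left ?_ hC2.le
  rw [Finset.mul_sum]
  refine Finset.sum_le_sum fun i _ => ?_
  have hh := (hF i).pos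
  set S := Real.sqrt (sobSq (M.cell i) (derivFamily Ω u) (k + 1)) with hS
  have hS0 : 0 ≤ S := Real.sqrt_nonneg _
  have e1 : l2 (M.cell i).vol (fun x => u x - M.piecewise p x) =
      l2 (M.cell i).vol (fun x => u x - p i x) := by
    apply l2_congr
    filter_upwards [M.piecewise_ae_eq p i] with x hx
    rw [hx]
  have e2 : l2 (M.cell i).vol (fun x => u x - p i x) ^ 2 ≤ (C1 * M.cellDiam i ^ (k + 1) * S) ^ 2 :=
    pow_le_pow_left₀ l2_nonneg (h3 i) 2
  have e3 : ∑ l, l2 (M.cell i).vol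
      (fun x => derivFamily Ω u 1 (fun _ => l) x - pd l (p i) x) ^ 2 ≤
      d * (C1 * M.cellDiam i ^ k * S) ^ 2 := by
    refine (Finset.sum_le_sum fun l _ => pow_le_pow_left₀ l2_nonneg (h4 i l) 2).trans
      (le_of_eq ?_)
    rw [Finset.sum_const, Finset.card_univ, Fintype.card_fin, nsmul_eq_mul]
  rw [e1]
  calc _ ≤ (M.cellDiam i)⁻¹ ^ 2 * (C1 * M.cellDiam i ^ (k + 1) * S) ^ 2 +
        d * (C1 * M.cellDiam i ^ k * S) ^ 2 := by gcongr
    _ = _ := by field_simp; ring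

lemma energyNorm_eq (c : BoundaryCase) (j : Fin M.numCells → ℕ) (v : E d → ℝ) :
    M.weakForm c j v v = ∑ i, ∑ l, l2 (M.cell i).vol (M.wgrad c (j i) v i l) ^ 2 := by
  refine Finset.sum_congr rfl fun i _ => ?_
  change ∫ x, ∑ l, M.wgrad c (j i) v i l x * M.wgrad c (j i) v i l x ∂(M.cell i).vol = _
  rw [integral_finsetSum _ fun l _ => integrable_mul_of_memLp (memLp_wgrad c (j i) v i l)
    (memLp_wgrad c (j i) v i l)]
  refine Finset.sum_congr rfl fun l _ => ?_
  rw [l2_sq]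
  simp only [sq]

lemma sum_l2_mul_le {F G : Fin M.numCells → Fin d → E d → ℝ} :
    ∑ i, ∑ l, l2 (M.cell i).vol (F i l) * l2 (M.cell i).vol (G i l) ≤
      Real.sqrt (∑ i, ∑ l, l2 (M.cell i).vol (F i l) ^ 2) *
        Real.sqrt (∑ i, ∑ l, l2 (M.cell i).vol (G i l) ^ 2) := by
  have := Real.sum_mul_le_sqrt_mul_sqrt Finset.univ
    (fun x : Fin M.numCells × Fin d => l2 (M.cell x.1).vol (F x.1 x.2))
    (fun x => l2 (M.cell x.1).vol (G x.1 x.2))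
  simpa only [Fintype.sum_prod_type] using this

end PolytopalMesh

end
end ConformingDG

/-! ### The error estimate -/

namespace ConformingDG
noncomputable section

variable {d : ℕ}

namespace PolytopalMesh

/-- The energy norm of the error is bounded by the interpolation and consistency errors. -/
lemma energyNorm_sub_sq_le {Ω : Set (E d)} {M : PolytopalMesh Ω} {γ : ℝ} (hF : M.IsFat γ)
    (hγ : 0 < γ) {c : BoundaryCase} {j : Fin M.numCells → ℕ} {k : ℕ} {f u uh v : E d → ℝ}
    {p : Fin M.numCells → E d → ℝ} (hcu : M.CellH1 u) (hv : M.VhData c k v p)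
    (huh : M.IsDGSolution c k j f uh) {R : ℝ}
    (hR : ∀ w, M.MemVh c k w →
      |∑ i, ∫ x, ∑ l, M.wgrad c (j i) u i l x * M.wgrad c (j i) w i l x ∂(M.cell i).vol -
        ∫ x in Ω, f x * w x| ≤
      R * Real.sqrt (∑ i, ∑ l, l2 (M.cell i).vol (M.wgrad c (j i) w i l) ^ 2)) :
    M.weakForm c j (fun x => u x - uh x) (fun x => u x - uh x) ≤
      2 * M.weakForm c j (fun x => u x - v x) (fun x => u x - v x) +
      2 * (R + Real.sqrt (M.weakForm c j (fun x => u x - v x) (fun x => u x - v x))) ^ 2 := by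
  obtain ⟨q, hq⟩ := huh.1.exists_data
  have hw := hv.sub hq
  set w : E d → ℝ := fun x => v x - uh x with hwdef
  set U := fun i l => M.wgrad c (j i) u i l with hU
  set V := fun i l => M.wgrad c (j i) v i l with hV
  set Z := fun i l => M.wgrad c (j i) uh i l with hZ
  set W := fun i l => M.wgrad c (j i) w i l with hW
  set Y := fun i l => M.wgrad c (j i) (fun x => u x - v x) i l with hY
  have mU : ∀ i l, MemLp (U i l) 2 (M.cell i).vol := fun i l => memLp_wgrad c (j i) u i l
  have mV : ∀ i l, MemLp (V i l) 2 (M.cell i).vol := fun i l => memLp_wgrad c (j i) v i l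
  have mZ : ∀ i l, MemLp (Z i l) 2 (M.cell i).vol := fun i l => memLp_wgrad c (j i) uh i l
  have mW : ∀ i l, MemLp (W i l) 2 (M.cell i).vol := fun i l => memLp_wgrad c (j i) w i l
  have mY : ∀ i l, MemLp (Y i l) 2 (M.cell i).vol := fun i l => memLp_wgrad c (j i) _ i l
  have aW : ∀ i l, W i l =ᵐ[(M.cell i).vol] fun x => V i l x - Z i l x := fun i l =>
    hv.cellH1.wgrad_sub hq.cellH1 hF hγ c (j i) i l
  have aY : ∀ i l, Y i l =ᵐ[(M.cell i).vol] fun x => U i l x - V i l x := fun i l =>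
    hcu.wgrad_sub hv.cellH1 hF hγ c (j i) i l
  have aE : ∀ i l, M.wgrad c (j i) (fun x => u x - uh x) i l =ᵐ[(M.cell i).vol]
      fun x => Y i l x + W i l x := fun i l => by
    filter_upwards [hcu.wgrad_sub hq.cellH1 hF hγ c (j i) i l, aW i l, aY i l] with x h1 h2 h3
    rw [h1, h2, h3]
    ring
  simp only [energyNorm_eq]
  set XY := ∑ i, ∑ l, l2 (M.cell i).vol (Y i l) ^ 2 with hXY
  set XW := ∑ i, ∑ l, l2 (M.cell i).vol (W i l) ^ 2 with hXW
  have hXW0 : 0 ≤ XW := Finset.sum_nonneg fun _ _ => Finset.sum_nonneg fun _ _ => sq_nonneg _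
  have hXY0 : 0 ≤ XY := Finset.sum_nonneg fun _ _ => Finset.sum_nonneg fun _ _ => sq_nonneg _
  have hgal : ∑ i, ∫ x, ∑ l, Z i l x * W i l x ∂(M.cell i).vol = ∫ x in Ω, f x * w x :=
    huh.2 w hw.memVh
  -- Write the weak gradient of `w` as that of `u - u_h` minus that of `u - v`. By the discrete
  -- equation the first part is the consistency functional, and the second is the interpolation
  -- error.
  have hid : XW = (∑ i, ∫ x, ∑ l, U i l x * W i l x ∂(M.cell i).vol - ∫ x in Ω, f x * w x) -
      ∑ i, ∫ x, ∑ l, Y i l x * W i l x ∂(M.cell i).vol := by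
    rw [← hgal, ← Finset.sum_sub_distrib, ← Finset.sum_sub_distrib]
    refine Finset.sum_congr rfl fun i _ => ?_
    have is : ∀ {F : Fin d → E d → ℝ}, (∀ l, MemLp (F l) 2 (M.cell i).vol) →
        ∫ x, ∑ l, F l x * W i l x ∂(M.cell i).vol =
          ∑ l, ∫ x, F l x * W i l x ∂(M.cell i).vol := fun hF =>
      integral_finsetSum _ fun l _ => integrable_mul_of_memLp (hF l) (mW i l)
    rw [is (mU i), is (mZ i), is (mY i), ← Finset.sum_sub_distrib, ← Finset.sum_sub_distrib]
    refine Finset.sum_congr rfl fun l _ => ?_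
    rw [← integral_sub (integrable_mul_of_memLp (mU i l) (mW i l))
      (integrable_mul_of_memLp (mZ i l) (mW i l)), ← integral_sub
      (show Integrable (fun x => U i l x * W i l x - Z i l x * W i l x) _ from
        (integrable_mul_of_memLp (mU i l) (mW i l)).sub
          (integrable_mul_of_memLp (mZ i l) (mW i l)))
      (integrable_mul_of_memLp (mY i l) (mW i l)), l2_sq]
    refine integral_congr_ae ?_
    filter_upwards [aW i l, aY i l] with x h1 h2
    rw [h2]
    have : U i l x - Z i l x - (U i l x - V i l x) = W i l x := by rw [h1]; ring
    rw [← sub_mul, ← sub_mul, this, sq]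
  have hYW : |∑ i, ∫ x, ∑ l, Y i l x * W i l x ∂(M.cell i).vol| ≤
      Real.sqrt XY * Real.sqrt XW :=
    (Finset.abs_sum_le_sum_abs _ _).trans ((Finset.sum_le_sum fun i _ =>
      abs_integral_sum_mul_le (mY i) (mW i)).trans sum_l2_mul_le)
  have hcons := hR w hw.memVh
  change |∑ i, ∫ x, ∑ l, U i l x * W i l x ∂(M.cell i).vol - ∫ x in Ω, f x * w x| ≤
    R * Real.sqrt XW at hcons
  have hle : Real.sqrt XW * Real.sqrt XW ≤ (R + Real.sqrt XY) * Real.sqrt XW := by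
    rw [Real.mul_self_sqrt hXW0]
    have h1 := abs_le.1 hYW
    have h2 := abs_le.1 hcons
    linarith
  -- Cancel one factor of the norm of `w`; if that norm is zero there is nothing to prove.
  have hXWle : XW ≤ (R + Real.sqrt XY) ^ 2 := by
    rcases (Real.sqrt_nonneg XW).eq_or_lt with h0 | h0
    · rw [(Real.sqrt_eq_zero hXW0).1 h0.symm]
      positivity
    · have h1 := le_of_mul_le_mul_right hle h0
      have h2 := pow_le_pow_left₀ h0.le h1 2
      rwa [Real.sq_sqrt hXW0] at h2
  have hsum : ∑ i, ∑ l, l2 (M.cell i).vol (M.wgrad c (j i) (fun x => u x - uh x) i l) ^ 2 ≤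
      2 * XY + 2 * XW := by
    rw [hXY, hXW, Finset.mul_sum, Finset.mul_sum, ← Finset.sum_add_distrib]
    refine Finset.sum_le_sum fun i _ => ?_
    rw [Finset.mul_sum, Finset.mul_sum, ← Finset.sum_add_distrib]
    refine Finset.sum_le_sum fun l _ => ?_
    rw [l2_congr (aE i l)]
    exact l2_add_sq_le (mY i l) (mW i l)
  linarith

end PolytopalMesh

end
end ConformingDG

theorem theorem4p5 (d k N : ℕ) (hd : d = 2 ∨ d = 3) (hk : 1 ≤ k)
    (ρ κ α : ℝ) (hρ : 0 < ρ) (hκ : 0 < κ) (hα : 0 < α) :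
    ∃ C : ℝ, 0 < C ∧
      ∀ (Ω : Set (ConformingDG.E d)), ConformingDG.IsPolytopalDomain Ω →
      ∀ (M : ConformingDG.PolytopalMesh Ω), M.ShapeRegular ρ κ α →
      ∀ (n : Fin M.numCells → ℕ), (∀ i, (M.cell i).numFacets ≤ n i ∧ n i ≤ N) →
      ∀ (c : ConformingDG.BoundaryCase),
        (c = ConformingDG.BoundaryCase.strong → M.AtMostBoundaryFacets d) →
      ∀ (f u uh : ConformingDG.E d → ℝ), MemLp f 2 (volume.restrict Ω) →
        ConformingDG.IsWeakSolution Ω f u →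
        ConformingDG.MemSobolev Ω (k + 1) u →
        M.IsDGSolution c k (fun i => n i + k - 1) f uh →
        M.energyNorm c (fun i => n i + k - 1) (fun x => u x - uh x) ≤
          C * M.meshSize ^ k * ConformingDG.sobolevSeminorm Ω (k + 1) u := by
  -- From here on the discrete degree is `k + 1`, so that `∇u` is approximated in degree `k` without
  -- truncated subtraction.
  obtain ⟨k, rfl⟩ : ∃ m, k = m + 1 := ⟨k - 1, by omega⟩
  obtain ⟨γ, hγ, hγ1, hfat⟩ := ConformingDG.exists_fat d N (by omega) hρ hκ hα
  obtain ⟨C1, hC1, hint⟩ :=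
    ConformingDG.PolytopalMesh.exists_interpolation_bound d (k + 1) N hγ hγ1 hκ
  obtain ⟨C2, hC2, hcon⟩ := ConformingDG.PolytopalMesh.exists_consistency_bound d k N hγ hγ1
  -- The squared error is at most `2 η + 2 (R + √η)²`, with interpolation error `η ≤ C1 A²` and
  -- consistency error `R = C2 A`.
  refine ⟨Real.sqrt (2 * C1 + 2 * (C2 + Real.sqrt C1) ^ 2), by positivity,
    fun Ω hΩ M hM n hn c _ f u uh hf hsol hu huh => ?_⟩
  have hN : ∀ i, (M.cell i).numFacets ≤ N := fun i => (hn i).1.trans (hn i).2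
  have hF : M.IsFat γ := fun i => hfat Ω M hM i (hN i)
  obtain ⟨hΩo, -, hΩc, -⟩ := hΩ
  have hcu : M.CellH1 u := fun i => ⟨_, ConformingDG.PolytopalMesh.h1Approx_of_memSobolev hΩo hΩc hu
    (by omega) hF hγ i⟩
  set A : ℝ := M.meshSize ^ (k + 1) * ConformingDG.sobolevSeminorm Ω (k + 1 + 1) u with hA
  have hS0 : 0 ≤ ConformingDG.sobolevSeminorm Ω (k + 1 + 1) u := Real.sqrt_nonneg _
  have hm0 : 0 ≤ M.meshSize := Real.iSup_nonneg fun i => Metric.diam_nonneg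
  have hA0 : 0 ≤ A := by positivity
  have hsum : ∑ i, (M.cellDiam i ^ (k + 1) *
      Real.sqrt (ConformingDG.sobSq (M.cell i) (ConformingDG.derivFamily Ω u) (k + 1 + 1))) ^ 2 ≤
      A ^ 2 := by
    rw [hA, mul_pow, ← ConformingDG.PolytopalMesh.sum_sobSq (M := M) hΩc hu, Finset.mul_sum]
    refine Finset.sum_le_sum fun i _ => ?_
    rw [mul_pow, Real.sq_sqrt (ConformingDG.sobSq_nonneg _ _ _)]
    have h1 := M.cellDiam_le i
    have h2 := (hF i).pos.le
    have h3 := ConformingDG.sobSq_nonneg (M.cell i) (ConformingDG.derivFamily Ω u) (k + 1 + 1)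
    gcongr
  obtain ⟨v, p, hv, hvle⟩ := hint Ω M ρ α hM hΩo hΩc hF hN c (fun i => n i + (k + 1) - 1)
    (fun i => by have := (hn i).2; omega) u hsol.1 hu
  have hη : M.weakForm c (fun i => n i + (k + 1) - 1) (fun x => u x - v x) (fun x => u x - v x) ≤
      C1 * A ^ 2 := by
    rw [ConformingDG.PolytopalMesh.energyNorm_eq]
    exact hvle.trans (mul_le_mul_of_nonneg_left hsum hC1.le)
  have hR : ∀ w, M.MemVh c (k + 1) w →
      |∑ i, ∫ x, ∑ l, M.wgrad c (n i + (k + 1) - 1) u i l x * M.wgrad c (n i + (k + 1) - 1) w i l x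
        ∂(M.cell i).vol - ∫ x in Ω, f x * w x| ≤ C2 * A * Real.sqrt (∑ i, ∑ l,
        ConformingDG.l2 (M.cell i).vol (M.wgrad c (n i + (k + 1) - 1) w i l) ^ 2) := by
    intro w hw
    refine (hcon Ω M hΩo hΩc hF hN c (fun i => n i + (k + 1) - 1)
      (fun i => by have := (hn i).1; omega) f u hf hsol hu w hw).trans ?_
    rw [mul_assoc]
    refine mul_le_mul_of_nonneg_left ?_ hC2.le
    -- Cauchy–Schwarz over the elements combines the local consistency bounds.
    refine (Real.sum_mul_le_sqrt_mul_sqrt _ _ _).trans ?_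
    have h1 : ∀ i, Real.sqrt (∑ l, ConformingDG.l2 (M.cell i).vol
        (M.wgrad c (n i + (k + 1) - 1) w i l) ^ 2) ^ 2 = ∑ l, ConformingDG.l2 (M.cell i).vol
        (M.wgrad c (n i + (k + 1) - 1) w i l) ^ 2 := fun i =>
      Real.sq_sqrt (Finset.sum_nonneg fun _ _ => sq_nonneg _)
    simp only [h1]
    exact mul_le_mul_of_nonneg_right (Real.sqrt_le_iff.2 ⟨hA0, hsum⟩) (Real.sqrt_nonneg _)
  have hmain := ConformingDG.PolytopalMesh.energyNorm_sub_sq_le hF hγ hcu hv huh hR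
  have hsq : Real.sqrt (M.weakForm c (fun i => n i + (k + 1) - 1) (fun x => u x - v x)
      (fun x => u x - v x)) ≤ Real.sqrt C1 * A := by
    rw [Real.sqrt_le_left (by positivity), mul_pow, Real.sq_sqrt hC1.le]
    exact hη
  rw [mul_assoc, ← hA, ConformingDG.PolytopalMesh.energyNorm, Real.sqrt_le_left (by positivity),
    mul_pow, Real.sq_sqrt (by positivity)]
  refine hmain.trans ?_
  have h2 : (C2 * A + Real.sqrt (M.weakForm c (fun i => n i + (k + 1) - 1) (fun x => u x - v x)
      (fun x => u x - v x))) ^ 2 ≤ (C2 * A + Real.sqrt C1 * A) ^ 2 := by gcongr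
  calc _ ≤ 2 * (C1 * A ^ 2) + 2 * (C2 * A + Real.sqrt C1 * A) ^ 2 := by gcongr
    _ = _ := by ring
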